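/- **Setting.** Let $\eta$ be a spatial white noise on $\mathbb R^2$ on a probability space $(\Omega,\mathcal F,\mathbb P)$, i.e. a centered Gaussian process $(W(h))_{h\in L^2(\mathbb R^2)}$ with $\mathbb E[W(h_1)W(h_2)]=\langle h_1,h_2\rangle_{L^2(\mathbb R^2)}$. Put $G_t(x)=\frac1{2\pi t}e^{-|x|^2/(2t)}$ and, for $\varepsilon\in(0,1)$, $\eta_\varepsilon(x)=G_{\varepsilon^2}*\eta(x)=W(G_{\varepsilon^2}(x-\cdot))$ and $\delta_\varepsilon=(\log\varepsilon^{-1})^{-1/2}$. For $L_1,L_2\ge 0$, a function $f=f(t,u)$ $(t>0,\ u\in\mathbb R)$ belongs to $\bar S_1(L_1,L_2)$ if the function $F$ defined by $f(t,u)=t^{-3/2}F(t,t^{1/2}u)$ is continuous and, for each fixed $t>0$, $F(t,\cdot)$ is odd and differentiable, with $\operatorname{Lip}(F(t,\cdot))\le L_1$ and $\operatorname{Lip}(\partial_uF(t,\cdot))\le L_2$. Write $f'=\partial_u f$. For $\mathfrak m\in\mathbb R$, let $u_\varepsilon$ and $v_\varepsilon$ be the solutions on $[0,\infty)\times\mathbb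 R^2$ of $$\partial_t u_\varepsilon=\tfrac12\Delta u_\varepsilon+\mathfrak m u_\varepsilon-\frac{f(t+\varepsilon^2,u_\varepsilon)}{\log\varepsilon^{-1}},\qquad u_\varepsilon(0,\cdot)=\eta_\varepsilon,$$ $$\partial_t v_\varepsilon=\tfrac12\Delta v_\varepsilon+\mathfrak m v_\varepsilon-\frac{\mathbb E[f'(t+\varepsilon^2,v_\varepsilon)]}{\log\varepsilon^{-1}}\,v_\varepsilon,\qquad v_\varepsilon(0,\cdot)=\eta_\varepsilon .$$ Here a solution is a random field that almost surely is continuous on $[0,\infty)\times\mathbb R^2$, is of class $C^{1,2}$ on $(0,\infty)\times\mathbb R^2$, satisfies the equation there, and for every $T>0$ satisfies $\sup_{t\in[0,T]}|u(t,x)|=O(e^{a|x|})$ for some $a>0$; for $v_\varepsilon$ one also requires that $\sup_{t\in[0,T]}\mathbb E|f'(t+\varepsilon^2,v_\varepsilon(t,x))|=O(e^{a|x|})$ for some $a>0$. **Proposition.** For each $T_0\in(0,\infty)$ and $\mathfrak m\in\mathbb R$ there is a constant $C_{T_0,\mathfrak m}<\infty$ such that the following holds. Let $L_1,L_2\ge0$,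 let $f\in\bar S_1(L_1,L_2)$, and let $\varepsilon\in(0,1)$ be such that $$\Big\lfloor\Big(2+\frac{\log(T_0+\varepsilon^2)}{\log\varepsilon^{-1}}\Big)\delta_\varepsilon^{-1}\Big\rfloor\le 3\,\delta_\varepsilon^{-1}$$ (which holds for all $\varepsilon$ small enough depending only on $T_0$, for instance if $T_0+\varepsilon^2\le\varepsilon^{-1}$), and $$2e^{|\mathfrak m|T_0}L_1\,\delta_\varepsilon\le 1,\qquad \frac{e^{3L_1}L_2}{1-L_1\delta_\varepsilon}\,\delta_\varepsilon<1 .$$ Then for every $X\in\mathbb R^2$ and every $T\in[0,T_0]$, $$(T+\varepsilon^2)^{1/2}\,\|u_\varepsilon(T,X)-v_\varepsilon(T,X)\|_{L^2(\mathbb P)}\le\frac{C_{T_0,\mathfrak m}\,e^{18L_1}L_2}{(\log\varepsilon^{-1})^{1/4}}\exp\left\{\frac{3e^{3L_1+|\mathfrak m|T}L_2}{1-(L_1+e^{3L_1}L_2)(\log\varepsilon^{-1})^{-1/2}}\right\}.$$ In particular, $\sup_{T\in[0,T_0]}(T+\varepsilon^2)^{1/2}\|u_\varepsilon(T,X)-v_\varepsilon(T,X)\|_{L^2(\mathbb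 P)}$ is bounded by the right-hand side with $T$ replaced by $T_0$. -/

import Mathlib

open MeasureTheory ProbabilityTheory Set
open scoped NNReal ENNReal

noncomputable section

namespace CriticalReaction

/-- The Euclidean plane. -/
abbrev Plane : Type := EuclideanSpace ℝ (Fin 2)

/-! ### The reaction terms -/

/-- The class `S₁(L₁, L₂)` of rescaled reaction terms `F = F(t, u)`, `t > 0`, `u ∈ ℝ`. -/
structure IsS1 (L₁ L₂ : ℝ≥0) (F : ℝ → ℝ → ℝ) : Prop where
  continuousOn : ContinuousOn (fun p : ℝ × ℝ => F p.1 p.2) (Ioi 0 ×ˢ univ)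
  odd : ∀ t, 0 < t → Function.Odd (F t)
  differentiable : ∀ t, 0 < t → Differentiable ℝ (F t)
  lipschitz : ∀ t, 0 < t → LipschitzWith L₁ (F t)
  lipschitz_deriv : ∀ t, 0 < t → LipschitzWith L₂ (deriv (F t))

/-- The function `F` determined, for `t > 0`, by `f(t, u) = t^{-3/2} F(t, t^{1/2} u)`. -/
def rescaled (f : ℝ → ℝ → ℝ) (t u : ℝ) : ℝ :=
  t ^ (3 / 2 : ℝ) * f t (t ^ (-(1 / 2) : ℝ) * u)

/-- `f ∈ S̄₁(L₁, L₂)`: the corresponding `F` is in `S₁(L₁, L₂)`. -/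
def IsS1Bar (L₁ L₂ : ℝ≥0) (f : ℝ → ℝ → ℝ) : Prop := IsS1 L₁ L₂ (rescaled f)

/-! ### White noise and the mollified initial data -/

/-- The heat kernel `G_t(x) = (2πt)⁻¹ exp(-|x|²/(2t))` of the plane. -/
def heatKernel (t : ℝ) (x : Plane) : ℝ :=
  (2 * Real.pi * t)⁻¹ * Real.exp (-‖x‖ ^ 2 / (2 * t))

theorem memLp_heatKernel {t : ℝ} (ht : 0 < t) (x : Plane) :
    MemLp (fun z : Plane => heatKernel t (x - z)) 2 (volume : Measure Plane) := by
  have hc : Continuous (heatKernel t) := by unfold heatKernel; fun_prop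
  have h0 : MemLp (heatKernel t) 2 (volume : Measure Plane) := by
    rw [memLp_two_iff_integrable_sq hc.aestronglyMeasurable]
    have h := (GaussianFourier.integrable_cexp_neg_mul_sq_norm_add (V := Plane)
      (b := ((1 / t : ℝ) : ℂ)) (by simpa using ht) 0 0).norm
    refine (h.const_mul (((2 * Real.pi * t)⁻¹) ^ 2)).congr (Filter.Eventually.of_forall ?_)
    intro z
    simp only [heatKernel, mul_pow, Complex.norm_exp, ← Real.exp_nat_mul]
    congr 2
    have : (-(((1 / t : ℝ) : ℂ)) * (‖z‖ : ℂ) ^ 2 + 0 * ((inner ℝ (0 : Plane) z : ℝ) : ℂ))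
        = ((-(1 / t) * ‖z‖ ^ 2 : ℝ) : ℂ) := by push_cast; ring
    rw [this, Complex.ofReal_re]
    field_simp
    push_cast
    ring
  exact h0.comp_measurePreserving (Measure.measurePreserving_sub_left volume x)

/-- The element `z ↦ G_t(x - z)` of `L²(ℝ²)`. -/
def heatKernelLp (t : ℝ) (ht : 0 < t) (x : Plane) : Lp ℝ 2 (volume : Measure Plane) :=
  (memLp_heatKernel ht x).toLp _

/-- A spatial white noise: a centered Gaussian process indexed by `L²(ℝ²)` whose covariance is the
inner product of `L²(ℝ²)`. -/
structure IsWhiteNoise {Ω : Type*} [MeasurableSpace Ω] (P : Measure Ω)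
    (W : Lp ℝ 2 (volume : Measure Plane) → Ω → ℝ) : Prop where
  gaussian : IsGaussianProcess W P
  mean_zero : ∀ h, ∫ ω, W h ω ∂P = 0
  covariance : ∀ h₁ h₂, ∫ ω, W h₁ ω * W h₂ ω ∂P = inner ℝ h₁ h₂

/-- The mollified noise `η_ε(x) = (G_{ε²} * η)(x)`. -/
def mollifiedNoise {Ω : Type*} (W : Lp ℝ 2 (volume : Measure Plane) → Ω → ℝ)
    (ε : ℝ) (hε : 0 < ε) (x : Plane) : Ω → ℝ :=
  W (heatKernelLp (ε ^ 2) (pow_pos hε 2) x)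

/-! ### The two Cauchy problems -/

/-- `u` is continuous on `[0, ∞) × ℝ²` and of class `C^{1,2}` on `(0, ∞) × ℝ²`. -/
structure IsC12 (u : ℝ → Plane → ℝ) : Prop where
  continuousOn : ContinuousOn (fun p : ℝ × Plane => u p.1 p.2) (Ici 0 ×ˢ univ)
  differentiableAt_time : ∀ t, 0 < t → ∀ x, DifferentiableAt ℝ (fun s => u s x) t
  contDiff_space : ∀ t, 0 < t → ContDiff ℝ 2 (u t)
  continuousOn_deriv_time :
    ContinuousOn (fun p : ℝ × Plane => deriv (fun s => u s p.2) p.1) (Ioi 0 ×ˢ univ)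
  continuousOn_fderiv :
    ContinuousOn (fun p : ℝ × Plane => fderiv ℝ (u p.1) p.2) (Ioi 0 ×ˢ univ)
  continuousOn_iteratedFDeriv_two :
    ContinuousOn (fun p : ℝ × Plane => iteratedFDeriv ℝ 2 (u p.1) p.2) (Ioi 0 ×ˢ univ)

/-- For every `T`, the function `x ↦ sup_{t ∈ [0,T]} |u(t,x)|` grows at most exponentially:
it is `O(e^{a|x|})` on the plane for some `a > 0`. -/
def HasExpGrowth (u : ℝ → Plane → ℝ) : Prop :=
  ∀ T : ℝ, 0 < T → ∃ a : ℝ, 0 < a ∧ ∃ K : ℝ, ∀ t ∈ Icc 0 T, ∀ x : Plane,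
    |u t x| * Real.exp (-(a * ‖x‖)) ≤ K

/-- The random field `u` solves
`∂ₜu = ½Δu + 𝔪u - (log ε⁻¹)⁻¹ f(t + ε², u)`, `u(0, ·) = η_ε`. -/
structure IsReactionDiffusionSolution {Ω : Type*} [MeasurableSpace Ω] (P : Measure Ω)
    (W : Lp ℝ 2 (volume : Measure Plane) → Ω → ℝ) (f : ℝ → ℝ → ℝ) (m : ℝ)
    (ε : ℝ) (hε : 0 < ε) (u : ℝ → Plane → Ω → ℝ) : Prop where
  aemeasurable : ∀ t, 0 ≤ t → ∀ x, AEMeasurable (u t x) P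
  initial : ∀ x, u 0 x =ᵐ[P] mollifiedNoise W ε hε x
  regular : ∀ᵐ ω ∂P, IsC12 (fun t x => u t x ω)
  growth : ∀ᵐ ω ∂P, HasExpGrowth (fun t x => u t x ω)
  equation : ∀ᵐ ω ∂P, ∀ t, 0 < t → ∀ x,
    deriv (fun s => u s x ω) t =
      1 / 2 * Laplacian.laplacian (fun y => u t y ω) x + m * u t x ω
        - f (t + ε ^ 2) (u t x ω) / Real.log ε⁻¹

/-- The random field `v` solves the McKean–Vlasov equation
`∂ₜv = ½Δv + 𝔪v - (log ε⁻¹)⁻¹ 𝔼[f'(t + ε², v)] v`, `v(0, ·) = η_ε`,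
where `f'` is the derivative of `f` in its second argument. -/
structure IsMcKeanVlasovSolution {Ω : Type*} [MeasurableSpace Ω] (P : Measure Ω)
    (W : Lp ℝ 2 (volume : Measure Plane) → Ω → ℝ) (f : ℝ → ℝ → ℝ) (m : ℝ)
    (ε : ℝ) (hε : 0 < ε) (v : ℝ → Plane → Ω → ℝ) : Prop where
  aemeasurable : ∀ t, 0 ≤ t → ∀ x, AEMeasurable (v t x) P
  initial : ∀ x, v 0 x =ᵐ[P] mollifiedNoise W ε hε x
  regular : ∀ᵐ ω ∂P, IsC12 (fun t x => v t x ω)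
  growth : ∀ᵐ ω ∂P, HasExpGrowth (fun t x => v t x ω)
  integrable_coeff : ∀ t, 0 ≤ t → ∀ x,
    Integrable (fun ω => deriv (f (t + ε ^ 2)) (v t x ω)) P
  growth_coeff : HasExpGrowth (fun t x => ∫ ω, |deriv (f (t + ε ^ 2)) (v t x ω)| ∂P)
  equation : ∀ᵐ ω ∂P, ∀ t, 0 < t → ∀ x,
    deriv (fun s => v s x ω) t =
      1 / 2 * Laplacian.laplacian (fun y => v t y ω) x + m * v t x ω
        - (∫ ω', deriv (f (t + ε ^ 2)) (v t x ω') ∂P) / Real.log ε⁻¹ * v t x ω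

/-! ### The small parameter -/

/-- `δ_ε = (log ε⁻¹)^{-1/2}`. -/
def delta (ε : ℝ) : ℝ := 1 / (Real.log ε⁻¹) ^ (1 / 2 : ℝ)

/-- `M_ε = ⌊(2 + log(T + ε²) / log ε⁻¹) δ_ε⁻¹⌋`. -/
def numSteps (T ε : ℝ) : ℤ :=
  ⌊(2 + Real.log (T + ε ^ 2) / Real.log ε⁻¹) * (delta ε)⁻¹⌋

end CriticalReaction

end

open MeasureTheory ProbabilityTheory Set
open scoped NNReal ENNReal

noncomputable section

namespace CriticalReaction

open Filter Topology

section
set_option linter.unusedSectionVars false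

/-! ### The heat semigroup -/

/-! Write `Λ = log ε⁻¹`, `e = ε²`, `r = s + e`, and let `P_t` be the heat flow. Multiplying both
equations by `e^{-𝔪t}` removes the mass term and leaves an odd reaction `h(s, u)` whose derivative
`h'` is bounded by `ℓ / r` and has Lipschitz constant `k / √r`, where `ℓ = L₁ / Λ` and `k = L₂
e^{|𝔪|T} / Λ` (`isReaction_damped`). Since `∫₀ᵀ ds / r = θ = log((T + e) / e)`, and the hypothesis
on the number of steps gives `θ ≤ (3 + δ_ε) Λ`, the products `ℓθ` and `kθ` stay bounded as `ε → 0`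
for fixed `L₁, L₂`, while `k√θ` is of order `Λ^{-1/2}`. The proof shows that the error is driven by
`k√θ`, not by `kθ`.

The mollified noise is replaced by `∑ g_i γ_i` with independent standard Gaussians `g_i` and
profiles `γ_i` given by mollified normalised indicators of small disjoint cells. Then `u` becomes a
function `U(g)`, and `v` becomes `∑ g_i V_i` with deterministic `V_i`, because the mean field
equation is linear once its deterministic coefficient is known. The difference `D = U(g) - ∑ g_i
V_i` is odd in `g`, so it has mean zero, and the Efron–Stein inequality (`efronStein`) bounds its
second moment by `∑ E D_i²`, where `D_i` is the change of `D` when `g_i` is set to `0`. The ansatz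
is `‖D_i(t, x)‖ ≤ p(t) P_tγ_i(x)` in `L²`. Since `∑ (P_tγ_i)² ≤ 1 / (2π(t + e))`, it yields the
decay `(t + e)^{-1/2}` of `D` (`eLpNorm_gap_le`).

By `gapDiff_eq` and `abs_gapRem_le`, `D_i` satisfies a Duhamel equation with four contributions. The
first is `(ℓ / r)|D_i|`. The second is `(k / √r)|V_i g_i|` times `D` evaluated with `g_i` off: the
two random factors are independent, and `D` is controlled by all the `D_j` through Efron–Stein. The
third is the diagonal term `(k / √r) V_i² g_i²`, made small by refining the cells. The last is `g_i`
times the Duhamel integral of `V_i (h' - E h')`, with `h'` taken at the mean field solution with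
`g_i` off. A covariance inequality for independent variables (`abs_covariance_gaussN_le`) shows that
this fluctuation has space-time correlations at most of order `k² / (√r √r' (r + r'))`. The double
time integral of that kernel produces a single logarithm, hence a source of size `k√θ`
(`eLpNorm_duhamel_coeffFluct_le`). All bounds have the form `c(s) P_sγ_i`, which Duhamel integration
preserves because `P_{t-s}P_s = P_t`. A Gronwall iteration on such majorants (`gronwall_majorant`)
then closes the estimate (`eLpNorm_gap_le_exp`).

It remains to know that classical solutions of exponential growth are mild (`eq_heat_sub_duhamel`),
that at fixed `ε` both equations are stable under convergence of the initial data in `L²`, so that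
the finite-dimensional bound passes to the limit (`IsWhiteNoise.eLpNorm_sub_le`), and to collect the
constants (`comparison_bound_le`). -/

/-- The standard Gaussian measure of the plane. -/
abbrev stdG : Measure Plane := stdGaussian Plane

variable {E : Type*} [NormedAddCommGroup E] [NormedSpace ℝ E]

/-- The heat semigroup, written as an average over a standard Gaussian vector. -/
def heat (t : ℝ) (φ : Plane → E) (x : Plane) : E := ∫ z, φ (x + √t • z) ∂stdG

/-- Fernique's theorem provides a moment `E e^{C‖z‖²}` with `C > 0`, and completing the square
absorbs the linear exponent `a‖z‖` into it. -/
theorem integrable_exp_norm (a : ℝ) : Integrable (fun z : Plane => Real.exp (a * ‖z‖)) stdG := by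
  obtain ⟨C, hC, hi⟩ := IsGaussian.exists_integrable_exp_sq stdG
  refine (hi.const_mul (Real.exp (a ^ 2 / (4 * C)))).mono'
    (by fun_prop) (Eventually.of_forall fun z => ?_)
  rw [Real.norm_eq_abs, abs_of_pos (Real.exp_pos _), ← Real.exp_add]
  apply Real.exp_le_exp.2
  have h : 0 ≤ (a / (2 * C) - ‖z‖) ^ 2 * C := by positivity
  have e : (a / (2 * C) - ‖z‖) ^ 2 * C = a ^ 2 / (4 * C) + C * ‖z‖ ^ 2 - a * ‖z‖ := by
    field_simp
    ring
  linarith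

/-- `φ` grows at most like `K e^{a|x|}`. -/
def ExpBound (a K : ℝ) (φ : Plane → E) : Prop := ∀ x, ‖φ x‖ ≤ K * Real.exp (a * ‖x‖)

theorem ExpBound.of_bounded {K : ℝ} {φ : Plane → E} (h : ∀ x, ‖φ x‖ ≤ K) : ExpBound 0 K φ := by
  intro x; simpa using h x

theorem ExpBound.nonneg {a K : ℝ} {φ : Plane → E} (h : ExpBound a K φ) : 0 ≤ K := by
  simpa using (norm_nonneg _).trans (h 0)

theorem ExpBound.mono {a a' K : ℝ} {φ : Plane → E} (h : ExpBound a K φ) (haa : a ≤ a') :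
    ExpBound a' K φ := by
  intro x
  refine (h x).trans ?_
  have := h.nonneg
  gcongr

theorem ExpBound.comp_le {a K T t : ℝ} (ha : 0 ≤ a) (ht : t ≤ T) {φ : Plane → E}
    (h : ExpBound a K φ) (x z : Plane) :
    ‖φ (x + √t • z)‖ ≤ K * Real.exp (a * ‖x‖) * Real.exp (a * √T * ‖z‖) := by
  refine (h _).trans ?_
  rw [mul_assoc, ← Real.exp_add]
  have hK := h.nonneg
  gcongr
  have h1 : ‖x + √t • z‖ ≤ ‖x‖ + √T * ‖z‖ := by
    refine (norm_add_le _ _).trans ?_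
    rw [norm_smul, Real.norm_eq_abs, abs_of_nonneg (Real.sqrt_nonneg t)]
    gcongr
  calc a * ‖x + √t • z‖ ≤ a * (‖x‖ + √T * ‖z‖) := by gcongr
    _ = _ := by ring

theorem ExpBound.integrable {a K : ℝ} (ha : 0 ≤ a) (t : ℝ) {φ : Plane → E}
    (h : ExpBound a K φ) (hm : StronglyMeasurable φ) (x : Plane) :
    Integrable (fun z => φ (x + √t • z)) stdG := by
  refine ((integrable_exp_norm (a * √t)).const_mul (K * Real.exp (a * ‖x‖))).mono'
    (hm.comp_measurable (by fun_prop)).aestronglyMeasurable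
    (Eventually.of_forall fun z => h.comp_le ha le_rfl x z)

/-- The exponential moment `E e^{c|Z|}` of a standard Gaussian vector `Z`. -/
def expMoment (c : ℝ) : ℝ := ∫ z : Plane, Real.exp (c * ‖z‖) ∂stdG

theorem expMoment_pos (c : ℝ) : 0 < expMoment c := by
  refine (integral_pos_iff_support_of_nonneg (fun z => (Real.exp_pos _).le)
    (integrable_exp_norm c)).2 ?_
  have : Function.support (fun z : Plane => Real.exp (c * ‖z‖)) = univ := by
    ext z; simp [(Real.exp_pos _).ne']
  rw [this]; simp

/-- The triangle inequality splits off the factor `e^{a√T|z|}`, whose Gaussian moment is a constant.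
The growth rate `a` is therefore not lost, and the constant is uniform over `t ≤ T`. -/
theorem ExpBound.heat_le {a K T t : ℝ} (ha : 0 ≤ a) (ht : t ≤ T) {φ : Plane → E}
    (h : ExpBound a K φ) : ExpBound a (K * expMoment (a * √T)) (heat t φ) := by
  intro x
  refine (norm_integral_le_integral_norm _).trans ?_
  have : K * expMoment (a * √T) * Real.exp (a * ‖x‖)
      = ∫ z : Plane, K * Real.exp (a * ‖x‖) * Real.exp (a * √T * ‖z‖) ∂stdG := by
    rw [integral_const_mul, expMoment]; ring
  rw [this]
  exact integral_mono_of_nonneg (Eventually.of_forall fun z => norm_nonneg _)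
    ((integrable_exp_norm _).const_mul _)
    (Eventually.of_forall fun z => h.comp_le ha ht x z)

/-- The reverse triangle inequality gives the lower counterpart of `ExpBound.heat_le`. It allows a
pointwise exponential bound to be rewritten as a multiple of a heat flow, the only kind of majorant
on which the Gronwall iteration operates. -/
theorem exp_le_heat_exp {a T t : ℝ} (ha : 0 ≤ a) (ht : t ≤ T) (x : Plane) :
    Real.exp (a * ‖x‖) * expMoment (-(a * √T)) ≤
      heat t (fun y : Plane => Real.exp (a * ‖y‖)) x := by
  rw [expMoment, ← integral_const_mul, heat]
  have hb : ExpBound a 1 (fun y : Plane => Real.exp (a * ‖y‖)) := by intro y; simp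
  refine integral_mono ((integrable_exp_norm _).const_mul _)
    (hb.integrable ha t (by fun_prop : Continuous _).stronglyMeasurable x) fun z => ?_
  simp only
  rw [← Real.exp_add]
  apply Real.exp_le_exp.2
  have h1 : ‖x‖ ≤ ‖x + √t • z‖ + √T * ‖z‖ := by
    have h2 : ‖x‖ ≤ ‖x + √t • z‖ + ‖√t • z‖ := by
      simpa using norm_sub_le (x + √t • z) (√t • z)
    refine h2.trans ?_
    rw [norm_smul, Real.norm_eq_abs, abs_of_nonneg (Real.sqrt_nonneg t)]
    gcongr
  nlinarith

@[simp] theorem heat_zero (φ : Plane → E) [CompleteSpace E] (x : Plane) : heat 0 φ x = φ x := by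
  simp [heat]

theorem heat_const [CompleteSpace E] (t : ℝ) (c : E) (x : Plane) : heat t (fun _ => c) x = c := by
  simp [heat]

theorem heat_nonneg {t : ℝ} {φ : Plane → ℝ} (h : ∀ x, 0 ≤ φ x) (x : Plane) : 0 ≤ heat t φ x :=
  integral_nonneg fun _ => h _

/-- The semigroup property in probabilistic form: independent Gaussians of variances `s` and `t` sum
to a Gaussian of variance `s + t`. The characteristic functions multiply and determine the law. -/
theorem map_add_smul_stdG {s t : ℝ} (hs : 0 ≤ s) (ht : 0 ≤ t) :
    (stdG.prod stdG).map (fun p : Plane × Plane => √s • p.1 + √t • p.2) =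
      stdG.map (fun z => √(s + t) • z) := by
  have h1 : (stdG.prod stdG).map (fun p : Plane × Plane => √s • p.1 + √t • p.2) =
      ((stdG.map (fun z => √s • z)).prod (stdG.map (fun z => √t • z))).map
        (fun p => p.1 + p.2) := by
    rw [Measure.map_prod_map _ _ (by fun_prop) (by fun_prop),
      Measure.map_map (by fun_prop) (by fun_prop)]
    rfl
  have : IsProbabilityMeasure (stdG.map (fun z => √s • z)) :=
    Measure.isProbabilityMeasure_map (by fun_prop)
  have : IsProbabilityMeasure (stdG.map (fun z => √t • z)) :=
    Measure.isProbabilityMeasure_map (by fun_prop)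
  rw [h1]
  apply Measure.ext_of_charFun
  rw [charFun_map_add_prod_eq_mul]
  ext ξ
  simp only [Pi.mul_apply, charFun_map_smul, charFun_stdGaussian, ← Complex.exp_add, norm_smul,
    Real.norm_eq_abs]
  congr 1
  push_cast
  simp only [mul_pow, ← Complex.ofReal_pow, sq_abs, Real.sq_sqrt hs, Real.sq_sqrt ht,
    Real.sq_sqrt (add_nonneg hs ht)]
  push_cast
  ring

theorem heat_heat {s t : ℝ} (hs : 0 ≤ s) (ht : 0 ≤ t) {a K : ℝ} (ha : 0 ≤ a) {φ : Plane → E}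
    (h : ExpBound a K φ) (hm : StronglyMeasurable φ) (x : Plane) :
    heat s (heat t φ) x = heat (s + t) φ x := by
  have hmeas : Measurable (fun p : Plane × Plane => √s • p.1 + √t • p.2) := by fun_prop
  have hsm : StronglyMeasurable (fun w => φ (x + w)) := hm.comp_measurable (by fun_prop)
  have hint : Integrable (fun p : Plane × Plane => φ (x + (√s • p.1 + √t • p.2)))
      (stdG.prod stdG) := by
    have := h.integrable ha (s + t) hm x
    have h2 : Integrable (fun w => φ (x + w)) (stdG.map (fun z => √(s + t) • z)) :=
      (integrable_map_measure hsm.aestronglyMeasurable (by fun_prop)).2 this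
    rw [← map_add_smul_stdG hs ht] at h2
    exact (integrable_map_measure hsm.aestronglyMeasurable hmeas.aemeasurable).1 h2
  calc heat s (heat t φ) x = ∫ z, ∫ z', φ (x + (√s • z + √t • z')) ∂stdG ∂stdG := by
        simp [heat, add_assoc]
    _ = ∫ p : Plane × Plane, φ (x + (√s • p.1 + √t • p.2)) ∂(stdG.prod stdG) :=
        (integral_prod _ hint).symm
    _ = ∫ w, φ (x + w) ∂((stdG.prod stdG).map (fun p : Plane × Plane => √s • p.1 + √t • p.2)) :=
        (integral_map hmeas.aemeasurable hsm.aestronglyMeasurable).symm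
    _ = heat (s + t) φ x := by
        rw [map_add_smul_stdG hs ht, integral_map (by fun_prop) hsm.aestronglyMeasurable, heat]

theorem continuous_heat {a K : ℝ} (ha : 0 ≤ a) {φ : Plane → E} (h : ExpBound a K φ)
    (hc : Continuous φ) : Continuous (fun p : ℝ × Plane => heat p.1 φ p.2) := by
  rw [continuous_iff_continuousAt]
  intro p
  have hK := h.nonneg
  refine continuousAt_of_dominated
    (bound := fun z => K * Real.exp (a * (‖p.2‖ + 1)) * Real.exp (a * √(p.1 + 1) * ‖z‖))
    (Eventually.of_forall fun q =>
      (hc.stronglyMeasurable.comp_measurable (by fun_prop)).aestronglyMeasurable) ?_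
    ((integrable_exp_norm _).const_mul _)
    (Eventually.of_forall fun z => by fun_prop)
  have h1 : ∀ᶠ q : ℝ × Plane in 𝓝 p, q.1 < p.1 + 1 :=
    continuous_fst.continuousAt.eventually_lt continuousAt_const (by simp)
  have h2 : ∀ᶠ q : ℝ × Plane in 𝓝 p, ‖q.2‖ < ‖p.2‖ + 1 :=
    continuous_snd.norm.continuousAt.eventually_lt continuousAt_const (by simp)
  filter_upwards [h1, h2] with q hq1 hq2
  refine Eventually.of_forall fun z => (h.comp_le ha hq1.le _ _).trans ?_
  gcongr

/-! ### The Gaussian average as convolution with the heat kernel. -/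

theorem integral_heatKernel_one_mul_cexp (ξ : Plane) :
    ∫ z : Plane, (heatKernel 1 z : ℂ) * Complex.exp (↑(inner ℝ z ξ) * Complex.I) =
      Complex.exp (-‖ξ‖ ^ 2 / 2) := by
  have h := GaussianFourier.integral_cexp_neg_mul_sq_norm_add (V := Plane) (b := (1 / 2 : ℂ))
    (by norm_num) Complex.I ξ
  have e : ∀ z : Plane, (heatKernel 1 z : ℂ) * Complex.exp (↑(inner ℝ z ξ) * Complex.I) =
      (2 * Real.pi : ℂ)⁻¹ *
        Complex.exp (-(1 / 2 : ℂ) * ↑‖z‖ ^ 2 + Complex.I * ↑(inner ℝ ξ z)) := by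
    intro z
    rw [Complex.exp_add, heatKernel, real_inner_comm]
    push_cast
    have e1 : Complex.exp (-(‖z‖ : ℂ) ^ 2 / (2 * 1)) = Complex.exp (-(1 / 2) * (‖z‖ : ℂ) ^ 2) := by
      congr 1; ring
    rw [e1, mul_comm Complex.I, mul_one]
    ring
  simp_rw [e]
  rw [integral_const_mul, h]
  have : (Module.finrank ℝ Plane : ℂ) / 2 = 1 := by simp
  rw [this, Complex.cpow_one]
  have hpi : (Real.pi : ℂ) ≠ 0 := by exact_mod_cast Real.pi_ne_zero
  rw [← mul_assoc]
  have : (2 * (Real.pi : ℂ))⁻¹ * (Real.pi / (1 / 2)) = 1 := by field_simp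
  rw [this, one_mul, Complex.I_sq]
  congr 1
  ring

theorem continuous_heatKernel (t : ℝ) : Continuous (heatKernel t) := by
  unfold heatKernel; fun_prop

theorem heatKernel_nonneg {t : ℝ} (ht : 0 ≤ t) (x : Plane) : 0 ≤ heatKernel t x := by
  unfold heatKernel; positivity

theorem integrable_heatKernel {t : ℝ} (ht : 0 < t) : Integrable (heatKernel t) := by
  have h := (GaussianFourier.integrable_cexp_neg_mul_sq_norm_add (V := Plane)
      (b := ((1 / (2 * t) : ℝ) : ℂ)) (by simpa using ht) 0 0).norm
  refine (h.const_mul ((2 * Real.pi * t)⁻¹)).congr (Eventually.of_forall fun z => ?_)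
  simp only [heatKernel, Complex.norm_exp]
  congr 2
  have : (-(((1 / (2 * t) : ℝ) : ℂ)) * (‖z‖ : ℂ) ^ 2 + 0 * ((inner ℝ (0 : Plane) z : ℝ) : ℂ))
      = ((-(1 / (2 * t)) * ‖z‖ ^ 2 : ℝ) : ℂ) := by push_cast; ring
  rw [this, Complex.ofReal_re]
  ring

/-- Both finite measures have characteristic function `e^{-|ξ|²/2}`. This links the probabilistic
definition of the heat flow, which has no singularity at time zero, to the explicit kernel that
defines the mollified noise. -/
theorem stdG_eq_withDensity :
    stdG = (volume : Measure Plane).withDensity (fun z => ENNReal.ofReal (heatKernel 1 z)) := by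
  have hi := integrable_heatKernel one_pos
  have : IsFiniteMeasure
      ((volume : Measure Plane).withDensity (fun z => ENNReal.ofReal (heatKernel 1 z))) :=
    isFiniteMeasure_withDensity_ofReal hi.2
  apply Measure.ext_of_charFun
  ext ξ
  rw [charFun_stdGaussian, charFun_apply, integral_withDensity_eq_integral_toReal_smul
    (by have := continuous_heatKernel 1; fun_prop) (by simp), ← integral_heatKernel_one_mul_cexp]
  refine integral_congr_ae (Eventually.of_forall fun z => ?_)
  simp only
  rw [ENNReal.toReal_ofReal (heatKernel_nonneg zero_le_one z), Complex.real_smul]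

theorem heatKernel_eq_smul {t : ℝ} (ht : 0 < t) (w : Plane) :
    heatKernel t w = t⁻¹ * heatKernel 1 ((√t)⁻¹ • w) := by
  simp only [heatKernel, norm_smul, norm_inv, Real.norm_eq_abs, abs_of_nonneg (Real.sqrt_nonneg t),
    mul_pow, inv_pow, Real.sq_sqrt ht.le]
  rw [mul_inv, mul_one, ← mul_assoc, mul_comm t⁻¹]
  congr 2
  field_simp

theorem heat_eq_integral {t : ℝ} (ht : 0 < t) (φ : Plane → E) (x : Plane) :
    heat t φ x = ∫ y, heatKernel t (x - y) • φ y := by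
  have hs : √t ≠ 0 := (Real.sqrt_pos.2 ht).ne'
  have h1 : heat t φ x = ∫ z, heatKernel 1 z • φ (x + √t • z) := by
    rw [heat, stdG_eq_withDensity, integral_withDensity_eq_integral_toReal_smul
      (by have := continuous_heatKernel 1; fun_prop) (by simp)]
    refine integral_congr_ae (Eventually.of_forall fun z => ?_)
    simp only
    rw [ENNReal.toReal_ofReal (heatKernel_nonneg zero_le_one z)]
  have h2 : heat t φ x = ∫ z, (fun w => heatKernel 1 ((√t)⁻¹ • w) • φ (x + w)) (√t • z) := by
    rw [h1]
    refine integral_congr_ae (Eventually.of_forall fun z => ?_)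
    simp only
    rw [smul_smul, inv_mul_cancel₀ hs, one_smul]
  rw [h2, Measure.integral_comp_smul volume (fun w => heatKernel 1 ((√t)⁻¹ • w) • φ (x + w)) (√t)]
  have h3 : |((√t) ^ Module.finrank ℝ Plane)⁻¹| = t⁻¹ := by
    simp [Real.sq_sqrt ht.le, abs_of_pos ht]
  rw [h3, ← integral_smul]
  rw [← integral_sub_left_eq_self (fun y => heatKernel t (x - y) • φ y) volume x,
    ← integral_neg_eq_self]
  refine integral_congr_ae (Eventually.of_forall fun w => ?_)
  simp only
  rw [sub_sub_cancel, smul_smul]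
  congr 1
  · rw [heatKernel_eq_smul ht, smul_neg]
    simp [heatKernel]

end

section
set_option linter.unusedSectionVars false

variable {E : Type*} [NormedAddCommGroup E] [NormedSpace ℝ E]

/-! ### The Duhamel integral -/

/-- Rescaling the time variable to `(0, 1]` puts all Duhamel integrals on one probability space that
does not depend on `(t, x)`. Continuity in `(t, x)` is then dominated convergence, and second
moments are double integrals over the product of this space with itself. -/
instance isProbabilityMeasure_volume_Ioc :
    IsProbabilityMeasure ((volume : Measure ℝ).restrict (Ioc (0 : ℝ) 1)) := ⟨by simp⟩

/-- A uniform time in `(0, 1]` and an independent standard Gaussian vector of the plane. -/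
abbrev stM : Measure (ℝ × Plane) := ((volume : Measure ℝ).restrict (Ioc (0 : ℝ) 1)).prod stdG

/-- The Duhamel integral `∫₀ᵗ P_{t-s} H_s(x) ds`, with the time interval rescaled to `(0, 1]`. -/
def duhamel (H : ℝ → Plane → E) (t : ℝ) (x : Plane) : E :=
  t • ∫ p, H (t * p.1) (x + √(t * (1 - p.1)) • p.2) ∂stM

theorem ae_stM_fst : ∀ᵐ p ∂stM, p.1 ∈ Ioc (0 : ℝ) 1 :=
  Measure.quasiMeasurePreserving_fst.ae (ae_restrict_mem measurableSet_Ioc)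

theorem mul_mem_Icc_of_mem_Ioc {t σ : ℝ} (ht : 0 ≤ t) (hσ : σ ∈ Ioc (0 : ℝ) 1) :
    t * σ ∈ Icc 0 t :=
  ⟨mul_nonneg ht hσ.1.le, mul_le_of_le_one_right ht hσ.2⟩

theorem integrable_duhamel {H : ℝ → Plane → E} {t a K : ℝ} (ht : 0 ≤ t) (ha : 0 ≤ a)
    (hm : StronglyMeasurable (Function.uncurry H)) (hH : ∀ s ∈ Icc 0 t, ExpBound a K (H s))
    (x : Plane) :
    Integrable (fun p : ℝ × Plane => H (t * p.1) (x + √(t * (1 - p.1)) • p.2)) stM := by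
  have hb : Integrable (fun p : ℝ × Plane =>
      K * Real.exp (a * ‖x‖) * Real.exp (a * √t * ‖p.2‖)) stM :=
    ((integrable_exp_norm (a * √t)).comp_snd _).const_mul _
  refine hb.mono' (hm.comp_measurable (g := fun p : ℝ × Plane =>
    (t * p.1, x + √(t * (1 - p.1)) • p.2)) (by fun_prop)).aestronglyMeasurable ?_
  filter_upwards [ae_stM_fst] with p hp
  refine (hH _ (mul_mem_Icc_of_mem_Ioc ht hp)).comp_le ha ?_ x p.2
  exact mul_le_of_le_one_right ht (by linarith [hp.1])

theorem duhamel_sub {H H' : ℝ → Plane → E} {t a K K' : ℝ} (ht : 0 ≤ t) (ha : 0 ≤ a)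
    (hm : StronglyMeasurable (Function.uncurry H)) (hH : ∀ s ∈ Icc 0 t, ExpBound a K (H s))
    (hm' : StronglyMeasurable (Function.uncurry H')) (hH' : ∀ s ∈ Icc 0 t, ExpBound a K' (H' s))
    (x : Plane) :
    duhamel (fun s y => H s y - H' s y) t x = duhamel H t x - duhamel H' t x := by
  simp only [duhamel]
  rw [← smul_sub, ← integral_sub (integrable_duhamel ht ha hm hH x)
    (integrable_duhamel ht ha hm' hH' x)]

theorem norm_duhamel_le {H : ℝ → Plane → E} {Ξ : ℝ → Plane → ℝ} {t : ℝ} (ht : 0 ≤ t) {x : Plane}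
    (hΞ : Integrable (fun p : ℝ × Plane => Ξ (t * p.1) (x + √(t * (1 - p.1)) • p.2)) stM)
    (h : ∀ s ∈ Icc 0 t, ∀ y, ‖H s y‖ ≤ Ξ s y) :
    ‖duhamel H t x‖ ≤ duhamel Ξ t x := by
  simp only [duhamel, norm_smul, Real.norm_eq_abs, abs_of_nonneg ht, smul_eq_mul]
  refine mul_le_mul_of_nonneg_left ((norm_integral_le_integral_norm _).trans ?_) ht
  refine integral_mono_of_nonneg (Eventually.of_forall fun _ => norm_nonneg _) hΞ ?_
  filter_upwards [ae_stM_fst] with p hp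
  exact h _ (mul_mem_Icc_of_mem_Ioc ht hp) _

theorem expBound_mul_heat {c : ℝ → ℝ} (hc : Continuous c) {ψ : Plane → ℝ} {a K : ℝ} (ha : 0 ≤ a)
    (hψ : ExpBound a K ψ) (t : ℝ) :
    ∃ K', ∀ s ∈ Icc 0 t, ExpBound a K' (fun y => c s * heat s ψ y) := by
  obtain ⟨M, hM⟩ := (isCompact_Icc (a := (0 : ℝ)) (b := t)).exists_bound_of_continuousOn
    hc.continuousOn
  refine ⟨M * (K * expMoment (a * √t)), fun s hs y => ?_⟩
  rw [norm_mul, mul_assoc]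
  have h1 := hM s hs
  have h2 := hψ.heat_le ha hs.2 y
  exact mul_le_mul h1 h2 (norm_nonneg _) ((norm_nonneg _).trans h1)

theorem integrable_duhamel_mul_heat {c : ℝ → ℝ} (hc : Continuous c) {ψ : Plane → ℝ} {a K t : ℝ}
    (ha : 0 ≤ a) (hψ : ExpBound a K ψ) (hψc : Continuous ψ) (ht : 0 ≤ t) (x : Plane) :
    Integrable (fun p : ℝ × Plane =>
      c (t * p.1) * heat (t * p.1) ψ (x + √(t * (1 - p.1)) • p.2)) stM := by
  obtain ⟨K', hK'⟩ := expBound_mul_heat hc ha hψ t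
  have hcont : Continuous (Function.uncurry fun s y => c s * heat s ψ y) :=
    (hc.comp continuous_fst).mul (continuous_heat ha hψ hψc)
  exact integrable_duhamel ht ha hcont.stronglyMeasurable hK' x

/-- Since `P_{t-s}P_sψ = P_tψ`, the spatial part leaves the time integral. Majorants of the form
`c(s) P_sψ` are thus stable under Duhamel integration, and this stability underlies every Gronwall
argument below. -/
theorem duhamel_mul_heat {c : ℝ → ℝ} (hc : Continuous c) {ψ : Plane → ℝ} {a K t : ℝ} (ha : 0 ≤ a)
    (hψ : ExpBound a K ψ) (hψc : Continuous ψ) (ht : 0 ≤ t) (x : Plane) :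
    duhamel (fun s y => c s * heat s ψ y) t x = (∫ s in 0..t, c s) * heat t ψ x := by
  rw [duhamel, integral_prod _ (integrable_duhamel_mul_heat hc ha hψ hψc ht x)]
  have h1 : ∀ σ ∈ Ioc (0 : ℝ) 1,
      ∫ z, c (t * σ) * heat (t * σ) ψ (x + √(t * (1 - σ)) • z) ∂stdG =
        c (t * σ) * heat t ψ x := by
    intro σ hσ
    rw [integral_const_mul]
    have := heat_heat (s := t * (1 - σ)) (t := t * σ)
      (mul_nonneg ht (by linarith [hσ.2])) (mul_nonneg ht hσ.1.le) ha hψ hψc.stronglyMeasurable x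
    rw [heat] at this
    rw [this]
    congr 2
    ring
  rw [setIntegral_congr_fun measurableSet_Ioc h1, integral_mul_const, smul_eq_mul, ← mul_assoc,
    ← intervalIntegral.integral_of_le zero_le_one, ← smul_eq_mul (a := t),
    intervalIntegral.smul_integral_comp_mul_left]
  simp

theorem norm_duhamel_le_mul_heat {H : ℝ → Plane → E} {c : ℝ → ℝ} (hc : Continuous c)
    {ψ : Plane → ℝ} {a K t : ℝ} (ha : 0 ≤ a) (hψ : ExpBound a K ψ) (hψc : Continuous ψ)
    (ht : 0 ≤ t) (h : ∀ s ∈ Icc 0 t, ∀ y, ‖H s y‖ ≤ c s * heat s ψ y) (x : Plane) :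
    ‖duhamel H t x‖ ≤ (∫ s in 0..t, c s) * heat t ψ x := by
  rw [← duhamel_mul_heat hc ha hψ hψc ht x]
  exact norm_duhamel_le ht (integrable_duhamel_mul_heat hc ha hψ hψc ht x) h

/-- Boundedness is asked on a symmetric time interval because `t` ranges over all reals: for
negative `t` the rescaled time `tσ` lies in `[-|t|, 0]`. -/
theorem continuous_duhamel {H : ℝ → Plane → E} (hc : Continuous (Function.uncurry H))
    (hb : ∀ T, ∃ K, ∀ s ∈ Icc (-T) T, ∀ y, ‖H s y‖ ≤ K) :
    Continuous (fun p : ℝ × Plane => duhamel H p.1 p.2) := by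
  simp only [duhamel]
  refine continuous_fst.smul ?_
  rw [continuous_iff_continuousAt]
  intro q
  obtain ⟨K, hK⟩ := hb (|q.1| + 1)
  refine continuousAt_of_dominated (bound := fun _ => K) ?_ ?_ (integrable_const _) ?_
  · refine Eventually.of_forall fun q => ?_
    exact (hc.comp (f := fun p : ℝ × Plane => (q.1 * p.1, q.2 + √(q.1 * (1 - p.1)) • p.2))
      (by fun_prop)).aestronglyMeasurable
  · have h1 : ∀ᶠ q' : ℝ × Plane in 𝓝 q, |q'.1| < |q.1| + 1 :=
      continuous_fst.abs.continuousAt.eventually_lt continuousAt_const (by simp)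
    filter_upwards [h1] with q' hq'
    filter_upwards [ae_stM_fst] with p hp
    refine hK _ ?_ _
    rw [mem_Icc, ← abs_le, abs_mul, abs_of_pos hp.1]
    exact (mul_le_of_le_one_right (abs_nonneg _) hp.2).trans hq'.le
  · refine Eventually.of_forall fun p => ?_
    exact (hc.comp (f := fun q : ℝ × Plane => (q.1 * p.1, q.2 + √(q.1 * (1 - p.1)) • p.2))
      (by fun_prop)).continuousAt

/-! ### A Gronwall inequality for majorants -/

theorem integral_mul_exp_integral {c : ℝ → ℝ} (hc : Continuous c) (t : ℝ) :
    ∫ s in 0..t, c s * Real.exp (∫ r in 0..s, c r) = Real.exp (∫ r in 0..t, c r) - 1 := by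
  have h : ∀ s, HasDerivAt (fun s => Real.exp (∫ r in 0..s, c r))
      (c s * Real.exp (∫ r in 0..s, c r)) s := by
    intro s
    have := (hc.integral_hasStrictDerivAt 0 s).hasDerivAt.exp
    rwa [mul_comm] at this
  rw [intervalIntegral.integral_eq_sub_of_hasDerivAt (fun s _ => h s)]
  · simp
  · refine Continuous.intervalIntegrable ?_ _ _
    have : Continuous fun s => ∫ r in 0..s, c r :=
      continuous_iff_continuousAt.2 fun s =>
        (hc.integral_hasStrictDerivAt 0 s).hasDerivAt.continuousAt
    fun_prop

theorem integral_mul_pow_integral {c : ℝ → ℝ} (hc : Continuous c) (n : ℕ) (t : ℝ) :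
    ∫ s in 0..t, c s * ((∫ r in 0..s, c r) ^ n / (n.factorial : ℝ)) =
      (∫ r in 0..t, c r) ^ (n + 1) / ((n + 1).factorial : ℝ) := by
  have h : ∀ s, HasDerivAt (fun s => (∫ r in 0..s, c r) ^ (n + 1) / ((n + 1).factorial : ℝ))
      (c s * ((∫ r in 0..s, c r) ^ n / (n.factorial : ℝ))) s := by
    intro s
    have := (((hc.integral_hasStrictDerivAt 0 s).hasDerivAt.pow (n + 1)).div_const
      ((n + 1).factorial : ℝ))
    refine this.congr_deriv ?_
    rw [Nat.factorial_succ]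
    push_cast
    field_simp
  rw [intervalIntegral.integral_eq_sub_of_hasDerivAt (fun s _ => h s)]
  · simp
  · refine Continuous.intervalIntegrable ?_ _ _
    have : Continuous fun s => ∫ r in 0..s, c r :=
      continuous_iff_continuousAt.2 fun s =>
        (hc.integral_hasStrictDerivAt 0 s).hasDerivAt.continuousAt
    fun_prop

/-- A Picard iteration on the coefficients of the majorant `pX + qY`, where `hstep` maps `(p, q)` to
`(1 + ∫cp, ∫cq)`. The choice `p = exp(∫c)` is a fixed point of the first component, while `q` starts
from the crude constant `B` and becomes `B (∫c)ⁿ / n!`, which tends to zero. No regularity of `d` is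
needed, so `d` can be a field of `L²` norms. The index set `S` is the plane in the deterministic
applications and pairs (noise coordinate, point) in the main one. -/
theorem gronwall_majorant {S : Type*} {T B : ℝ} (hB : 0 ≤ B) {c : ℝ → ℝ} (hc : Continuous c)
    (hc0 : ∀ s, 0 ≤ c s) {d X Y : ℝ → S → ℝ} (hX : ∀ t ∈ Icc 0 T, ∀ σ, 0 ≤ X t σ)
    (h0 : ∀ t ∈ Icc 0 T, ∀ σ, d t σ ≤ B * Y t σ)
    (hstep : ∀ p q : ℝ → ℝ, Continuous p → Continuous q → (∀ s ∈ Icc 0 T, 0 ≤ p s) →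
      (∀ s ∈ Icc 0 T, 0 ≤ q s) →
      (∀ s ∈ Icc 0 T, ∀ σ, d s σ ≤ p s * X s σ + q s * Y s σ) →
      ∀ t ∈ Icc 0 T, ∀ σ,
        d t σ ≤ (1 + ∫ s in 0..t, c s * p s) * X t σ + (∫ s in 0..t, c s * q s) * Y t σ) :
    ∀ t ∈ Icc 0 T, ∀ σ, d t σ ≤ Real.exp (∫ s in 0..t, c s) * X t σ := by
  have hCc : Continuous fun s => ∫ r in 0..s, c r :=
    continuous_iff_continuousAt.2 fun s =>
      (hc.integral_hasStrictDerivAt 0 s).hasDerivAt.continuousAt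
  have hC0 : ∀ s ∈ Icc 0 T, 0 ≤ ∫ r in 0..s, c r := fun s hs =>
    intervalIntegral.integral_nonneg hs.1 fun r _ => hc0 r
  have key : ∀ n : ℕ, ∀ t ∈ Icc 0 T, ∀ σ, d t σ ≤ Real.exp (∫ s in 0..t, c s) * X t σ +
      (B * ((∫ r in 0..t, c r) ^ n / (n.factorial : ℝ))) * Y t σ := by
    intro n
    induction n with
    | zero =>
      intro t ht σ
      have := h0 t ht σ
      have := mul_nonneg (Real.exp_pos (∫ s in 0..t, c s)).le (hX t ht σ)
      simp
      linarith
    | succ n ih =>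
      intro t ht σ
      have := hstep (fun s => Real.exp (∫ r in 0..s, c r))
        (fun s => B * ((∫ r in 0..s, c r) ^ n / (n.factorial : ℝ))) (by fun_prop) (by fun_prop)
        (fun s _ => (Real.exp_pos _).le)
        (fun s hs => by have := hC0 s hs; positivity) ih t ht σ
      simp only [mul_left_comm _ B] at this
      rw [intervalIntegral.integral_const_mul, integral_mul_pow_integral hc,
        integral_mul_exp_integral hc] at this
      convert this using 3
      ring
  intro t ht σ
  have hl : Tendsto (fun n : ℕ => Real.exp (∫ s in 0..t, c s) * X t σ +
      (B * ((∫ r in 0..t, c r) ^ n / (n.factorial : ℝ))) * Y t σ) atTop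
      (𝓝 (Real.exp (∫ s in 0..t, c s) * X t σ + (B * 0) * Y t σ)) :=
    (((FloorSemiring.tendsto_pow_div_factorial_atTop _).const_mul B).mul_const _).const_add _
  have := ge_of_tendsto' hl fun n => key n t ht σ
  simpa using this

/-- If `D` is dominated by its own Duhamel integral with potential `c`, up to the heat flow
of `ψ`, then `D` is dominated by the heat flow of `ψ` times `exp (∫ c)`. -/
theorem le_exp_mul_heat_of_le_duhamel {T a K K' : ℝ} (ha : 0 ≤ a) {c : ℝ → ℝ} (hc : Continuous c)
    (hc0 : ∀ s, 0 ≤ c s) {D : ℝ → Plane → ℝ} (hD : ∀ s ∈ Icc 0 T, ExpBound a K (D s))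
    {ψ : Plane → ℝ} (hψ : ExpBound a K' ψ) (hψc : Continuous ψ) (hψ0 : ∀ x, 0 ≤ ψ x)
    {G : ℝ → Plane → E} (hG : ∀ s ∈ Icc 0 T, ∀ y, ‖G s y‖ ≤ c s * D s y)
    (h : ∀ t ∈ Icc 0 T, ∀ x, D t x ≤ heat t ψ x + ‖duhamel G t x‖) :
    ∀ t ∈ Icc 0 T, ∀ x, D t x ≤ Real.exp (∫ s in 0..t, c s) * heat t ψ x := by
  by_cases hT : 0 ≤ T
  swap
  · intro t ht; exact absurd (ht.1.trans ht.2) hT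
  have hK : 0 ≤ K := (hD 0 ⟨le_rfl, hT⟩).nonneg
  set Hf : Plane → ℝ := fun y => Real.exp (a * ‖y‖) with hHf
  have hHb : ExpBound a 1 Hf := by intro y; simp [hHf]
  have hHc : Continuous Hf := by fun_prop
  have hM := expMoment_pos (-(a * √T))
  -- `Y` is the heat flow of the weight `e^{a|y|}`; by `exp_le_heat_exp` this `B` turns the a priori
  -- exponential bound on `D` into the starting bound of the iteration.
  refine gronwall_majorant (B := K / expMoment (-(a * √T))) (by positivity) hc hc0
    (Y := fun t x => heat t Hf x) (fun t _ x => heat_nonneg hψ0 x) ?_ ?_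
  · intro t ht x
    have h1 := hD t ht x
    have h2 := exp_le_heat_exp ha ht.2 x
    rw [div_mul_eq_mul_div, le_div_iff₀ hM]
    calc D t x * expMoment (-(a * √T)) ≤ (K * Real.exp (a * ‖x‖)) * expMoment (-(a * √T)) := by
          gcongr; exact (le_abs_self _).trans h1
      _ = K * (Real.exp (a * ‖x‖) * expMoment (-(a * √T))) := by ring
      _ ≤ _ := by gcongr
  · intro p q hp hq hp0 hq0 hle t ht x
    refine (h t ht x).trans ?_
    have i1 := integrable_duhamel_mul_heat (hc.fun_mul hp) ha hψ hψc ht.1 x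
    have i2 := integrable_duhamel_mul_heat (hc.fun_mul hq) ha hHb hHc ht.1 x
    have h1 : ‖duhamel G t x‖ ≤
        duhamel (fun s y => c s * p s * heat s ψ y + c s * q s * heat s Hf y) t x := by
      refine norm_duhamel_le ht.1 (i1.add i2) fun s hs y => ?_
      have hs' : s ∈ Icc 0 T := ⟨hs.1, hs.2.trans ht.2⟩
      refine (hG s hs' y).trans ?_
      have := mul_le_mul_of_nonneg_left (hle s hs' y) (hc0 s)
      linarith
    have h2 : duhamel (fun s y => c s * p s * heat s ψ y + c s * q s * heat s Hf y) t x =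
        (∫ s in 0..t, c s * p s) * heat t ψ x + (∫ s in 0..t, c s * q s) * heat t Hf x := by
      rw [← duhamel_mul_heat (hc.fun_mul hp) ha hψ hψc ht.1 x,
        ← duhamel_mul_heat (hc.fun_mul hq) ha hHb hHc ht.1 x]
      simp only [duhamel]
      rw [← smul_add, ← integral_add i1 i2]
    rw [h2] at h1
    linarith

/-! ### Existence of mild solutions -/

-- Banach's fixed point theorem for `w = e^{-Lt}U` among bounded continuous functions: the
-- exponential weight makes the Duhamel map a contraction on the whole half-line at once. The target
-- is a general Banach space so that the same result serves the scalar reaction equation and the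
-- coupled mean field system in `ℝⁿ`.
open BoundedContinuousFunction in
theorem exists_mild_solution [CompleteSpace E] {h : ℝ → Plane → E → E}
    (hc : Continuous fun p : ℝ × Plane × E => h p.1 p.2.1 p.2.2) {Λ : ℝ} (hΛ : 0 ≤ Λ)
    (hl : ∀ s y v v', ‖h s y v - h s y v'‖ ≤ Λ * ‖v - v'‖) (h0 : ∀ s y, h s y 0 = 0)
    {φ : Plane → E} (hφ : Continuous φ) {K : ℝ} (hφb : ∀ x, ‖φ x‖ ≤ K) :
    ∃ U : ℝ → Plane → E, Continuous (Function.uncurry U) ∧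
      (∀ T, ∃ M, ∀ s ≤ T, ∀ y, ‖U s y‖ ≤ M) ∧
      ∀ t, 0 ≤ t → ∀ x, U t x = heat t φ x - duhamel (fun s y => h s y (U s y)) t x := by
  -- The contraction factor is `Λ / L`, and this choice keeps it below `1/2` and `L` positive even
  -- when `Λ = 0`.
  set L : ℝ := 2 * Λ + 1 with hL
  have hLpos : 0 < L := by positivity
  have hφe : ExpBound 0 K φ := ExpBound.of_bounded hφb
  have hlin : ∀ s y v, ‖h s y v‖ ≤ Λ * ‖v‖ := by
    intro s y v; simpa [h0] using hl s y v 0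
  let Hw : (ℝ × Plane →ᵇ E) → ℝ → Plane → E := fun w s y =>
    h s y (Real.exp (L * max s 0) • w (s, y))
  have hHwc : ∀ w, Continuous (Function.uncurry (Hw w)) := fun w =>
    hc.comp (f := fun p : ℝ × Plane => (p.1, p.2, Real.exp (L * max p.1 0) • w p)) (by fun_prop)
  have hHwb : ∀ w s y, ‖Hw w s y‖ ≤ Λ * (Real.exp (L * max s 0) * ‖w‖) := by
    intro w s y
    refine (hlin _ _ _).trans ?_
    rw [norm_smul, Real.norm_eq_abs, abs_of_pos (Real.exp_pos _)]
    gcongr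
    exact w.norm_coe_le_norm _
  have hHwe : ∀ w t, ∀ s ∈ Icc 0 t, ExpBound 0 (Λ * (Real.exp (L * t) * ‖w‖)) (Hw w s) := by
    intro w t s hs y
    refine (hHwb w s y).trans ?_
    rw [max_eq_left hs.1]
    simp only [zero_mul, Real.exp_zero, mul_one]
    have := hs.2
    gcongr
  have hduc : ∀ w, Continuous fun p : ℝ × Plane => duhamel (Hw w) p.1 p.2 := by
    intro w
    refine continuous_duhamel (hHwc w) fun T => ⟨Λ * (Real.exp (L * max T 0) * ‖w‖), ?_⟩
    intro s hs y
    refine (hHwb w s y).trans ?_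
    have := hs.2
    gcongr
  have hint : ∀ M t, 0 ≤ t → ∫ s in 0..t, Λ * (Real.exp (L * s) * M) ≤
      Λ / L * (Real.exp (L * t) * M) - Λ / L * M := by
    intro M t ht
    rw [intervalIntegral.integral_const_mul, intervalIntegral.integral_mul_const,
      intervalIntegral.integral_comp_mul_left (fun s => Real.exp s) hLpos.ne', integral_exp]
    simp only [mul_zero, Real.exp_zero, smul_eq_mul]
    apply le_of_eq
    ring
  have hone : ExpBound 0 1 (fun _ : Plane => (1 : ℝ)) := by intro x; simp
  have hdub : ∀ w t, 0 ≤ t → ∀ x, ‖duhamel (Hw w) t x‖ ≤ Λ / L * (Real.exp (L * t) * ‖w‖) := by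
    intro w t ht x
    have := norm_duhamel_le_mul_heat (H := Hw w) (c := fun s => Λ * (Real.exp (L * s) * ‖w‖))
      (by fun_prop) le_rfl hone continuous_const ht (fun s hs y => by
        have := hHwb w s y
        rw [max_eq_left hs.1] at this
        simpa [heat_const] using this) x
    rw [heat_const, mul_one] at this
    refine this.trans ((hint _ t ht).trans ?_)
    have : 0 ≤ Λ / L * ‖w‖ := by positivity
    linarith
  -- Negative times are replaced by `0`, so that the map acts on functions defined on all of `ℝ ×
  -- ℝ²`; only `t ≥ 0` matters in the end.
  let Ψ : (ℝ × Plane →ᵇ E) → (ℝ × Plane →ᵇ E) := fun w =>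
    BoundedContinuousFunction.ofNormedAddCommGroup
      (fun p : ℝ × Plane => Real.exp (-(L * max p.1 0)) •
        (heat (max p.1 0) φ p.2 - duhamel (Hw w) (max p.1 0) p.2))
      (by
        have h1 := (continuous_heat le_rfl hφe hφ).comp
          (f := fun p : ℝ × Plane => (max p.1 0, p.2)) (by fun_prop)
        have h2 := (hduc w).comp (f := fun p : ℝ × Plane => (max p.1 0, p.2)) (by fun_prop)
        exact Continuous.smul (by fun_prop) (h1.sub h2))
      (K + Λ / L * ‖w‖)
      (by
        intro p
        have hp : 0 ≤ max p.1 0 := le_max_right _ _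
        rw [norm_smul, Real.norm_eq_abs, abs_of_pos (Real.exp_pos _)]
        have h1 : ‖heat (max p.1 0) φ p.2‖ ≤ K := by
          have := hφe.heat_le le_rfl (le_refl (max p.1 0)) p.2
          simpa [expMoment] using this
        have h2 := hdub w _ hp p.2
        have h3 : Real.exp (-(L * max p.1 0)) ≤ 1 := by
          rw [Real.exp_le_one_iff]; nlinarith
        have hK : 0 ≤ K := (norm_nonneg _).trans h1
        have h4 : Real.exp (-(L * max p.1 0)) * Real.exp (L * max p.1 0) = 1 := by
          rw [← Real.exp_add]; simp
        calc Real.exp (-(L * max p.1 0)) * ‖heat (max p.1 0) φ p.2 - duhamel (Hw w) (max p.1 0) p.2‖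
            ≤ Real.exp (-(L * max p.1 0)) *
              (K + Λ / L * (Real.exp (L * max p.1 0) * ‖w‖)) := by
              gcongr
              exact (norm_sub_le _ _).trans (add_le_add h1 h2)
          _ = Real.exp (-(L * max p.1 0)) * K + Λ / L * ‖w‖ *
              (Real.exp (-(L * max p.1 0)) * Real.exp (L * max p.1 0)) := by ring
          _ ≤ 1 * K + Λ / L * ‖w‖ * 1 := by rw [h4]; gcongr
          _ = _ := by ring)
  have hΨ : ∀ w t, 0 ≤ t → ∀ x, Ψ w (t, x) =
      Real.exp (-(L * t)) • (heat t φ x - duhamel (Hw w) t x) := by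
    intro w t ht x
    simp [Ψ, max_eq_left ht]
  have hcontr : ContractingWith (1 / 2 : ℝ≥0) Ψ := by
    refine ⟨by rw [← NNReal.coe_lt_coe]; norm_num, LipschitzWith.of_dist_le_mul fun w w' => ?_⟩
    rw [BoundedContinuousFunction.dist_le (by positivity)]
    intro p
    have hp : 0 ≤ max p.1 0 := le_max_right _ _
    set t := max p.1 0 with ht
    have e : dist (Ψ w p) (Ψ w' p) =
        Real.exp (-(L * t)) * ‖duhamel (fun s y => Hw w' s y - Hw w s y) t p.2‖ := by
      rw [duhamel_sub hp le_rfl (hHwc w').stronglyMeasurable (hHwe w' t)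
        (hHwc w).stronglyMeasurable (hHwe w t), dist_eq_norm]
      simp only [Ψ, BoundedContinuousFunction.coe_ofNormedAddCommGroup]
      rw [← smul_sub, norm_smul, Real.norm_eq_abs, abs_of_pos (Real.exp_pos _)]
      congr 2
      abel
    have h1 := norm_duhamel_le_mul_heat (H := fun s y => Hw w' s y - Hw w s y)
      (c := fun s => Λ * (Real.exp (L * s) * dist w w'))
      (by fun_prop) le_rfl hone continuous_const hp (fun s hs y => by
        simp only [heat_const, mul_one, Hw]
        refine (hl _ _ _ _).trans ?_
        rw [max_eq_left hs.1, ← smul_sub, norm_smul, Real.norm_eq_abs, abs_of_pos (Real.exp_pos _)]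
        gcongr
        rw [← dist_eq_norm, dist_comm]
        exact BoundedContinuousFunction.dist_coe_le_dist _) p.2
    rw [heat_const, mul_one] at h1
    have h2 := h1.trans (hint _ t hp)
    have h4 : Real.exp (-(L * t)) * Real.exp (L * t) = 1 := by
      rw [← Real.exp_add]; simp
    have h5 : Λ / L ≤ 1 / 2 := by rw [div_le_iff₀ hLpos]; linarith
    have h6 : 0 ≤ Λ / L * dist w w' := by positivity
    rw [e]
    calc _ ≤ Real.exp (-(L * t)) * (Λ / L * (Real.exp (L * t) * dist w w')) := by
          gcongr; linarith
      _ = Λ / L * dist w w' * (Real.exp (-(L * t)) * Real.exp (L * t)) := by ring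
      _ ≤ _ := by rw [h4, mul_one]; push_cast; gcongr
  set w := hcontr.fixedPoint with hw
  have hfix : Ψ w = w := hcontr.fixedPoint_isFixedPt
  have hHU : Hw w = fun s y => h s y (Real.exp (L * max s 0) • w (s, y)) := rfl
  refine ⟨fun s y => Real.exp (L * max s 0) • w (s, y), ?_, ?_, ?_⟩
  · exact Continuous.smul (by fun_prop) w.continuous
  · intro T
    refine ⟨Real.exp (L * max T 0) * ‖w‖, fun s hs y => ?_⟩
    rw [norm_smul, Real.norm_eq_abs, abs_of_pos (Real.exp_pos _)]
    gcongr
    exact w.norm_coe_le_norm _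
  · intro t ht x
    rw [← hHU]
    have := hΨ w t ht x
    rw [hfix] at this
    simp only [max_eq_left ht]
    rw [this, smul_smul, ← Real.exp_add]
    simp

end

section
/-! ### Classical solutions are mild solutions -/

/-- The second derivative of `f` at `y` in the direction `e`. -/
def secondDeriv (e : Plane) (f : Plane → ℝ) (y : Plane) : ℝ :=
  fderiv ℝ (fun y => fderiv ℝ f y e) y e

/-- The standard orthonormal basis of the plane. -/
abbrev planeBasis : OrthonormalBasis (Fin 2) ℝ Plane := EuclideanSpace.basisFun (Fin 2) ℝ

theorem contDiff_fderiv_apply {f : Plane → ℝ} (hf : ContDiff ℝ 2 f) (e : Plane) :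
    ContDiff ℝ 1 (fun y => fderiv ℝ f y e) :=
  (hf.fderiv_right (m := 1) (by norm_num)).clm_apply contDiff_const

theorem secondDeriv_eq {f : Plane → ℝ} (hf : ContDiff ℝ 2 f) (e y : Plane) :
    secondDeriv e f y = fderiv ℝ (fderiv ℝ f) y e e := by
  have h : DifferentiableAt ℝ (fderiv ℝ f) y :=
    (hf.fderiv_right (m := 1) (by norm_num)).differentiable (by norm_num) y
  rw [secondDeriv, fderiv_clm_apply h (by fun_prop)]
  simp

theorem continuous_secondDeriv {f : Plane → ℝ} (hf : ContDiff ℝ 2 f) (e : Plane) :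
    Continuous (secondDeriv e f) :=
  ((contDiff_fderiv_apply hf e).continuous_fderiv (by norm_num)).clm_apply continuous_const

theorem laplacian_eq_sum_secondDeriv {f : Plane → ℝ} (hf : ContDiff ℝ 2 f) (y : Plane) :
    Laplacian.laplacian f y = ∑ i, secondDeriv (planeBasis i) f y := by
  rw [InnerProductSpace.laplacian_eq_iteratedFDeriv_orthonormalBasis f planeBasis]
  refine Finset.sum_congr rfl fun i _ => ?_
  rw [iteratedFDeriv_two_apply, secondDeriv_eq hf]
  simp

/-- Two integrations by parts; the compact support of `ψ` makes every product integrable, whatever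
the growth of `z`. -/
theorem integral_mul_secondDeriv {ψ z : Plane → ℝ} (hψ : ContDiff ℝ 2 ψ) (hs : HasCompactSupport ψ)
    (hz : ContDiff ℝ 2 z) (e : Plane) :
    ∫ y, ψ y * secondDeriv e z y = ∫ y, secondDeriv e ψ y * z y := by
  have hψ1 := contDiff_fderiv_apply hψ e
  have hz1 := contDiff_fderiv_apply hz e
  have hs1 : HasCompactSupport (fun y => fderiv ℝ ψ y e) :=
    (hs.fderiv ℝ).comp_left (g := fun l : Plane →L[ℝ] ℝ => l e) (by simp)
  have hs2 : HasCompactSupport (secondDeriv e ψ) :=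
    (hs1.fderiv ℝ).comp_left (g := fun l : Plane →L[ℝ] ℝ => l e) (by simp)
  have i1 : Integrable (fun y => ψ y * secondDeriv e z y) :=
    (hψ.continuous.mul (continuous_secondDeriv hz e)).integrable_of_hasCompactSupport hs.mul_right
  have i2 : Integrable (fun y => fderiv ℝ ψ y e * fderiv ℝ z y e) :=
    (hψ1.continuous.mul hz1.continuous).integrable_of_hasCompactSupport hs1.mul_right
  have i3 : Integrable (fun y => ψ y * fderiv ℝ z y e) :=
    (hψ.continuous.mul hz1.continuous).integrable_of_hasCompactSupport hs.mul_right
  have i4 : Integrable (fun y => fderiv ℝ ψ y e * z y) :=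
    (hψ1.continuous.mul hz.continuous).integrable_of_hasCompactSupport hs1.mul_right
  have i5 : Integrable (fun y => secondDeriv e ψ y * z y) :=
    ((continuous_secondDeriv hψ e).mul hz.continuous).integrable_of_hasCompactSupport hs2.mul_right
  have e1 := integral_mul_fderiv_eq_neg_fderiv_mul_of_integrable (μ := volume) (f := ψ)
    (g := fun y => fderiv ℝ z y e) (v := e) i2 i1 i3
    (fun y _ => hψ.differentiable (by norm_num) y) (fun y _ => hz1.differentiable (by norm_num) y)
  have e2 := integral_mul_fderiv_eq_neg_fderiv_mul_of_integrable (μ := volume)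
    (f := fun y => fderiv ℝ ψ y e) (g := z) (v := e) i5 i2 i4
    (fun y _ => hψ1.differentiable (by norm_num) y) (fun y _ => hz.differentiable (by norm_num) y)
  simp only [secondDeriv] at *
  rw [e1, e2, neg_neg]

theorem secondDeriv_mul {χ k : Plane → ℝ} (hχ : ContDiff ℝ 2 χ) (hk : ContDiff ℝ 2 k)
    (e y : Plane) :
    secondDeriv e (fun y => χ y * k y) y =
      secondDeriv e χ y * k y + 2 * (fderiv ℝ χ y e * fderiv ℝ k y e) +
        χ y * secondDeriv e k y := by
  have hχ1 : ∀ y, DifferentiableAt ℝ χ y := fun y => hχ.differentiable (by norm_num) y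
  have hk1 : ∀ y, DifferentiableAt ℝ k y := fun y => hk.differentiable (by norm_num) y
  have hχ2 : DifferentiableAt ℝ (fun y => fderiv ℝ χ y e) y :=
    (contDiff_fderiv_apply hχ e).differentiable (by norm_num) y
  have hk2 : DifferentiableAt ℝ (fun y => fderiv ℝ k y e) y :=
    (contDiff_fderiv_apply hk e).differentiable (by norm_num) y
  have h1 : (fun y => fderiv ℝ (fun y => χ y * k y) y e) =
      fun y => χ y * fderiv ℝ k y e + k y * fderiv ℝ χ y e := by
    ext y
    rw [fderiv_fun_mul (hχ1 y) (hk1 y)]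
    simp
  simp only [secondDeriv]
  rw [h1, fderiv_fun_add ((hχ1 y).fun_mul hk2) ((hk1 y).fun_mul hχ2), fderiv_fun_mul (hχ1 y) hk2,
    fderiv_fun_mul (hk1 y) hχ2]
  simp
  ring

theorem contDiff_heatKernel (τ : ℝ) (x : Plane) :
    ContDiff ℝ 2 (fun y => heatKernel τ (x - y)) := by
  unfold heatKernel
  have : ContDiff ℝ 2 (fun y : Plane => ‖x - y‖ ^ 2) := (contDiff_const.sub contDiff_id).norm_sq ℝ
  exact contDiff_const.mul ((this.neg.div_const _).exp)

theorem fderiv_heatKernel (τ : ℝ) (x y e : Plane) :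
    fderiv ℝ (fun y => heatKernel τ (x - y)) y e =
      heatKernel τ (x - y) * (inner ℝ (x - y) e / τ) := by
  have h1 : HasFDerivAt (fun y : Plane => x - y) (-ContinuousLinearMap.id ℝ Plane) y :=
    (hasFDerivAt_id y).const_sub x
  have h2 := (((h1.norm_sq.neg.mul_const ((2 * τ)⁻¹)).exp).const_mul ((2 * Real.pi * τ)⁻¹))
  have h3 : HasFDerivAt (fun y => heatKernel τ (x - y)) _ y := h2
  rw [h3.fderiv]
  simp [heatKernel, inner_sub_left]
  ring_nf

theorem secondDeriv_heatKernel (τ : ℝ) (x y e : Plane) :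
    secondDeriv e (fun y => heatKernel τ (x - y)) y =
      heatKernel τ (x - y) * ((inner ℝ (x - y) e) ^ 2 / τ ^ 2 - ‖e‖ ^ 2 / τ) := by
  have h0 : (fun y => fderiv ℝ (fun y => heatKernel τ (x - y)) y e) =
      fun y => heatKernel τ (x - y) * (inner ℝ (x - y) e / τ) := by
    ext y; exact fderiv_heatKernel τ x y e
  have h1 : HasFDerivAt (fun y : Plane => x - y) (-ContinuousLinearMap.id ℝ Plane) y :=
    (hasFDerivAt_id y).const_sub x
  have h2 : HasFDerivAt (fun y : Plane => inner ℝ (x - y) e / τ) _ y :=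
    (h1.inner ℝ (hasFDerivAt_const e y)).mul_const τ⁻¹
  have hk : DifferentiableAt ℝ (fun y => heatKernel τ (x - y)) y :=
    (contDiff_heatKernel τ x).differentiable (by norm_num) y
  rw [secondDeriv, h0, fderiv_fun_mul hk h2.differentiableAt, h2.fderiv]
  simp [fderiv_heatKernel]
  ring

theorem sum_secondDeriv_heatKernel (τ : ℝ) (x y : Plane) :
    ∑ i, secondDeriv (planeBasis i) (fun y => heatKernel τ (x - y)) y =
      heatKernel τ (x - y) * (‖x - y‖ ^ 2 / τ ^ 2 - 2 / τ) := by
  have h := planeBasis.sum_sq_inner_right (x - y)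
  simp only [secondDeriv_heatKernel, planeBasis.norm_eq_one, ← Finset.mul_sum,
    Finset.sum_sub_distrib, ← Finset.sum_div]
  congr 2
  · rw [← h]; simp only [real_inner_comm]
  · simp

/-- The kernel with reversed time solves the backward heat equation: the derivative is minus half
the Laplacian found in `sum_secondDeriv_heatKernel`. -/
theorem hasDerivAt_heatKernel_time {t s : ℝ} (hs : s < t) (w : Plane) :
    HasDerivAt (fun s => heatKernel (t - s) w)
      (-(1 / 2 * (heatKernel (t - s) w * (‖w‖ ^ 2 / (t - s) ^ 2 - 2 / (t - s))))) s := by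
  have hτ : t - s ≠ 0 := (sub_pos.2 hs).ne'
  have hpi := Real.pi_ne_zero
  have h1 : HasDerivAt (fun s => t - s) (-1) s := (hasDerivAt_id s).const_sub t
  have h2 : HasDerivAt (fun s => (2 * Real.pi * (t - s))⁻¹) _ s :=
    (h1.const_mul (2 * Real.pi)).fun_inv (by positivity)
  have h3 : HasDerivAt (fun s => Real.exp (-‖w‖ ^ 2 / (2 * (t - s)))) _ s :=
    ((hasDerivAt_const s (-‖w‖ ^ 2)).fun_div (h1.const_mul 2) (by positivity)).exp
  refine (h2.fun_mul h3).congr_deriv ?_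
  simp only [heatKernel]
  field_simp
  ring

/-- The commutator of the Laplacian with the cutoff `χ`, applied to the heat kernel. -/
def cutoffError (χ : Plane → ℝ) (τ : ℝ) (x y : Plane) : ℝ :=
  ∑ i, (1 / 2 * secondDeriv (planeBasis i) χ y +
    fderiv ℝ χ y (planeBasis i) * (inner ℝ (x - y) (planeBasis i) / τ)) * heatKernel τ (x - y)

/-- The Laplacian is moved onto the product of cutoff and kernel. By the product rule, the terms in
which a derivative hits the cutoff form `cutoffError`; the remaining one cancels later against the
time derivative of the kernel. -/
theorem integral_cutoff_mul_laplacian {χ z : Plane → ℝ} (hχ : ContDiff ℝ 2 χ)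
    (hs : HasCompactSupport χ) (hz : ContDiff ℝ 2 z) (τ : ℝ) (x : Plane) :
    ∫ y, χ y * (heatKernel τ (x - y) * (1 / 2 * Laplacian.laplacian z y)) =
      ∫ y, (cutoffError χ τ x y + χ y *
        (1 / 2 * (heatKernel τ (x - y) * (‖x - y‖ ^ 2 / τ ^ 2 - 2 / τ)))) * z y := by
  have hk := contDiff_heatKernel τ x
  have hψ : ContDiff ℝ 2 (fun y => χ y * heatKernel τ (x - y)) := hχ.mul hk
  have hsψ : HasCompactSupport (fun y => χ y * heatKernel τ (x - y)) := hs.mul_right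
  have hs1 : ∀ e, HasCompactSupport (secondDeriv e (fun y => χ y * heatKernel τ (x - y))) := by
    intro e
    have : HasCompactSupport (fun y => fderiv ℝ (fun y => χ y * heatKernel τ (x - y)) y e) :=
      (hsψ.fderiv ℝ).comp_left (g := fun l : Plane →L[ℝ] ℝ => l e) (by simp)
    exact (this.fderiv ℝ).comp_left (g := fun l : Plane →L[ℝ] ℝ => l e) (by simp)
  calc ∫ y, χ y * (heatKernel τ (x - y) * (1 / 2 * Laplacian.laplacian z y))
      = ∫ y, ∑ i, 1 / 2 * ((χ y * heatKernel τ (x - y)) * secondDeriv (planeBasis i) z y) := by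
        refine integral_congr_ae (Eventually.of_forall fun y => ?_)
        simp only [laplacian_eq_sum_secondDeriv hz, Finset.mul_sum]
        exact Finset.sum_congr rfl fun i _ => by ring
    _ = ∑ i, ∫ y, 1 / 2 * ((χ y * heatKernel τ (x - y)) * secondDeriv (planeBasis i) z y) := by
        refine integral_finsetSum _ fun i _ => Integrable.const_mul ?_ _
        exact (hψ.continuous.mul (continuous_secondDeriv hz _)).integrable_of_hasCompactSupport
          hsψ.mul_right
    _ = ∑ i, ∫ y, 1 / 2 * (secondDeriv (planeBasis i)
          (fun y => χ y * heatKernel τ (x - y)) y * z y) := by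
        refine Finset.sum_congr rfl fun i _ => ?_
        rw [integral_const_mul, integral_const_mul, integral_mul_secondDeriv hψ hsψ hz]
    _ = ∫ y, ∑ i, 1 / 2 * (secondDeriv (planeBasis i)
          (fun y => χ y * heatKernel τ (x - y)) y * z y) := by
        refine (integral_finsetSum _ fun i _ => Integrable.const_mul ?_ _).symm
        exact ((continuous_secondDeriv hψ _).mul hz.continuous).integrable_of_hasCompactSupport
          (hs1 _).mul_right
    _ = _ := by
        refine integral_congr_ae (Eventually.of_forall fun y => ?_)
        simp only
        rw [← sum_secondDeriv_heatKernel, cutoffError, Finset.mul_sum, Finset.mul_sum,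
          ← Finset.sum_add_distrib, Finset.sum_mul]
        refine Finset.sum_congr rfl fun i _ => ?_
        rw [secondDeriv_mul hχ hk, fderiv_heatKernel]
        ring

end

/-! ### Cutoff functions and Gaussian domination. -/

section
-- Dilations `b(y / (n + 1))` of a fixed bump function. Each derivative brings a factor at most `1`,
-- so the bounds are uniform in `n`, and every fixed point eventually lies in the open region where
-- the function is constantly `1`.
theorem exists_cutoff : ∃ (χ : ℕ → Plane → ℝ) (C : ℝ), 0 ≤ C ∧ (∀ n, ContDiff ℝ 2 (χ n)) ∧
    (∀ n, HasCompactSupport (χ n)) ∧ (∀ n y, |χ n y| ≤ 1) ∧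
    (∀ n y i, |secondDeriv (planeBasis i) (χ n) y| ≤ C) ∧
    (∀ n y i, |fderiv ℝ (χ n) y (planeBasis i)| ≤ C) ∧
    (∀ y, ∀ᶠ n in atTop, χ n y = 1 ∧ ∀ i, secondDeriv (planeBasis i) (χ n) y = 0 ∧
      fderiv ℝ (χ n) y (planeBasis i) = 0) := by
  let b : ContDiffBump (0 : Plane) := ⟨1, 2, one_pos, one_lt_two⟩
  have hb : ContDiff ℝ 2 b := b.contDiff (n := 2)
  have hbs : HasCompactSupport b := b.hasCompactSupport
  have hb1 : ∀ i, HasCompactSupport (fun y => fderiv ℝ b y (planeBasis i)) := fun i =>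
    (hbs.fderiv ℝ).comp_left (g := fun l : Plane →L[ℝ] ℝ => l (planeBasis i)) (by simp)
  have hb2 : ∀ i, HasCompactSupport (secondDeriv (planeBasis i) b) := fun i =>
    ((hb1 i).fderiv ℝ).comp_left (g := fun l : Plane →L[ℝ] ℝ => l (planeBasis i)) (by simp)
  choose C1 hC1 using fun i => (hb1 i).exists_bound_of_continuous
    (contDiff_fderiv_apply hb (planeBasis i)).continuous
  choose C2 hC2 using fun i => (hb2 i).exists_bound_of_continuous
    (continuous_secondDeriv hb (planeBasis i))
  have hC1' : ∀ i, 0 ≤ C1 i := fun i => (norm_nonneg _).trans (hC1 i 0)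
  have hC2' : ∀ i, 0 ≤ C2 i := fun i => (norm_nonneg _).trans (hC2 i 0)
  have hC1s : ∀ i, C1 i ≤ ∑ i, C1 i + ∑ i, C2 i := fun i => by
    have h1 := Finset.single_le_sum (fun j _ => hC1' j) (Finset.mem_univ i)
    have h2 := Finset.sum_nonneg fun j (_ : j ∈ Finset.univ) => hC2' j
    linarith
  have hC2s : ∀ i, C2 i ≤ ∑ i, C1 i + ∑ i, C2 i := fun i => by
    have h1 := Finset.single_le_sum (fun j _ => hC2' j) (Finset.mem_univ i)
    have h2 := Finset.sum_nonneg fun j (_ : j ∈ Finset.univ) => hC1' j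
    linarith
  let r : ℕ → ℝ := fun n => ((n : ℝ) + 1)⁻¹
  have hr0 : ∀ n, 0 < r n := fun n => by positivity
  have hr1 : ∀ n, r n ≤ 1 := fun n => inv_le_one_of_one_le₀ (by linarith [n.cast_nonneg (α := ℝ)])
  have hd1 : ∀ n e y, fderiv ℝ (fun y => b (r n • y)) y e = r n * fderiv ℝ b (r n • y) e := by
    intro n e y
    have h1 : HasFDerivAt (fun y : Plane => r n • y) (r n • ContinuousLinearMap.id ℝ Plane) y :=
      (hasFDerivAt_id y).const_smul (r n)
    have h2 := (hb.differentiable (by norm_num) (r n • y)).hasFDerivAt.comp y h1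
    have h3 : HasFDerivAt (fun y => b (r n • y)) _ y := h2
    rw [h3.fderiv]
    simp
  have hd2 : ∀ n e y, secondDeriv e (fun y => b (r n • y)) y =
      r n * (r n * secondDeriv e b (r n • y)) := by
    intro n e y
    have h0 : (fun y => fderiv ℝ (fun y => b (r n • y)) y e) =
        fun y => r n * fderiv ℝ b (r n • y) e := by ext y; exact hd1 n e y
    have h1 : HasFDerivAt (fun y : Plane => r n • y) (r n • ContinuousLinearMap.id ℝ Plane) y :=
      (hasFDerivAt_id y).const_smul (r n)
    have h2 := (((contDiff_fderiv_apply hb e).differentiable (by norm_num)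
      (r n • y)).hasFDerivAt.comp y h1).const_mul (r n)
    have h3 : HasFDerivAt (fun y => r n * fderiv ℝ b (r n • y) e) _ y := h2
    rw [secondDeriv, h0, h3.fderiv]
    simp [secondDeriv]
  refine ⟨fun n y => b (r n • y), ∑ i, C1 i + ∑ i, C2 i,
    add_nonneg (Finset.sum_nonneg fun i _ => hC1' i) (Finset.sum_nonneg fun i _ => hC2' i),
    fun n => hb.comp (contDiff_const_smul _), fun n => ?_, fun n y => ?_, fun n y i => ?_,
    fun n y i => ?_, fun y => ?_⟩
  · exact hbs.comp_homeomorph (Homeomorph.smulOfNeZero (r n) (hr0 n).ne')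
  · rw [abs_of_nonneg b.nonneg]; exact b.le_one
  · rw [hd2, abs_mul, abs_mul, abs_of_pos (hr0 n)]
    have h := hC2 i (r n • y)
    rw [Real.norm_eq_abs] at h
    calc r n * (r n * _) ≤ 1 * (1 * C2 i) := by
          have := hr1 n; have := hr0 n
          gcongr
      _ ≤ _ := by rw [one_mul, one_mul]; exact hC2s i
  · rw [hd1, abs_mul, abs_of_pos (hr0 n)]
    have h := hC1 i (r n • y)
    rw [Real.norm_eq_abs] at h
    calc r n * _ ≤ 1 * C1 i := by
          have := hr1 n; have := hr0 n
          gcongr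
      _ ≤ _ := by rw [one_mul]; exact hC1s i
  · obtain ⟨N, hN⟩ := exists_nat_gt ‖y‖
    filter_upwards [eventually_ge_atTop N] with n hn
    have hmem : r n • y ∈ Metric.ball (0 : Plane) 1 := by
      rw [mem_ball_zero_iff, norm_smul, Real.norm_eq_abs, abs_of_pos (hr0 n)]
      have h1 : ‖y‖ < (n : ℝ) + 1 := by
        have : (N : ℝ) ≤ n := by exact_mod_cast hn
        linarith
      have h2 : r n * ((n : ℝ) + 1) = 1 := inv_mul_cancel₀ (by positivity)
      calc r n * ‖y‖ < r n * ((n : ℝ) + 1) := mul_lt_mul_of_pos_left h1 (hr0 n)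
        _ = 1 := h2
    have hone : ∀ w ∈ Metric.ball (0 : Plane) 1, b w = 1 := fun w hw =>
      b.one_of_mem_closedBall (Metric.ball_subset_closedBall hw)
    have hf0 : ∀ w ∈ Metric.ball (0 : Plane) 1, fderiv ℝ b w = 0 := by
      intro w hw
      have : (b : Plane → ℝ) =ᶠ[𝓝 w] fun _ => 1 :=
        Filter.eventuallyEq_of_mem (Metric.isOpen_ball.mem_nhds hw) hone
      rw [this.fderiv_eq]; simp
    refine ⟨hone _ hmem, fun i => ⟨?_, ?_⟩⟩
    · have : (fun w => fderiv ℝ b w (planeBasis i)) =ᶠ[𝓝 (r n • y)] fun _ => 0 :=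
        Filter.eventuallyEq_of_mem (Metric.isOpen_ball.mem_nhds hmem) fun w hw => by
          simp [hf0 w hw]
      rw [hd2, secondDeriv, this.fderiv_eq]; simp
    · rw [hd1, hf0 _ hmem]; simp

/-- The Gaussian weight with an exponential factor that dominates the integrands below. -/
def gaussWeight (t b : ℝ) (w : Plane) : ℝ := Real.exp (-‖w‖ ^ 2 / (2 * t)) * Real.exp (b * ‖w‖)

theorem integrable_gaussWeight {t : ℝ} (ht : 0 < t) (b : ℝ) (x : Plane) :
    Integrable (fun y => gaussWeight t b (x - y)) := by
  have h : Integrable (gaussWeight t b) := by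
    refine ((integrable_heatKernel (t := 2 * t) (by positivity)).const_mul
      ((2 * Real.pi * (2 * t)) * Real.exp (b ^ 2 * t))).mono' ?_ (Eventually.of_forall fun w => ?_)
    · exact (by unfold gaussWeight; fun_prop : Continuous (gaussWeight t b)).aestronglyMeasurable
    · rw [gaussWeight, Real.norm_eq_abs, abs_of_pos (by positivity), heatKernel, ← Real.exp_add]
      have e : 2 * Real.pi * (2 * t) * Real.exp (b ^ 2 * t) *
          ((2 * Real.pi * (2 * t))⁻¹ * Real.exp (-‖w‖ ^ 2 / (2 * (2 * t)))) =
          Real.exp (b ^ 2 * t + -‖w‖ ^ 2 / (2 * (2 * t))) := by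
        rw [Real.exp_add]
        have := Real.pi_pos
        field_simp
      rw [e]
      apply Real.exp_le_exp.2
      have h : 0 ≤ (‖w‖ / (2 * t) - b) ^ 2 * t := by positivity
      have e2 : (‖w‖ / (2 * t) - b) ^ 2 * t =
          (b ^ 2 * t + -‖w‖ ^ 2 / (2 * (2 * t))) - (-‖w‖ ^ 2 / (2 * t) + b * ‖w‖) := by
        field_simp
        ring
      linarith
  exact h.comp_sub_left x

theorem heatKernel_le {τ₀ τ t : ℝ} (h0 : 0 < τ₀) (h1 : τ₀ ≤ τ) (h2 : τ ≤ t) (w : Plane) :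
    heatKernel τ w ≤ (2 * Real.pi * τ₀)⁻¹ * Real.exp (-‖w‖ ^ 2 / (2 * t)) := by
  have hτ : 0 < τ := h0.trans_le h1
  have := Real.pi_pos
  unfold heatKernel
  gcongr ?_ * ?_
  · gcongr
  · apply Real.exp_le_exp.2
    rw [neg_div, neg_div, neg_le_neg_iff]
    gcongr

/-- For times in `[τ₀, t]` the kernel is below one fixed Gaussian, and `|y| ≤ |x| + |x - y|`
transfers the growth of the solution to the variable `x - y`. This gives an integrable majorant
independent of the time. -/
theorem heatKernel_mul_le {τ₀ τ t a K b : ℝ} (h0 : 0 < τ₀) (h1 : τ₀ ≤ τ) (h2 : τ ≤ t) (ha : 0 ≤ a)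
    (hab : a ≤ b) (hK : 0 ≤ K) {x y : Plane} {v : ℝ} (hv : |v| ≤ K * Real.exp (a * ‖y‖)) :
    heatKernel τ (x - y) * |v| ≤
      (2 * Real.pi * τ₀)⁻¹ * (K * Real.exp (a * ‖x‖)) * gaussWeight t b (x - y) := by
  have hτ : 0 < τ := h0.trans_le h1
  have := Real.pi_pos
  have h3 : |v| ≤ K * Real.exp (a * ‖x‖) * Real.exp (b * ‖x - y‖) := by
    refine hv.trans ?_
    rw [mul_assoc, ← Real.exp_add]
    have h4 : ‖y‖ ≤ ‖x‖ + ‖x - y‖ := by simpa using norm_sub_le x (x - y)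
    have h5 : a * ‖y‖ ≤ a * ‖x‖ + b * ‖x - y‖ := by
      have h6 : a * ‖x - y‖ ≤ b * ‖x - y‖ := mul_le_mul_of_nonneg_right hab (norm_nonneg _)
      nlinarith
    gcongr
  calc heatKernel τ (x - y) * |v| ≤ ((2 * Real.pi * τ₀)⁻¹ * Real.exp (-‖x - y‖ ^ 2 / (2 * t))) *
        (K * Real.exp (a * ‖x‖) * Real.exp (b * ‖x - y‖)) := by
        gcongr
        exact heatKernel_le h0 h1 h2 _
    _ = _ := by rw [gaussWeight]; ring

/-- The unbounded factor `(x - y) / τ` from the gradient of the kernel is absorbed by `e^{|x-y|}`.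
For this reason the dominating weight later has rate `a + 1` instead of `a`. -/
theorem abs_cutoffError_le {χ : Plane → ℝ} {C τ₀ τ : ℝ} (hC : 0 ≤ C) (h0 : 0 < τ₀) (h1 : τ₀ ≤ τ)
    {y : Plane} (h2 : ∀ i, |secondDeriv (planeBasis i) χ y| ≤ C)
    (h3 : ∀ i, |fderiv ℝ χ y (planeBasis i)| ≤ C) (x : Plane) :
    |cutoffError χ τ x y| ≤ C * (1 + 2 / τ₀) * Real.exp ‖x - y‖ * heatKernel τ (x - y) := by
  have hτ : 0 < τ := h0.trans_le h1
  have hk := heatKernel_nonneg hτ.le (x - y)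
  rw [cutoffError, ← Finset.sum_mul, abs_mul, abs_of_nonneg hk]
  refine mul_le_mul_of_nonneg_right ((Finset.abs_sum_le_sum_abs _ _).trans ?_) hk
  have hterm : ∀ i ∈ Finset.univ, |1 / 2 * secondDeriv (planeBasis i) χ y +
      fderiv ℝ χ y (planeBasis i) * (inner ℝ (x - y) (planeBasis i) / τ)| ≤
      C * (1 / 2 + 1 / τ₀) * Real.exp ‖x - y‖ := by
    intro i _
    have hin : |inner ℝ (x - y) (planeBasis i)| ≤ Real.exp ‖x - y‖ := by
      refine (abs_real_inner_le_norm _ _).trans ?_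
      rw [planeBasis.norm_eq_one, mul_one]
      linarith [Real.add_one_le_exp ‖x - y‖]
    have hin2 : |inner ℝ (x - y) (planeBasis i) / τ| ≤ Real.exp ‖x - y‖ / τ₀ := by
      rw [abs_div, abs_of_pos hτ]
      gcongr
    have h1e : 1 ≤ Real.exp ‖x - y‖ := Real.one_le_exp (norm_nonneg _)
    calc _ ≤ 1 / 2 * |secondDeriv (planeBasis i) χ y| +
          |fderiv ℝ χ y (planeBasis i)| * |inner ℝ (x - y) (planeBasis i) / τ| := by
          refine (abs_add_le _ _).trans ?_
          rw [abs_mul, abs_mul, abs_of_pos (by norm_num : (0 : ℝ) < 1 / 2)]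
      _ ≤ 1 / 2 * (C * Real.exp ‖x - y‖) + C * (Real.exp ‖x - y‖ / τ₀) := by
          gcongr
          · exact (h2 i).trans (le_mul_of_one_le_right hC h1e)
          · exact h3 i
      _ = _ := by ring
  refine (Finset.sum_le_sum hterm).trans (le_of_eq ?_)
  simp
  ring

end

/-! ### Duhamel's formula for classical solutions. -/

section
/-- Integrating the equation against the heat kernel with a cutoff. -/
theorem integral_cutoff_sub {T t : ℝ} {z H : ℝ → Plane → ℝ} {χ : Plane → ℝ}
    (hχ : ContDiff ℝ 2 χ) (hχs : HasCompactSupport χ) (htT : t ≤ T)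
    (hzc : Continuous (Function.uncurry z)) (hHc : Continuous (Function.uncurry H))
    (hz2 : ∀ s ∈ Ioo 0 T, ContDiff ℝ 2 (z s))
    (hzL : ContinuousOn (fun p : ℝ × Plane => Laplacian.laplacian (z p.1) p.2) (Ioo 0 T ×ˢ univ))
    (heq : ∀ s ∈ Ioo 0 T, ∀ x,
      HasDerivAt (fun s => z s x) (1 / 2 * Laplacian.laplacian (z s) x - H s x) s)
    (x : Plane) {s₀ s₁ : ℝ} (h0 : 0 < s₀) (h01 : s₀ ≤ s₁) (h1 : s₁ < t) :
    ∫ y, χ y * (heatKernel (t - s₁) (x - y) * z s₁ y - heatKernel (t - s₀) (x - y) * z s₀ y) =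
      ∫ s in Ioc s₀ s₁, ∫ y, (cutoffError χ (t - s) x y * z s y -
        χ y * (heatKernel (t - s) (x - y) * H s y)) := by
  have hmem : ∀ s ∈ Icc s₀ s₁, s ∈ Ioo 0 T ∧ s < t := fun s hs =>
    ⟨⟨h0.trans_le hs.1, (hs.2.trans_lt h1).trans_le htT⟩, hs.2.trans_lt h1⟩
  set k : ℝ → Plane → ℝ := fun s y => heatKernel (t - s) (x - y) with hk
  set k' : ℝ → Plane → ℝ := fun s y =>
    -(1 / 2 * (heatKernel (t - s) (x - y) * (‖x - y‖ ^ 2 / (t - s) ^ 2 - 2 / (t - s)))) with hk'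
  set G : ℝ → Plane → ℝ := fun s y =>
    k' s y * z s y + k s y * (1 / 2 * Laplacian.laplacian (z s) y - H s y) with hG
  have hkc : ContinuousOn (Function.uncurry k) (Icc s₀ s₁ ×ˢ univ) := by
    simp only [hk, Function.uncurry_def, heatKernel]
    have hne : ∀ p ∈ Icc s₀ s₁ ×ˢ (univ : Set Plane), 2 * Real.pi * (t - p.1) ≠ 0 := fun p hp => by
      have := sub_pos.2 (hmem p.1 hp.1).2
      have := Real.pi_pos
      positivity
    have hne2 : ∀ p ∈ Icc s₀ s₁ ×ˢ (univ : Set Plane), 2 * (t - p.1) ≠ 0 := fun p hp => by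
      have := sub_pos.2 (hmem p.1 hp.1).2
      positivity
    refine ContinuousOn.mul (ContinuousOn.inv₀ (by fun_prop) hne) ?_
    exact (ContinuousOn.div (by fun_prop) (by fun_prop) hne2).rexp
  have hk'c : ContinuousOn (Function.uncurry k') (Icc s₀ s₁ ×ˢ univ) := by
    have hne : ∀ p ∈ Icc s₀ s₁ ×ˢ (univ : Set Plane), t - p.1 ≠ 0 := fun p hp =>
      (sub_pos.2 (hmem p.1 hp.1).2).ne'
    have h3 : ContinuousOn (fun p : ℝ × Plane => ‖x - p.2‖ ^ 2 / (t - p.1) ^ 2 - 2 / (t - p.1))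
        (Icc s₀ s₁ ×ˢ univ) :=
      (ContinuousOn.div (by fun_prop) (by fun_prop) fun p hp => pow_ne_zero 2 (hne p hp)).sub
        (ContinuousOn.div (by fun_prop) (by fun_prop) hne)
    exact ((hkc.mul h3).const_mul (1 / 2)).neg
  have hGc : ContinuousOn (Function.uncurry G) (Icc s₀ s₁ ×ˢ univ) := by
    have hL := hzL.mono (show Icc s₀ s₁ ×ˢ (univ : Set Plane) ⊆ Ioo 0 T ×ˢ univ from
      prod_mono (fun s hs => (hmem s hs).1) subset_rfl)
    exact (hk'c.mul hzc.continuousOn).add (hkc.mul ((hL.const_mul (1 / 2)).sub hHc.continuousOn))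
  have hslice : ∀ y, ContinuousOn (fun s => G s y) (Icc s₀ s₁) := fun y =>
    hGc.comp (f := fun s : ℝ => (s, y)) (by fun_prop) fun s hs => ⟨hs, mem_univ _⟩
  -- The fundamental theorem of calculus in time at a fixed point `y`: `G` is the time derivative of
  -- kernel times solution.
  have hftc : ∀ y, k s₁ y * z s₁ y - k s₀ y * z s₀ y = ∫ s in Ioc s₀ s₁, G s y := by
    intro y
    rw [← intervalIntegral.integral_of_le h01]
    refine (intervalIntegral.integral_eq_sub_of_hasDerivAt (f := fun s => k s y * z s y) ?_ ?_).symm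
    · intro s hs
      rw [uIcc_of_le h01] at hs
      exact (hasDerivAt_heatKernel_time (hmem s hs).2 (x - y)).fun_mul (heq s (hmem s hs).1 y)
    · exact ContinuousOn.intervalIntegrable (by rw [uIcc_of_le h01]; exact hslice y)
  -- The integrand is continuous and vanishes off the compact set `[s₀, s₁] × supp χ`; this
  -- justifies the exchange of the two integrals.
  have hint : Integrable (Function.uncurry fun s y => χ y * G s y)
      (((volume : Measure ℝ).restrict (Ioc s₀ s₁)).prod volume) := by
    have h3 : IntegrableOn (Function.uncurry fun s y => χ y * G s y)
        (Icc s₀ s₁ ×ˢ tsupport χ) ((volume : Measure ℝ).prod (volume : Measure Plane)) := by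
      refine ContinuousOn.integrableOn_compact (isCompact_Icc.prod hχs) ?_
      exact ContinuousOn.mul (hχ.continuous.comp continuous_snd).continuousOn
        (hGc.mono (prod_mono subset_rfl (subset_univ _)))
    have h4 := h3.of_forall_sdiff_eq_zero (t := Ioc s₀ s₁ ×ˢ univ)
      (measurableSet_Ioc.prod MeasurableSet.univ) (by
        rintro ⟨s, y⟩ ⟨⟨hs, -⟩, hn⟩
        have : y ∉ tsupport χ := fun hy => hn ⟨Ioc_subset_Icc_self hs, hy⟩
        simp [Function.uncurry, image_eq_zero_of_notMem_tsupport this])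
    rw [IntegrableOn, ← Measure.prod_restrict, Measure.restrict_univ] at h4
    exact h4
  calc ∫ y, χ y * (k s₁ y * z s₁ y - k s₀ y * z s₀ y)
      = ∫ y, ∫ s in Ioc s₀ s₁, χ y * G s y := by
        refine integral_congr_ae (Eventually.of_forall fun y => ?_)
        simp only
        rw [hftc, integral_const_mul]
    _ = ∫ s in Ioc s₀ s₁, ∫ y, χ y * G s y := (integral_integral_swap hint).symm
    _ = _ := by
        refine setIntegral_congr_fun measurableSet_Ioc fun s hs => ?_
        have hs' := hmem s (Ioc_subset_Icc_self hs)
        have hzs : Continuous (z s) := hzc.comp (f := fun y => (s, y)) (by fun_prop)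
        have hHs : Continuous (H s) := hHc.comp (f := fun y => (s, y)) (by fun_prop)
        have hks : Continuous (fun y => heatKernel (t - s) (x - y)) :=
          (contDiff_heatKernel (t - s) x).continuous
        have hLs : Continuous (fun y => Laplacian.laplacian (z s) y) := by
          have : (fun y => Laplacian.laplacian (z s) y) =
              fun y => ∑ i, secondDeriv (planeBasis i) (z s) y := by
            ext y; exact laplacian_eq_sum_secondDeriv (hz2 s hs'.1) y
          rw [this]
          exact continuous_finsetSum _ fun i _ => continuous_secondDeriv (hz2 s hs'.1) _
        have hI := integral_cutoff_mul_laplacian hχ hχs (hz2 s hs'.1) (t - s) x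
        have hcut : HasCompactSupport (cutoffError χ (t - s) x) := by
          refine HasCompactSupport.of_support_subset_isCompact hχs fun y hy => ?_
          by_contra hn
          apply hy
          have hev : χ =ᶠ[𝓝 y] fun _ => 0 := notMem_tsupport_iff_eventuallyEq.1 hn
          have h1 : ∀ e, fderiv ℝ χ y e = 0 := fun e => by rw [hev.fderiv_eq]; simp
          have h2 : ∀ e, secondDeriv e χ y = 0 := fun e => by
            have h3 : (fun y => fderiv ℝ χ y e) =ᶠ[𝓝 y] fun _ => 0 := by
              filter_upwards [hev.fderiv (𝕜 := ℝ)] with w hw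
              rw [hw]; simp
            rw [secondDeriv, h3.fderiv_eq]; simp
          simp [cutoffError, h1, h2]
        have hcutc : Continuous (cutoffError χ (t - s) x) := by
          unfold cutoffError
          refine continuous_finsetSum _ fun i _ => ?_
          have h1 := continuous_secondDeriv hχ (planeBasis i)
          have h2 := (contDiff_fderiv_apply hχ (planeBasis i)).continuous
          fun_prop
        have hw : Continuous (fun y => 1 / 2 * (heatKernel (t - s) (x - y) *
            (‖x - y‖ ^ 2 / (t - s) ^ 2 - 2 / (t - s)))) := by fun_prop
        have hχc := hχ.continuous
        have i1 : Integrable (fun y => χ y * (k' s y * z s y)) :=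
          (hχc.mul (hw.neg.mul hzs)).integrable_of_hasCompactSupport hχs.mul_right
        have i2 : Integrable (fun y =>
            χ y * (heatKernel (t - s) (x - y) * (1 / 2 * Laplacian.laplacian (z s) y))) :=
          (hχc.mul (hks.mul (continuous_const.mul hLs))).integrable_of_hasCompactSupport
            hχs.mul_right
        have i3 : Integrable (fun y => χ y * (heatKernel (t - s) (x - y) * H s y)) :=
          (hχc.mul (hks.mul hHs)).integrable_of_hasCompactSupport hχs.mul_right
        have i4 : Integrable (fun y => cutoffError χ (t - s) x y * z s y) :=
          (hcutc.mul hzs).integrable_of_hasCompactSupport hcut.mul_right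
        have i5 : Integrable (fun y => (cutoffError χ (t - s) x y + χ y *
            (1 / 2 * (heatKernel (t - s) (x - y) * (‖x - y‖ ^ 2 / (t - s) ^ 2 - 2 / (t - s))))) *
              z s y) :=
          ((hcutc.add (hχc.mul hw)).mul hzs).integrable_of_hasCompactSupport
            (hcut.add hχs.mul_right).mul_right
        calc ∫ y, χ y * G s y
            = ∫ y, (χ y * (k' s y * z s y) +
                χ y * (heatKernel (t - s) (x - y) * (1 / 2 * Laplacian.laplacian (z s) y)) -
                χ y * (heatKernel (t - s) (x - y) * H s y)) := by
              refine integral_congr_ae (Eventually.of_forall fun y => ?_)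
              simp only [hG, hk]
              ring
          _ = (∫ y, χ y * (k' s y * z s y)) +
                (∫ y, χ y * (heatKernel (t - s) (x - y) * (1 / 2 * Laplacian.laplacian (z s) y))) -
                ∫ y, χ y * (heatKernel (t - s) (x - y) * H s y) := by
              rw [integral_sub (i1.fun_add i2) i3, integral_add i1 i2]
          _ = ∫ y, (cutoffError χ (t - s) x y * z s y -
                χ y * (heatKernel (t - s) (x - y) * H s y)) := by
              rw [hI, integral_sub i4 i3, ← integral_add i1 i5]
              congr 1
              refine integral_congr_ae (Eventually.of_forall fun y => ?_)
              simp only [hk']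
              ring

/-- The cutoff is removed by dominated convergence. Taking `s₁ < t` keeps the kernel away from its
singularity, and `s₀ > 0` keeps to times at which the equation holds; both endpoints are recovered
afterwards by continuity. -/
theorem heat_sub_eq_integral {T t a K : ℝ} (ha : 0 ≤ a) {z H : ℝ → Plane → ℝ} (htT : t ≤ T)
    (hzc : Continuous (Function.uncurry z)) (hHc : Continuous (Function.uncurry H))
    (hzb : ∀ s ∈ Icc 0 T, ExpBound a K (z s)) (hHb : ∀ s ∈ Icc 0 T, ExpBound a K (H s))
    (hz2 : ∀ s ∈ Ioo 0 T, ContDiff ℝ 2 (z s))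
    (hzL : ContinuousOn (fun p : ℝ × Plane => Laplacian.laplacian (z p.1) p.2) (Ioo 0 T ×ˢ univ))
    (heq : ∀ s ∈ Ioo 0 T, ∀ x,
      HasDerivAt (fun s => z s x) (1 / 2 * Laplacian.laplacian (z s) x - H s x) s)
    (x : Plane) {s₀ s₁ : ℝ} (h0 : 0 < s₀) (h01 : s₀ ≤ s₁) (h1 : s₁ < t) :
    heat (t - s₁) (z s₁) x - heat (t - s₀) (z s₀) x =
      -∫ s in s₀..s₁, heat (t - s) (H s) x := by
  obtain ⟨χ, C, hC, hχ, hχs, hχ1, hχ2, hχd, hχlim⟩ := exists_cutoff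
  have ht : 0 < t := h0.trans_le (h01.trans h1.le)
  set τ₀ := t - s₁ with hτ₀
  have hτ : 0 < τ₀ := sub_pos.2 h1
  have hmem : ∀ s ∈ Icc s₀ s₁, s ∈ Icc 0 T ∧ τ₀ ≤ t - s ∧ t - s ≤ t := fun s hs =>
    ⟨⟨h0.le.trans hs.1, (hs.2.trans h1.le).trans htT⟩, by rw [hτ₀]; linarith [hs.2],
      by linarith [hs.1]⟩
  have hK : 0 ≤ K := (hzb s₀ (hmem s₀ ⟨le_rfl, h01⟩).1).nonneg
  set M : ℝ := (2 * Real.pi * τ₀)⁻¹ * (K * Real.exp (a * ‖x‖)) with hM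
  have hM0 : 0 ≤ M := by have := Real.pi_pos; positivity
  have hW : ∀ b, Integrable fun y => gaussWeight t b (x - y) := fun b =>
    integrable_gaussWeight ht b x
  have hkz : ∀ s ∈ Icc s₀ s₁, ∀ y, |heatKernel (t - s) (x - y) * z s y| ≤
      M * gaussWeight t (a + 1) (x - y) := by
    intro s hs y
    obtain ⟨m1, m2, m3⟩ := hmem s hs
    rw [abs_mul, abs_of_nonneg (heatKernel_nonneg (hτ.le.trans m2) _)]
    exact heatKernel_mul_le hτ m2 m3 ha (by linarith) hK (hzb s m1 y)
  have hkH : ∀ s ∈ Icc s₀ s₁, ∀ y, |heatKernel (t - s) (x - y) * H s y| ≤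
      M * gaussWeight t (a + 1) (x - y) := by
    intro s hs y
    obtain ⟨m1, m2, m3⟩ := hmem s hs
    rw [abs_mul, abs_of_nonneg (heatKernel_nonneg (hτ.le.trans m2) _)]
    exact heatKernel_mul_le hτ m2 m3 ha (by linarith) hK (hHb s m1 y)
  have hez : ∀ n, ∀ s ∈ Icc s₀ s₁, ∀ y, |cutoffError (χ n) (t - s) x y * z s y| ≤
      C * (1 + 2 / τ₀) * M * gaussWeight t (a + 1) (x - y) := by
    intro n s hs y
    obtain ⟨m1, m2, m3⟩ := hmem s hs
    have e1 := abs_cutoffError_le hC hτ m2 (hχ2 n y) (hχd n y) x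
    have e2 := heatKernel_mul_le (x := x) hτ m2 m3 ha le_rfl hK (hzb s m1 y)
    have e3 : gaussWeight t (a + 1) (x - y) = Real.exp ‖x - y‖ * gaussWeight t a (x - y) := by
      rw [gaussWeight, gaussWeight, add_mul, Real.exp_add, one_mul]; ring
    rw [abs_mul]
    calc _ ≤ C * (1 + 2 / τ₀) * Real.exp ‖x - y‖ * heatKernel (t - s) (x - y) * |z s y| := by
          gcongr
      _ = C * (1 + 2 / τ₀) * Real.exp ‖x - y‖ * (heatKernel (t - s) (x - y) * |z s y|) := by ring
      _ ≤ C * (1 + 2 / τ₀) * Real.exp ‖x - y‖ * (M * gaussWeight t a (x - y)) := by gcongr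
      _ = _ := by rw [e3]; ring
  have hzm := hzc.measurable
  have hHm := hHc.measurable
  -- the left side
  have hL : Tendsto (fun n => ∫ y, χ n y *
      (heatKernel (t - s₁) (x - y) * z s₁ y - heatKernel (t - s₀) (x - y) * z s₀ y)) atTop
      (𝓝 (∫ y, (heatKernel (t - s₁) (x - y) * z s₁ y - heatKernel (t - s₀) (x - y) * z s₀ y))) := by
    have hcs : ∀ s, Continuous fun y => heatKernel (t - s) (x - y) * z s y := fun s =>
      (contDiff_heatKernel (t - s) x).continuous.mul (hzc.comp (f := fun y => (s, y)) (by fun_prop))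
    refine tendsto_integral_of_dominated_convergence
      (fun y => 2 * (M * gaussWeight t (a + 1) (x - y))) (fun n => ?_)
      (((hW _).const_mul _).const_mul _) (fun n => Eventually.of_forall fun y => ?_)
      (Eventually.of_forall fun y => ?_)
    · exact ((hχ n).continuous.mul ((hcs s₁).sub (hcs s₀))).aestronglyMeasurable
    · rw [Real.norm_eq_abs, abs_mul]
      have e1 := hkz s₁ ⟨h01, le_rfl⟩ y
      have e2 := hkz s₀ ⟨le_rfl, h01⟩ y
      calc _ ≤ 1 * (M * gaussWeight t (a + 1) (x - y) + M * gaussWeight t (a + 1) (x - y)) := by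
            gcongr
            · exact hχ1 n y
            · exact (abs_sub _ _).trans (add_le_add e1 e2)
        _ = _ := by ring
    · refine tendsto_const_nhds.congr' ?_
      filter_upwards [hχlim y] with n hn
      rw [hn.1, one_mul]
  -- the right side
  have hbd : Integrable (fun p : ℝ × Plane => (C * (1 + 2 / τ₀) * M + M) *
      gaussWeight t (a + 1) (x - p.2)) (((volume : Measure ℝ).restrict (Ioc s₀ s₁)).prod volume) :=
    ((hW (a + 1)).comp_snd _).const_mul _
  have hfst : ∀ᵐ p : ℝ × Plane ∂(((volume : Measure ℝ).restrict (Ioc s₀ s₁)).prod volume),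
      p.1 ∈ Icc s₀ s₁ :=
    (Measure.quasiMeasurePreserving_fst.ae (ae_restrict_mem measurableSet_Ioc)).mono
      fun p hp => Ioc_subset_Icc_self hp
  have hmeas : ∀ n, Measurable (fun p : ℝ × Plane => cutoffError (χ n) (t - p.1) x p.2 * z p.1 p.2 -
      χ n p.2 * (heatKernel (t - p.1) (x - p.2) * H p.1 p.2)) := by
    intro n
    have m1 : ∀ i, Measurable (secondDeriv (planeBasis i) (χ n)) := fun i =>
      (continuous_secondDeriv (hχ n) _).measurable
    have m2 : ∀ i, Measurable (fun y => fderiv ℝ (χ n) y (planeBasis i)) := fun i =>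
      (contDiff_fderiv_apply (hχ n) _).continuous.measurable
    have m3 : Measurable (χ n) := (hχ n).continuous.measurable
    have m4 : Measurable (fun p : ℝ × Plane => z p.1 p.2) := hzm
    have m5 : Measurable (fun p : ℝ × Plane => H p.1 p.2) := hHm
    have m6 : Measurable (fun p : ℝ × Plane => heatKernel (t - p.1) (x - p.2)) := by
      unfold heatKernel; fun_prop
    have m7 : Measurable (fun p : ℝ × Plane => cutoffError (χ n) (t - p.1) x p.2) := by
      unfold cutoffError
      refine Finset.measurable_sum _ fun i _ => ?_
      have a1 : Measurable (fun p : ℝ × Plane => secondDeriv (planeBasis i) (χ n) p.2) :=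
        (m1 i).comp measurable_snd
      have a2 : Measurable (fun p : ℝ × Plane => fderiv ℝ (χ n) p.2 (planeBasis i)) :=
        (m2 i).comp measurable_snd
      have a3 : Measurable (fun p : ℝ × Plane => inner ℝ (x - p.2) (planeBasis i) / (t - p.1)) := by
        fun_prop
      exact (((measurable_const.mul a1).add (a2.mul a3)).mul m6)
    exact (m7.mul m4).sub ((m3.comp measurable_snd).mul (m6.mul m5))
  have hdom : ∀ n, ∀ᵐ p : ℝ × Plane ∂(((volume : Measure ℝ).restrict (Ioc s₀ s₁)).prod volume),
      ‖cutoffError (χ n) (t - p.1) x p.2 * z p.1 p.2 -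
        χ n p.2 * (heatKernel (t - p.1) (x - p.2) * H p.1 p.2)‖ ≤
        (C * (1 + 2 / τ₀) * M + M) * gaussWeight t (a + 1) (x - p.2) := by
    intro n
    filter_upwards [hfst] with p hp
    have e1 := hez n p.1 hp p.2
    have e2 := hkH p.1 hp p.2
    have e3 : |χ n p.2 * (heatKernel (t - p.1) (x - p.2) * H p.1 p.2)| ≤
        1 * (M * gaussWeight t (a + 1) (x - p.2)) := by
      rw [abs_mul]
      gcongr
      exact hχ1 n p.2
    rw [Real.norm_eq_abs]
    refine (abs_sub _ _).trans ((add_le_add e1 e3).trans (le_of_eq ?_))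
    ring
  have hR : Tendsto (fun n => ∫ p : ℝ × Plane, (cutoffError (χ n) (t - p.1) x p.2 * z p.1 p.2 -
      χ n p.2 * (heatKernel (t - p.1) (x - p.2) * H p.1 p.2))
        ∂(((volume : Measure ℝ).restrict (Ioc s₀ s₁)).prod volume)) atTop
      (𝓝 (∫ p : ℝ × Plane, -(heatKernel (t - p.1) (x - p.2) * H p.1 p.2)
        ∂(((volume : Measure ℝ).restrict (Ioc s₀ s₁)).prod volume))) := by
    refine tendsto_integral_of_dominated_convergence _
      (fun n => (hmeas n).aestronglyMeasurable) hbd hdom (Eventually.of_forall fun p => ?_)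
    refine tendsto_const_nhds.congr' ?_
    filter_upwards [hχlim p.2] with n hn
    have : cutoffError (χ n) (t - p.1) x p.2 = 0 := by
      simp only [cutoffError, (hn.2 _).1, (hn.2 _).2]
      simp
    rw [this, hn.1]
    ring
  have hLR : ∀ n, ∫ y, χ n y *
      (heatKernel (t - s₁) (x - y) * z s₁ y - heatKernel (t - s₀) (x - y) * z s₀ y) =
      ∫ p : ℝ × Plane, (cutoffError (χ n) (t - p.1) x p.2 * z p.1 p.2 -
      χ n p.2 * (heatKernel (t - p.1) (x - p.2) * H p.1 p.2))
        ∂(((volume : Measure ℝ).restrict (Ioc s₀ s₁)).prod volume) := by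
    intro n
    rw [integral_prod _ (hbd.mono' (hmeas n).aestronglyMeasurable (hdom n))]
    exact integral_cutoff_sub (hχ n) (hχs n) htT hzc hHc hz2 hzL heq x h0 h01 h1
  have hfin := tendsto_nhds_unique hL (hR.congr fun n => (hLR n).symm)
  have hint : ∀ s ∈ Icc s₀ s₁, Integrable fun y => heatKernel (t - s) (x - y) * z s y := by
    intro s hs
    refine ((hW (a + 1)).const_mul M).mono' ?_ (Eventually.of_forall fun y => hkz s hs y)
    exact ((contDiff_heatKernel (t - s) x).continuous.mul
      (hzc.comp (f := fun y => (s, y)) (by fun_prop))).aestronglyMeasurable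
  have hintH : Integrable (fun p : ℝ × Plane => -(heatKernel (t - p.1) (x - p.2) * H p.1 p.2))
      (((volume : Measure ℝ).restrict (Ioc s₀ s₁)).prod volume) := by
    refine (((hW (a + 1)).comp_snd _).const_mul M).mono' ?_ ?_
    · have m6 : Measurable (fun p : ℝ × Plane => heatKernel (t - p.1) (x - p.2)) := by
        unfold heatKernel; fun_prop
      exact (m6.mul hHm).neg.aestronglyMeasurable
    · filter_upwards [hfst] with p hp
      rw [norm_neg]
      exact hkH p.1 hp p.2
  rw [integral_sub (hint s₁ ⟨h01, le_rfl⟩) (hint s₀ ⟨le_rfl, h01⟩), integral_prod _ hintH] at hfin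
  rw [heat_eq_integral hτ, heat_eq_integral (hτ.trans_le (hmem s₀ ⟨le_rfl, h01⟩).2.1)]
  simp only [smul_eq_mul]
  rw [hfin, intervalIntegral.integral_of_le h01, ← integral_neg]
  refine setIntegral_congr_fun measurableSet_Ioc fun s hs => ?_
  simp only
  rw [integral_neg, heat_eq_integral (hτ.trans_le (hmem s (Ioc_subset_Icc_self hs)).2.1)]
  simp only [smul_eq_mul]

theorem continuousOn_heat_time {T t a K : ℝ} (ha : 0 ≤ a) {z : ℝ → Plane → ℝ} (htT : t ≤ T)
    (hzc : Continuous (Function.uncurry z)) (hzb : ∀ s ∈ Icc 0 T, ExpBound a K (z s)) (x : Plane) :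
    ContinuousOn (fun s => heat (t - s) (z s) x) (Icc 0 t) := by
  unfold heat
  refine continuousOn_of_dominated
    (bound := fun ζ => K * Real.exp (a * ‖x‖) * Real.exp (a * √t * ‖ζ‖)) ?_ ?_
    ((integrable_exp_norm _).const_mul _) (Eventually.of_forall fun ζ => ?_)
  · intro s _
    exact (hzc.comp (f := fun ζ => (s, x + √(t - s) • ζ)) (by fun_prop)).aestronglyMeasurable
  · intro s hs
    exact Eventually.of_forall fun ζ => (hzb s ⟨hs.1, hs.2.trans htT⟩).comp_le ha
      (by linarith [hs.1]) x ζ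
  · exact (hzc.comp (f := fun s => (s, x + √(t - s) • ζ)) (by fun_prop)).continuousOn

/-- A classical solution of the inhomogeneous heat equation of at most exponential growth is
given by Duhamel's formula. -/
theorem eq_heat_sub_duhamel {T a K : ℝ} (ha : 0 ≤ a) {z H : ℝ → Plane → ℝ}
    (hzc : Continuous (Function.uncurry z)) (hHc : Continuous (Function.uncurry H))
    (hzb : ∀ s ∈ Icc 0 T, ExpBound a K (z s)) (hHb : ∀ s ∈ Icc 0 T, ExpBound a K (H s))
    (hz2 : ∀ s ∈ Ioo 0 T, ContDiff ℝ 2 (z s))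
    (hzL : ContinuousOn (fun p : ℝ × Plane => Laplacian.laplacian (z p.1) p.2) (Ioo 0 T ×ˢ univ))
    (heq : ∀ s ∈ Ioo 0 T, ∀ x,
      HasDerivAt (fun s => z s x) (1 / 2 * Laplacian.laplacian (z s) x - H s x) s) :
    ∀ t ∈ Icc 0 T, ∀ x, z t x = heat t (z 0) x - duhamel H t x := by
  intro t ht x
  rcases ht.1.eq_or_lt with rfl | ht0
  · simp [duhamel]
  have hF := continuousOn_heat_time ha ht.2 hzc hzb x
  have hQ := continuousOn_heat_time ha ht.2 hHc hHb x
  have hQi : ∀ s ∈ Icc 0 t, ∀ s' ∈ Icc 0 t, IntervalIntegrable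
      (fun s => heat (t - s) (H s) x) volume s s' := fun s hs s' hs' =>
    (hQ.mono (uIcc_subset_Icc hs hs')).intervalIntegrable
  have hΓ : ContinuousOn (fun s => heat (t - s) (z s) x + ∫ r in 0..s, heat (t - r) (H r) x)
      (Icc 0 t) := by
    refine hF.add ?_
    have := intervalIntegral.continuousOn_primitive_interval'
      (hQi 0 ⟨le_rfl, ht0.le⟩ t ⟨ht0.le, le_rfl⟩) left_mem_uIcc
    rwa [uIcc_of_le ht0.le] at this
  have hmid : t / 2 ∈ Ioo 0 t := ⟨by positivity, by linarith⟩
  -- The conserved quantity of Duhamel's principle: it is constant on `(0, t)` by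
  -- `heat_sub_eq_integral` and continuous on `[0, t]`, and its values at the two endpoints give the
  -- formula.
  have hconst : EqOn (fun s => heat (t - s) (z s) x + ∫ r in 0..s, heat (t - r) (H r) x)
      (fun _ => heat (t - t / 2) (z (t / 2)) x + ∫ r in 0..(t / 2), heat (t - r) (H r) x)
      (Icc 0 t) := by
    refine Set.EqOn.of_subset_closure (s := Ioo 0 t) ?_ hΓ continuousOn_const Ioo_subset_Icc_self
      (by rw [closure_Ioo ht0.ne])
    have main : ∀ s ∈ Ioo 0 t, ∀ s' ∈ Ioo 0 t, s ≤ s' →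
        heat (t - s) (z s) x + ∫ r in 0..s, heat (t - r) (H r) x =
          heat (t - s') (z s') x + ∫ r in 0..s', heat (t - r) (H r) x := by
      intro s hs s' hs' hss
      have h1 := heat_sub_eq_integral ha ht.2 hzc hHc hzb hHb hz2 hzL heq x hs.1 hss hs'.2
      have h2 := intervalIntegral.integral_add_adjacent_intervals
        (hQi 0 ⟨le_rfl, ht0.le⟩ s (Ioo_subset_Icc_self hs))
        (hQi s (Ioo_subset_Icc_self hs) s' (Ioo_subset_Icc_self hs'))
      linarith
    intro s hs
    rcases le_total s (t / 2) with h | h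
    · exact main s hs _ hmid h
    · exact (main _ hmid s hs h).symm
  have h0 := hconst ⟨le_rfl, ht0.le⟩
  have h1 := hconst ⟨ht0.le, le_rfl⟩
  simp only [sub_zero, intervalIntegral.integral_same, add_zero, sub_self, heat_zero] at h0 h1
  have h2 : duhamel H t x = ∫ r in 0..t, heat (t - r) (H r) x := by
    rw [duhamel, integral_prod _ (integrable_duhamel ht0.le ha hHc.stronglyMeasurable
      (fun s hs => hHb s ⟨hs.1, hs.2.trans ht.2⟩) x),
      ← intervalIntegral.integral_of_le zero_le_one]
    have := intervalIntegral.smul_integral_comp_mul_left (a := 0) (b := 1)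
      (fun r => heat (t - r) (H r) x) t
    simp only [mul_zero, mul_one] at this
    rw [← this]
    congr 1
    refine intervalIntegral.integral_congr fun σ _ => ?_
    simp only [heat]
    congr 1
    ext ζ
    congr 4
    ring
  rw [h2]
  linarith

end

section
/-! ### Inequalities in `L²` -/

section Minkowski

variable {α β : Type*} [MeasurableSpace α] [MeasurableSpace β] {π : Measure α} {ν : Measure β}

theorem eLpNorm_two_sq (f : β → ℝ) : eLpNorm f 2 ν ^ 2 = ∫⁻ g, ‖f g‖ₑ ^ 2 ∂ν := by
  have := eLpNorm_nnreal_pow_eq_lintegral (μ := ν) (f := f) (p := 2) two_ne_zero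
  simpa using this

theorem eLpNorm_two_le_of_sq {f : β → ℝ} {B : ℝ≥0∞} (h : ∫⁻ g, ‖f g‖ₑ ^ 2 ∂ν ≤ B ^ 2) :
    eLpNorm f 2 ν ≤ B := by
  rw [← eLpNorm_two_sq] at h
  exact (ENNReal.pow_le_pow_left_iff two_ne_zero).1 h

theorem ofReal_integral_sq {f : β → ℝ} (hf : MemLp f 2 ν) :
    ENNReal.ofReal (∫ g, f g ^ 2 ∂ν) = eLpNorm f 2 ν ^ 2 := by
  rw [eLpNorm_two_sq, ofReal_integral_eq_lintegral_ofReal hf.integrable_sq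
    (Eventually.of_forall fun _ => sq_nonneg _)]
  refine lintegral_congr fun g => ?_
  rw [← sq_abs, ENNReal.ofReal_pow (abs_nonneg _), ← Real.enorm_eq_ofReal_abs]

theorem eLpNorm_two_le_ofReal_iff {f : β → ℝ} (hf : MemLp f 2 ν) {b : ℝ} (hb : 0 ≤ b) :
    eLpNorm f 2 ν ≤ ENNReal.ofReal b ↔ ∫ g, f g ^ 2 ∂ν ≤ b ^ 2 := by
  rw [← ENNReal.pow_le_pow_left_iff two_ne_zero, ← ofReal_integral_sq hf, ← ENNReal.ofReal_pow hb,
    ENNReal.ofReal_le_ofReal_iff (by positivity)]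

theorem lintegral_mul_le_eLpNorm {f g : β → ℝ} (hf : AEStronglyMeasurable f ν)
    (hg : AEStronglyMeasurable g ν) :
    ∫⁻ x, ‖f x‖ₑ * ‖g x‖ₑ ∂ν ≤ eLpNorm f 2 ν * eLpNorm g 2 ν := by
  have h := ENNReal.lintegral_mul_le_Lp_mul_Lq ν (p := 2) (q := 2) Real.HolderConjugate.two_two
    hf.enorm hg.enorm
  rw [eLpNorm_eq_lintegral_rpow_enorm_toReal two_ne_zero ENNReal.ofNat_ne_top,
    eLpNorm_eq_lintegral_rpow_enorm_toReal two_ne_zero ENNReal.ofNat_ne_top]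
  simpa using h

/-- Minkowski's integral inequality in `L²`. -/
theorem eLpNorm_integral_le [SFinite π] [SFinite ν] {X : α → β → ℝ}
    (hX : AEStronglyMeasurable (Function.uncurry X) (π.prod ν)) {b : α → ℝ} (hb : Integrable b π)
    (hb0 : ∀ᵐ p ∂π, 0 ≤ b p) (h : ∀ᵐ p ∂π, eLpNorm (X p) 2 ν ≤ ENNReal.ofReal (b p)) :
    eLpNorm (fun g => ∫ p, X p g ∂π) 2 ν ≤ ENNReal.ofReal (∫ p, b p ∂π) := by
  rw [ofReal_integral_eq_lintegral_ofReal hb hb0]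
  apply eLpNorm_two_le_of_sq
  have hXe : AEMeasurable (fun q : α × β => ‖X q.1 q.2‖ₑ) (π.prod ν) := hX.enorm
  have hsec : ∀ᵐ p ∂π, AEStronglyMeasurable (X p) ν := hX.prodMk_left
  set A : β → ℝ≥0∞ := fun g => ∫⁻ p, ‖X p g‖ₑ ∂π with hA
  have hAm : AEMeasurable A ν := hXe.lintegral_prod_left'
  -- The square is expanded into a double integral over `(p, q)`; Tonelli and Cauchy–Schwarz in `g`
  -- then bound each pair by `b p * b q`.
  calc ∫⁻ g, ‖∫ p, X p g ∂π‖ₑ ^ 2 ∂ν ≤ ∫⁻ g, A g * A g ∂ν := by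
        refine lintegral_mono fun g => ?_
        rw [← sq]
        exact pow_le_pow_left' (enorm_integral_le_lintegral_enorm _) 2
    _ = ∫⁻ g, ∫⁻ p, ‖X p g‖ₑ * A g ∂π ∂ν := by
        refine lintegral_congr_ae ?_
        filter_upwards [hX.prod_swap.prodMk_left] with g hg
        exact (lintegral_mul_const'' _ hg.enorm).symm
    _ = ∫⁻ p, ∫⁻ g, ‖X p g‖ₑ * A g ∂ν ∂π :=
        (lintegral_lintegral_swap (hXe.mul
          (hAm.comp_quasiMeasurePreserving Measure.quasiMeasurePreserving_snd))).symm
    _ ≤ ∫⁻ p, ENNReal.ofReal (b p) * ∫⁻ q, ENNReal.ofReal (b q) ∂π ∂π := by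
        refine lintegral_mono_ae ?_
        filter_upwards [h, hsec] with p hp hpm
        calc ∫⁻ g, ‖X p g‖ₑ * A g ∂ν = ∫⁻ g, ∫⁻ q, ‖X p g‖ₑ * ‖X q g‖ₑ ∂π ∂ν := by
              refine lintegral_congr_ae ?_
              filter_upwards [hX.prod_swap.prodMk_left] with g hg
              exact (lintegral_const_mul'' _ hg.enorm).symm
          _ = ∫⁻ q, ∫⁻ g, ‖X p g‖ₑ * ‖X q g‖ₑ ∂ν ∂π :=
              (lintegral_lintegral_swap ((hpm.enorm.comp_quasiMeasurePreserving
                Measure.quasiMeasurePreserving_snd).mul hXe)).symm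
          _ ≤ ∫⁻ q, ENNReal.ofReal (b p) * ENNReal.ofReal (b q) ∂π := by
              refine lintegral_mono_ae ?_
              filter_upwards [h, hsec] with q hq hqm
              exact (lintegral_mul_le_eLpNorm hpm hqm).trans (mul_le_mul' hp hq)
          _ = _ := lintegral_const_mul'' _ hb.1.aemeasurable.ennreal_ofReal
    _ = (∫⁻ p, ENNReal.ofReal (b p) ∂π) ^ 2 := by
        rw [lintegral_mul_const'' _ hb.1.aemeasurable.ennreal_ofReal, sq]

/-- The second moment of an average, through the correlations. -/
theorem integral_sq_integral_le [IsProbabilityMeasure π] [IsProbabilityMeasure ν] {X : α → β → ℝ}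
    (hX : StronglyMeasurable (Function.uncurry X)) {C : ℝ} (hC : ∀ p g, |X p g| ≤ C)
    {B : α × α → ℝ} (hB : Integrable B (π.prod π))
    (h : ∀ᵐ q ∂(π.prod π), |∫ g, X q.1 g * X q.2 g ∂ν| ≤ B q) :
    ∫ g, (∫ p, X p g ∂π) ^ 2 ∂ν ≤ ∫ q, B q ∂(π.prod π) := by
  have h1 : ∀ g, (∫ p, X p g ∂π) ^ 2 = ∫ q : α × α, X q.1 g * X q.2 g ∂(π.prod π) := fun g => by
    rw [integral_prod_mul (fun p => X p g) (fun p => X p g), sq]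
  have hm : StronglyMeasurable
      (Function.uncurry fun (g : β) (q : α × α) => X q.1 g * X q.2 g) :=
    (hX.comp_measurable (g := fun r : β × α × α => (r.2.1, r.1)) (by fun_prop)).mul
      (hX.comp_measurable (g := fun r : β × α × α => (r.2.2, r.1)) (by fun_prop))
  have hi : Integrable (Function.uncurry fun (g : β) (q : α × α) => X q.1 g * X q.2 g)
      (ν.prod (π.prod π)) := by
    refine (integrable_const (C * C)).mono' hm.aestronglyMeasurable
      (Eventually.of_forall fun r => ?_)
    simp only [Function.uncurry, norm_mul, Real.norm_eq_abs]
    exact mul_le_mul (hC _ _) (hC _ _) (abs_nonneg _) ((abs_nonneg _).trans (hC r.2.1 r.1))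
  simp_rw [h1]
  rw [integral_integral_swap hi]
  refine integral_mono_ae hi.integral_prod_right hB ?_
  filter_upwards [h] with q hq
  exact (le_abs_self _).trans hq

end Minkowski

/-! ### Functions of independent Gaussian variables -/

/-- The law of `n` independent standard Gaussian variables. -/
abbrev gaussN (n : ℕ) : Measure (Fin n → ℝ) := Measure.pi fun _ => gaussianReal 0 1

theorem _root_.LipschitzWith.memLp_of_memLp_id {F : Type*} [NormedAddCommGroup F]
    [MeasurableSpace F] [BorelSpace F] [SecondCountableTopology F] {μ : Measure F}
    [IsFiniteMeasure μ] {p : ℝ≥0∞} (hμ : MemLp id p μ)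
    {K : ℝ≥0} {A : F → ℝ} (hA : LipschitzWith K A) : MemLp A p μ := by
  have h0 : MemLp (fun x : F => ‖x‖) p μ := hμ.norm
  have ha : MemLp (fun _ : F => |A 0|) p μ := memLp_const _
  have hb : MemLp (fun x : F => (K : ℝ) * ‖x‖) p μ := h0.const_mul (K : ℝ)
  have h1 : MemLp (fun x : F => |A 0| + (K : ℝ) * ‖x‖) p μ := ha.add hb
  refine h1.mono' hA.continuous.aestronglyMeasurable (Eventually.of_forall fun x => ?_)
  have h2 := hA.dist_le_mul x 0
  rw [dist_zero_right, Real.dist_eq] at h2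
  have h3 : |A x| ≤ |A x - A 0| + |A 0| := by simpa using abs_add_le (A x - A 0) (A 0)
  rw [Real.norm_eq_abs]
  linarith

theorem memLp_eval_gaussN {n : ℕ} (i : Fin n) {p : ℝ≥0∞} (hp : p ≠ ∞) :
    MemLp (fun g : Fin n → ℝ => g i) p (gaussN n) :=
  (memLp_id_gaussianReal' p hp).comp_measurePreserving
    (measurePreserving_eval (fun _ : Fin n => gaussianReal 0 1) i)

theorem memLp_id_gaussN (n : ℕ) : MemLp (id : (Fin n → ℝ) → (Fin n → ℝ)) 2 (gaussN n) := by
  have h1 : MemLp (fun g : Fin n → ℝ => ∑ i, ‖g i‖) 2 (gaussN n) :=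
    memLp_finsetSum _ fun i _ => (memLp_eval_gaussN i ENNReal.ofNat_ne_top).norm
  refine h1.mono' (by fun_prop) (Eventually.of_forall fun g => ?_)
  rw [pi_norm_le_iff_of_nonneg (Finset.sum_nonneg fun i _ => norm_nonneg _)]
  intro i
  exact Finset.single_le_sum (fun j _ => norm_nonneg (g j)) (Finset.mem_univ i)

theorem _root_.LipschitzWith.memLp_gaussN {n : ℕ} {K : ℝ≥0} {A : (Fin n → ℝ) → ℝ}
    (hA : LipschitzWith K A) : MemLp A 2 (gaussN n) := hA.memLp_of_memLp_id (memLp_id_gaussN n)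

theorem measurePreserving_cons (n : ℕ) :
    MeasurePreserving (fun p : ℝ × (Fin n → ℝ) => (Fin.cons p.1 p.2 : Fin (n + 1) → ℝ))
      ((gaussianReal 0 1).prod (gaussN n)) (gaussN (n + 1)) := by
  have h := (measurePreserving_piFinSuccAbove (fun _ : Fin (n + 1) => gaussianReal 0 1) 0).symm
  have e : (fun p : ℝ × (Fin n → ℝ) => (Fin.cons p.1 p.2 : Fin (n + 1) → ℝ)) =
      (MeasurableEquiv.piFinSuccAbove (fun _ : Fin (n + 1) => ℝ) 0).symm := by
    ext p
    simp
  rw [e]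
  exact h

theorem norm_cons_sub_cons {n : ℕ} (x x' : ℝ) (y y' : Fin n → ℝ) :
    dist (Fin.cons x y : Fin (n + 1) → ℝ) (Fin.cons x' y') ≤ max (dist x x') (dist y y') := by
  rw [dist_pi_le_iff (by positivity)]
  intro i
  refine Fin.cases ?_ (fun j => ?_) i
  · simp
  · simp only [Fin.cons_succ]
    exact (dist_le_pi_dist y y' j).trans (le_max_right _ _)

theorem lipschitz_cons_left {n : ℕ} {K : ℝ≥0} {A : (Fin (n + 1) → ℝ) → ℝ}
    (hA : LipschitzWith K A) (y : Fin n → ℝ) : LipschitzWith K fun x => A (Fin.cons x y) :=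
  LipschitzWith.of_dist_le_mul fun x x' => (hA.dist_le_mul _ _).trans <| by
    gcongr
    exact (norm_cons_sub_cons _ _ _ _).trans (by simp)

theorem lipschitz_integral_cons {n : ℕ} {K : ℝ≥0} {A : (Fin (n + 1) → ℝ) → ℝ}
    (hA : LipschitzWith K A) :
    LipschitzWith K fun y => ∫ x, A (Fin.cons x y) ∂(gaussianReal 0 1) := by
  have hi : ∀ y, Integrable (fun x => A (Fin.cons x y)) (gaussianReal 0 1) := fun y =>
    ((lipschitz_cons_left hA y).memLp_of_memLp_id
      (memLp_id_gaussianReal' 2 ENNReal.ofNat_ne_top)).integrable one_le_two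
  refine LipschitzWith.of_dist_le_mul fun y y' => ?_
  rw [dist_eq_norm, ← integral_sub (hi y) (hi y')]
  refine (norm_integral_le_integral_norm _).trans ?_
  have : ∫ _ : ℝ, (K * dist y y' : ℝ) ∂(gaussianReal 0 1) = K * dist y y' := by simp
  rw [← this]
  refine integral_mono ((hi y).sub (hi y')).norm (integrable_const _) fun x => ?_
  simp only
  rw [← dist_eq_norm]
  refine (hA.dist_le_mul _ _).trans ?_
  gcongr
  exact (norm_cons_sub_cons _ _ _ _).trans (by simp)

theorem integral_gaussN_succ {n : ℕ} {A : (Fin (n + 1) → ℝ) → ℝ}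
    (hA : Integrable A (gaussN (n + 1))) :
    ∫ g, A g ∂(gaussN (n + 1)) =
      ∫ y, ∫ x, A (Fin.cons x y) ∂(gaussianReal 0 1) ∂(gaussN n) := by
  have hmp := measurePreserving_cons n
  rw [← hmp.map_eq, integral_map hmp.measurable.aemeasurable (by rw [hmp.map_eq]; exact hA.1),
    integral_prod_symm]
  exact hmp.integrable_comp_of_integrable hA

theorem integrable_integral_cons {n : ℕ} {A : (Fin (n + 1) → ℝ) → ℝ}
    (hA : Integrable A (gaussN (n + 1))) :
    Integrable (fun y => ∫ x, A (Fin.cons x y) ∂(gaussianReal 0 1)) (gaussN n) :=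
  ((measurePreserving_cons n).integrable_comp_of_integrable hA).integral_prod_right

/-- The law of total covariance. -/
theorem covariance_gaussN_succ {n : ℕ} {K K' : ℝ≥0} {A B : (Fin (n + 1) → ℝ) → ℝ}
    (hA : LipschitzWith K A) (hB : LipschitzWith K' B) :
    ∫ g, A g * B g ∂(gaussN (n + 1)) -
        (∫ g, A g ∂(gaussN (n + 1))) * ∫ g, B g ∂(gaussN (n + 1)) =
      (∫ y, (∫ x, A (Fin.cons x y) * B (Fin.cons x y) ∂(gaussianReal 0 1) -
        (∫ x, A (Fin.cons x y) ∂(gaussianReal 0 1)) *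
          ∫ x, B (Fin.cons x y) ∂(gaussianReal 0 1)) ∂(gaussN n)) +
      (∫ y, (∫ x, A (Fin.cons x y) ∂(gaussianReal 0 1)) *
          (∫ x, B (Fin.cons x y) ∂(gaussianReal 0 1)) ∂(gaussN n) -
        (∫ y, ∫ x, A (Fin.cons x y) ∂(gaussianReal 0 1) ∂(gaussN n)) *
          ∫ y, ∫ x, B (Fin.cons x y) ∂(gaussianReal 0 1) ∂(gaussN n)) := by
  have hAB : Integrable (fun g => A g * B g) (gaussN (n + 1)) :=
    hA.memLp_gaussN.integrable_mul hB.memLp_gaussN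
  rw [integral_gaussN_succ hAB, integral_gaussN_succ (hA.memLp_gaussN.integrable one_le_two),
    integral_gaussN_succ (hB.memLp_gaussN.integrable one_le_two), integral_sub]
  · ring
  · exact integrable_integral_cons hAB
  · exact (lipschitz_integral_cons hA).memLp_gaussN.integrable_mul
      (lipschitz_integral_cons hB).memLp_gaussN

/-- The variance is the least mean square deviation from a constant. With `c` the value at a
switched-off coordinate, this is the one-variable Efron–Stein inequality. -/
theorem integral_sq_sub_le {α : Type*} [MeasurableSpace α] {μ : Measure α} [IsProbabilityMeasure μ]
    {f : α → ℝ} (hf : MemLp f 2 μ) (c : ℝ) :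
    ∫ x, f x * f x ∂μ - (∫ x, f x ∂μ) * ∫ x, f x ∂μ ≤ ∫ x, (f x - c) ^ 2 ∂μ := by
  have h1 : Integrable f μ := hf.integrable one_le_two
  have h2 : Integrable (fun x => f x * f x) μ := hf.integrable_mul hf
  have e : ∀ x, (f x - c) ^ 2 = f x * f x - 2 * c * f x + c ^ 2 := fun x => by ring
  simp_rw [e]
  have h3 : Integrable (fun x => f x * f x - 2 * c * f x) μ := h2.sub (h1.const_mul _)
  rw [integral_add h3 (integrable_const _), integral_sub h2 (h1.const_mul _),
    integral_const_mul]
  simp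
  nlinarith [sq_nonneg ((∫ x, f x ∂μ) - c)]

theorem lipschitz_update {n : ℕ} (i : Fin n) :
    LipschitzWith 1 fun g : Fin n → ℝ => Function.update g i 0 :=
  LipschitzWith.of_dist_le_mul fun g g' => by
    rw [NNReal.coe_one, one_mul, dist_pi_le_iff dist_nonneg]
    intro j
    by_cases hj : j = i
    · subst hj; simp
    · simp only [Function.update_of_ne hj]; exact dist_le_pi_dist g g' j

theorem _root_.LipschitzWith.sub_update {n : ℕ} {K : ℝ≥0} {A : (Fin n → ℝ) → ℝ}
    (hA : LipschitzWith K A) (i : Fin n) :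
    LipschitzWith (K + K * 1) fun g => A g - A (Function.update g i 0) :=
  hA.sub (hA.comp (lipschitz_update i))

/-- The Efron–Stein inequality. -/
theorem efronStein {n : ℕ} {K : ℝ≥0} {A : (Fin n → ℝ) → ℝ} (hA : LipschitzWith K A) :
    ∫ g, A g * A g ∂(gaussN n) - (∫ g, A g ∂(gaussN n)) * ∫ g, A g ∂(gaussN n) ≤
      ∑ i, ∫ g, (A g - A (Function.update g i 0)) ^ 2 ∂(gaussN n) := by
  induction n with
  | zero =>
    rw [show gaussN 0 = Measure.dirac isEmptyElim from Measure.pi_of_empty _ _]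
    simp
  | succ n ih =>
    -- The law of total variance: the conditional variance given the last `n` coordinates accounts
    -- for coordinate `0`, and the induction hypothesis is applied to the function averaged over
    -- coordinate `0`.
    rw [covariance_gaussN_succ hA hA, Fin.sum_univ_succ]
    have hsq : ∀ i, Integrable (fun g => (A g - A (Function.update g i 0)) ^ 2)
        (gaussN (n + 1)) := fun i => (hA.sub_update i).memLp_gaussN.integrable_sq
    have hLx : ∀ y, MemLp (fun x => A (Fin.cons x y)) 2 (gaussianReal 0 1) := fun y =>
      (lipschitz_cons_left hA y).memLp_of_memLp_id (memLp_id_gaussianReal' 2 ENNReal.ofNat_ne_top)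
    refine add_le_add ?_ ((ih (lipschitz_integral_cons hA)).trans (Finset.sum_le_sum fun j _ => ?_))
    · rw [integral_gaussN_succ (hsq 0)]
      refine integral_mono ?_ (integrable_integral_cons (hsq 0)) fun y => ?_
      · exact (integrable_integral_cons (hA.memLp_gaussN.integrable_mul hA.memLp_gaussN)).sub
          ((lipschitz_integral_cons hA).memLp_gaussN.integrable_mul
            (lipschitz_integral_cons hA).memLp_gaussN)
      · simp only [Fin.update_cons_zero]
        exact integral_sq_sub_le (hLx y) _
    · rw [integral_gaussN_succ (hsq j.succ)]
      refine integral_mono ((lipschitz_integral_cons hA).sub_update j).memLp_gaussN.integrable_sq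
        (integrable_integral_cons (hsq j.succ)) fun y => ?_
      simp only [← Fin.cons_update]
      rw [← integral_sub ((hLx _).integrable one_le_two) ((hLx _).integrable one_le_two)]
      have hm : MemLp (fun x => A (Fin.cons x y) - A (Fin.cons x (Function.update y j 0))) 2
          (gaussianReal 0 1) := (hLx y).sub (hLx (Function.update y j 0))
      -- Jensen's inequality: the square of an averaged increment is at most the average of the
      -- squared increments.
      have h3 := variance_nonneg (fun x => A (Fin.cons x y) - A (Fin.cons x (Function.update y j 0)))
        (gaussianReal 0 1)
      rw [variance_eq_sub hm] at h3
      simp only [Pi.pow_apply] at h3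
      linarith

theorem integral_sq_gaussianReal : ∫ x : ℝ, x ^ 2 ∂(gaussianReal 0 1) = 1 := by
  have h := variance_id_gaussianReal (μ := 0) (v := 1)
  rw [variance_eq_sub (memLp_id_gaussianReal' 2 ENNReal.ofNat_ne_top)] at h
  simpa using h

/-- After subtracting the values at `0`, the mean of the product is at most `αβ E x² = αβ`, and the
product of the means is at most `αβ` because `E|x| ≤ 1`. The sharp factor is not needed. -/
theorem abs_covariance_gaussianReal_le {α β : ℝ} {f g : ℝ → ℝ} (hα : 0 ≤ α)
    (hf : ∀ x x', |f x - f x'| ≤ α * |x - x'|) (hg : ∀ x x', |g x - g x'| ≤ β * |x - x'|) :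
    |∫ x, f x * g x ∂(gaussianReal 0 1) -
      (∫ x, f x ∂(gaussianReal 0 1)) * ∫ x, g x ∂(gaussianReal 0 1)| ≤ 2 * (α * β) := by
  have hβ : 0 ≤ β := by simpa using (abs_nonneg _).trans (hg 1 0)
  have hid := memLp_id_gaussianReal' (μ := 0) (v := 1) 2 ENNReal.ofNat_ne_top
  have hfL : LipschitzWith ⟨α, hα⟩ f := LipschitzWith.of_dist_le_mul fun x x' => by
    rw [Real.dist_eq, Real.dist_eq]; exact hf x x'
  have hgL : LipschitzWith ⟨β, hβ⟩ g := LipschitzWith.of_dist_le_mul fun x x' => by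
    rw [Real.dist_eq, Real.dist_eq]; exact hg x x'
  have mf := hfL.memLp_of_memLp_id hid
  have mg := hgL.memLp_of_memLp_id hid
  have mf0 : MemLp (fun x => f x - f 0) 2 (gaussianReal 0 1) := mf.sub (memLp_const _)
  have mg0 : MemLp (fun x => g x - g 0) 2 (gaussianReal 0 1) := mg.sub (memLp_const _)
  have if1 := mf.integrable one_le_two
  have ig1 := mg.integrable one_le_two
  have ifg : Integrable (fun x => f x * g x) (gaussianReal 0 1) := mf.integrable_mul mg
  have hx2 : Integrable (fun x : ℝ => x ^ 2) (gaussianReal 0 1) := hid.integrable_sq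
  have hxa : Integrable (fun x : ℝ => |x|) (gaussianReal 0 1) := (hid.integrable one_le_two).abs
  have hE : ∫ x : ℝ, |x| ∂(gaussianReal 0 1) ≤ 1 := by
    have h3 := variance_nonneg (fun x : ℝ => |x|) (gaussianReal 0 1)
    rw [variance_eq_sub (X := fun x : ℝ => |x|) hid.abs] at h3
    simp only [Pi.pow_apply, sq_abs, integral_sq_gaussianReal] at h3
    nlinarith [integral_nonneg (μ := gaussianReal 0 1) (f := fun x : ℝ => |x|) fun x => abs_nonneg x]
  have hE0 : 0 ≤ ∫ x : ℝ, |x| ∂(gaussianReal 0 1) := integral_nonneg fun x => abs_nonneg x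
  have e : ∫ x, f x * g x ∂(gaussianReal 0 1) -
      (∫ x, f x ∂(gaussianReal 0 1)) * ∫ x, g x ∂(gaussianReal 0 1) =
      ∫ x, (f x - f 0) * (g x - g 0) ∂(gaussianReal 0 1) -
        (∫ x, (f x - f 0) ∂(gaussianReal 0 1)) * ∫ x, (g x - g 0) ∂(gaussianReal 0 1) := by
    have e1 : ∀ x, (f x - f 0) * (g x - g 0) = f x * g x - g 0 * f x - f 0 * g x + f 0 * g 0 :=
      fun x => by ring
    simp_rw [e1]
    have i1 : Integrable (fun x => f x * g x - g 0 * f x) (gaussianReal 0 1) :=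
      ifg.sub (if1.const_mul _)
    have i2 : Integrable (fun x => f x * g x - g 0 * f x - f 0 * g x) (gaussianReal 0 1) :=
      i1.sub (ig1.const_mul _)
    rw [integral_add i2 (integrable_const _), integral_sub i1 (ig1.const_mul _), integral_sub ifg (if1.const_mul _),
      integral_sub if1 (integrable_const _), integral_sub ig1 (integrable_const _),
      integral_const_mul, integral_const_mul]
    simp
    ring
  have h1 : |∫ x, (f x - f 0) * (g x - g 0) ∂(gaussianReal 0 1)| ≤ α * β := by
    refine (abs_integral_le_integral_abs).trans ?_
    have : ∫ x : ℝ, α * β * x ^ 2 ∂(gaussianReal 0 1) = α * β := by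
      rw [integral_const_mul, integral_sq_gaussianReal, mul_one]
    rw [← this]
    refine integral_mono (mf0.integrable_mul mg0).abs (hx2.const_mul _) fun x => ?_
    simp only [abs_mul]
    have a1 := hf x 0
    have a2 := hg x 0
    rw [sub_zero] at a1 a2
    calc _ ≤ (α * |x|) * (β * |x|) := by gcongr
      _ = α * β * |x| ^ 2 := by ring
      _ = _ := by rw [sq_abs]
  have h2 : |∫ x, (f x - f 0) ∂(gaussianReal 0 1)| ≤ α := by
    refine (abs_integral_le_integral_abs).trans ?_
    calc _ ≤ ∫ x : ℝ, α * |x| ∂(gaussianReal 0 1) :=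
          integral_mono (mf0.integrable one_le_two).abs (hxa.const_mul _) fun x => by
            simpa using hf x 0
      _ ≤ α := by rw [integral_const_mul]; exact mul_le_of_le_one_right hα hE
  have h3 : |∫ x, (g x - g 0) ∂(gaussianReal 0 1)| ≤ β := by
    refine (abs_integral_le_integral_abs).trans ?_
    calc _ ≤ ∫ x : ℝ, β * |x| ∂(gaussianReal 0 1) :=
          integral_mono (mg0.integrable one_le_two).abs (hxa.const_mul _) fun x => by
            simpa using hg x 0
      _ ≤ β := by rw [integral_const_mul]; exact mul_le_of_le_one_right hβ hE
  rw [e]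
  refine (abs_sub _ _).trans ?_
  rw [abs_mul]
  have := mul_le_mul h2 h3 (abs_nonneg _) hα
  linarith

/-- A covariance bound for coordinatewise Lipschitz functions of independent variables. -/
theorem abs_covariance_gaussN_le {n : ℕ} {K K' : ℝ≥0} {A B : (Fin n → ℝ) → ℝ}
    (hA : LipschitzWith K A) (hB : LipschitzWith K' B) {α β : Fin n → ℝ} (hα : ∀ i, 0 ≤ α i)
    (hAi : ∀ i g x x', |A (Function.update g i x) - A (Function.update g i x')| ≤ α i * |x - x'|)
    (hBi : ∀ i g x x', |B (Function.update g i x) - B (Function.update g i x')| ≤ β i * |x - x'|) :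
    |∫ g, A g * B g ∂(gaussN n) - (∫ g, A g ∂(gaussN n)) * ∫ g, B g ∂(gaussN n)| ≤
      2 * ∑ i, α i * β i := by
  induction n with
  | zero =>
    rw [show gaussN 0 = Measure.dirac isEmptyElim from Measure.pi_of_empty _ _]
    simp
  | succ n ih =>
    have hint : ∀ {K : ℝ≥0} {A : (Fin (n + 1) → ℝ) → ℝ}, LipschitzWith K A → ∀ y,
        Integrable (fun x => A (Fin.cons x y)) (gaussianReal 0 1) := fun hA y =>
      ((lipschitz_cons_left hA y).memLp_of_memLp_id
        (memLp_id_gaussianReal' 2 ENNReal.ofNat_ne_top)).integrable one_le_two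
    have hbar : ∀ {K : ℝ≥0} {A : (Fin (n + 1) → ℝ) → ℝ} {α : Fin (n + 1) → ℝ}, LipschitzWith K A →
        (∀ i g x x', |A (Function.update g i x) - A (Function.update g i x')| ≤ α i * |x - x'|) →
        ∀ (i : Fin n) g x x', |∫ z, A (Fin.cons z (Function.update g i x)) ∂(gaussianReal 0 1) -
          ∫ z, A (Fin.cons z (Function.update g i x')) ∂(gaussianReal 0 1)| ≤
          α i.succ * |x - x'| := by
      intro K A α hA h i g x x'
      rw [← integral_sub (hint hA _) (hint hA _)]
      refine (abs_integral_le_integral_abs).trans ?_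
      have : ∫ _ : ℝ, α i.succ * |x - x'| ∂(gaussianReal 0 1) = α i.succ * |x - x'| := by simp
      rw [← this]
      refine integral_mono ((hint hA _).sub (hint hA _)).abs (integrable_const _) fun z => ?_
      simp only [Fin.cons_update]
      exact h _ _ _ _
    -- The conditional covariance in coordinate `0` is bounded by the one-variable case uniformly in
    -- the others; averaging over coordinate `0` does not increase the remaining coordinatewise
    -- Lipschitz constants.
    rw [covariance_gaussN_succ hA hB, Fin.sum_univ_succ, mul_add]
    refine (abs_add_le _ _).trans (add_le_add ?_ (ih (lipschitz_integral_cons hA)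
      (lipschitz_integral_cons hB) (fun i => hα i.succ) (hbar hA hAi) (hbar hB hBi)))
    rw [← Real.norm_eq_abs]
    have hC : ∀ y : Fin n → ℝ, ‖∫ x, A (Fin.cons x y) * B (Fin.cons x y) ∂(gaussianReal 0 1) -
        (∫ x, A (Fin.cons x y) ∂(gaussianReal 0 1)) *
          ∫ x, B (Fin.cons x y) ∂(gaussianReal 0 1)‖ ≤ 2 * (α 0 * β 0) := fun y => ?_
    · simpa using norm_integral_le_of_norm_le_const (μ := gaussN n) (Eventually.of_forall hC)
    refine abs_covariance_gaussianReal_le (hα 0) (fun x x' => ?_) fun x x' => ?_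
    · simpa using hAi 0 (Fin.cons 0 y) x x'
    · simpa using hBi 0 (Fin.cons 0 y) x x'

end

section
/-! ### Reaction terms and mild solutions -/

/-- The time `s`, clamped to `[0, T]`. -/
def clampT (T s : ℝ) : ℝ := min (max s 0) T

theorem continuous_clampT (T : ℝ) : Continuous (clampT T) := by unfold clampT; fun_prop

theorem clampT_mem {T : ℝ} (hT : 0 ≤ T) (s : ℝ) : clampT T s ∈ Icc 0 T :=
  ⟨le_min (le_max_right _ _) hT, min_le_right _ _⟩

theorem clampT_of_mem {T s : ℝ} (hs : s ∈ Icc 0 T) : clampT T s = s := by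
  rw [clampT, max_eq_left hs.1, min_eq_left hs.2]

/-- The shifted time `s + e`, clamped. -/
def rad (T e s : ℝ) : ℝ := clampT T s + e

theorem continuous_rad (T e : ℝ) : Continuous (rad T e) :=
  (continuous_clampT T).add continuous_const

theorem rad_of_mem {T e s : ℝ} (hs : s ∈ Icc 0 T) : rad T e s = s + e := by
  rw [rad, clampT_of_mem hs]

theorem le_rad {T e : ℝ} (hT : 0 ≤ T) (s : ℝ) : e ≤ rad T e s := by
  have := (clampT_mem hT s).1
  simp only [rad]; linarith

theorem rad_pos {T e : ℝ} (hT : 0 ≤ T) (he : 0 < e) (s : ℝ) : 0 < rad T e s :=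
  he.trans_le (le_rad hT s)

theorem continuous_div_rad {T e : ℝ} (hT : 0 ≤ T) (he : 0 < e) (c : ℝ) :
    Continuous fun s => c / rad T e s :=
  continuous_const.div (continuous_rad T e) fun s => (rad_pos hT he s).ne'

/-- This is the source of the logarithm: with `e = ε²` it is comparable to `log ε⁻¹`, the factor by
which the reaction term is divided. -/
theorem integral_div_rad {T e t : ℝ} (he : 0 < e) (ht : t ∈ Icc 0 T) (c : ℝ) :
    ∫ s in 0..t, c / rad T e s = c * Real.log ((t + e) / e) := by
  have h1 : ∫ s in 0..t, c / rad T e s = ∫ s in 0..t, c * (s + e)⁻¹ := by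
    refine intervalIntegral.integral_congr fun s hs => ?_
    rw [uIcc_of_le ht.1] at hs
    rw [rad_of_mem ⟨hs.1, hs.2.trans ht.2⟩, div_eq_mul_inv]
  rw [h1, intervalIntegral.integral_const_mul,
    intervalIntegral.integral_comp_add_right (fun s => s⁻¹), zero_add,
    integral_inv_of_pos he (by linarith [ht.1])]

theorem duhamel_congr {E : Type*} [NormedAddCommGroup E] [NormedSpace ℝ E] {H H' : ℝ → Plane → E}
    {t : ℝ} (ht : 0 ≤ t) (h : ∀ s ∈ Icc 0 t, ∀ y, H s y = H' s y) (x : Plane) :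
    duhamel H t x = duhamel H' t x := by
  simp only [duhamel]
  congr 1
  refine integral_congr_ae ?_
  filter_upwards [ae_stM_fst] with p hp
  exact h _ (mul_mem_Icc_of_mem_Ioc ht hp) _

theorem duhamel_const_mul (c : ℝ) (H : ℝ → Plane → ℝ) (t : ℝ) (x : Plane) :
    duhamel (fun s y => c * H s y) t x = c * duhamel H t x := by
  simp only [duhamel, integral_const_mul, smul_eq_mul]
  ring

theorem heat_const_mul (c : ℝ) (φ : Plane → ℝ) (t : ℝ) (x : Plane) :
    heat t (fun y => c * φ y) x = c * heat t φ x := by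
  simp only [heat, integral_const_mul]

/-- A reaction term `h` with derivative `h'` in its second argument: odd, with the critical decay
in time of its Lipschitz constant and of the Lipschitz constant of its derivative. -/
structure IsReaction (T e ℓ k : ℝ) (h h' : ℝ → ℝ → ℝ) : Prop where
  T_nonneg : 0 ≤ T
  e_pos : 0 < e
  ℓ_nonneg : 0 ≤ ℓ
  k_nonneg : 0 ≤ k
  cont : Continuous (Function.uncurry h)
  cont' : Continuous (Function.uncurry h')
  hasDerivAt : ∀ s u, HasDerivAt (h s) (h' s u) u
  odd : ∀ s u, h s (-u) = -h s u
  bound : ∀ s u, |h' s u| ≤ ℓ / rad T e s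
  lip : ∀ s u v, |h' s u - h' s v| ≤ k / √(rad T e s) * |u - v|

theorem abs_sub_le_of_hasDerivAt {f f' : ℝ → ℝ} {C : ℝ} (hf : ∀ x, HasDerivAt f (f' x) x)
    (hC : ∀ x, |f' x| ≤ C) (x y : ℝ) : |f x - f y| ≤ C * |x - y| :=
  convex_univ.norm_image_sub_le_of_norm_hasDerivWithin_le
    (fun x _ => (hf x).hasDerivWithinAt) (fun x _ => hC x) (mem_univ y) (mem_univ x)

namespace IsReaction

variable {T e ℓ k : ℝ} {h h' : ℝ → ℝ → ℝ}

theorem coeff_nonneg (hR : IsReaction T e ℓ k h h') (s : ℝ) : 0 ≤ ℓ / rad T e s :=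
  div_nonneg hR.ℓ_nonneg (rad_pos hR.T_nonneg hR.e_pos s).le

theorem coeff_le (hR : IsReaction T e ℓ k h h') (s : ℝ) : ℓ / rad T e s ≤ ℓ / e :=
  div_le_div_of_nonneg_left hR.ℓ_nonneg hR.e_pos (le_rad hR.T_nonneg s)

theorem klip_nonneg (hR : IsReaction T e ℓ k h h') (s : ℝ) : 0 ≤ k / √(rad T e s) :=
  div_nonneg hR.k_nonneg (Real.sqrt_nonneg _)

theorem klip_le (hR : IsReaction T e ℓ k h h') (s : ℝ) : k / √(rad T e s) ≤ k / √e :=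
  div_le_div_of_nonneg_left hR.k_nonneg (Real.sqrt_pos.2 hR.e_pos)
    (Real.sqrt_le_sqrt (le_rad hR.T_nonneg s))

theorem lipschitz (hR : IsReaction T e ℓ k h h') (s u v : ℝ) :
    |h s u - h s v| ≤ ℓ / rad T e s * |u - v| :=
  abs_sub_le_of_hasDerivAt (hR.hasDerivAt s) (hR.bound s) u v

theorem zero (hR : IsReaction T e ℓ k h h') (s : ℝ) : h s 0 = 0 := by
  have := hR.odd s 0
  rw [neg_zero] at this
  linarith

theorem abs_le (hR : IsReaction T e ℓ k h h') (s u : ℝ) : |h s u| ≤ ℓ / rad T e s * |u| := by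
  simpa [hR.zero] using hR.lipschitz s u 0

/-- The point `u₀ + (v - v₀)` is inserted. Moving from `u` to it costs only the difference of the
two increments. What remains compares increments of equal length `v - v₀` started at `u₀` and at
`v₀`, so the Lipschitz bound on `h'` yields a product of two small quantities. -/
theorem abs_second_diff_le (hR : IsReaction T e ℓ k h h') (s u u₀ v v₀ : ℝ) :
    |h s u - h s u₀ - (h s v - h s v₀)| ≤
      ℓ / rad T e s * |(u - v) - (u₀ - v₀)| + k / √(rad T e s) * |u₀ - v₀| * |v - v₀| := by
  have h1 := hR.lipschitz s u (u₀ + (v - v₀))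
  have h2 := abs_sub_le_of_hasDerivAt (f := fun x => h s (u₀ + x) - h s (v₀ + x))
    (f' := fun x => h' s (u₀ + x) - h' s (v₀ + x)) (C := k / √(rad T e s) * |u₀ - v₀|)
    (fun x => ((hR.hasDerivAt s _).comp_const_add u₀ x).sub
      ((hR.hasDerivAt s _).comp_const_add v₀ x))
    (fun x => by simpa using hR.lip s (u₀ + x) (v₀ + x)) (v - v₀) 0
  simp only [add_zero, sub_zero, add_sub_cancel] at h2
  have e1 : h s u - h s u₀ - (h s v - h s v₀) =
      (h s u - h s (u₀ + (v - v₀))) + (h s (u₀ + (v - v₀)) - h s v - (h s u₀ - h s v₀)) := by ring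
  have e2 : u - (u₀ + (v - v₀)) = (u - v) - (u₀ - v₀) := by ring
  rw [e2] at h1
  rw [e1]
  exact (abs_add_le _ _).trans (add_le_add h1 h2)

/-- The mean value inequality for `h s x - h' s v₀ * x`, whose derivative on the segment is at most
`k / √r * |v - v₀|`; the factor `1/2` of Taylor's formula is not pursued. -/
theorem abs_taylor_le (hR : IsReaction T e ℓ k h h') (s v v₀ : ℝ) :
    |h s v - h s v₀ - h' s v₀ * (v - v₀)| ≤ k / √(rad T e s) * |v - v₀| ^ 2 := by
  have h2 := (convex_uIcc v₀ v).norm_image_sub_le_of_norm_hasDerivWithin_le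
    (f := fun x => h s x - h' s v₀ * x)
    (f' := fun x => h' s x - h' s v₀) (C := k / √(rad T e s) * |v - v₀|)
    (fun x _ => ((hR.hasDerivAt s x).sub
      (by simpa using (hasDerivAt_id x).const_mul (h' s v₀))).hasDerivWithinAt)
    (fun x hx => (hR.lip s x v₀).trans (mul_le_mul_of_nonneg_left
      (abs_sub_left_of_mem_uIcc hx) (hR.klip_nonneg s)))
    left_mem_uIcc right_mem_uIcc
  simp only [Real.norm_eq_abs] at h2
  calc _ = |h s v - h' s v₀ * v - (h s v₀ - h' s v₀ * v₀)| := by ring_nf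
    _ ≤ _ := h2
    _ = _ := by ring

/-- The growth factor of the linearised equation. -/
theorem exp_integral_coeff_le (hR : IsReaction T e ℓ k h h') {t : ℝ} (ht : t ∈ Icc 0 T) :
    Real.exp (∫ s in 0..t, ℓ / rad T e s) ≤ Real.exp (ℓ * Real.log ((T + e) / e)) := by
  rw [integral_div_rad hR.e_pos ht]
  have := hR.e_pos
  have := ht.1
  have := ht.2
  have := hR.ℓ_nonneg
  gcongr

/-- Stability of mild solutions with respect to the initial data. -/
theorem abs_sub_le_heat (hR : IsReaction T e ℓ k h h') {a K : ℝ} (ha : 0 ≤ a)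
    {z z' : ℝ → Plane → ℝ} {φ φ' : Plane → ℝ} (hzc : Continuous (Function.uncurry z))
    (hzc' : Continuous (Function.uncurry z')) (hzb : ∀ s ∈ Icc 0 T, ExpBound a K (z s))
    (hzb' : ∀ s ∈ Icc 0 T, ExpBound a K (z' s)) (hφ : Continuous φ) (hφ' : Continuous φ')
    (hφb : ExpBound a K φ) (hφb' : ExpBound a K φ')
    (hz : ∀ t ∈ Icc 0 T, ∀ x, z t x = heat t φ x - duhamel (fun s y => h s (z s y)) t x)
    (hz' : ∀ t ∈ Icc 0 T, ∀ x, z' t x = heat t φ' x - duhamel (fun s y => h s (z' s y)) t x) :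
    ∀ t ∈ Icc 0 T, ∀ x, |z t x - z' t x| ≤
      Real.exp (ℓ * Real.log ((T + e) / e)) * heat t (fun y => |φ y - φ' y|) x := by
  have hK : 0 ≤ K := hφb.nonneg
  have hsub : ∀ {p q : Plane → ℝ}, ExpBound a K p → ExpBound a K q →
      ExpBound a (2 * K) fun y => |p y - q y| := fun {p q} hp hq y => by
    have h1 := hp y
    have h2 := hq y
    simp only [Real.norm_eq_abs, abs_abs] at *
    linarith [abs_sub (p y) (q y)]
  have hHc : ∀ {z : ℝ → Plane → ℝ}, Continuous (Function.uncurry z) →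
      StronglyMeasurable (Function.uncurry fun s y => h s (z s y)) := fun hz =>
    (hR.cont.comp (f := fun p : ℝ × Plane => (p.1, _)) (continuous_fst.prodMk hz)).stronglyMeasurable
  have hHb : ∀ {z : ℝ → Plane → ℝ}, (∀ s ∈ Icc 0 T, ExpBound a K (z s)) → ∀ s ∈ Icc 0 T,
      ExpBound a (ℓ / e * K) fun y => h s (z s y) := fun hz s hs y => by
    refine (hR.abs_le s _).trans ?_
    rw [mul_assoc]
    exact mul_le_mul (hR.coeff_le s) (hz s hs y) (abs_nonneg _)
      (div_nonneg hR.ℓ_nonneg hR.e_pos.le)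
  have main := le_exp_mul_heat_of_le_duhamel (T := T) ha
    (continuous_div_rad hR.T_nonneg hR.e_pos ℓ) hR.coeff_nonneg
    (D := fun t x => |z t x - z' t x|) (fun s hs => hsub (hzb s hs) (hzb' s hs))
    (ψ := fun y => |φ y - φ' y|) (hsub hφb hφb') (by fun_prop) (fun x => abs_nonneg _)
    (G := fun s y => h s (z s y) - h s (z' s y)) (fun s _ y => hR.lipschitz s _ _) ?_
  · intro t ht x
    refine (main t ht x).trans ?_
    exact mul_le_mul_of_nonneg_right (hR.exp_integral_coeff_le ht)
      (heat_nonneg (fun y => abs_nonneg _) x)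
  · intro t ht x
    have hle : ∀ s ∈ Icc 0 t, s ∈ Icc 0 T := fun s hs => ⟨hs.1, hs.2.trans ht.2⟩
    rw [duhamel_sub ht.1 ha (hHc hzc) (fun s hs => hHb hzb s (hle s hs)) (hHc hzc')
      (fun s hs => hHb hzb' s (hle s hs)), hz t ht x, hz' t ht x]
    have e1 : heat t φ x - duhamel (fun s y => h s (z s y)) t x -
        (heat t φ' x - duhamel (fun s y => h s (z' s y)) t x) =
        (heat t φ x - heat t φ' x) - (duhamel (fun s y => h s (z s y)) t x -
          duhamel (fun s y => h s (z' s y)) t x) := by ring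
    rw [e1]
    refine (abs_sub _ _).trans (add_le_add ?_ le_rfl)
    rw [heat, heat, ← integral_sub (hφb.integrable ha t hφ.stronglyMeasurable x)
      (hφb'.integrable ha t hφ'.stronglyMeasurable x)]
    exact abs_integral_le_integral_abs

end IsReaction

end

section
/-! ### Bounds in `L²` -/

section L2

variable {α : Type*} [MeasurableSpace α] {μ : Measure α}

theorem eLpNorm_le_of_abs_le {A B : α → ℝ} {b : ℝ≥0∞} (h : ∀ᵐ ω ∂μ, |A ω| ≤ |B ω|)
    (hB : eLpNorm B 2 μ ≤ b) : eLpNorm A 2 μ ≤ b :=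
  (eLpNorm_mono_ae h).trans hB

theorem eLpNorm_add_le_ofReal {A B : α → ℝ} {a b : ℝ} (ha : 0 ≤ a) (hb : 0 ≤ b)
    (hAm : AEStronglyMeasurable A μ) (hBm : AEStronglyMeasurable B μ)
    (hA : eLpNorm A 2 μ ≤ ENNReal.ofReal a) (hB : eLpNorm B 2 μ ≤ ENNReal.ofReal b) :
    eLpNorm (fun ω => A ω + B ω) 2 μ ≤ ENNReal.ofReal (a + b) := by
  rw [ENNReal.ofReal_add ha hb]
  exact (eLpNorm_add_le hAm hBm one_le_two).trans (add_le_add hA hB)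

theorem eLpNorm_const_mul_le_ofReal {A : α → ℝ} {a : ℝ} (c : ℝ)
    (hA : eLpNorm A 2 μ ≤ ENNReal.ofReal a) :
    eLpNorm (fun ω => c * A ω) 2 μ ≤ ENNReal.ofReal (|c| * a) := by
  have := eLpNorm_const_smul_le (c := c) (f := A) (p := 2) (μ := μ)
  rw [ENNReal.ofReal_mul (abs_nonneg c), ← Real.enorm_eq_ofReal_abs]
  exact this.trans (mul_le_mul_right hA _)

end L2

/-! ### Symmetry and independence for the Gaussian law -/

/-- Once coordinate `i` has been overwritten by `0`, `F` depends only on the other coordinates,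
which are independent of `g i`. The value `0` carries no information and only serves as a
placeholder. -/
theorem lintegral_eval_mul_update {n : ℕ} (i : Fin n) {φ : ℝ → ℝ≥0∞} (hφ : Measurable φ)
    {F : (Fin n → ℝ) → ℝ≥0∞} (hF : Measurable F) :
    ∫⁻ g, φ (g i) * F (Function.update g i 0) ∂(gaussN n) =
      (∫⁻ x, φ x ∂(gaussianReal 0 1)) * ∫⁻ g, F (Function.update g i 0) ∂(gaussN n) := by
  cases n with
  | zero => exact i.elim0
  | succ n =>
    have hmp := measurePreserving_piFinSuccAbove (fun _ : Fin (n + 1) => gaussianReal 0 1) i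
    have hG : Measurable fun y : Fin n → ℝ => F (i.insertNth 0 y) := by
      refine hF.comp ?_
      have h1 : Measurable fun y : Fin n → ℝ => ((0 : ℝ), y) := by fun_prop
      exact (MeasurableEquiv.piFinSuccAbove (fun _ : Fin (n + 1) => ℝ) i).symm.measurable.comp h1
    have e : ∀ g : Fin (n + 1) → ℝ, F (Function.update g i 0) = F (i.insertNth 0 (i.removeNth g)) :=
      fun g => by
        rw [Fin.insertNth_removeNth]
    have key : ∀ φ : ℝ → ℝ≥0∞, Measurable φ →
        ∫⁻ g, φ (g i) * F (Function.update g i 0) ∂(gaussN (n + 1)) =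
        (∫⁻ x, φ x ∂(gaussianReal 0 1)) * ∫⁻ y, F (i.insertNth 0 y) ∂(gaussN n) := by
      intro φ hφ
      have h2 := hmp.lintegral_comp (f := fun q : ℝ × (Fin n → ℝ) => φ q.1 * F (i.insertNth 0 q.2))
        ((hφ.comp measurable_fst).mul (hG.comp measurable_snd))
      rw [lintegral_prod_mul hφ.aemeasurable hG.aemeasurable] at h2
      simp_rw [e]
      exact h2
    have h1 := key (fun _ => 1) measurable_const
    simp only [one_mul, lintegral_const, measure_univ] at h1
    rw [key φ hφ, h1]

theorem lintegral_enorm_sq_gaussianReal : ∫⁻ x : ℝ, ‖x‖ₑ ^ 2 ∂(gaussianReal 0 1) = 1 := by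
  have h := ofReal_integral_sq (memLp_id_gaussianReal' (μ := 0) (v := 1) 2 ENNReal.ofNat_ne_top)
  simp only [id, integral_sq_gaussianReal, ENNReal.ofReal_one] at h
  rw [h, eLpNorm_two_sq]
  rfl

/-- Independence and `E g_i² = 1`. Thanks to this, a factor `g_i` in front of a quantity with `g_i`
switched off costs nothing in `L²`, and no fourth moment is required. -/
theorem eLpNorm_eval_mul_update {n : ℕ} (i : Fin n) {F : (Fin n → ℝ) → ℝ} (hF : Measurable F) :
    eLpNorm (fun g => g i * F (Function.update g i 0)) 2 (gaussN n) =
      eLpNorm (fun g => F (Function.update g i 0)) 2 (gaussN n) := by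
  have h : eLpNorm (fun g => g i * F (Function.update g i 0)) 2 (gaussN n) ^ 2 =
      eLpNorm (fun g => F (Function.update g i 0)) 2 (gaussN n) ^ 2 := by
    rw [eLpNorm_two_sq, eLpNorm_two_sq]
    simp_rw [enorm_mul, mul_pow]
    rw [lintegral_eval_mul_update i (φ := fun x => ‖x‖ₑ ^ 2) (by fun_prop)
      (F := fun g => ‖F g‖ₑ ^ 2) (by fun_prop), lintegral_enorm_sq_gaussianReal, one_mul]
  exact le_antisymm ((ENNReal.pow_le_pow_left_iff two_ne_zero).1 h.le)
    ((ENNReal.pow_le_pow_left_iff two_ne_zero).1 h.ge)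

theorem eLpNorm_eval_gaussN {n : ℕ} (i : Fin n) {p : ℝ≥0∞} {f : ℝ → ℝ} (hf : Measurable f) :
    eLpNorm (fun g : Fin n → ℝ => f (g i)) p (gaussN n) = eLpNorm f p (gaussianReal 0 1) :=
  eLpNorm_comp_measurePreserving hf.aestronglyMeasurable
    (measurePreserving_eval (fun _ : Fin n => gaussianReal 0 1) i)

theorem eLpNorm_eval_two {n : ℕ} (i : Fin n) :
    eLpNorm (fun g : Fin n → ℝ => g i) 2 (gaussN n) ≤ ENNReal.ofReal 1 := by
  apply eLpNorm_two_le_of_sq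
  rw [← eLpNorm_two_sq, eLpNorm_eval_gaussN i (f := fun x => x) measurable_id, eLpNorm_two_sq]
  simp only [lintegral_enorm_sq_gaussianReal]
  simp

theorem integral_abs_gaussianReal_le : ∫ x : ℝ, |x| ∂(gaussianReal 0 1) ≤ 1 := by
  have hid := memLp_id_gaussianReal' (μ := 0) (v := 1) 2 ENNReal.ofNat_ne_top
  have h3 := variance_nonneg (fun x : ℝ => |x|) (gaussianReal 0 1)
  rw [variance_eq_sub (X := fun x : ℝ => |x|) hid.abs] at h3
  simp only [Pi.pow_apply, sq_abs, integral_sq_gaussianReal] at h3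
  nlinarith [integral_nonneg (μ := gaussianReal 0 1) (f := fun x : ℝ => |x|) fun x => abs_nonneg x]

theorem integral_abs_eval_le {n : ℕ} (i : Fin n) : ∫ g : Fin n → ℝ, |g i| ∂(gaussN n) ≤ 1 := by
  have hmp := measurePreserving_eval (fun _ : Fin n => gaussianReal 0 1) i
  have := integral_map (μ := gaussN n) (φ := Function.eval i) (f := fun x : ℝ => |x|)
    hmp.measurable.aemeasurable (by fun_prop)
  rw [hmp.map_eq] at this
  rw [show ∫ g : Fin n → ℝ, |g i| ∂(gaussN n) = _ from this.symm]
  exact integral_abs_gaussianReal_le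

theorem integrable_eval {n : ℕ} (i : Fin n) : Integrable (fun g : Fin n → ℝ => g i) (gaussN n) :=
  (memLp_eval_gaussN i ENNReal.ofNat_ne_top (p := 2)).integrable one_le_two

theorem integral_eq_zero_of_odd {n : ℕ} {A : (Fin n → ℝ) → ℝ} (h : ∀ g, A (-g) = -A g) :
    ∫ g, A g ∂(gaussN n) = 0 := by
  have hmp : MeasurePreserving (fun g : Fin n → ℝ => fun i => -g i) (gaussN n) (gaussN n) := by
    refine measurePreserving_pi (fun _ : Fin n => gaussianReal 0 1) _ fun i => ⟨by fun_prop, ?_⟩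
    have := gaussianReal_map_neg (μ := 0) (v := 1)
    simpa using this
  have h1 := hmp.integral_comp (MeasurableEquiv.neg (Fin n → ℝ)).measurableEmbedding A
  have h2 : ∫ g, A (fun i => -g i) ∂(gaussN n) = -∫ g, A g ∂(gaussN n) := by
    rw [← integral_neg]
    exact integral_congr_ae (Eventually.of_forall fun g => h g)
  rw [h2] at h1
  linarith

end

section
/-! ### Finite-dimensional noise -/

/-- Profiles `γ i` of a finite-dimensional noise `∑ g i γ i`, whose heat flows have the correlations
of the white noise at most, each of them being small. -/
structure IsNoiseData (T e ϰ : ℝ) {n : ℕ} (γ : Fin n → Plane → ℝ) : Prop where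
  cont : ∀ i, Continuous (γ i)
  nonneg : ∀ i x, 0 ≤ γ i x
  bdd : ∃ K, ∀ i x, γ i x ≤ K
  cov : ∀ s ∈ Icc 0 T, ∀ s' ∈ Icc 0 T, ∀ y y',
    ∑ i, heat s (γ i) y * heat s' (γ i) y' ≤ 1 / (2 * Real.pi * max (s + e) (s' + e))
  small : ∀ s ∈ Icc 0 T, ∀ i y, heat s (γ i) y ≤ ϰ / √(2 * Real.pi * (s + e))

/-- The linear combination `∑ g i V i`. -/
def linComb {n : ℕ} (V : Fin n → Plane → ℝ) (g : Fin n → ℝ) (y : Plane) : ℝ := ∑ i, g i * V i y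

variable {T e ℓ k ϰ : ℝ} {h h' : ℝ → ℝ → ℝ} {n : ℕ} {γ : Fin n → Plane → ℝ}

theorem IsNoiseData.continuous_linComb (hγ : IsNoiseData T e ϰ γ) (g : Fin n → ℝ) :
    Continuous (linComb γ g) := by
  have := hγ.cont
  unfold linComb
  fun_prop

theorem IsNoiseData.exists_bound (hγ : IsNoiseData T e ϰ γ) :
    ∃ K, 0 ≤ K ∧ ∀ i, ExpBound 0 K (γ i) := by
  obtain ⟨K, hK⟩ := hγ.bdd
  refine ⟨max K 0, le_max_right _ _, fun i => ExpBound.of_bounded fun x => ?_⟩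
  rw [Real.norm_eq_abs, abs_of_nonneg (hγ.nonneg i x)]
  exact (hK i x).trans (le_max_left _ _)

theorem IsNoiseData.heat_nonneg (hγ : IsNoiseData T e ϰ γ) (i : Fin n) (s : ℝ) (y : Plane) :
    0 ≤ heat s (γ i) y := CriticalReaction.heat_nonneg (hγ.nonneg i) y

theorem heat_le_of_le {φ : Plane → ℝ} {K s : ℝ} (h : ExpBound 0 K φ) (y : Plane) :
    |heat s φ y| ≤ K := by
  have := h.heat_le le_rfl (le_refl s) y
  simpa [expMoment] using this

theorem abs_linComb_le {V : Fin n → Plane → ℝ} {K : ℝ} {y : Plane} (hV : ∀ i, |V i y| ≤ K)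
    (g : Fin n → ℝ) : |linComb V g y| ≤ n * K * ‖g‖ := by
  refine (Finset.abs_sum_le_sum_abs _ _).trans ?_
  calc ∑ i, |g i * V i y| ≤ ∑ _ : Fin n, K * ‖g‖ := by
        refine Finset.sum_le_sum fun i _ => ?_
        rw [abs_mul, mul_comm]
        exact mul_le_mul (hV i) (norm_le_pi_norm g i) (abs_nonneg _)
          ((abs_nonneg _).trans (hV i))
    _ = _ := by simp; ring

theorem linComb_sub (V : Fin n → Plane → ℝ) (g g' : Fin n → ℝ) (y : Plane) :
    linComb V g y - linComb V g' y = linComb V (g - g') y := by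
  simp [linComb, ← Finset.sum_sub_distrib, sub_mul]

theorem linComb_neg (V : Fin n → Plane → ℝ) (g : Fin n → ℝ) (y : Plane) :
    linComb V (-g) y = -linComb V g y := by
  simp [linComb]

theorem linComb_sub_update (V : Fin n → Plane → ℝ) (g : Fin n → ℝ) (i : Fin n) (y : Plane) :
    linComb V g y - linComb V (Function.update g i 0) y = g i * V i y := by
  rw [linComb_sub, linComb, Finset.sum_eq_single i]
  · simp
  · intro j _ hj; simp [Function.update_of_ne hj]
  · simp

theorem linComb_update_sub (V : Fin n → Plane → ℝ) (g : Fin n → ℝ) (i : Fin n) (x x' : ℝ)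
    (y : Plane) : linComb V (Function.update g i x) y - linComb V (Function.update g i x') y =
      (x - x') * V i y := by
  rw [linComb_sub, linComb, Finset.sum_eq_single i]
  · simp
  · intro j _ hj; simp [Function.update_of_ne hj]
  · simp

theorem IsNoiseData.heat_linComb (hγ : IsNoiseData T e ϰ γ) (g : Fin n → ℝ) (t : ℝ) (x : Plane) :
    heat t (linComb γ g) x = linComb (fun i => heat t (γ i)) g x := by
  obtain ⟨K, hK0, hK⟩ := hγ.exists_bound
  simp only [heat, linComb]
  rw [integral_finsetSum _ fun i _ => ((hK i).integrable le_rfl t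
    (hγ.cont i).stronglyMeasurable x).const_mul _]
  simp_rw [integral_const_mul]

/-- The flow of the reaction–diffusion equation with initial data `∑ g i γ i`. -/
structure IsFlow (T e ℓ : ℝ) (h : ℝ → ℝ → ℝ) {n : ℕ} (γ : Fin n → Plane → ℝ)
    (U : (Fin n → ℝ) → ℝ → Plane → ℝ) : Prop where
  cont : Continuous fun p : (Fin n → ℝ) × ℝ × Plane => U p.1 p.2.1 p.2.2
  lip : ∃ K : ℝ≥0, ∀ s y, LipschitzWith K fun g => U g s y
  odd : ∀ g s y, U (-g) s y = -U g s y
  mild : ∀ g, ∀ t ∈ Icc 0 T, ∀ x,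
    U g t x = heat t (linComb γ g) x - duhamel (fun s y => h s (U g s y)) t x
  stable : ∀ g g', ∀ t ∈ Icc 0 T, ∀ x, |U g t x - U g' t x| ≤
    Real.exp (ℓ * Real.log ((T + e) / e)) * heat t (fun y => |linComb γ g y - linComb γ g' y|) x

/-- For each `g` the equation is solved by the fixed point theorem and then frozen outside `[0, T]`.
The stability estimate has three uses: it is recorded itself, it makes the flow Lipschitz in `g`
uniformly in `(s, y)`, and it gives uniqueness, hence oddness. -/
theorem exists_flow (hR : IsReaction T e ℓ k h h') (hγ : IsNoiseData T e ϰ γ) :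
    ∃ U, IsFlow T e ℓ h γ U := by
  obtain ⟨K, hK0, hK⟩ := hγ.exists_bound
  have hKx : ∀ y i, |γ i y| ≤ K := fun y i => by simpa using hK i y
  have hφb : ∀ g, ExpBound 0 (n * K * ‖g‖) (linComb γ g) := fun g =>
    ExpBound.of_bounded fun y => abs_linComb_le (hKx y) g
  have hex : ∀ g : Fin n → ℝ, ∃ U : ℝ → Plane → ℝ, Continuous (Function.uncurry U) ∧
      (∀ T, ∃ M, ∀ s ≤ T, ∀ y, ‖U s y‖ ≤ M) ∧
      ∀ t, 0 ≤ t → ∀ x, U t x = heat t (linComb γ g) x - duhamel (fun s y => h s (U s y)) t x := by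
    intro g
    have hΛ : 0 ≤ ℓ / e := div_nonneg hR.ℓ_nonneg hR.e_pos.le
    refine exists_mild_solution (h := fun s _ v => h s v) (Λ := ℓ / e)
      (hR.cont.comp (f := fun p : ℝ × Plane × ℝ => (p.1, p.2.2)) (by fun_prop)) hΛ
      (fun s y v v' => (hR.lipschitz s v v').trans
        (mul_le_mul_of_nonneg_right (hR.coeff_le s) (abs_nonneg _))) (fun s y => hR.zero s)
      (hγ.continuous_linComb g) (K := n * K * ‖g‖) fun x => abs_linComb_le (hKx x) g
  choose U0 hUc hUb hUm using hex
  set U : (Fin n → ℝ) → ℝ → Plane → ℝ := fun g s y => U0 g (clampT T s) y with hU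
  have hUc' : ∀ g, Continuous (Function.uncurry (U g)) := fun g =>
    (hUc g).comp (f := fun p : ℝ × Plane => (clampT T p.1, p.2))
      (((continuous_clampT T).comp continuous_fst).prodMk continuous_snd)
  have hUt : ∀ g, ∀ t ∈ Icc 0 T, ∀ x, U g t x = U0 g t x := fun g t ht x => by
    simp only [hU, clampT_of_mem ht]
  have hUm' : ∀ g, ∀ t ∈ Icc 0 T, ∀ x,
      U g t x = heat t (linComb γ g) x - duhamel (fun s y => h s (U g s y)) t x := by
    intro g t ht x
    rw [hUt g t ht x, hUm g t ht.1 x]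
    congr 1
    refine duhamel_congr ht.1 (fun s hs y => ?_) x
    rw [hUt g s ⟨hs.1, hs.2.trans ht.2⟩]
  have hUb' : ∀ g, ∃ M, 0 ≤ M ∧ ∀ s y, |U g s y| ≤ M := fun g => by
    obtain ⟨M, hM⟩ := hUb g T
    exact ⟨max M 0, le_max_right _ _, fun s y =>
      (hM _ (clampT_mem hR.T_nonneg s).2 y).trans (le_max_left _ _)⟩
  have hst : ∀ g g', ∀ t ∈ Icc 0 T, ∀ x, |U g t x - U g' t x| ≤
      Real.exp (ℓ * Real.log ((T + e) / e)) *
        heat t (fun y => |linComb γ g y - linComb γ g' y|) x := by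
    intro g g'
    obtain ⟨M, hM0, hM⟩ := hUb' g
    obtain ⟨M', hM0', hM'⟩ := hUb' g'
    have hle : ∀ {A B : ℝ} {φ : Plane → ℝ}, ExpBound 0 A φ → A ≤ B → ExpBound 0 B φ :=
      fun hA hAB x => (hA x).trans (by simpa using hAB)
    have p1 : 0 ≤ n * K * ‖g‖ := by positivity
    have p2 : 0 ≤ n * K * ‖g'‖ := by positivity
    exact hR.abs_sub_le_heat (a := 0) (K := M + M' + n * K * ‖g‖ + n * K * ‖g'‖) le_rfl
      (hUc' g) (hUc' g')
      (fun s _ => hle (ExpBound.of_bounded fun y => hM s y) (by linarith))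
      (fun s _ => hle (ExpBound.of_bounded fun y => hM' s y) (by linarith))
      (hγ.continuous_linComb g) (hγ.continuous_linComb g')
      (hle (hφb g) (by linarith)) (hle (hφb g') (by linarith)) (hUm' g) (hUm' g')
  have hlip : ∀ s y, LipschitzWith
      (Real.toNNReal (Real.exp (ℓ * Real.log ((T + e) / e)) * (n * K))) fun g => U g s y := by
    intro s y
    refine LipschitzWith.of_dist_le_mul fun g g' => ?_
    rw [Real.coe_toNNReal _ (by positivity), Real.dist_eq, dist_eq_norm]
    have h1 := hst g g' _ (clampT_mem hR.T_nonneg s) y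
    rw [hUt _ _ (clampT_mem hR.T_nonneg s), hUt _ _ (clampT_mem hR.T_nonneg s)] at h1
    refine h1.trans ?_
    rw [mul_assoc]
    refine mul_le_mul_of_nonneg_left ?_ (Real.exp_pos _).le
    refine (le_abs_self _).trans (heat_le_of_le (ExpBound.of_bounded fun y => ?_) _)
    rw [Real.norm_eq_abs, abs_abs, linComb_sub]
    exact abs_linComb_le (hKx y) _
  refine ⟨U, ⟨?_, ⟨_, hlip⟩, ?_, hUm', hst⟩⟩
  -- Joint continuity follows from continuity in `(s, y)` for each `g` and the uniform Lipschitz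
  -- bound in `g`.
  · exact continuous_prod_of_continuous_lipschitzWith
      (fun p : (Fin n → ℝ) × ℝ × Plane => U p.1 p.2.1 p.2.2) _ hUc' fun p => hlip p.1 p.2
  · intro g s y
    have hs := clampT_mem hR.T_nonneg s
    obtain ⟨M, hM0, hM⟩ := hUb' g
    obtain ⟨M', hM0', hM'⟩ := hUb' (-g)
    have hle : ∀ {A B : ℝ} {φ : Plane → ℝ}, ExpBound 0 A φ → A ≤ B → ExpBound 0 B φ :=
      fun hA hAB x => (hA x).trans (by simpa using hAB)
    have p1 : 0 ≤ n * K * ‖-g‖ := by positivity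
    -- Since the reaction is odd, `-U g` solves the equation started from `linComb γ (-g)`.
    -- Stability with equal initial data identifies it with `U (-g)`.
    have h1 := hR.abs_sub_le_heat (a := 0) (K := M + M' + n * K * ‖-g‖) le_rfl
      (z' := fun s y => -U g s y)
      (hUc' (-g)) (hUc' g).neg
      (fun s _ => hle (ExpBound.of_bounded fun y => hM' s y) (by linarith))
      (fun s _ => hle (ExpBound.of_bounded (K := M) fun y => by simpa using hM s y) (by linarith))
      (hγ.continuous_linComb (-g)) (hγ.continuous_linComb (-g))
      (hle (hφb (-g)) (by linarith)) (hle (hφb (-g)) (by linarith)) (hUm' (-g))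
      (fun t ht x => by
        rw [hUm' g t ht x, hγ.heat_linComb, hγ.heat_linComb, linComb_neg]
        simp only [hR.odd]
        simp only [duhamel, integral_neg, smul_neg]
        ring) _ hs y
    simp only [sub_self, abs_zero, heat_const, mul_zero] at h1
    rw [hUt _ _ hs, hUt _ _ hs] at h1
    have := abs_nonpos_iff.1 h1
    simp only [hU]
    linarith

/-- The coefficient `E h'(s, ∑ g i V i)` of the mean field equation. -/
def meanCoeff (h' : ℝ → ℝ → ℝ) {n : ℕ} (V : Fin n → ℝ → Plane → ℝ) (s : ℝ) (y : Plane) : ℝ :=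
  ∫ g, h' s (linComb (fun i => V i s) g y) ∂(gaussN n)

/-- The profiles of the solution `∑ g i V i` of the mean field equation. -/
structure IsMeanField (T e ℓ : ℝ) (h' : ℝ → ℝ → ℝ) {n : ℕ} (γ : Fin n → Plane → ℝ)
    (V : Fin n → ℝ → Plane → ℝ) : Prop where
  cont : ∀ i, Continuous (Function.uncurry (V i))
  bdd : ∃ K, 0 ≤ K ∧ ∀ i s y, |V i s y| ≤ K
  le : ∀ i, ∀ t ∈ Icc 0 T, ∀ x,
    |V i t x| ≤ Real.exp (ℓ * Real.log ((T + e) / e)) * heat t (γ i) x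
  mild : ∀ i, ∀ t ∈ Icc 0 T, ∀ x, V i t x =
    heat t (γ i) x - duhamel (fun s y => meanCoeff h' V s y * V i s y) t x

/-- The average `E h'(s, ∑ g i v i)`. -/
def gaussAverage (h' : ℝ → ℝ → ℝ) {n : ℕ} (s : ℝ) (v : Fin n → ℝ) : ℝ :=
  ∫ g, h' s (∑ i, g i * v i) ∂(gaussN n)

theorem meanCoeff_eq (h' : ℝ → ℝ → ℝ) (V : Fin n → ℝ → Plane → ℝ) (s : ℝ) (y : Plane) :
    meanCoeff h' V s y = gaussAverage h' s fun i => V i s y := rfl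

theorem IsReaction.continuous_gaussAverage (hR : IsReaction T e ℓ k h h') :
    Continuous fun p : ℝ × (Fin n → ℝ) => gaussAverage h' p.1 p.2 := by
  unfold gaussAverage
  refine continuous_of_dominated (bound := fun _ => ℓ / e) (fun p => ?_)
    (fun p => Eventually.of_forall fun g => (hR.bound _ _).trans (hR.coeff_le _))
    (integrable_const _) (Eventually.of_forall fun g => ?_)
  · exact (hR.cont'.comp (f := fun g : Fin n → ℝ => (p.1, ∑ i, g i * p.2 i))
      (by fun_prop)).aestronglyMeasurable
  · exact hR.cont'.comp (f := fun p : ℝ × (Fin n → ℝ) => (p.1, ∑ i, g i * p.2 i)) (by fun_prop)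

theorem IsReaction.integrable_deriv_comp (hR : IsReaction T e ℓ k h h') (s : ℝ)
    {α : Type*} [MeasurableSpace α] {μ : Measure α} [IsFiniteMeasure μ] {A : α → ℝ}
    (hA : AEStronglyMeasurable A μ) : Integrable (fun g => h' s (A g)) μ := by
  have hc : Continuous (h' s) := hR.cont'.comp (f := fun u => (s, u)) (by fun_prop)
  exact (integrable_const (ℓ / rad T e s)).mono' (hc.comp_aestronglyMeasurable hA)
    (Eventually.of_forall fun g => hR.bound s _)

theorem IsReaction.abs_gaussAverage_le (hR : IsReaction T e ℓ k h h') (s : ℝ) (v : Fin n → ℝ) :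
    |gaussAverage h' s v| ≤ ℓ / rad T e s := by
  have := norm_integral_le_of_norm_le_const (μ := gaussN n) (C := ℓ / rad T e s)
    (f := fun g => h' s (∑ i, g i * v i)) (Eventually.of_forall fun g => hR.bound s _)
  simpa [gaussAverage] using this

/-- Only the existence of the mean field profiles uses this bound, so a constant depending on `n` is
harmless. -/
theorem IsReaction.abs_gaussAverage_sub_le (hR : IsReaction T e ℓ k h h') (s : ℝ)
    (v v' : Fin n → ℝ) :
    |gaussAverage h' s v - gaussAverage h' s v'| ≤ k / √e * n * ‖v - v'‖ := by
  have hi : ∀ v : Fin n → ℝ, Integrable (fun g => h' s (∑ i, g i * v i)) (gaussN n) := fun v =>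
    hR.integrable_deriv_comp s (by fun_prop : Continuous _).aestronglyMeasurable
  have hk : 0 ≤ k / √e := div_nonneg hR.k_nonneg (Real.sqrt_nonneg _)
  rw [gaussAverage, gaussAverage, ← integral_sub (hi v) (hi v')]
  refine (abs_integral_le_integral_abs).trans ?_
  have hb : Integrable (fun g : Fin n → ℝ => k / √e * (‖v - v'‖ * ∑ i, |g i|)) (gaussN n) :=
    ((integrable_finsetSum _ fun i _ => (integrable_eval i).abs).const_mul _).const_mul _
  calc _ ≤ ∫ g : Fin n → ℝ, k / √e * (‖v - v'‖ * ∑ i, |g i|) ∂(gaussN n) := by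
        refine integral_mono ((hi v).sub (hi v')).abs hb fun g => ?_
        refine (hR.lip s _ _).trans (mul_le_mul (hR.klip_le s) ?_ (abs_nonneg _) hk)
        rw [← Finset.sum_sub_distrib, Finset.mul_sum]
        refine (Finset.abs_sum_le_sum_abs _ _).trans (Finset.sum_le_sum fun i _ => ?_)
        rw [← mul_sub, abs_mul, mul_comm]
        exact mul_le_mul_of_nonneg_right (norm_le_pi_norm (v - v') i) (abs_nonneg _)
    _ = k / √e * (‖v - v'‖ * ∑ i, ∫ g : Fin n → ℝ, |g i| ∂(gaussN n)) := by
        rw [integral_const_mul, integral_const_mul,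
          integral_finsetSum _ fun i _ => (integrable_eval i).abs]
    _ ≤ k / √e * (‖v - v'‖ * ∑ _ : Fin n, 1) := by
        gcongr with i
        exact integral_abs_eval_le i
    _ = _ := by simp; ring

theorem heat_apply {φ : Plane → Fin n → ℝ} {K : ℝ} (hφ : Continuous φ) (hb : ExpBound 0 K φ)
    (t : ℝ) (x : Plane) (i : Fin n) : heat t φ x i = heat t (fun y => φ y i) x := by
  have := hb.integrable le_rfl t hφ.stronglyMeasurable x
  exact ((ContinuousLinearMap.proj (R := ℝ) (φ := fun _ : Fin n => ℝ) i).integral_comp_comm this).symm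

theorem duhamel_apply {H : ℝ → Plane → Fin n → ℝ} {K t : ℝ} (ht : 0 ≤ t)
    (hm : Continuous (Function.uncurry H))
    (hH : ∀ s ∈ Icc 0 t, ExpBound 0 K (H s)) (x : Plane) (i : Fin n) :
    duhamel H t x i = duhamel (fun s y => H s y i) t x := by
  have := integrable_duhamel ht le_rfl hm.stronglyMeasurable hH x
  rw [duhamel, duhamel, Pi.smul_apply]
  congr 1
  exact ((ContinuousLinearMap.proj (R := ℝ) (φ := fun _ : Fin n => ℝ) i).integral_comp_comm this).symm

/-- The profiles solve a coupled system in `ℝⁿ` with nonlinearity `E h'(∑ g_j v_j) v_i`, which is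
only locally Lipschitz. It is truncated at a level that the a priori bound by `ρ P_tγ_i` never
exceeds, and that bound holds for the truncated system because the coefficient is bounded whatever
its argument. -/
theorem exists_meanField (hR : IsReaction T e ℓ k h h') (hγ : IsNoiseData T e ϰ γ) :
    ∃ V, IsMeanField T e ℓ h' γ V := by
  obtain ⟨K, hK0, hK⟩ := hγ.exists_bound
  set ρ := Real.exp (ℓ * Real.log ((T + e) / e)) with hρ
  have hρ0 : 0 < ρ := Real.exp_pos _
  set M := ρ * K with hM
  have hM0 : 0 ≤ M := by positivity
  have hℓe : 0 ≤ ℓ / e := div_nonneg hR.ℓ_nonneg hR.e_pos.le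
  have hk : 0 ≤ k / √e := div_nonneg hR.k_nonneg (Real.sqrt_nonneg _)
  -- The truncation at `M = ρK`, where `K` bounds the profiles `γ i`. It is 1-Lipschitz and does not
  -- increase absolute values, so the linear Gronwall bound survives it.
  let cl : ℝ → ℝ := fun x => max (min x M) (-M)
  have hclc : Continuous cl := by fun_prop
  have hcl1 : ∀ x x', |cl x - cl x'| ≤ |x - x'| := fun x x' => by
    refine (abs_max_sub_max_le_abs _ _ _).trans ?_
    simpa using abs_min_sub_min_le_max x M x' M
  have hcl0 : cl 0 = 0 := by simp [cl, hM0]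
  have hcl2 : ∀ x, |cl x| ≤ |x| := fun x => by simpa [hcl0] using hcl1 x 0
  have hcl3 : ∀ x, |cl x| ≤ M := fun x =>
    _root_.abs_le.2 ⟨le_max_right _ _, max_le (min_le_right _ _) (by linarith)⟩
  have hcl4 : ∀ x, |x| ≤ M → cl x = x := fun x hx => by
    have := _root_.abs_le.1 hx
    simp only [cl]
    rw [min_eq_left this.2, max_eq_left this.1]
  let N : ℝ → Plane → (Fin n → ℝ) → (Fin n → ℝ) := fun s _ v i => gaussAverage h' s v * cl (v i)
  have hga := hR.continuous_gaussAverage (n := n)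
  have hNc : Continuous fun p : ℝ × Plane × (Fin n → ℝ) => N p.1 p.2.1 p.2.2 := by
    refine continuous_pi fun i => ?_
    exact (hga.comp (f := fun p : ℝ × Plane × (Fin n → ℝ) => (p.1, p.2.2)) (by fun_prop)).mul
      (hclc.comp (by fun_prop))
  have hφc : Continuous fun y : Plane => fun i => γ i y := continuous_pi hγ.cont
  have hφb : ∀ y : Plane, ‖fun i => γ i y‖ ≤ K := fun y => by
    rw [pi_norm_le_iff_of_nonneg hK0]
    intro i
    simpa using hK i y
  obtain ⟨V0, hVc, hVb, hVm⟩ := exists_mild_solution (h := N) (Λ := ℓ / e + k / √e * n * M)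
    hNc (by positivity) (fun s y v v' => by
      rw [pi_norm_le_iff_of_nonneg (by positivity)]
      intro i
      simp only [N, Pi.sub_apply, Real.norm_eq_abs]
      have e1 : gaussAverage h' s v * cl (v i) - gaussAverage h' s v' * cl (v' i) =
        gaussAverage h' s v * (cl (v i) - cl (v' i)) +
          (gaussAverage h' s v - gaussAverage h' s v') * cl (v' i) := by ring
      rw [e1, add_mul]
      refine (abs_add_le _ _).trans (add_le_add ?_ ?_)
      · rw [abs_mul]
        exact mul_le_mul ((hR.abs_gaussAverage_le s v).trans (hR.coeff_le s))
          ((hcl1 _ _).trans (norm_le_pi_norm (v - v') i)) (abs_nonneg _) hℓe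
      · rw [abs_mul, mul_right_comm]
        exact mul_le_mul (hR.abs_gaussAverage_sub_le s v v') (hcl3 _) (abs_nonneg _) (by positivity))
    (fun s y => by ext i; simp [N, hcl0]) hφc hφb
  obtain ⟨B, hB⟩ := hVb T
  have hVmi : ∀ i, ∀ t ∈ Icc 0 T, ∀ x, V0 t x i = heat t (γ i) x -
      duhamel (fun s y => gaussAverage h' s (V0 s y) * cl (V0 s y i)) t x := by
    intro i t ht x
    rw [hVm t ht.1 x, Pi.sub_apply, heat_apply hφc (ExpBound.of_bounded hφb),
      duhamel_apply (K := ℓ / e * M) ht.1]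
    · exact hNc.comp (f := fun p : ℝ × Plane => (p.1, p.2, V0 p.1 p.2))
        (continuous_fst.prodMk (continuous_snd.prodMk hVc))
    · intro s _
      refine ExpBound.of_bounded fun y => ?_
      rw [pi_norm_le_iff_of_nonneg (by positivity)]
      intro j
      simp only [N, norm_mul, Real.norm_eq_abs]
      exact mul_le_mul ((hR.abs_gaussAverage_le s _).trans (hR.coeff_le s)) (hcl3 _)
        (abs_nonneg _) hℓe
  have hVle : ∀ i, ∀ t ∈ Icc 0 T, ∀ x, |V0 t x i| ≤ ρ * heat t (γ i) x := by
    intro i t ht x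
    have := le_exp_mul_heat_of_le_duhamel (T := T) (K := B) le_rfl
      (continuous_div_rad hR.T_nonneg hR.e_pos ℓ) hR.coeff_nonneg
      (D := fun t x => |V0 t x i|)
      (fun s hs => ExpBound.of_bounded fun y => by
        simpa using (norm_le_pi_norm (V0 s y) i).trans (hB s hs.2 y))
      (hK i) (hγ.cont i) (hγ.nonneg i)
      (G := fun s y => gaussAverage h' s (V0 s y) * cl (V0 s y i))
      (fun s _ y => by
        rw [norm_mul]
        exact mul_le_mul (hR.abs_gaussAverage_le s _) (hcl2 _) (abs_nonneg _) (hR.coeff_nonneg s))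
      (fun t ht x => by
        rw [hVmi i t ht x]
        refine (abs_sub _ _).trans (add_le_add ?_ le_rfl)
        rw [abs_of_nonneg (hγ.heat_nonneg i t x)]) t ht x
    refine this.trans (mul_le_mul_of_nonneg_right (hR.exp_integral_coeff_le ht)
      (hγ.heat_nonneg i t x))
  -- The solution stays in the range where the truncation is the identity, so it solves the original
  -- system.
  have hVM : ∀ i, ∀ t ∈ Icc 0 T, ∀ x, |V0 t x i| ≤ M := fun i t ht x =>
    (hVle i t ht x).trans (mul_le_mul_of_nonneg_left
      ((le_abs_self _).trans (heat_le_of_le (hK i) x)) hρ0.le)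
  refine ⟨fun i s y => V0 (clampT T s) y i, fun i => ?_, ⟨M, hM0, fun i s y =>
    hVM i _ (clampT_mem hR.T_nonneg s) y⟩, fun i t ht x => ?_, fun i t ht x => ?_⟩
  · exact (continuous_apply i).comp (hVc.comp (f := fun p : ℝ × Plane => (clampT T p.1, p.2))
      (((continuous_clampT T).comp continuous_fst).prodMk continuous_snd))
  · simp only [clampT_of_mem ht]
    exact hVle i t ht x
  · simp only [clampT_of_mem ht]
    rw [hVmi i t ht x]
    congr 1
    refine duhamel_congr ht.1 (fun s hs y => ?_) x
    have hs' : s ∈ Icc 0 T := ⟨hs.1, hs.2.trans ht.2⟩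
    rw [hcl4 _ (hVM i s hs' y), meanCoeff_eq]
    simp only [clampT_of_mem hs']

end

section
/-! ### Duhamel integrals of bounded continuous functions -/

/-- `H` is continuous and bounded. -/
def IsBC (H : ℝ → Plane → ℝ) : Prop :=
  Continuous (Function.uncurry H) ∧ ∃ K, ∀ s y, |H s y| ≤ K

namespace IsBC

variable {H H' : ℝ → Plane → ℝ}

theorem sub (h : IsBC H) (h' : IsBC H') : IsBC fun s y => H s y - H' s y := by
  obtain ⟨K, hK⟩ := h.2
  obtain ⟨K', hK'⟩ := h'.2
  exact ⟨h.1.sub h'.1, K + K', fun s y => (abs_sub _ _).trans (add_le_add (hK s y) (hK' s y))⟩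

theorem mul (h : IsBC H) (h' : IsBC H') : IsBC fun s y => H s y * H' s y := by
  obtain ⟨K, hK⟩ := h.2
  obtain ⟨K', hK'⟩ := h'.2
  refine ⟨h.1.mul h'.1, K * K', fun s y => ?_⟩
  rw [abs_mul]
  exact mul_le_mul (hK s y) (hK' s y) (abs_nonneg _) ((abs_nonneg _).trans (hK s y))

theorem const_mul (h : IsBC H) (c : ℝ) : IsBC fun s y => c * H s y :=
  IsBC.mul (H := fun _ _ => c) ⟨continuous_const, |c|, fun _ _ => le_rfl⟩ h

theorem sum {ι : Type*} [Fintype ι] {H : ι → ℝ → Plane → ℝ} (h : ∀ i, IsBC (H i)) :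
    IsBC fun s y => ∑ i, H i s y := by
  choose hc K hK using h
  exact ⟨continuous_finsetSum _ fun i _ => hc i, ∑ i, K i, fun s y =>
    (Finset.abs_sum_le_sum_abs _ _).trans (Finset.sum_le_sum fun i _ => hK i s y)⟩

theorem integrable (h : IsBC H) (t : ℝ) (x : Plane) :
    Integrable (fun p : ℝ × Plane => H (t * p.1) (x + √(t * (1 - p.1)) • p.2)) stM := by
  obtain ⟨K, hK⟩ := h.2
  refine (integrable_const K).mono' ?_ (Eventually.of_forall fun p => hK _ _)
  exact (h.1.comp (f := fun p : ℝ × Plane => (t * p.1, x + √(t * (1 - p.1)) • p.2))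
    (by fun_prop)).aestronglyMeasurable

theorem duhamel_add (h : IsBC H) (h' : IsBC H') (t : ℝ) (x : Plane) :
    duhamel (fun s y => H s y + H' s y) t x = duhamel H t x + duhamel H' t x := by
  simp only [duhamel]
  rw [← smul_add, ← integral_add (h.integrable t x) (h'.integrable t x)]

theorem duhamel_sub (h : IsBC H) (h' : IsBC H') (t : ℝ) (x : Plane) :
    duhamel (fun s y => H s y - H' s y) t x = duhamel H t x - duhamel H' t x := by
  simp only [duhamel]
  rw [← smul_sub, ← integral_sub (h.integrable t x) (h'.integrable t x)]

theorem duhamel_sum {ι : Type*} [Fintype ι] {H : ι → ℝ → Plane → ℝ} (h : ∀ i, IsBC (H i))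
    (t : ℝ) (x : Plane) : duhamel (fun s y => ∑ i, H i s y) t x = ∑ i, duhamel (H i) t x := by
  simp only [duhamel]
  rw [integral_finsetSum _ fun i _ => (h i).integrable t x, Finset.smul_sum]

end IsBC

/-- Minkowski's inequality for the Duhamel integral. -/
theorem eLpNorm_duhamel_le {β : Type*} [MeasurableSpace β] {ν : Measure β} [SFinite ν]
    {A : ℝ → Plane → β → ℝ} {c : ℝ → ℝ} (hc : Continuous c) {ψ : Plane → ℝ} {a K t : ℝ}
    (ha : 0 ≤ a) (hψ : ExpBound a K ψ) (hψc : Continuous ψ) (hψ0 : ∀ x, 0 ≤ ψ x) (ht : 0 ≤ t)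
    {x : Plane} (hc0 : ∀ s ∈ Icc 0 t, 0 ≤ c s)
    (hA : AEStronglyMeasurable (fun q : (ℝ × Plane) × β =>
      A (t * q.1.1) (x + √(t * (1 - q.1.1)) • q.1.2) q.2) (stM.prod ν))
    (h : ∀ s ∈ Icc 0 t, ∀ y, eLpNorm (A s y) 2 ν ≤ ENNReal.ofReal (c s * heat s ψ y)) :
    eLpNorm (fun g => duhamel (fun s y => A s y g) t x) 2 ν ≤
      ENNReal.ofReal ((∫ s in 0..t, c s) * heat t ψ x) := by
  have hi := integrable_duhamel_mul_heat hc ha hψ hψc ht x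
  have h1 := eLpNorm_integral_le (π := stM) (ν := ν)
    (X := fun p g => A (t * p.1) (x + √(t * (1 - p.1)) • p.2) g) hA hi
    (by
      filter_upwards [ae_stM_fst] with p hp
      exact mul_nonneg (hc0 _ (mul_mem_Icc_of_mem_Ioc ht hp)) (heat_nonneg hψ0 _))
    (by
      filter_upwards [ae_stM_fst] with p hp
      exact h _ (mul_mem_Icc_of_mem_Ioc ht hp) _)
  have h2 := eLpNorm_const_mul_le_ofReal t h1
  rw [← duhamel_mul_heat hc ha hψ hψc ht x, duhamel, smul_eq_mul]
  rw [abs_of_nonneg ht] at h2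
  exact h2

/-- An explicit antiderivative is `(2 / √r) arctan(√(s + e) / √r)`. This Hilbert-type kernel lets
one of the two time integrations over correlations be carried out without producing a logarithm. -/
theorem integral_inv_sqrt_mul_inv_add_le {T e t r : ℝ} (he : 0 < e) (ht : t ∈ Icc 0 T)
    (hr : 0 < r) :
    ∫ s in 0..t, (√(rad T e s))⁻¹ * (r + rad T e s)⁻¹ ≤ Real.pi / √r := by
  have h1 : ∫ s in 0..t, (√(rad T e s))⁻¹ * (r + rad T e s)⁻¹ =
      ∫ s in 0..t, (√(s + e))⁻¹ * (r + (s + e))⁻¹ := by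
    refine intervalIntegral.integral_congr fun s hs => ?_
    rw [uIcc_of_le ht.1] at hs
    simp only [rad_of_mem ⟨hs.1, hs.2.trans ht.2⟩]
  have hpos : ∀ s ∈ uIcc 0 t, 0 < s + e := fun s hs => by
    rw [uIcc_of_le ht.1] at hs
    linarith [hs.1]
  have hsr := Real.sqrt_pos.2 hr
  have hd : ∀ s ∈ uIcc 0 t, HasDerivAt (fun s => 2 / √r * Real.arctan (√(s + e) / √r))
      ((√(s + e))⁻¹ * (r + (s + e))⁻¹) s := by
    intro s hs
    have hp := hpos s hs
    have hsp := Real.sqrt_pos.2 hp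
    have h2 := ((((hasDerivAt_id s).add_const e).sqrt hp.ne').div_const (√r)).arctan.const_mul
      (2 / √r)
    refine h2.congr_deriv ?_
    simp only [id, div_pow, Real.sq_sqrt hp.le, Real.sq_sqrt hr.le]
    field_simp
    rw [Real.sq_sqrt hr.le]
  rw [h1, intervalIntegral.integral_eq_sub_of_hasDerivAt hd]
  · have h3 := (Real.arctan_lt_pi_div_two (√(t + e) / √r)).le
    have h4 : 0 ≤ Real.arctan (√(0 + e) / √r) := Real.arctan_nonneg.2 (by positivity)
    have h5 : 0 ≤ 2 / √r := by positivity
    calc _ ≤ 2 / √r * (Real.pi / 2) - 2 / √r * 0 := by gcongr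
      _ = _ := by ring
  · refine ContinuousOn.intervalIntegrable fun s hs => ?_
    have hp := hpos s hs
    have hsp := Real.sqrt_pos.2 hp
    refine ContinuousAt.continuousWithinAt ?_
    refine ContinuousAt.mul (ContinuousAt.inv₀ (by fun_prop) hsp.ne')
      (ContinuousAt.inv₀ (by fun_prop) (by positivity))

end

section
variable {T e ℓ k ϰ : ℝ} {h h' : ℝ → ℝ → ℝ} {n : ℕ} {γ : Fin n → Plane → ℝ}
  {U : (Fin n → ℝ) → ℝ → Plane → ℝ} {V : Fin n → ℝ → Plane → ℝ}

/-! ### The flow and the mean field as functions of the noise -/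

theorem IsFlow.isBC (hU : IsFlow T e ℓ h γ U) (g : Fin n → ℝ) : IsBC (U g) := by
  obtain ⟨K, hK⟩ := hU.lip
  refine ⟨hU.cont.comp (f := fun p : ℝ × Plane => (g, p.1, p.2)) (by fun_prop), K * ‖g‖,
    fun s y => ?_⟩
  have h0 : U 0 s y = 0 := by
    have := hU.odd 0 s y
    rw [neg_zero] at this
    linarith
  have := (hK s y).dist_le_mul g 0
  rwa [h0, dist_zero_right, dist_zero_right, Real.norm_eq_abs] at this

theorem IsReaction.isBC_comp (hR : IsReaction T e ℓ k h h') {z : ℝ → Plane → ℝ} (hz : IsBC z) :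
    IsBC fun s y => h s (z s y) := by
  obtain ⟨K, hK⟩ := hz.2
  refine ⟨hR.cont.comp (f := fun p : ℝ × Plane => (p.1, z p.1 p.2)) (continuous_fst.prodMk hz.1),
    ℓ / e * K, fun s y => (hR.abs_le s _).trans (mul_le_mul (hR.coeff_le s) (hK s y) (abs_nonneg _)
      (div_nonneg hR.ℓ_nonneg hR.e_pos.le))⟩

theorem IsReaction.isBC_deriv_comp (hR : IsReaction T e ℓ k h h') {z : ℝ → Plane → ℝ}
    (hz : IsBC z) : IsBC fun s y => h' s (z s y) :=
  ⟨hR.cont'.comp (f := fun p : ℝ × Plane => (p.1, z p.1 p.2)) (continuous_fst.prodMk hz.1),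
    ℓ / e, fun s _ => (hR.bound s _).trans (hR.coeff_le s)⟩

theorem IsMeanField.isBC (hV : IsMeanField T e ℓ h' γ V) (i : Fin n) : IsBC (V i) := by
  obtain ⟨K, _, hK⟩ := hV.bdd
  exact ⟨hV.cont i, K, hK i⟩

theorem IsMeanField.isBC_linComb (hV : IsMeanField T e ℓ h' γ V) (g : Fin n → ℝ) :
    IsBC fun s y => linComb (fun i => V i s) g y :=
  IsBC.sum fun i => (hV.isBC i).const_mul (g i)

theorem IsMeanField.continuous_linComb (hV : IsMeanField T e ℓ h' γ V) :
    Continuous fun p : (Fin n → ℝ) × ℝ × Plane => linComb (fun i => V i p.2.1) p.1 p.2.2 := by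
  refine continuous_finsetSum _ fun i _ => ?_
  exact ((continuous_apply i).comp continuous_fst).mul ((hV.cont i).comp continuous_snd)

theorem IsMeanField.lipschitz_linComb (hV : IsMeanField T e ℓ h' γ V) :
    ∃ K : ℝ≥0, ∀ s y, LipschitzWith K fun g => linComb (fun i => V i s) g y := by
  obtain ⟨K, hK0, hK⟩ := hV.bdd
  refine ⟨Real.toNNReal (n * K), fun s y => LipschitzWith.of_dist_le_mul fun g g' => ?_⟩
  rw [Real.coe_toNNReal _ (by positivity), Real.dist_eq, linComb_sub, dist_eq_norm]
  exact abs_linComb_le (fun i => hK i s y) _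

theorem isBC_meanCoeff (hR : IsReaction T e ℓ k h h') (hV : IsMeanField T e ℓ h' γ V) :
    IsBC (meanCoeff h' V) := by
  refine ⟨(hR.continuous_gaussAverage (n := n)).comp
    (f := fun p : ℝ × Plane => (p.1, fun i => V i p.1 p.2))
    (continuous_fst.prodMk (continuous_pi fun i => hV.cont i)), ℓ / e, fun s y =>
    (hR.abs_gaussAverage_le s _).trans (hR.coeff_le s)⟩

theorem IsMeanField.mild_linComb (hR : IsReaction T e ℓ k h h') (hγ : IsNoiseData T e ϰ γ)
    (hV : IsMeanField T e ℓ h' γ V) (g : Fin n → ℝ) {t : ℝ} (ht : t ∈ Icc 0 T) (x : Plane) :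
    linComb (fun i => V i t) g x = heat t (linComb γ g) x -
      duhamel (fun s y => meanCoeff h' V s y * linComb (fun i => V i s) g y) t x := by
  have e1 : (fun s y => meanCoeff h' V s y * linComb (fun i => V i s) g y) =
      fun s y => ∑ i, g i * (meanCoeff h' V s y * V i s y) := by
    ext s y
    rw [linComb, Finset.mul_sum]
    exact Finset.sum_congr rfl fun i _ => by ring
  rw [e1, IsBC.duhamel_sum fun i => ((isBC_meanCoeff hR hV).mul (hV.isBC i)).const_mul (g i),
    hγ.heat_linComb, linComb, linComb, ← Finset.sum_sub_distrib]
  refine Finset.sum_congr rfl fun i _ => ?_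
  rw [hV.mild i t ht x, duhamel_const_mul]
  ring

/-- The difference between the flow and the mean field solution. -/
def gap (U : (Fin n → ℝ) → ℝ → Plane → ℝ) (V : Fin n → ℝ → Plane → ℝ) (t : ℝ) (x : Plane)
    (g : Fin n → ℝ) : ℝ := U g t x - linComb (fun i => V i t) g x

/-- The increment of the difference when the `i`-th noise variable is switched off. -/
def gapDiff (U : (Fin n → ℝ) → ℝ → Plane → ℝ) (V : Fin n → ℝ → Plane → ℝ) (i : Fin n) (t : ℝ)
    (x : Plane) (g : Fin n → ℝ) : ℝ := gap U V t x g - gap U V t x (Function.update g i 0)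

theorem exists_lipschitz_gap (hU : IsFlow T e ℓ h γ U) (hV : IsMeanField T e ℓ h' γ V) :
    ∃ K : ℝ≥0, ∀ s y, LipschitzWith K (gap U V s y) := by
  obtain ⟨K, hK⟩ := hU.lip
  obtain ⟨K', hK'⟩ := hV.lipschitz_linComb
  exact ⟨K + K', fun s y => (hK s y).sub (hK' s y)⟩

theorem memLp_gapDiff (hU : IsFlow T e ℓ h γ U) (hV : IsMeanField T e ℓ h' γ V) (i : Fin n) (t : ℝ)
    (x : Plane) : MemLp (gapDiff U V i t x) 2 (gaussN n) := by
  obtain ⟨K, hK⟩ := exists_lipschitz_gap hU hV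
  exact ((hK t x).sub_update i).memLp_gaussN

theorem continuous_update_zero (i : Fin n) :
    Continuous fun g : Fin n → ℝ => Function.update g i 0 := (lipschitz_update i).continuous

/-- The remainder terms in the equation of `gapDiff`. -/
def gapRem (h h' : ℝ → ℝ → ℝ) (U : (Fin n → ℝ) → ℝ → Plane → ℝ) (V : Fin n → ℝ → Plane → ℝ)
    (i : Fin n) (s : ℝ) (y : Plane) (g : Fin n → ℝ) : ℝ :=
  h s (U g s y) - h s (U (Function.update g i 0) s y) -
    h' s (linComb (fun j => V j s) (Function.update g i 0) y) * (g i * V i s y)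

/-- The fluctuation of the linearised coefficient around its mean. -/
def coeffFluct (h' : ℝ → ℝ → ℝ) (V : Fin n → ℝ → Plane → ℝ) (i : Fin n) (s : ℝ) (y : Plane)
    (g : Fin n → ℝ) : ℝ :=
  h' s (linComb (fun j => V j s) (Function.update g i 0) y) - meanCoeff h' V s y

/-- The Duhamel formulas with `g_i` on and off are subtracted. Switching off `g_i` changes the mean
field solution by exactly `g_i V_i`. Adding and subtracting `h'(∑_{j≠i} g_j V_j) g_i V_i` separates
a remainder, which compares `h` with its linearisation, from a fluctuation term in which `g_i`
multiplies a quantity independent of it. -/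
theorem gapDiff_eq (hR : IsReaction T e ℓ k h h') (hγ : IsNoiseData T e ϰ γ)
    (hU : IsFlow T e ℓ h γ U) (hV : IsMeanField T e ℓ h' γ V) (i : Fin n) {t : ℝ}
    (ht : t ∈ Icc 0 T) (x : Plane) (g : Fin n → ℝ) :
    gapDiff U V i t x g = -(duhamel (fun s y => gapRem h h' U V i s y g) t x +
      g i * duhamel (fun s y => V i s y * coeffFluct h' V i s y g) t x) := by
  set g₀ := Function.update g i 0 with hg₀
  have b1 := hR.isBC_comp (hU.isBC g)
  have b2 := hR.isBC_comp (hU.isBC g₀)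
  have ba := isBC_meanCoeff hR hV
  have b3 := ba.mul (hV.isBC_linComb g)
  have b4 := ba.mul (hV.isBC_linComb g₀)
  have bh := hR.isBC_deriv_comp (hV.isBC_linComb g₀)
  have b5 : IsBC fun s y => gapRem h h' U V i s y g :=
    (b1.sub b2).sub (bh.mul ((hV.isBC i).const_mul (g i)))
  have b6 : IsBC fun s y => V i s y * coeffFluct h' V i s y g := (hV.isBC i).mul (bh.sub ba)
  rw [← duhamel_const_mul, ← b5.duhamel_add (b6.const_mul _)]
  have e2 : duhamel (fun s y => gapRem h h' U V i s y g +
      g i * (V i s y * coeffFluct h' V i s y g)) t x =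
      duhamel (fun s y => (h s (U g s y) - h s (U g₀ s y)) -
        (meanCoeff h' V s y * linComb (fun i => V i s) g y -
          meanCoeff h' V s y * linComb (fun i => V i s) g₀ y)) t x := by
    refine duhamel_congr ht.1 (fun s _ y => ?_) x
    rw [← mul_sub, linComb_sub_update, gapRem, coeffFluct]
    ring
  rw [e2, (b1.sub b2).duhamel_sub (b3.sub b4), b1.duhamel_sub b2, b3.duhamel_sub b4, gapDiff, gap,
    gap, hU.mild g t ht x, hU.mild g₀ t ht x, hV.mild_linComb hR hγ g ht x,
    hV.mild_linComb hR hγ g₀ ht x]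
  ring

/-- The increment of `h` along the mean field solution is inserted. `abs_second_diff_le` gives the
term linear in the unknown and the cross term; `abs_taylor_le` gives the diagonal term in `g_i²`. In
the cross term the gap is taken with `g_i` off, so it is independent of the factor `g_i`. -/
theorem abs_gapRem_le (hR : IsReaction T e ℓ k h h') (i : Fin n) (s : ℝ) (y : Plane)
    (g : Fin n → ℝ) :
    |gapRem h h' U V i s y g| ≤ ℓ / rad T e s * |gapDiff U V i s y g| +
      k / √(rad T e s) * |V i s y| * |g i * gap U V s y (Function.update g i 0)| +
      k / √(rad T e s) * |V i s y| ^ 2 * |g i ^ 2| := by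
  set g₀ := Function.update g i 0 with hg₀
  have h1 := hR.abs_second_diff_le s (U g s y) (U g₀ s y) (linComb (fun j => V j s) g y)
    (linComb (fun j => V j s) g₀ y)
  have h2 := hR.abs_taylor_le s (linComb (fun j => V j s) g y) (linComb (fun j => V j s) g₀ y)
  rw [linComb_sub_update] at h1 h2
  have e1 : gapRem h h' U V i s y g = (h s (U g s y) - h s (U g₀ s y) -
      (h s (linComb (fun j => V j s) g y) - h s (linComb (fun j => V j s) g₀ y))) +
      (h s (linComb (fun j => V j s) g y) - h s (linComb (fun j => V j s) g₀ y) -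
        h' s (linComb (fun j => V j s) g₀ y) * (g i * V i s y)) := by
    rw [gapRem]; ring
  rw [e1]
  refine (abs_add_le _ _).trans ((add_le_add h1 h2).trans_eq ?_)
  simp only [gapDiff, gap, abs_mul, abs_pow]
  ring

/-! ### Correlations of the fluctuating coefficient -/

theorem lipschitz_coeff (hR : IsReaction T e ℓ k h h') (hV : IsMeanField T e ℓ h' γ V) (i : Fin n)
    (s : ℝ) (y : Plane) : ∃ K : ℝ≥0, LipschitzWith K fun g =>
      h' s (linComb (fun j => V j s) (Function.update g i 0) y) := by
  obtain ⟨K, hK⟩ := hV.lipschitz_linComb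
  have h1 : LipschitzWith (Real.toNNReal (k / √(rad T e s))) (h' s) :=
    LipschitzWith.of_dist_le_mul fun u v => by
      rw [Real.coe_toNNReal _ (hR.klip_nonneg s), Real.dist_eq, Real.dist_eq]
      exact hR.lip s u v
  exact ⟨_, h1.comp ((hK s y).comp (lipschitz_update i))⟩

/-- These coordinatewise Lipschitz constants enter the covariance inequality. They are proportional
to `P_sγ_j(y)`, so their products sum to the space-time covariance of the noise. -/
theorem abs_coeff_update_le (hR : IsReaction T e ℓ k h h') (hV : IsMeanField T e ℓ h' γ V)
    (i : Fin n) {s : ℝ} (hs : s ∈ Icc 0 T) (y : Plane) (j : Fin n) (g : Fin n → ℝ) (x x' : ℝ) :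
    |h' s (linComb (fun j => V j s) (Function.update (Function.update g j x) i 0) y) -
      h' s (linComb (fun j => V j s) (Function.update (Function.update g j x') i 0) y)| ≤
    k / √(rad T e s) * (Real.exp (ℓ * Real.log ((T + e) / e)) * heat s (γ j) y) * |x - x'| := by
  have hnn : 0 ≤ Real.exp (ℓ * Real.log ((T + e) / e)) * heat s (γ j) y :=
    (abs_nonneg _).trans (hV.le j s hs y)
  by_cases hj : j = i
  · subst hj
    simp only [Function.update_idem, sub_self, abs_zero]
    exact mul_nonneg (mul_nonneg (hR.klip_nonneg s) hnn) (abs_nonneg _)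
  · refine (hR.lip s _ _).trans ?_
    rw [Function.update_comm hj, Function.update_comm hj, linComb_update_sub, abs_mul, mul_assoc]
    refine mul_le_mul_of_nonneg_left ?_ (hR.klip_nonneg s)
    rw [mul_comm]
    exact mul_le_mul_of_nonneg_right (hV.le j s hs y) (abs_nonneg _)

/-- Centring at the full mean, as the mean field equation dictates, differs from centring at the
true mean of the switched-off coefficient by the effect of one variable, and `E|g_i| ≤ 1`. -/
theorem abs_integral_coeff_sub_le (hR : IsReaction T e ℓ k h h') (hV : IsMeanField T e ℓ h' γ V)
    (i : Fin n) {s : ℝ} (hs : s ∈ Icc 0 T) (y : Plane) :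
    |∫ g, h' s (linComb (fun j => V j s) (Function.update g i 0) y) ∂(gaussN n) -
      meanCoeff h' V s y| ≤
    k / √(rad T e s) * (Real.exp (ℓ * Real.log ((T + e) / e)) * heat s (γ i) y) := by
  have hc : Continuous fun g : Fin n → ℝ => linComb (fun j => V j s) g y :=
    hV.continuous_linComb.comp (f := fun g => (g, s, y)) (by fun_prop)
  have i1 : Integrable (fun g => h' s (linComb (fun j => V j s) (Function.update g i 0) y))
      (gaussN n) :=
    hR.integrable_deriv_comp s (hc.comp (continuous_update_zero i)).aestronglyMeasurable
  have i2 : Integrable (fun g => h' s (linComb (fun j => V j s) g y)) (gaussN n) :=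
    hR.integrable_deriv_comp s hc.aestronglyMeasurable
  have hnn := (abs_nonneg _).trans (hV.le i s hs y)
  rw [meanCoeff, ← integral_sub i1 i2]
  refine (abs_integral_le_integral_abs).trans ?_
  calc _ ≤ ∫ g : Fin n → ℝ, k / √(rad T e s) *
        (Real.exp (ℓ * Real.log ((T + e) / e)) * heat s (γ i) y) * |g i| ∂(gaussN n) := by
        refine integral_mono (i1.sub i2).abs ((integrable_eval i).abs.const_mul _) fun g => ?_
        simp only
        rw [abs_sub_comm]
        refine (hR.lip s _ _).trans ?_
        rw [linComb_sub_update, abs_mul, mul_assoc, mul_comm |g i|]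
        exact mul_le_mul_of_nonneg_left (mul_le_mul_of_nonneg_right (hV.le i s hs y) (abs_nonneg _))
          (hR.klip_nonneg s)
    _ ≤ _ := by
        rw [integral_const_mul]
        exact mul_le_of_le_one_right (mul_nonneg (hR.klip_nonneg s) hnn) (integral_abs_eval_le i)

/-- The mean of the product is a covariance plus a product of two mean defects. The covariance
inequality bounds the first by `2 ∑_j α_j β_j`, and the second is at most the single summand `j = i`
of the same sum: hence the factor `3`. The sum is the covariance of the two heat flows, which
supplies the decay in `r + r'`. -/
theorem abs_integral_coeffFluct_mul_le (hR : IsReaction T e ℓ k h h') (hγ : IsNoiseData T e ϰ γ)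
    (hV : IsMeanField T e ℓ h' γ V) (i : Fin n) {s s' : ℝ} (hs : s ∈ Icc 0 T) (hs' : s' ∈ Icc 0 T)
    (y y' : Plane) :
    |∫ g, coeffFluct h' V i s y g * coeffFluct h' V i s' y' g ∂(gaussN n)| ≤
      3 * k ^ 2 * Real.exp (ℓ * Real.log ((T + e) / e)) ^ 2 / Real.pi *
        ((√(rad T e s))⁻¹ * (√(rad T e s'))⁻¹ * (rad T e s + rad T e s')⁻¹) := by
  set ρ := Real.exp (ℓ * Real.log ((T + e) / e)) with hρ
  have hρ0 : 0 < ρ := Real.exp_pos _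
  have hr := rad_pos hR.T_nonneg hR.e_pos s
  have hr' := rad_pos hR.T_nonneg hR.e_pos s'
  obtain ⟨K, hK⟩ := lipschitz_coeff hR hV i s y
  obtain ⟨K', hK'⟩ := lipschitz_coeff hR hV i s' y'
  set A : (Fin n → ℝ) → ℝ := fun g => h' s (linComb (fun j => V j s) (Function.update g i 0) y)
    with hA
  set B : (Fin n → ℝ) → ℝ := fun g => h' s' (linComb (fun j => V j s') (Function.update g i 0) y')
    with hB
  have hcov := abs_covariance_gaussN_le hK hK'
    (α := fun j => k / √(rad T e s) * (ρ * heat s (γ j) y))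
    (β := fun j => k / √(rad T e s') * (ρ * heat s' (γ j) y'))
    (fun j => mul_nonneg (hR.klip_nonneg s) (mul_nonneg hρ0.le (hγ.heat_nonneg j s y)))
    (fun j g x x' => abs_coeff_update_le hR hV i hs y j g x x')
    (fun j g x x' => abs_coeff_update_le hR hV i hs' y' j g x x')
  have m1 := abs_integral_coeff_sub_le hR hV i hs y
  have m2 := abs_integral_coeff_sub_le hR hV i hs' y'
  rw [← hρ] at m1 m2
  have iA : Integrable A (gaussN n) := hK.memLp_gaussN.integrable one_le_two
  have iB : Integrable B (gaussN n) := hK'.memLp_gaussN.integrable one_le_two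
  have iAB : Integrable (fun g => A g * B g) (gaussN n) :=
    hK.memLp_gaussN.integrable_mul hK'.memLp_gaussN
  set a := meanCoeff h' V s y with ha
  set b := meanCoeff h' V s' y' with hb
  have e1 : ∫ g, coeffFluct h' V i s y g * coeffFluct h' V i s' y' g ∂(gaussN n) =
      (∫ g, A g * B g ∂(gaussN n) - (∫ g, A g ∂(gaussN n)) * ∫ g, B g ∂(gaussN n)) +
      (∫ g, A g ∂(gaussN n) - a) * (∫ g, B g ∂(gaussN n) - b) := by
    have e2 : ∀ g, coeffFluct h' V i s y g * coeffFluct h' V i s' y' g =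
        A g * B g - b * A g - a * B g + a * b := fun g => by
      simp only [coeffFluct, hA, hB, ha, hb]; ring
    simp_rw [e2]
    have i1 : Integrable (fun g => A g * B g - b * A g) (gaussN n) := iAB.sub (iA.const_mul _)
    have i2 : Integrable (fun g => A g * B g - b * A g - a * B g) (gaussN n) :=
      i1.sub (iB.const_mul _)
    rw [integral_add i2 (integrable_const _), integral_sub i1 (iB.const_mul _),
      integral_sub iAB (iA.const_mul _), integral_const_mul, integral_const_mul]
    simp
    ring
  set S := ∑ j, heat s (γ j) y * heat s' (γ j) y' with hS
  have hS1 : ∑ j, k / √(rad T e s) * (ρ * heat s (γ j) y) *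
      (k / √(rad T e s') * (ρ * heat s' (γ j) y')) =
      k ^ 2 * ρ ^ 2 * ((√(rad T e s))⁻¹ * (√(rad T e s'))⁻¹) * S := by
    rw [hS, Finset.mul_sum]
    refine Finset.sum_congr rfl fun j _ => ?_
    simp only [div_eq_mul_inv]
    ring
  have hSi : heat s (γ i) y * heat s' (γ i) y' ≤ S :=
    Finset.single_le_sum (f := fun j => heat s (γ j) y * heat s' (γ j) y')
      (fun j _ => mul_nonneg (hγ.heat_nonneg j s y) (hγ.heat_nonneg j s' y')) (Finset.mem_univ i)
  -- A maximum is at least half of the sum, so the factor `2` in `2π max` disappears.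
  have hS2 : S ≤ (Real.pi)⁻¹ * (rad T e s + rad T e s')⁻¹ := by
    have := hγ.cov s hs s' hs' y y'
    rw [← rad_of_mem (e := e) hs, ← rad_of_mem (e := e) hs'] at this
    refine this.trans ?_
    rw [← mul_inv, one_div]
    apply inv_anti₀ (mul_pos Real.pi_pos (by positivity))
    have h1 := le_max_left (rad T e s) (rad T e s')
    have h2 := le_max_right (rad T e s) (rad T e s')
    nlinarith [Real.pi_pos]
  set c := k ^ 2 * ρ ^ 2 * ((√(rad T e s))⁻¹ * (√(rad T e s'))⁻¹) with hc
  have hc0 : 0 ≤ c := by positivity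
  have hprod : |(∫ g, A g ∂(gaussN n) - a) * (∫ g, B g ∂(gaussN n) - b)| ≤ c * S := by
    rw [abs_mul]
    refine (mul_le_mul m1 m2 (abs_nonneg _) ((abs_nonneg _).trans m1)).trans ?_
    refine le_trans (le_of_eq ?_) (mul_le_mul_of_nonneg_left hSi hc0)
    rw [hc]
    simp only [div_eq_mul_inv]
    ring
  rw [e1]
  rw [hS1] at hcov
  refine (abs_add_le _ _).trans ((add_le_add hcov hprod).trans ?_)
  calc 2 * (c * S) + c * S = 3 * c * S := by ring
    _ ≤ 3 * c * ((Real.pi)⁻¹ * (rad T e s + rad T e s')⁻¹) := by gcongr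
    _ = _ := by rw [hc]; field_simp

end

section
variable {T e ℓ k ϰ : ℝ} {h h' : ℝ → ℝ → ℝ} {n : ℕ} {γ : Fin n → Plane → ℝ}
  {U : (Fin n → ℝ) → ℝ → Plane → ℝ} {V : Fin n → ℝ → Plane → ℝ}

/-! ### The comparison for finite-dimensional noise -/

theorem continuous_coeffFluct (hR : IsReaction T e ℓ k h h') (hV : IsMeanField T e ℓ h' γ V)
    (i : Fin n) : Continuous fun q : (ℝ × Plane) × (Fin n → ℝ) =>
      coeffFluct h' V i q.1.1 q.1.2 q.2 := by
  refine Continuous.sub (hR.cont'.comp (f := fun q : (ℝ × Plane) × (Fin n → ℝ) =>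
    (q.1.1, linComb (fun j => V j q.1.1) (Function.update q.2 i 0) q.1.2)) ?_)
    ((isBC_meanCoeff hR hV).1.comp continuous_fst)
  refine (continuous_fst.comp continuous_fst).prodMk ?_
  exact hV.continuous_linComb.comp (f := fun q : (ℝ × Plane) × (Fin n → ℝ) =>
    (Function.update q.2 i 0, q.1.1, q.1.2))
    (((continuous_update_zero i).comp continuous_snd).prodMk (by fun_prop))

theorem abs_coeffFluct_le (hR : IsReaction T e ℓ k h h') (i : Fin n) (s : ℝ) (y : Plane)
    (g : Fin n → ℝ) : |coeffFluct h' V i s y g| ≤ 2 * (ℓ / e) := by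
  have h1 := (hR.bound s (linComb (fun j => V j s) (Function.update g i 0) y)).trans (hR.coeff_le s)
  have h2 := (hR.abs_gaussAverage_le s fun i => V i s y).trans (hR.coeff_le s)
  rw [← meanCoeff_eq] at h2
  refine (abs_sub _ _).trans ?_
  linarith

theorem continuous_stPoint (t : ℝ) (x : Plane) : Continuous fun p : ℝ × Plane =>
    (t * p.1, x + √(t * (1 - p.1)) • p.2) := by fun_prop

/-- The inner time integral is at most `π / √r` by the arctangent bound. Together with the outer
factor `1 / √r` it leaves `π / r`, so the double integral costs one logarithm rather than two. -/
theorem duhamel_duhamel_kernel_le (hR : IsReaction T e ℓ k h h') (hγ : IsNoiseData T e ϰ γ)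
    (i : Fin n) {t : ℝ} (ht : t ∈ Icc 0 T) (x : Plane) :
    duhamel (fun s y => (√(rad T e s))⁻¹ * heat s (γ i) y *
      duhamel (fun s' y' => (√(rad T e s'))⁻¹ * (rad T e s + rad T e s')⁻¹ *
        heat s' (γ i) y') t x) t x ≤
      Real.pi * Real.log ((t + e) / e) * heat t (γ i) x ^ 2 := by
  obtain ⟨K, hK0, hK⟩ := hγ.exists_bound
  have hrp := rad_pos hR.T_nonneg hR.e_pos
  have hrc := continuous_rad T e
  have hc1 : ∀ s, Continuous fun s' => (√(rad T e s'))⁻¹ * (rad T e s + rad T e s')⁻¹ := fun s =>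
    (hrc.sqrt.inv₀ fun s' => (Real.sqrt_pos.2 (hrp s')).ne').mul
      ((continuous_const.add hrc).inv₀ fun s' => (add_pos (hrp s) (hrp s')).ne')
  have h1 : ∀ s, duhamel (fun s' y' => (√(rad T e s'))⁻¹ * (rad T e s + rad T e s')⁻¹ *
      heat s' (γ i) y') t x ≤ Real.pi / √(rad T e s) * heat t (γ i) x := fun s => by
    rw [duhamel_mul_heat (hc1 s) le_rfl (hK i) (hγ.cont i) ht.1]
    exact mul_le_mul_of_nonneg_right (integral_inv_sqrt_mul_inv_add_le hR.e_pos ht (hrp s))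
      (hγ.heat_nonneg i t x)
  have h0 : ∀ s, 0 ≤ duhamel (fun s' y' => (√(rad T e s'))⁻¹ * (rad T e s + rad T e s')⁻¹ *
      heat s' (γ i) y') t x := fun s => by
    simp only [duhamel]
    refine mul_nonneg ht.1 (integral_nonneg fun p => ?_)
    have := hrp s
    have := hrp (t * p.1)
    have := hγ.heat_nonneg i (t * p.1) (x + √(t * (1 - p.1)) • p.2)
    simp only
    positivity
  have hcr : Continuous fun s => Real.pi * heat t (γ i) x / rad T e s :=
    continuous_div_rad hR.T_nonneg hR.e_pos _
  have h2 := norm_duhamel_le_mul_heat (H := fun s y => (√(rad T e s))⁻¹ * heat s (γ i) y *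
      duhamel (fun s' y' => (√(rad T e s'))⁻¹ * (rad T e s + rad T e s')⁻¹ *
        heat s' (γ i) y') t x) hcr le_rfl (hK i) (hγ.cont i) ht.1 (fun s hs y => by
      have hb := hγ.heat_nonneg i s y
      have hsp := Real.sqrt_pos.2 (hrp s)
      rw [Real.norm_eq_abs, abs_of_nonneg (mul_nonneg (mul_nonneg (by positivity) hb) (h0 s))]
      refine (mul_le_mul_of_nonneg_left (h1 s) (mul_nonneg (by positivity) hb)).trans_eq ?_
      have := hrp s
      have e1 : rad T e s = √(rad T e s) * √(rad T e s) := (Real.mul_self_sqrt (hrp s).le).symm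
      rw [div_eq_mul_inv _ (rad T e s), e1, mul_inv, ← e1]
      field_simp) x
  refine (le_abs_self _).trans (h2.trans_eq ?_)
  rw [integral_div_rad hR.e_pos ht]
  ring

/-- This is the averaging gain. Taking norms inside the time integral would give a full logarithm,
whereas expanding the square and using the correlations gives its square root. Both factors `V_i`
and both coordinatewise Lipschitz bounds contribute a `ρ`, hence `ρ⁴` in the second moment and `ρ²`
here. -/
theorem eLpNorm_duhamel_coeffFluct_le (hR : IsReaction T e ℓ k h h') (hγ : IsNoiseData T e ϰ γ)
    (hV : IsMeanField T e ℓ h' γ V) (i : Fin n) {t : ℝ} (ht : t ∈ Icc 0 T) (x : Plane) :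
    eLpNorm (fun g => duhamel (fun s y => V i s y * coeffFluct h' V i s y g) t x) 2 (gaussN n) ≤
      ENNReal.ofReal (k * Real.exp (ℓ * Real.log ((T + e) / e)) ^ 2 *
        √(3 * Real.log ((t + e) / e)) * heat t (γ i) x) := by
  set ρ := Real.exp (ℓ * Real.log ((T + e) / e)) with hρ
  have hρ0 : 0 < ρ := Real.exp_pos _
  obtain ⟨K, hK0, hK⟩ := hγ.exists_bound
  obtain ⟨M, hM0, hM⟩ := hV.bdd
  have hrp := rad_pos hR.T_nonneg hR.e_pos
  have hrc := continuous_rad T e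
  have hθ : 0 ≤ Real.log ((t + e) / e) := Real.log_nonneg (by
    rw [one_le_div hR.e_pos]; linarith [ht.1])
  have hkn := hR.k_nonneg
  set X : ℝ × Plane → (Fin n → ℝ) → ℝ := fun p g =>
    V i (t * p.1) (x + √(t * (1 - p.1)) • p.2) *
      coeffFluct h' V i (t * p.1) (x + √(t * (1 - p.1)) • p.2) g with hX
  have hXc : Continuous (Function.uncurry X) := by
    refine ((hV.cont i).comp ((continuous_stPoint t x).comp continuous_fst)).mul ?_
    exact (continuous_coeffFluct hR hV i).comp
      (((continuous_stPoint t x).comp continuous_fst).prodMk continuous_snd)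
  have hXb : ∀ p g, |X p g| ≤ M * (2 * (ℓ / e)) := fun p g => by
    simp only [hX, abs_mul]
    exact mul_le_mul (hM _ _ _) (abs_coeffFluct_le hR i _ _ g) (abs_nonneg _) hM0
  set D := 3 * k ^ 2 * ρ ^ 2 / Real.pi with hD
  have hD0 : 0 ≤ D := by positivity
  set b : ℝ × Plane → ℝ := fun p => heat (t * p.1) (γ i) (x + √(t * (1 - p.1)) • p.2) with hb
  have hbc : Continuous b := (continuous_heat le_rfl (hK i) (hγ.cont i)).comp (continuous_stPoint t x)
  have hb0 : ∀ p, 0 ≤ b p := fun p => hγ.heat_nonneg i _ _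
  have hbK : ∀ p, b p ≤ K := fun p => (le_abs_self _).trans (heat_le_of_le (hK i) _)
  set B : (ℝ × Plane) × (ℝ × Plane) → ℝ := fun q =>
    D * ρ ^ 2 * ((√(rad T e (t * q.1.1)))⁻¹ * b q.1 * ((√(rad T e (t * q.2.1)))⁻¹ *
      (rad T e (t * q.1.1) + rad T e (t * q.2.1))⁻¹ * b q.2)) with hB
  have hr1 : Continuous fun q : (ℝ × Plane) × (ℝ × Plane) => rad T e (t * q.1.1) :=
    hrc.comp (by fun_prop)
  have hr2 : Continuous fun q : (ℝ × Plane) × (ℝ × Plane) => rad T e (t * q.2.1) :=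
    hrc.comp (by fun_prop)
  have hBc : Continuous B := by
    refine continuous_const.mul (((hr1.sqrt.inv₀ fun q => (Real.sqrt_pos.2 (hrp _)).ne').mul
      (hbc.comp continuous_fst)).mul (((hr2.sqrt.inv₀ fun q => (Real.sqrt_pos.2 (hrp _)).ne').mul
      ((hr1.add hr2).inv₀ fun q => (add_pos (hrp _) (hrp _)).ne')).mul (hbc.comp continuous_snd)))
  have hse := Real.sqrt_pos.2 hR.e_pos
  have hBi : Integrable B (stM.prod stM) := by
    refine (integrable_const (D * ρ ^ 2 * ((√e)⁻¹ * K * ((√e)⁻¹ * e⁻¹ * K)))).mono'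
      hBc.aestronglyMeasurable (Eventually.of_forall fun q => ?_)
    have p1 := hrp (t * q.1.1)
    have p2 := hrp (t * q.2.1)
    have p3 := hb0 q.1
    have p4 := hb0 q.2
    have p5 := hR.e_pos
    rw [Real.norm_eq_abs, abs_of_nonneg (by simp only [hB]; positivity)]
    simp only [hB]
    gcongr
    · exact le_rad hR.T_nonneg _
    · exact hbK _
    · exact le_rad hR.T_nonneg _
    · exact (le_rad hR.T_nonneg _).trans (le_add_of_nonneg_right (hrp _).le)
    · exact hbK _
  have hcor : ∀ᵐ q ∂(stM.prod stM), |∫ g, X q.1 g * X q.2 g ∂(gaussN n)| ≤ B q := by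
    filter_upwards [Measure.quasiMeasurePreserving_fst.ae ae_stM_fst,
      Measure.quasiMeasurePreserving_snd.ae ae_stM_fst] with q hq1 hq2
    have hm : ∀ {σ : ℝ}, σ ∈ Ioc (0 : ℝ) 1 → t * σ ∈ Icc 0 T := fun hσ =>
      ⟨(mul_mem_Icc_of_mem_Ioc ht.1 hσ).1, (mul_mem_Icc_of_mem_Ioc ht.1 hσ).2.trans ht.2⟩
    have e1 : ∫ g, X q.1 g * X q.2 g ∂(gaussN n) =
        V i (t * q.1.1) (x + √(t * (1 - q.1.1)) • q.1.2) *
        V i (t * q.2.1) (x + √(t * (1 - q.2.1)) • q.2.2) *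
        ∫ g, coeffFluct h' V i (t * q.1.1) (x + √(t * (1 - q.1.1)) • q.1.2) g *
          coeffFluct h' V i (t * q.2.1) (x + √(t * (1 - q.2.1)) • q.2.2) g ∂(gaussN n) := by
      rw [← integral_const_mul]
      exact integral_congr_ae (Eventually.of_forall fun g => by simp only [hX]; ring)
    rw [e1, abs_mul, abs_mul]
    have v1 := hV.le i _ (hm hq1) (x + √(t * (1 - q.1.1)) • q.1.2)
    have v2 := hV.le i _ (hm hq2) (x + √(t * (1 - q.2.1)) • q.2.2)
    have v3 := abs_integral_coeffFluct_mul_le hR hγ hV i (hm hq1) (hm hq2)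
      (x + √(t * (1 - q.1.1)) • q.1.2) (x + √(t * (1 - q.2.1)) • q.2.2)
    refine (mul_le_mul (mul_le_mul v1 v2 (abs_nonneg _) ((abs_nonneg _).trans v1)) v3
      (abs_nonneg _) (mul_nonneg ((abs_nonneg _).trans v1) ((abs_nonneg _).trans v2))).trans_eq ?_
    simp only [hB, hb, hD, ← hρ]
    ring
  have hmain := integral_sq_integral_le (π := stM) (ν := gaussN n) hXc.stronglyMeasurable hXb hBi
    hcor
  have hdu : ∀ g, duhamel (fun s y => V i s y * coeffFluct h' V i s y g) t x = t * ∫ p, X p g ∂stM :=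
    fun g => rfl
  have hBint : t ^ 2 * ∫ q, B q ∂(stM.prod stM) ≤
      D * ρ ^ 2 * (Real.pi * Real.log ((t + e) / e) * heat t (γ i) x ^ 2) := by
    refine le_trans (le_of_eq ?_) (mul_le_mul_of_nonneg_left
      (duhamel_duhamel_kernel_le hR hγ i ht x) (by positivity))
    rw [integral_prod _ hBi]
    simp only [duhamel, smul_eq_mul, hB]
    simp_rw [integral_const_mul]
    have e2 : ∀ p : ℝ × Plane, (√(rad T e (t * p.1)))⁻¹ * heat (t * p.1) (γ i)
        (x + √(t * (1 - p.1)) • p.2) * (t * ∫ p' : ℝ × Plane, (√(rad T e (t * p'.1)))⁻¹ *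
          (rad T e (t * p.1) + rad T e (t * p'.1))⁻¹ *
          heat (t * p'.1) (γ i) (x + √(t * (1 - p'.1)) • p'.2) ∂stM) =
        t * ((√(rad T e (t * p.1)))⁻¹ * b p * ∫ p' : ℝ × Plane, (√(rad T e (t * p'.1)))⁻¹ *
          (rad T e (t * p.1) + rad T e (t * p'.1))⁻¹ * b p' ∂stM) := fun p => by
      simp only [hb]; ring
    simp_rw [e2]
    rw [integral_const_mul]
    ring
  have hmem : MemLp (fun g => duhamel (fun s y => V i s y * coeffFluct h' V i s y g) t x) 2
      (gaussN n) := by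
    simp_rw [hdu]
    refine MemLp.const_mul ?_ t
    have hsm : StronglyMeasurable fun g => ∫ p, X p g ∂stM :=
      (hXc.stronglyMeasurable).integral_prod_left
    refine MemLp.of_bound hsm.aestronglyMeasurable (M * (2 * (ℓ / e)))
      (Eventually.of_forall fun g => ?_)
    have := norm_integral_le_of_norm_le_const (μ := stM) (f := fun p => X p g)
      (Eventually.of_forall fun p => hXb p g)
    simpa using this
  have hkr : 0 ≤ k * ρ ^ 2 * √(3 * Real.log ((t + e) / e)) * heat t (γ i) x :=
    mul_nonneg (by positivity) (hγ.heat_nonneg i t x)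
  rw [eLpNorm_two_le_ofReal_iff hmem hkr]
  simp_rw [hdu, mul_pow]
  rw [integral_const_mul, Real.sq_sqrt (by positivity)]
  refine (mul_le_mul_of_nonneg_left hmain (sq_nonneg t)).trans (hBint.trans_eq ?_)
  rw [hD]
  have := Real.pi_pos
  field_simp

/-- A bound for each `gapDiff` gives a bound for `gap`. -/
theorem eLpNorm_gap_le (hR : IsReaction T e ℓ k h h') (hγ : IsNoiseData T e ϰ γ)
    (hU : IsFlow T e ℓ h γ U) (hV : IsMeanField T e ℓ h' γ V) {s : ℝ} (hs : s ∈ Icc 0 T)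
    (y : Plane) {p : ℝ} (hp : 0 ≤ p) (hle : ∀ i, eLpNorm (gapDiff U V i s y) 2 (gaussN n) ≤
      ENNReal.ofReal (p * heat s (γ i) y)) :
    eLpNorm (gap U V s y) 2 (gaussN n) ≤ ENNReal.ofReal (p / √(2 * Real.pi * (s + e))) := by
  obtain ⟨K, hK⟩ := exists_lipschitz_gap hU hV
  have hse : 0 < s + e := by linarith [hs.1, hR.e_pos]
  -- Oddness makes the mean vanish, so the Efron–Stein bound on the variance controls the whole
  -- second moment.
  have h0 : ∫ g, gap U V s y g ∂(gaussN n) = 0 := integral_eq_zero_of_odd fun g => by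
    simp only [gap, hU.odd, linComb_neg]; ring
  have h1 := efronStein (hK s y)
  rw [h0, mul_zero, sub_zero] at h1
  rw [eLpNorm_two_le_ofReal_iff (hK s y).memLp_gaussN (by positivity)]
  have h2 : ∀ i, ∫ g, (gap U V s y g - gap U V s y (Function.update g i 0)) ^ 2 ∂(gaussN n) ≤
      (p * heat s (γ i) y) ^ 2 := fun i =>
    (eLpNorm_two_le_ofReal_iff (memLp_gapDiff hU hV i s y)
      (mul_nonneg hp (hγ.heat_nonneg i s y))).1 (hle i)
  calc ∫ g, gap U V s y g ^ 2 ∂(gaussN n) = ∫ g, gap U V s y g * gap U V s y g ∂(gaussN n) := by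
        simp_rw [sq]
    _ ≤ ∑ i, (p * heat s (γ i) y) ^ 2 := h1.trans (Finset.sum_le_sum fun i _ => h2 i)
    _ = p ^ 2 * ∑ i, heat s (γ i) y * heat s (γ i) y := by
        rw [Finset.mul_sum]
        exact Finset.sum_congr rfl fun i _ => by ring
    _ ≤ p ^ 2 * (1 / (2 * Real.pi * max (s + e) (s + e))) := by
        gcongr; exact hγ.cov s hs s hs y y
    _ = _ := by
        rw [max_self, div_pow, Real.sq_sqrt (by positivity)]; ring

/-- The `L²` norm of the square of a standard Gaussian variable. -/
def gaussSqNorm : ℝ := (eLpNorm (fun x : ℝ => x ^ 2) 2 (gaussianReal 0 1)).toReal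

theorem eLpNorm_eval_sq (i : Fin n) : eLpNorm (fun g : Fin n → ℝ => g i ^ 2) 2 (gaussN n) ≤
    ENNReal.ofReal gaussSqNorm := by
  rw [eLpNorm_eval_gaussN i (f := fun x => x ^ 2) (by fun_prop), gaussSqNorm, ENNReal.ofReal_toReal]
  have h4 := memLp_id_gaussianReal' (μ := 0) (v := 1) 4 ENNReal.ofNat_ne_top
  have : MemLp (fun x : ℝ => x * x) 2 (gaussianReal 0 1) := by
    have : ENNReal.HolderTriple 4 4 2 := ⟨by
      rw [← ENNReal.toReal_eq_toReal_iff' (by simp) (by simp), ENNReal.toReal_add (by simp) (by simp)]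
      simp; norm_num⟩
    exact h4.mul' h4
  simp_rw [sq]
  exact this.eLpNorm_ne_top

theorem continuous_gap (hU : IsFlow T e ℓ h γ U) (hV : IsMeanField T e ℓ h' γ V) (s : ℝ)
    (y : Plane) : Continuous (gap U V s y) := by
  obtain ⟨K, hK⟩ := exists_lipschitz_gap hU hV
  exact (hK s y).continuous

/-- Under the ansatz at time `s` for all coordinates, each of the three terms of `abs_gapRem_le` is
a constant times `P_sγ_i / r`. The cross term uses Efron–Stein for `gap`, which costs a second
factor `1 / √r`; the diagonal term obtains that factor from the smallness of a single profile. The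
bound therefore has the form required by the Gronwall iteration. -/
theorem eLpNorm_gapRem_le (hR : IsReaction T e ℓ k h h') (hγ : IsNoiseData T e ϰ γ)
    (hU : IsFlow T e ℓ h γ U) (hV : IsMeanField T e ℓ h' γ V) {s : ℝ} (hs : s ∈ Icc 0 T)
    (y : Plane) {p : ℝ} (hp : 0 ≤ p) (hle : ∀ i, eLpNorm (gapDiff U V i s y) 2 (gaussN n) ≤
      ENNReal.ofReal (p * heat s (γ i) y)) (i : Fin n) {ρ : ℝ}
    (hρ : ρ = Real.exp (ℓ * Real.log ((T + e) / e))) :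
    eLpNorm (gapRem h h' U V i s y) 2 (gaussN n) ≤
      ENNReal.ofReal (((ℓ + k * ρ * (1 + ϰ) / √(2 * Real.pi)) * p +
        k * ρ ^ 2 * gaussSqNorm * ϰ / √(2 * Real.pi)) / rad T e s * heat s (γ i) y) := by
  have hρ0 : 0 < ρ := hρ ▸ Real.exp_pos _
  have hr : 0 < rad T e s := rad_pos hR.T_nonneg hR.e_pos s
  have hre : rad T e s = s + e := rad_of_mem hs
  have hβ := hγ.heat_nonneg i s y
  have hβs := hγ.small s hs i y
  have hVle := hV.le i s hs y
  rw [← hρ] at hVle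
  have hk := hR.klip_nonneg s
  have hm4 : 0 ≤ gaussSqNorm := ENNReal.toReal_nonneg
  have hgc := continuous_gap hU hV s y
  have hgc0 : Continuous fun g => gap U V s y (Function.update g i 0) :=
    hgc.comp (continuous_update_zero i)
  have hgap := eLpNorm_gap_le hR hγ hU hV hs y hp hle
  rw [← hre] at hgap hβs
  have hsq : √(2 * Real.pi * rad T e s) = √(2 * Real.pi) * √(rad T e s) :=
    Real.sqrt_mul (by positivity) _
  set b := heat s (γ i) y with hb
  set r := rad T e s with hrdef
  have h2p : 0 < √(2 * Real.pi) := by positivity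
  have hsr : 0 < √r := Real.sqrt_pos.2 hr
  have hϰ : 0 ≤ ϰ := by
    have := hβ.trans hβs
    rw [hsq] at this
    by_contra hneg
    push Not at hneg
    exact absurd this (not_le.2 (div_neg_of_neg_of_pos hneg (by positivity)))
  -- The gap with `g_i` off is the gap minus `gapDiff`. The first part gives `p / √(2πr)`, and the
  -- second is smaller by the factor `ϰ` since `P_sγ_i ≤ ϰ / √(2πr)`.
  have hw0 : eLpNorm (fun g => gap U V s y (Function.update g i 0)) 2 (gaussN n) ≤
      ENNReal.ofReal (p * (1 + ϰ) / √(2 * Real.pi * r)) := by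
    have h1 := eLpNorm_add_le_ofReal (μ := gaussN n) (B := fun g => -1 * gapDiff U V i s y g)
      (by positivity) (by positivity : 0 ≤ |(-1 : ℝ)| * (p * b)) hgc.aestronglyMeasurable
      (by exact (continuous_const.mul (hgc.sub hgc0)).aestronglyMeasurable) hgap
      (eLpNorm_const_mul_le_ofReal (-1) (hle i))
    have e1 : (fun g => gap U V s y g + -1 * gapDiff U V i s y g) =
        fun g => gap U V s y (Function.update g i 0) := by
      ext g; rw [gapDiff]; ring
    rw [e1] at h1
    refine h1.trans (ENNReal.ofReal_le_ofReal ?_)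
    rw [abs_neg, abs_one, one_mul]
    have := mul_le_mul_of_nonneg_left hβs hp
    refine (add_le_add le_rfl this).trans_eq ?_
    ring
  have t1 := eLpNorm_const_mul_le_ofReal (ℓ / r) (hle i)
  have t2 : eLpNorm (fun g => k / √r * |V i s y| * (g i * gap U V s y (Function.update g i 0))) 2
      (gaussN n) ≤ ENNReal.ofReal (abs (k / √r * |V i s y|) * (p * (1 + ϰ) / √(2 * Real.pi * r))) := by
    refine eLpNorm_const_mul_le_ofReal _ ?_
    rw [eLpNorm_eval_mul_update i (F := gap U V s y) hgc.measurable]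
    exact hw0
  have t3 := eLpNorm_const_mul_le_ofReal (k / √r * |V i s y| ^ 2) (eLpNorm_eval_sq i)
  have m1 : AEStronglyMeasurable (fun g => ℓ / r * gapDiff U V i s y g) (gaussN n) :=
    (memLp_gapDiff hU hV i s y).1.const_mul _
  have m2 : Continuous fun g : Fin n → ℝ =>
      k / √r * |V i s y| * (g i * gap U V s y (Function.update g i 0)) := by fun_prop
  have m3 : Continuous fun g : Fin n → ℝ => k / √r * |V i s y| ^ 2 * g i ^ 2 := by fun_prop
  have hℓr : 0 ≤ ℓ / r := hR.coeff_nonneg s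
  have hA : 0 ≤ k / √r * |V i s y| := by positivity
  have hA2 : 0 ≤ k / √r * |V i s y| ^ 2 := by positivity
  rw [abs_of_nonneg hℓr] at t1
  rw [abs_of_nonneg hA] at t2
  rw [abs_of_nonneg hA2] at t3
  rw [← eLpNorm_norm] at t1 t2 t3
  have a12 := eLpNorm_add_le_ofReal (by positivity) (by positivity) m1.norm
    m2.norm.aestronglyMeasurable t1 t2
  have a123 := eLpNorm_add_le_ofReal (by positivity) (by positivity)
    (m1.norm.add m2.norm.aestronglyMeasurable) m3.norm.aestronglyMeasurable a12 t3
  refine (eLpNorm_le_of_abs_le (Eventually.of_forall fun g => ?_) a123).trans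
    (ENNReal.ofReal_le_ofReal ?_)
  · refine (abs_gapRem_le (U := U) (V := V) hR i s y g).trans ((le_of_eq ?_).trans (le_abs_self _))
    simp only [Real.norm_eq_abs, Pi.add_apply]
    rw [abs_mul (ℓ / r), abs_mul (k / √r * |V i s y|), abs_mul (k / √r * |V i s y| ^ 2),
      abs_of_nonneg hℓr, abs_of_nonneg hA, abs_of_nonneg hA2]
  · have hkn := hR.k_nonneg
    -- One of the two factors `P_sγ_i` is kept for the majorant and the other is replaced by its
    -- small supremum bound.
    have hv2 : |V i s y| ^ 2 ≤ ρ ^ 2 * (ϰ / √(2 * Real.pi * r) * b) := by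
      calc |V i s y| ^ 2 ≤ (ρ * b) ^ 2 := by gcongr
        _ = ρ ^ 2 * (b * b) := by ring
        _ ≤ _ := by gcongr
    calc ℓ / r * (p * b) + k / √r * |V i s y| * (p * (1 + ϰ) / √(2 * Real.pi * r)) +
        k / √r * |V i s y| ^ 2 * gaussSqNorm
        ≤ ℓ / r * (p * b) + k / √r * (ρ * b) * (p * (1 + ϰ) / √(2 * Real.pi * r)) +
        k / √r * (ρ ^ 2 * (ϰ / √(2 * Real.pi * r) * b)) * gaussSqNorm := by gcongr
      _ = _ := by
        rw [hsq]
        have e2 : r = √r * √r := (Real.mul_self_sqrt hr.le).symm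
        rw [div_eq_mul_inv _ r, div_eq_mul_inv _ r, e2, mul_inv, ← e2]
        field_simp

/-- The flow and the mean field solution each change by at most `ρ |g_i| P_sγ_i` when `g_i` is
switched off. This crude bound without smallness only starts the Gronwall iteration, where its
contribution vanishes in the limit. -/
theorem eLpNorm_gapDiff_le_two_mul (hγ : IsNoiseData T e ϰ γ)
    (hU : IsFlow T e ℓ h γ U) (hV : IsMeanField T e ℓ h' γ V) {s : ℝ} (hs : s ∈ Icc 0 T)
    (y : Plane) (i : Fin n) : eLpNorm (gapDiff U V i s y) 2 (gaussN n) ≤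
      ENNReal.ofReal (2 * Real.exp (ℓ * Real.log ((T + e) / e)) * heat s (γ i) y) := by
  set ρ := Real.exp (ℓ * Real.log ((T + e) / e)) with hρ
  have hρ0 : 0 < ρ := Real.exp_pos _
  have hβ := hγ.heat_nonneg i s y
  have hnn : 0 ≤ 2 * ρ * heat s (γ i) y := by positivity
  have h1 := eLpNorm_const_mul_le_ofReal (2 * ρ * heat s (γ i) y) (eLpNorm_eval_two i)
  rw [mul_one, abs_of_nonneg hnn] at h1
  refine eLpNorm_le_of_abs_le (Eventually.of_forall fun g => ?_) h1
  have h2 := hU.stable g (Function.update g i 0) s hs y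
  simp only [linComb_sub_update] at h2
  have e1 : heat s (fun y => |g i * γ i y|) y = |g i| * heat s (γ i) y := by
    rw [← heat_const_mul]
    congr 1
    ext y
    rw [abs_mul, abs_of_nonneg (hγ.nonneg i y)]
  rw [e1] at h2
  have h3 := linComb_sub_update (fun j => V j s) g i y
  have e2 : gapDiff U V i s y g = (U g s y - U (Function.update g i 0) s y) - g i * V i s y := by
    rw [gapDiff, gap, gap, ← h3]; ring
  rw [e2, abs_mul, abs_of_nonneg hnn]
  refine (abs_sub _ _).trans ?_
  rw [abs_mul]
  have h4 := mul_le_mul_of_nonneg_left (hV.le i s hs y) (abs_nonneg (g i))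
  rw [← hρ] at h2 h4
  linarith

/-- The flow and the mean field solution are close in `L²`. -/
theorem eLpNorm_gap_le_exp (hR : IsReaction T e ℓ k h h') (hγ : IsNoiseData T e ϰ γ)
    (hU : IsFlow T e ℓ h γ U) (hV : IsMeanField T e ℓ h' γ V) (hϰ : 0 ≤ ϰ) {ρ θ : ℝ}
    (hρ : ρ = Real.exp (ℓ * Real.log ((T + e) / e))) (hθ : θ = Real.log ((T + e) / e))
    {t : ℝ} (ht : t ∈ Icc 0 T) (x : Plane) :
    eLpNorm (gap U V t x) 2 (gaussN n) ≤ ENNReal.ofReal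
      ((k * ρ ^ 2 * √(3 * θ) + k * ρ ^ 2 * gaussSqNorm * ϰ / √(2 * Real.pi) * θ) *
        Real.exp ((ℓ + k * ρ * (1 + ϰ) / √(2 * Real.pi)) * θ) / √(2 * Real.pi * (t + e))) := by
  obtain ⟨K, hK0, hK⟩ := hγ.exists_bound
  have hρ0 : 0 < ρ := hρ ▸ Real.exp_pos _
  have he := hR.e_pos
  have hk := hR.k_nonneg
  have hℓ := hR.ℓ_nonneg
  have hm4 : 0 ≤ gaussSqNorm := ENNReal.toReal_nonneg
  have hlog : ∀ s ∈ Icc 0 T, 0 ≤ Real.log ((s + e) / e) ∧ Real.log ((s + e) / e) ≤ θ := fun s hs => by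
    have := hs.1
    constructor
    · exact Real.log_nonneg (by rw [one_le_div he]; linarith)
    · rw [hθ]
      have := hs.2
      gcongr
  have hθ0 : 0 ≤ θ := (hlog t ht).1.trans (hlog t ht).2
  -- `κ` is the rate of the terms linear in the unknown, `R₂` the size of the diagonal source, and
  -- `R` below the total source, with its logarithms evaluated at the final time.
  set κ := ℓ + k * ρ * (1 + ϰ) / √(2 * Real.pi) with hκ
  have hκ0 : 0 ≤ κ := by positivity
  set R₂ := k * ρ ^ 2 * gaussSqNorm * ϰ / √(2 * Real.pi) with hR₂
  have hR₂0 : 0 ≤ R₂ := by positivity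
  set R := k * ρ ^ 2 * √(3 * θ) + R₂ * θ with hRdef
  have hR0 : 0 ≤ R := by positivity
  have hfin : ∀ i s y, eLpNorm (gapDiff U V i s y) 2 (gaussN n) ≠ ∞ := fun i s y =>
    (memLp_gapDiff hU hV i s y).eLpNorm_ne_top
  have hiff : ∀ i s y {b : ℝ}, 0 ≤ b → ((eLpNorm (gapDiff U V i s y) 2 (gaussN n)).toReal ≤ b ↔
      eLpNorm (gapDiff U V i s y) 2 (gaussN n) ≤ ENNReal.ofReal b) := fun i s y b hb =>
    (ENNReal.le_ofReal_iff_toReal_le (hfin i s y) hb).symm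
  -- All coordinates are treated at once, because the cross term for one `i` involves the norms for
  -- every `j`. Both comparison fields are multiples of the same heat flows and differ only by the
  -- factor `R`.
  have key := gronwall_majorant (S := Fin n × Plane) (T := T) (B := 2 * ρ) (by positivity)
    (continuous_div_rad hR.T_nonneg he κ)
    (fun s => div_nonneg hκ0 (rad_pos hR.T_nonneg he s).le)
    (d := fun t σ => (eLpNorm (gapDiff U V σ.1 t σ.2) 2 (gaussN n)).toReal)
    (X := fun t σ => R * heat t (γ σ.1) σ.2) (Y := fun t σ => heat t (γ σ.1) σ.2)
    (fun s _ σ => mul_nonneg hR0 (hγ.heat_nonneg _ _ _)) ?_ ?_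
  · refine eLpNorm_gap_le hR hγ hU hV ht x (p := R * Real.exp (κ * θ)) (by positivity) fun i => ?_
    rw [← hiff i t x (mul_nonneg (by positivity) (hγ.heat_nonneg _ _ _))]
    refine (key t ht (i, x)).trans ?_
    rw [integral_div_rad he ht]
    have := (hlog t ht).2
    have hb := hγ.heat_nonneg i t x
    calc Real.exp (κ * Real.log ((t + e) / e)) * (R * heat t (γ i) x)
        ≤ Real.exp (κ * θ) * (R * heat t (γ i) x) := by gcongr
      _ = _ := by ring
  · intro s hs σ
    have := eLpNorm_gapDiff_le_two_mul hγ hU hV hs σ.2 σ.1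
    rw [← hρ] at this
    exact (hiff _ _ _ (mul_nonneg (by positivity) (hγ.heat_nonneg _ _ _))).2 this
  · intro p q hp hq hp0 hq0 hle s hs σ
    obtain ⟨i, y⟩ := σ
    have hP0 : ∀ r ∈ Icc 0 T, 0 ≤ p r * R + q r := fun r hr =>
      add_nonneg (mul_nonneg (hp0 r hr) hR0) (hq0 r hr)
    have hrem : ∀ r ∈ Icc 0 s, ∀ z, eLpNorm (gapRem h h' U V i r z) 2 (gaussN n) ≤
        ENNReal.ofReal ((κ * (p r * R + q r) + R₂) / rad T e r * heat r (γ i) z) := by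
      intro r hr z
      have hr' : r ∈ Icc 0 T := ⟨hr.1, hr.2.trans hs.2⟩
      refine eLpNorm_gapRem_le hR hγ hU hV hr' z (hP0 r hr') (fun j => ?_) i hρ
      rw [← hiff j r z (mul_nonneg (hP0 r hr') (hγ.heat_nonneg _ _ _))]
      exact (hle r hr' (j, z)).trans_eq (by ring)
    have hcc : Continuous fun r => (κ * (p r * R + q r) + R₂) / rad T e r :=
      (by fun_prop : Continuous fun r => κ * (p r * R + q r) + R₂).div (continuous_rad T e)
        fun r => (rad_pos hR.T_nonneg he r).ne'
    have hremc : Continuous fun z : (ℝ × Plane) × (Fin n → ℝ) =>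
        gapRem h h' U V i z.1.1 z.1.2 z.2 := by
      have cu : Continuous fun z : (ℝ × Plane) × (Fin n → ℝ) => Function.update z.2 i 0 :=
        (continuous_update_zero i).comp continuous_snd
      have c1 : Continuous fun z : (ℝ × Plane) × (Fin n → ℝ) => h z.1.1 (U z.2 z.1.1 z.1.2) :=
        hR.cont.comp ((by fun_prop : Continuous fun z : (ℝ × Plane) × (Fin n → ℝ) => z.1.1).prodMk
          (hU.cont.comp (f := fun z : (ℝ × Plane) × (Fin n → ℝ) => (z.2, z.1.1, z.1.2))
            (by fun_prop)))
      have c2 : Continuous fun z : (ℝ × Plane) × (Fin n → ℝ) =>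
          h z.1.1 (U (Function.update z.2 i 0) z.1.1 z.1.2) :=
        hR.cont.comp ((by fun_prop : Continuous fun z : (ℝ × Plane) × (Fin n → ℝ) => z.1.1).prodMk
          (hU.cont.comp (f := fun z : (ℝ × Plane) × (Fin n → ℝ) =>
            (Function.update z.2 i 0, z.1.1, z.1.2)) (cu.prodMk (by fun_prop))))
      have c3 : Continuous fun z : (ℝ × Plane) × (Fin n → ℝ) =>
          h' z.1.1 (linComb (fun j => V j z.1.1) (Function.update z.2 i 0) z.1.2) :=
        hR.cont'.comp ((by fun_prop : Continuous fun z : (ℝ × Plane) × (Fin n → ℝ) => z.1.1).prodMk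
          (hV.continuous_linComb.comp (f := fun z : (ℝ × Plane) × (Fin n → ℝ) =>
            (Function.update z.2 i 0, z.1.1, z.1.2)) (cu.prodMk (by fun_prop))))
      have c4 : Continuous fun z : (ℝ × Plane) × (Fin n → ℝ) => z.2 i * V i z.1.1 z.1.2 :=
        (by fun_prop : Continuous fun z : (ℝ × Plane) × (Fin n → ℝ) => z.2 i).mul
          ((hV.cont i).comp continuous_fst)
      exact (c1.sub c2).sub (c3.mul c4)
    have hremp : Continuous fun z : (ℝ × Plane) × (Fin n → ℝ) => gapRem h h' U V i (s * z.1.1)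
        (y + √(s * (1 - z.1.1)) • z.1.2) z.2 :=
      hremc.comp (f := fun z : (ℝ × Plane) × (Fin n → ℝ) =>
        ((s * z.1.1, y + √(s * (1 - z.1.1)) • z.1.2), z.2)) (by fun_prop)
    have d1 := eLpNorm_duhamel_le (ν := gaussN n) (A := gapRem h h' U V i) hcc le_rfl (hK i)
      (hγ.cont i) (hγ.nonneg i) hs.1 (x := y) (fun r hr => div_nonneg
        (add_nonneg (mul_nonneg hκ0 (hP0 r ⟨hr.1, hr.2.trans hs.2⟩)) hR₂0)
        (rad_pos hR.T_nonneg he r).le) hremp.aestronglyMeasurable hrem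
    -- The same functional without the switch: the fluctuation integral is `F` evaluated with
    -- coordinate `i` set to zero, the form required by `eLpNorm_eval_mul_update`.
    set F : (Fin n → ℝ) → ℝ := fun g =>
      duhamel (fun s y => V i s y * (h' s (linComb (fun j => V j s) g y) - meanCoeff h' V s y)) s y
      with hF
    have hFu : ∀ g, duhamel (fun s y => V i s y * coeffFluct h' V i s y g) s y =
        F (Function.update g i 0) := fun g => rfl
    have hFm : Measurable F := by
      have c5 : Continuous fun z : (Fin n → ℝ) × (ℝ × Plane) => V i z.2.1 z.2.2 *
          (h' z.2.1 (linComb (fun j => V j z.2.1) z.1 z.2.2) - meanCoeff h' V z.2.1 z.2.2) := by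
        refine ((hV.cont i).comp continuous_snd).mul ((hR.cont'.comp
          ((continuous_fst.comp continuous_snd).prodMk hV.continuous_linComb)).sub
          ((isBC_meanCoeff hR hV).1.comp continuous_snd))
      have c6 : Continuous fun z : (Fin n → ℝ) × (ℝ × Plane) =>
          (z.1, s * z.2.1, y + √(s * (1 - z.2.1)) • z.2.2) := by fun_prop
      exact ((c5.comp c6).stronglyMeasurable.integral_prod_right'.const_mul s).measurable
    have d2 : eLpNorm (fun g => g i *
        duhamel (fun s y => V i s y * coeffFluct h' V i s y g) s y) 2 (gaussN n) ≤
        ENNReal.ofReal (k * ρ ^ 2 * √(3 * θ) * heat s (γ i) y) := by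
      simp_rw [hFu]
      rw [eLpNorm_eval_mul_update i hFm]
      refine (eLpNorm_duhamel_coeffFluct_le hR hγ hV i hs y).trans (ENNReal.ofReal_le_ofReal ?_)
      rw [← hρ]
      have hb := hγ.heat_nonneg i s y
      have := (hlog s hs).2
      gcongr
    have hDm : Measurable fun g => duhamel (fun s y => gapRem h h' U V i s y g) s y := by
      have c6 : Continuous fun z : (Fin n → ℝ) × (ℝ × Plane) =>
          gapRem h h' U V i (s * z.2.1) (y + √(s * (1 - z.2.1)) • z.2.2) z.1 :=
        hremp.comp (f := fun z : (Fin n → ℝ) × (ℝ × Plane) => (z.2, z.1)) (by fun_prop)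
      exact (c6.stronglyMeasurable.integral_prod_right'.const_mul s).measurable
    have hFm' : Measurable fun g : Fin n → ℝ => g i *
        duhamel (fun s y => V i s y * coeffFluct h' V i s y g) s y := by
      simp_rw [hFu]
      exact (measurable_pi_apply i).mul (hFm.comp (continuous_update_zero i).measurable)
    have hb := hγ.heat_nonneg i s y
    have hi1 : 0 ≤ ∫ r in 0..s, (κ * (p r * R + q r) + R₂) / rad T e r :=
      intervalIntegral.integral_nonneg hs.1 fun r hr => div_nonneg
        (add_nonneg (mul_nonneg hκ0 (hP0 r ⟨hr.1, hr.2.trans hs.2⟩)) hR₂0)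
        (rad_pos hR.T_nonneg he r).le
    have d3 := eLpNorm_add_le_ofReal (mul_nonneg hi1 hb) (by positivity)
      hDm.aestronglyMeasurable hFm'.aestronglyMeasurable d1 d2
    have d4 : eLpNorm (gapDiff U V i s y) 2 (gaussN n) ≤ ENNReal.ofReal
        ((∫ r in 0..s, (κ * (p r * R + q r) + R₂) / rad T e r) * heat s (γ i) y +
          k * ρ ^ 2 * √(3 * θ) * heat s (γ i) y) := by
      refine eLpNorm_le_of_abs_le (Eventually.of_forall fun g => ?_) d3
      rw [gapDiff_eq hR hγ hU hV i hs y g, abs_neg]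
    rw [← hiff i s y (by positivity)] at d4
    refine d4.trans ?_
    have ic : ∀ {f : ℝ → ℝ}, Continuous f → IntervalIntegrable f volume 0 s := fun hf =>
      hf.intervalIntegrable _ _
    have hcκ := continuous_div_rad hR.T_nonneg he κ
    have hcp : Continuous fun r => R * (κ / rad T e r * p r) := (hcκ.mul hp).const_mul R
    have hcq : Continuous fun r => κ / rad T e r * q r := hcκ.mul hq
    have hcpq : Continuous fun r => R * (κ / rad T e r * p r) + κ / rad T e r * q r := hcp.add hcq
    have e3 : ∫ r in 0..s, (κ * (p r * R + q r) + R₂) / rad T e r =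
        R * (∫ r in 0..s, κ / rad T e r * p r) + (∫ r in 0..s, κ / rad T e r * q r) +
          R₂ * Real.log ((s + e) / e) := by
      rw [← integral_div_rad he hs, ← intervalIntegral.integral_const_mul,
        ← intervalIntegral.integral_add (ic hcp) (ic hcq), ← intervalIntegral.integral_add (ic hcpq)
          (ic (continuous_div_rad hR.T_nonneg he R₂))]
      refine intervalIntegral.integral_congr fun r _ => ?_
      ring
    have h5 : R₂ * Real.log ((s + e) / e) ≤ R₂ * θ :=
      mul_le_mul_of_nonneg_left (hlog s hs).2 hR₂0
    simp only
    rw [e3]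
    have h6 : R₂ * Real.log ((s + e) / e) * heat s (γ i) y ≤ R₂ * θ * heat s (γ i) y :=
      mul_le_mul_of_nonneg_right h5 hb
    have e4 : (1 + ∫ r in 0..s, κ / rad T e r * p r) * (R * heat s (γ i) y) =
        k * ρ ^ 2 * √(3 * θ) * heat s (γ i) y + R₂ * θ * heat s (γ i) y +
          R * (∫ r in 0..s, κ / rad T e r * p r) * heat s (γ i) y := by rw [hRdef]; ring
    rw [e4]
    linarith

end

section
/-! ### The white noise on a finite family of cells -/

theorem heatKernel_le_inv {t : ℝ} (ht : 0 < t) (x : Plane) : heatKernel t x ≤ (2 * Real.pi * t)⁻¹ := by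
  rw [heatKernel]
  refine mul_le_of_le_one_right (by positivity) (Real.exp_le_one_iff.2 ?_)
  rw [neg_div]
  exact neg_nonpos.2 (by positivity)

theorem continuous_heatKernel_sub (t : ℝ) (x : Plane) :
    Continuous fun z => heatKernel t (x - z) :=
  (continuous_heatKernel t).comp (by fun_prop)

theorem integrable_heatKernel_sub {t : ℝ} (ht : 0 < t) (x : Plane) :
    Integrable (fun z => heatKernel t (x - z)) :=
  (integrable_heatKernel ht).comp_sub_left x

theorem heat_indicator {t : ℝ} (ht : 0 < t) {Q : Set Plane} (hQ : MeasurableSet Q) (x : Plane) :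
    heat t (Q.indicator fun _ => (1 : ℝ)) x = ∫ z in Q, heatKernel t (x - z) := by
  rw [heat_eq_integral ht, ← integral_indicator hQ]
  refine integral_congr_ae (Eventually.of_forall fun z => ?_)
  by_cases hz : z ∈ Q <;> simp [hz]

/-- The kernel is a function of the norm, and the radial derivative of `e^{-r²/(2t)}` is bounded by
`1 / √t` because `w e^{-w²/2} ≤ 1` with `w = |r| / √t`. -/
theorem heatKernel_lipschitz {t : ℝ} (ht : 0 < t) (x y : Plane) :
    |heatKernel t x - heatKernel t y| ≤ (2 * Real.pi * t)⁻¹ * (√t)⁻¹ * ‖x - y‖ := by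
  have hst := Real.sqrt_pos.2 ht
  have h1 := abs_sub_le_of_hasDerivAt (f := fun r : ℝ => Real.exp (-r ^ 2 / (2 * t)))
    (f' := fun r => Real.exp (-r ^ 2 / (2 * t)) * (-(2 * r) / (2 * t))) (C := (√t)⁻¹)
    (fun r => by
      have := (((hasDerivAt_pow 2 r).neg).div_const (2 * t)).exp
      simpa using this)
    (fun r => by
      rw [abs_mul, abs_of_pos (Real.exp_pos _), neg_div (2 * t) (2 * r), abs_neg, mul_div_mul_left _ _ two_ne_zero,
        abs_div, abs_of_pos ht]
      set w := |r| / √t with hw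
      have e1 : |r| / t = w * (√t)⁻¹ := by
        rw [hw, div_mul_eq_mul_div, ← div_eq_mul_inv, div_div, Real.mul_self_sqrt ht.le]
      have e2 : -r ^ 2 / (2 * t) = -(w ^ 2 / 2) := by
        rw [hw, div_pow, sq_abs, Real.sq_sqrt ht.le]; field_simp
      rw [e1, e2, ← mul_assoc]
      refine mul_le_of_le_one_left (by positivity) ?_
      have h2 := Real.add_one_le_exp (w ^ 2 / 2)
      rw [Real.exp_neg, inv_mul_le_iff₀ (Real.exp_pos _), mul_one]
      nlinarith [sq_nonneg (w - 1)]) ‖x‖ ‖y‖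
  have hc : 0 < (2 * Real.pi * t)⁻¹ := by positivity
  rw [heatKernel, heatKernel, ← mul_sub, abs_mul, abs_of_pos hc, mul_assoc _ (√t)⁻¹]
  refine mul_le_mul_of_nonneg_left (h1.trans ?_) hc.le
  exact mul_le_mul_of_nonneg_left (abs_norm_sub_norm_le x y) (by positivity)

/-- A finite family of disjoint cells of positive finite area. -/
structure IsCells {n : ℕ} (Q : Fin n → Set Plane) : Prop where
  meas : ∀ i, MeasurableSet (Q i)
  disj : Pairwise fun i j => Disjoint (Q i) (Q j)
  fin : ∀ i, volume (Q i) ≠ ∞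
  pos : ∀ i, 0 < volume.real (Q i)

/-- The heat kernel averaged over the cell `Q i`, with the normalisation of `L²`. -/
def cellProfile (e : ℝ) {n : ℕ} (Q : Fin n → Set Plane) (i : Fin n) (y : Plane) : ℝ :=
  (√(volume.real (Q i)))⁻¹ * ∫ z in Q i, heatKernel e (y - z)

variable {n : ℕ} {Q : Fin n → Set Plane} {e : ℝ}

theorem expBound_indicator (Q : Set Plane) : ExpBound 0 1 (Q.indicator fun _ => (1 : ℝ)) :=
  ExpBound.of_bounded fun x => by by_cases hx : x ∈ Q <;> simp [hx]

/-- A profile is itself a heat flow at time `e` of a normalised indicator, so the semigroup property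
produces the shifted time `s + e`. -/
theorem IsCells.heat_cellProfile (hQ : IsCells Q) (he : 0 < e) {s : ℝ} (hs : 0 ≤ s) (i : Fin n)
    (y : Plane) : heat s (cellProfile e Q i) y =
      (√(volume.real (Q i)))⁻¹ * heat (s + e) ((Q i).indicator fun _ => 1) y := by
  have h1 : cellProfile e Q i = fun y => (√(volume.real (Q i)))⁻¹ *
      heat e ((Q i).indicator fun _ => 1) y := by
    ext y
    rw [cellProfile, heat_indicator he (hQ.meas i)]
  rw [h1, heat_const_mul]
  congr 1
  exact heat_heat hs he.le le_rfl (expBound_indicator _)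
    (stronglyMeasurable_const.indicator (hQ.meas i)) y

theorem IsCells.heat_indicator_le (hQ : IsCells Q) {r : ℝ} (hr : 0 < r) (i : Fin n) (y : Plane) :
    heat r ((Q i).indicator fun _ => 1) y ≤ (2 * Real.pi * r)⁻¹ * volume.real (Q i) := by
  rw [heat_indicator hr (hQ.meas i)]
  have h1 : ∫ _ in Q i, (2 * Real.pi * r)⁻¹ = (2 * Real.pi * r)⁻¹ * volume.real (Q i) := by
    rw [setIntegral_const, smul_eq_mul, mul_comm]
  rw [← h1]
  refine setIntegral_mono (integrable_heatKernel_sub hr y).integrableOn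
    (integrableOn_const (hQ.fin i)) fun z => heatKernel_le_inv hr _

theorem IsCells.sum_heat_indicator_le (hQ : IsCells Q) (r : ℝ) (y : Plane) :
    ∑ i, heat r ((Q i).indicator fun _ => (1 : ℝ)) y ≤ 1 := by
  have hi : ∀ i, Integrable (fun z => (Q i).indicator (fun _ => (1 : ℝ)) (y + √r • z)) stdG :=
    fun i => (expBound_indicator (Q i)).integrable le_rfl r
      (stronglyMeasurable_const.indicator (hQ.meas i)) y
  simp only [heat]
  rw [← integral_finsetSum _ fun i _ => hi i]
  have h1 : ∫ _ : Plane, (1 : ℝ) ∂stdG = 1 := by simp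
  refine le_trans ?_ h1.le
  refine integral_mono (integrable_finsetSum _ fun i _ => hi i) (integrable_const _) fun z => ?_
  simp only
  by_cases hz : ∃ i, y + √r • z ∈ Q i
  · obtain ⟨i, hz⟩ := hz
    rw [Finset.sum_eq_single i]
    · simp [hz]
    · intro j _ hj
      exact indicator_of_notMem (fun h => disjoint_left.1 (hQ.disj hj) h hz) _
    · simp
  · push Not at hz
    rw [Finset.sum_eq_zero fun i _ => indicator_of_notMem (hz i) _]
    exact zero_le_one

theorem cellProfile_nonneg (he : 0 < e) (i : Fin n) (y : Plane) : 0 ≤ cellProfile e Q i y :=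
  mul_nonneg (by positivity) (integral_nonneg fun z => heatKernel_nonneg he.le _)

theorem IsCells.continuous_cellProfile (hQ : IsCells Q) (he : 0 < e) (i : Fin n) :
    Continuous (cellProfile e Q i) := by
  refine continuous_const.mul ?_
  refine continuous_of_dominated (bound := fun _ => (2 * Real.pi * e)⁻¹)
    (fun y => (continuous_heatKernel_sub e y).aestronglyMeasurable)
    (fun y => Eventually.of_forall fun z => ?_) (integrableOn_const (hQ.fin i))
    (Eventually.of_forall fun z => (continuous_heatKernel e).comp (by fun_prop))
  rw [Real.norm_eq_abs, abs_of_nonneg (heatKernel_nonneg he.le _)]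
  exact heatKernel_le_inv he _

/-- One factor in the covariance sum is bounded by the supremum of the kernel times `√|Q_i|`. This
cancels the normalisation of the other factor, whose sum is at most `1` because the cells are
disjoint. By symmetry the larger of the two times may be chosen. The smallness of each profile comes
from the small area of its cell. -/
theorem IsCells.isNoiseData (hQ : IsCells Q) (he : 0 < e) {ϰ : ℝ} (hϰ : 0 ≤ ϰ)
    (hsmall : ∀ i, volume.real (Q i) ≤ 2 * Real.pi * e * ϰ ^ 2) (T : ℝ) :
    IsNoiseData T e ϰ (cellProfile e Q) := by
  have hle : ∀ s : ℝ, 0 ≤ s → ∀ i y, heat s (cellProfile e Q i) y ≤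
      (2 * Real.pi * (s + e))⁻¹ * √(volume.real (Q i)) := fun s hs i y => by
    rw [hQ.heat_cellProfile he hs]
    have hq := hQ.pos i
    have hsq := Real.sqrt_pos.2 hq
    calc _ ≤ (√(volume.real (Q i)))⁻¹ * ((2 * Real.pi * (s + e))⁻¹ * volume.real (Q i)) :=
          mul_le_mul_of_nonneg_left (hQ.heat_indicator_le (by linarith) i y) (by positivity)
      _ = (2 * Real.pi * (s + e))⁻¹ * (volume.real (Q i) / √(volume.real (Q i))) := by ring
      _ = _ := by rw [Real.div_sqrt]
  have hnn : ∀ s i y, 0 ≤ heat s (cellProfile e Q i) y := fun s i y =>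
    heat_nonneg (cellProfile_nonneg he i) y
  refine ⟨hQ.continuous_cellProfile he, cellProfile_nonneg he,
    ⟨(2 * Real.pi * e)⁻¹ * √(2 * Real.pi * e * ϰ ^ 2), fun i x => ?_⟩, ?_, ?_⟩
  · have := hle 0 le_rfl i x
    rw [heat_zero, zero_add] at this
    refine this.trans ?_
    gcongr
    exact hsmall i
  · have key : ∀ s, 0 ≤ s → ∀ s', 0 ≤ s' → ∀ y y',
        ∑ i, heat s (cellProfile e Q i) y * heat s' (cellProfile e Q i) y' ≤
        1 / (2 * Real.pi * (s + e)) := by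
      intro s hs s' hs' y y'
      have hse : 0 < s + e := by linarith
      calc ∑ i, heat s (cellProfile e Q i) y * heat s' (cellProfile e Q i) y'
          ≤ ∑ i, (2 * Real.pi * (s + e))⁻¹ * heat (s' + e) ((Q i).indicator fun _ => 1) y' := by
            refine Finset.sum_le_sum fun i _ => ?_
            have hsq := Real.sqrt_pos.2 (hQ.pos i)
            refine (mul_le_mul_of_nonneg_right (hle s hs i y) (hnn s' i y')).trans_eq ?_
            rw [hQ.heat_cellProfile he hs']
            field_simp
        _ = (2 * Real.pi * (s + e))⁻¹ *
              ∑ i, heat (s' + e) ((Q i).indicator fun _ => (1 : ℝ)) y' := by rw [Finset.mul_sum]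
        _ ≤ (2 * Real.pi * (s + e))⁻¹ * 1 := by
            gcongr
            exact hQ.sum_heat_indicator_le _ y'
        _ = _ := by rw [mul_one, one_div]
    intro s hs s' hs' y y'
    rcases le_total (s + e) (s' + e) with hh | hh
    · rw [max_eq_right hh]
      have := key s' hs'.1 s hs.1 y' y
      simpa only [mul_comm] using this
    · rw [max_eq_left hh]
      exact key s hs.1 s' hs'.1 y y'
  · intro s hs i y
    have hse : 0 < s + e := by linarith [hs.1]
    refine (hle s hs.1 i y).trans ?_
    have h2 : √(volume.real (Q i)) ≤ √(2 * Real.pi * (s + e)) * ϰ := by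
      rw [← Real.sqrt_sq hϰ, ← Real.sqrt_mul (by positivity)]
      apply Real.sqrt_le_sqrt
      refine (hsmall i).trans ?_
      gcongr
      linarith [hs.1]
    have hsp : 0 < √(2 * Real.pi * (s + e)) := by positivity
    calc _ ≤ (2 * Real.pi * (s + e))⁻¹ * (√(2 * Real.pi * (s + e)) * ϰ) := by gcongr
      _ = ϰ / (2 * Real.pi * (s + e) / √(2 * Real.pi * (s + e))) := by field_simp
      _ = _ := by rw [Real.div_sqrt]

/-- The normalised indicator of a cell. -/
def IsCells.unit (hQ : IsCells Q) (i : Fin n) : Lp ℝ 2 (volume : Measure Plane) :=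
  indicatorConstLp 2 (hQ.meas i) (hQ.fin i) (√(volume.real (Q i)))⁻¹

theorem IsCells.inner_unit (hQ : IsCells Q) (i j : Fin n) :
    inner ℝ (hQ.unit i) (hQ.unit j) = if i = j then (1 : ℝ) else 0 := by
  rw [IsCells.unit, IsCells.unit,
    L2.inner_indicatorConstLp_indicatorConstLp (hQ.meas i) (hQ.meas j) (hQ.fin i) (hQ.fin j)]
  split_ifs with h
  · subst h
    have hsq := Real.sqrt_pos.2 (hQ.pos i)
    rw [inter_self]
    simp only [RCLike.inner_apply, conj_trivial, smul_eq_mul, ← mul_inv,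
      Real.mul_self_sqrt (hQ.pos i).le]
    exact mul_inv_cancel₀ (hQ.pos i).ne'
  · rw [(disjoint_iff_inter_eq_empty.1 (hQ.disj h))]
    simp

/-- The profiles are the coefficients of the kernel along the orthonormal cell indicators, so the
finite-dimensional noise is the white noise tested against the orthogonal projection of the kernel.
-/
theorem IsCells.inner_unit_heatKernelLp (hQ : IsCells Q) (he : 0 < e) (i : Fin n) (y : Plane) :
    inner ℝ (hQ.unit i) (heatKernelLp e he y) = cellProfile e Q i y := by
  rw [IsCells.unit, L2.inner_indicatorConstLp_eq_inner_setIntegral, cellProfile]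
  have : ∫ z in Q i, heatKernelLp e he y z = ∫ z in Q i, heatKernel e (y - z) :=
    setIntegral_congr_ae (hQ.meas i) (((memLp_heatKernel he y).coeFn_toLp).mono fun z hz _ => hz)
  rw [this]
  simp [mul_comm]

theorem inner_heatKernelLp_self (he : 0 < e) (y : Plane) :
    inner ℝ (heatKernelLp e he y) (heatKernelLp e he y) = ∫ z, heatKernel e (y - z) ^ 2 := by
  rw [L2.inner_def]
  refine integral_congr_ae (((memLp_heatKernel he y).coeFn_toLp).mono fun z hz => ?_)
  simp only [heatKernelLp]
  rw [hz]
  simp [sq]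

section WhiteNoise

variable {Ω : Type*} [MeasurableSpace Ω] {P : Measure Ω}
  {W : Lp ℝ 2 (volume : Measure Plane) → Ω → ℝ}

/-- The white noise tested against the normalised indicators of the cells. -/
def IsCells.noise (hQ : IsCells Q) (W : Lp ℝ 2 (volume : Measure Plane) → Ω → ℝ) (ω : Ω)
    (i : Fin n) : ℝ := W (hQ.unit i) ω

theorem IsWhiteNoise.memLp (hW : IsWhiteNoise P W) (h : Lp ℝ 2 (volume : Measure Plane)) :
    MemLp (W h) 2 P := (hW.gaussian.hasGaussianLaw_eval h).memLp_two

theorem IsCells.aemeasurable_noise (hQ : IsCells Q) (hW : IsWhiteNoise P W) :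
    AEMeasurable (hQ.noise W) P :=
  aemeasurable_pi_lambda _ fun i => hW.gaussian.aemeasurable (hQ.unit i)

/-- The values of the noise on the orthonormal cell indicators are jointly Gaussian and
uncorrelated, hence independent, and each has mean zero and variance one. -/
theorem IsCells.map_noise (hQ : IsCells Q) (hW : IsWhiteNoise P W) :
    P.map (hQ.noise W) = gaussN n := by
  have hP := hW.gaussian.isProbabilityMeasure
  have hcov : ∀ i j, cov[W (hQ.unit i), W (hQ.unit j); P] = if i = j then 1 else 0 := by
    intro i j
    rw [covariance_eq_sub (hW.memLp _) (hW.memLp _), hW.mean_zero, hW.mean_zero, mul_zero, sub_zero,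
      ← hQ.inner_unit, ← hW.covariance]
    rfl
  have hind := (hW.gaussian.comp_right fun p : (_ : Fin n) × Unit => hQ.unit p.1)
    |>.iIndepFun_of_covariance_eq_zero (X := fun i _ => W (hQ.unit i))
      (fun i _ => hW.gaussian.aemeasurable _) fun i j hij _ _ => by rw [hcov, if_neg hij]
  have hind2 : iIndepFun (fun i => W (hQ.unit i)) P :=
    hind.comp (fun _ (f : Unit → ℝ) => f ()) fun _ => measurable_pi_apply ()
  have h1 := (iIndepFun_iff_map_fun_eq_pi_map fun i => hW.gaussian.aemeasurable (hQ.unit i)).1 hind2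
  change P.map (fun ω i => W (hQ.unit i) ω) = _
  rw [h1]
  congr 1
  ext1 i
  rw [(hW.gaussian.hasGaussianLaw_eval (hQ.unit i)).map_eq_gaussianReal, hW.mean_zero,
    ← covariance_self (hW.gaussian.aemeasurable _), hcov, if_pos rfl]
  simp

/-- The mean square error of the approximation of the mollified noise. -/
theorem IsCells.integral_sq_sub (hQ : IsCells Q) (hW : IsWhiteNoise P W) (he : 0 < e) (y : Plane) :
    ∫ ω, (W (heatKernelLp e he y) ω - linComb (cellProfile e Q) (hQ.noise W ω) y) ^ 2 ∂P =
      (∫ z, heatKernel e (y - z) ^ 2) - ∑ i, cellProfile e Q i y ^ 2 := by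
  set c := fun i => cellProfile e Q i y with hc
  have e1 : ∀ ω, (W (heatKernelLp e he y) ω - linComb (cellProfile e Q) (hQ.noise W ω) y) ^ 2 =
      W (heatKernelLp e he y) ω * W (heatKernelLp e he y) ω -
      2 * (∑ i, c i * (W (hQ.unit i) ω * W (heatKernelLp e he y) ω)) +
      ∑ i, ∑ j, c i * c j * (W (hQ.unit i) ω * W (hQ.unit j) ω) := by
    intro ω
    have e2 : linComb (cellProfile e Q) (hQ.noise W ω) y = ∑ i, c i * W (hQ.unit i) ω :=
      Finset.sum_congr rfl fun i _ => mul_comm _ _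
    have e3 : ∑ i, c i * (W (hQ.unit i) ω * W (heatKernelLp e he y) ω) =
        (∑ i, c i * W (hQ.unit i) ω) * W (heatKernelLp e he y) ω := by
      rw [Finset.sum_mul]; exact Finset.sum_congr rfl fun i _ => by ring
    have e4 : ∑ i, ∑ j, c i * c j * (W (hQ.unit i) ω * W (hQ.unit j) ω) =
        (∑ i, c i * W (hQ.unit i) ω) * ∑ i, c i * W (hQ.unit i) ω := by
      rw [Finset.sum_mul_sum]
      exact Finset.sum_congr rfl fun i _ => Finset.sum_congr rfl fun j _ => by ring
    rw [e2, e3, e4]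
    ring
  have i1 : ∀ f g, Integrable (fun ω => W f ω * W g ω) P := fun f g =>
    (hW.memLp f).integrable_mul (hW.memLp g)
  have i2 : Integrable (fun ω => ∑ i, c i * (W (hQ.unit i) ω * W (heatKernelLp e he y) ω)) P :=
    integrable_finsetSum _ fun i _ => (i1 _ _).const_mul _
  have i3 : Integrable (fun ω => ∑ i, ∑ j, c i * c j * (W (hQ.unit i) ω * W (hQ.unit j) ω)) P :=
    integrable_finsetSum _ fun i _ => integrable_finsetSum _ fun j _ => (i1 _ _).const_mul _
  have i4 : Integrable (fun ω => W (heatKernelLp e he y) ω * W (heatKernelLp e he y) ω -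
      2 * (∑ i, c i * (W (hQ.unit i) ω * W (heatKernelLp e he y) ω))) P :=
    (i1 _ _).sub (i2.const_mul _)
  simp_rw [e1]
  rw [integral_add i4 i3, integral_sub (i1 _ _) (i2.const_mul _), integral_const_mul,
    integral_finsetSum _ fun i _ => (i1 _ _).const_mul _,
    integral_finsetSum _ fun i _ => integrable_finsetSum _ fun j _ => (i1 _ _).const_mul _]
  have e5 : ∀ i, ∫ ω, ∑ j, c i * c j * (W (hQ.unit i) ω * W (hQ.unit j) ω) ∂P = c i ^ 2 := by
    intro i
    rw [integral_finsetSum _ fun j _ => (i1 _ _).const_mul _]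
    simp_rw [integral_const_mul, hW.covariance, hQ.inner_unit]
    simp [sq]
  simp_rw [e5, integral_const_mul, hW.covariance, hQ.inner_unit_heatKernelLp he]
  rw [inner_heatKernelLp_self]
  have e6 : ∑ i, c i * cellProfile e Q i y = ∑ i, c i ^ 2 :=
    Finset.sum_congr rfl fun i _ => (sq _).symm
  rw [e6]
  ring

end WhiteNoise

end

section
/-! ### Approximation of the mollified noise on a grid -/

/-- The left side is the squared distance of `f` to the constants in `L²(Q)`, which no choice of
constant `c` improves on. -/
theorem setIntegral_sq_sub_le {Q : Set Plane} (hQ : MeasurableSet Q) (hfin : volume Q ≠ ∞)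
    (hpos : 0 < volume.real Q) {f : Plane → ℝ} (hf : IntegrableOn f Q)
    (hf2 : IntegrableOn (fun z => f z ^ 2) Q) {c η : ℝ} (hη : ∀ z ∈ Q, |f z - c| ≤ η) :
    (∫ z in Q, f z ^ 2) - ((√(volume.real Q))⁻¹ * ∫ z in Q, f z) ^ 2 ≤ η ^ 2 * volume.real Q := by
  set v := volume.real Q with hv
  set I := ∫ z in Q, f z with hI
  have hc : IntegrableOn (fun _ : Plane => c ^ 2) Q := integrableOn_const hfin
  have h2 : IntegrableOn (fun z => f z ^ 2 - 2 * c * f z) Q := hf2.sub (hf.const_mul _)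
  have e1 : ∫ z in Q, (f z - c) ^ 2 = (∫ z in Q, f z ^ 2) - 2 * c * I + c ^ 2 * v := by
    have : ∀ z, (f z - c) ^ 2 = f z ^ 2 - 2 * c * f z + c ^ 2 := fun z => by ring
    simp_rw [this]
    rw [integral_add h2 hc, integral_sub hf2 (hf.const_mul _), integral_const_mul,
      setIntegral_const, smul_eq_mul]
    ring
  have h3 : ∫ z in Q, (f z - c) ^ 2 ≤ ∫ _ in Q, η ^ 2 := by
    refine setIntegral_mono_on ?_ (integrableOn_const hfin) hQ fun z hz => ?_
    · have h4 : IntegrableOn (fun z => f z ^ 2 - 2 * c * f z + c ^ 2) Q := h2.add hc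
      refine h4.congr (Eventually.of_forall fun z => ?_)
      simp only
      ring
    · rw [← sq_abs]
      exact pow_le_pow_left₀ (abs_nonneg _) (hη z hz) 2
  rw [setIntegral_const, smul_eq_mul, ← hv] at h3
  have h5 : ((√v)⁻¹ * I) ^ 2 = I ^ 2 / v := by
    rw [mul_pow, inv_pow, Real.sq_sqrt hpos.le]; ring
  have h6 : 0 ≤ (I - c * v) ^ 2 / v := by positivity
  have h7 : (I - c * v) ^ 2 / v = I ^ 2 / v - 2 * c * I + c ^ 2 * v := by field_simp; ring
  rw [h5]
  linarith

theorem integrable_heatKernel_sub_sq {e : ℝ} (he : 0 < e) (y : Plane) :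
    Integrable fun z => heatKernel e (y - z) ^ 2 := (memLp_heatKernel he y).integrable_sq

/-- The defect in Bessel's inequality has two sources: the mass of the kernel outside the cells, and
its oscillation inside each cell, which is at most its Lipschitz constant times the diameter. -/
theorem IsCells.error_le {n : ℕ} {Q : Fin n → Set Plane} (hQ : IsCells Q) {e : ℝ} (he : 0 < e)
    {d : ℝ} (hd : ∀ i, ∀ z ∈ Q i, ∀ z' ∈ Q i, ‖z - z'‖ ≤ d) (y : Plane) :
    (∫ z, heatKernel e (y - z) ^ 2) - ∑ i, cellProfile e Q i y ^ 2 ≤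
      (∫ z in (⋃ i, Q i)ᶜ, heatKernel e (y - z) ^ 2) +
        ((2 * Real.pi * e)⁻¹ * (√e)⁻¹ * d) ^ 2 * ∑ i, volume.real (Q i) := by
  have hi := integrable_heatKernel_sub_sq he y
  have hm : MeasurableSet (⋃ i, Q i) := MeasurableSet.iUnion hQ.meas
  rw [← integral_add_compl hm hi, integral_iUnion_fintype hQ.meas hQ.disj
    fun i => hi.integrableOn, Finset.mul_sum]
  have h1 : ∀ i, (∫ z in Q i, heatKernel e (y - z) ^ 2) - cellProfile e Q i y ^ 2 ≤
      ((2 * Real.pi * e)⁻¹ * (√e)⁻¹ * d) ^ 2 * volume.real (Q i) := by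
    intro i
    have hne : (Q i).Nonempty := by
      by_contra hemp
      have := hQ.pos i
      rw [not_nonempty_iff_eq_empty.1 hemp] at this
      simp at this
    obtain ⟨z₀, hz₀⟩ := hne
    refine setIntegral_sq_sub_le (hQ.meas i) (hQ.fin i) (hQ.pos i)
      (integrable_heatKernel_sub he y).integrableOn hi.integrableOn
      (c := heatKernel e (y - z₀)) fun z hz => (heatKernel_lipschitz he _ _).trans ?_
    rw [sub_sub_sub_cancel_left, norm_sub_rev]
    exact mul_le_mul_of_nonneg_left (hd i z hz z₀ hz₀) (by positivity)
  have h2 := Finset.sum_le_sum fun i (_ : i ∈ Finset.univ) => h1 i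
  rw [Finset.sum_sub_distrib] at h2
  linarith

/-- The cell of index `c` in the grid of mesh `1 / m`. -/
def gridCell (m : ℕ) (c : ℤ × ℤ) : Set Plane := {z | ⌊(m : ℝ) * z 0⌋ = c.1 ∧ ⌊(m : ℝ) * z 1⌋ = c.2}

theorem measurableSet_gridCell (m : ℕ) (c : ℤ × ℤ) : MeasurableSet (gridCell m c) := by
  have h : ∀ i : Fin 2, Measurable fun z : Plane => ⌊(m : ℝ) * z i⌋ := fun i =>
    Int.measurable_floor.comp (by fun_prop)
  exact ((h 0) (measurableSet_singleton c.1)).inter ((h 1) (measurableSet_singleton c.2))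

theorem volume_gridCell {m : ℕ} (hm : 0 < m) (c : ℤ × ℤ) :
    volume (gridCell m c) = ENNReal.ofReal ((m : ℝ)⁻¹ ^ 2) := by
  have hm' : (0 : ℝ) < m := by exact_mod_cast hm
  have hv := (PiLp.volume_preserving_toLp (Fin 2)).measure_preimage
    (measurableSet_gridCell m c).nullMeasurableSet
  have e1 : (WithLp.toLp 2 : (Fin 2 → ℝ) → Plane) ⁻¹' gridCell m c =
      Set.pi univ fun i => Ico (![(c.1 : ℝ) / m, (c.2 : ℝ) / m] i)
        (![((c.1 : ℝ) + 1) / m, ((c.2 : ℝ) + 1) / m] i) := by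
    ext w
    simp only [gridCell, mem_preimage, mem_ofPred_eq, Int.floor_eq_iff, Set.mem_pi, mem_univ,
      true_imp_iff, Fin.forall_fin_two, mem_Ico, Matrix.cons_val_zero, Matrix.cons_val_one,
      div_le_iff₀ hm', lt_div_iff₀ hm', mul_comm (m : ℝ)]
  rw [← hv, e1, Real.volume_pi_Ico, Fin.prod_univ_two]
  simp only [Matrix.cons_val_zero, Matrix.cons_val_one]
  rw [← ENNReal.ofReal_mul (by rw [← sub_div]; simp)]
  congr 1
  ring

theorem norm_sub_le_of_mem_gridCell {m : ℕ} (hm : 0 < m) {c : ℤ × ℤ} {z z' : Plane}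
    (hz : z ∈ gridCell m c) (hz' : z' ∈ gridCell m c) : ‖z - z'‖ ≤ 2 * (m : ℝ)⁻¹ := by
  have hm' : (0 : ℝ) < m := by exact_mod_cast hm
  have key : ∀ i : Fin 2, ⌊(m : ℝ) * z i⌋ = ⌊(m : ℝ) * z' i⌋ → |z i - z' i| ≤ (m : ℝ)⁻¹ := by
    intro i hi
    have := (Int.abs_sub_lt_one_of_floor_eq_floor hi).le
    rw [← mul_sub, abs_mul, abs_of_pos hm'] at this
    rwa [← one_div, le_div_iff₀ hm', mul_comm]
  have h0 := key 0 (hz.1.trans hz'.1.symm)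
  have h1 := key 1 (hz.2.trans hz'.2.symm)
  rw [EuclideanSpace.norm_eq, Fin.sum_univ_two]
  apply Real.sqrt_le_iff.2
  refine ⟨by positivity, ?_⟩
  simp only [PiLp.sub_apply, Real.norm_eq_abs]
  nlinarith [pow_le_pow_left₀ (abs_nonneg _) h0 2, pow_le_pow_left₀ (abs_nonneg _) h1 2]

/-- The indices of the cells that cover the square of side `2M`. -/
def gridIndex (M : ℕ) : Finset (ℤ × ℤ) :=
  Finset.Ico (-(M : ℤ) ^ 3) ((M : ℤ) ^ 3) ×ˢ Finset.Ico (-(M : ℤ) ^ 3) ((M : ℤ) ^ 3)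

/-- The cells of mesh `1 / M²` that cover the square of side `2M`. -/
def grid (M : ℕ) (i : Fin (gridIndex M).card) : Set Plane :=
  gridCell (M ^ 2) ((gridIndex M).equivFin.symm i).1

theorem isCells_grid {M : ℕ} (hM : 0 < M) : IsCells (grid M) := by
  have hm : 0 < M ^ 2 := by positivity
  refine ⟨fun i => measurableSet_gridCell _ _, fun i j hij => ?_, fun i => ?_, fun i => ?_⟩
  · refine disjoint_left.2 fun z hz hz' => ?_
    apply hij
    apply (gridIndex M).equivFin.symm.injective
    apply Subtype.ext
    exact Prod.ext (hz.1.symm.trans hz'.1) (hz.2.symm.trans hz'.2)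
  · rw [grid, volume_gridCell hm]
    exact ENNReal.ofReal_ne_top
  · rw [grid, Measure.real, volume_gridCell hm, ENNReal.toReal_ofReal (by positivity)]
    positivity

theorem volume_real_grid {M : ℕ} (hM : 0 < M) (i : Fin (gridIndex M).card) :
    volume.real (grid M i) = ((M : ℝ) ^ 4)⁻¹ := by
  rw [grid, Measure.real, volume_gridCell (by positivity), ENNReal.toReal_ofReal (by positivity)]
  push_cast
  rw [inv_pow, ← pow_mul]

theorem card_gridIndex (M : ℕ) : ((gridIndex M).card : ℝ) = 4 * (M : ℝ) ^ 6 := by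
  have h : (Finset.Ico (-(M : ℤ) ^ 3) ((M : ℤ) ^ 3)).card = 2 * M ^ 3 := by
    rw [Int.card_Ico, sub_neg_eq_add]
    have : (M : ℤ) ^ 3 + (M : ℤ) ^ 3 = ((2 * M ^ 3 : ℕ) : ℤ) := by push_cast; ring
    rw [this, Int.toNat_natCast]
  rw [gridIndex, Finset.card_product, h]
  push_cast
  ring

theorem mem_iUnion_grid {M : ℕ} (hM : 0 < M) {z : Plane} (hz : ‖z‖ < M) : z ∈ ⋃ i, grid M i := by
  have hM' : (0 : ℝ) < M := by exact_mod_cast hM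
  have key : ∀ i : Fin 2, ⌊((M ^ 2 : ℕ) : ℝ) * z i⌋ ∈ Finset.Ico (-(M : ℤ) ^ 3) ((M : ℤ) ^ 3) := by
    intro i
    have h1 : |z i| < M := (PiLp.norm_apply_le z i).trans_lt hz
    rw [abs_lt] at h1
    rw [Finset.mem_Ico, Int.le_floor, Int.floor_lt]
    push_cast
    constructor <;> nlinarith [h1.1, h1.2, pow_pos hM' 2]
  set c : ℤ × ℤ := (⌊((M ^ 2 : ℕ) : ℝ) * z 0⌋, ⌊((M ^ 2 : ℕ) : ℝ) * z 1⌋) with hc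
  have hmem : c ∈ gridIndex M := Finset.mem_product.2 ⟨key 0, key 1⟩
  rw [mem_iUnion]
  refine ⟨(gridIndex M).equivFin ⟨c, hmem⟩, ?_⟩
  rw [grid, Equiv.symm_apply_apply]
  exact ⟨rfl, rfl⟩

/-- With `M = N + 1`, the cells cover a square of area `4M²`, and their squared diameter is at most
`4M⁻⁴`. The mesh is thus fine enough for the oscillation error `O(M⁻²)` to vanish although the
region grows. The mass outside tends to zero by dominated convergence, and Bessel's inequality gives
nonnegativity. -/
theorem tendsto_grid_error {e : ℝ} (he : 0 < e) (y : Plane) :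
    Tendsto (fun N : ℕ => (∫ z, heatKernel e (y - z) ^ 2) -
      ∑ i, cellProfile e (grid (N + 1)) i y ^ 2) atTop (𝓝 0) := by
  have hi := integrable_heatKernel_sub_sq he y
  set A := (2 * Real.pi * e)⁻¹ * (√e)⁻¹ with hA
  have h0 : ∀ N : ℕ, 0 ≤ (∫ z, heatKernel e (y - z) ^ 2) -
      ∑ i, cellProfile e (grid (N + 1)) i y ^ 2 := by
    intro N
    have hQ := isCells_grid N.succ_pos
    rw [← inner_heatKernelLp_self he]
    simp_rw [← hQ.inner_unit_heatKernelLp he]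
    have hon : Orthonormal ℝ hQ.unit := orthonormal_iff_ite.2 hQ.inner_unit
    have := hon.sum_inner_products_le (heatKernelLp e he y) (s := Finset.univ)
    rw [real_inner_self_eq_norm_sq]
    simp only [Real.norm_eq_abs, sq_abs] at this
    linarith
  have h1 : ∀ N : ℕ, (∫ z, heatKernel e (y - z) ^ 2) -
      ∑ i, cellProfile e (grid (N + 1)) i y ^ 2 ≤
      (∫ z, {z : Plane | (N : ℝ) + 1 ≤ ‖z‖}.indicator (fun z => heatKernel e (y - z) ^ 2) z) +
        16 * A ^ 2 * (((N : ℝ) + 1)⁻¹) ^ 2 := by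
    intro N
    have hQ := isCells_grid N.succ_pos
    have hm : MeasurableSet {z : Plane | (N : ℝ) + 1 ≤ ‖z‖} :=
      measurableSet_le measurable_const measurable_norm
    have hN : (0 : ℝ) < N + 1 := by positivity
    refine (hQ.error_le he (d := 2 * (((N + 1) ^ 2 : ℕ) : ℝ)⁻¹) (fun i z hz z' hz' =>
      norm_sub_le_of_mem_gridCell (by positivity) hz hz') y).trans (add_le_add ?_ (le_of_eq ?_))
    · rw [integral_indicator hm]
      refine setIntegral_mono_set hi.integrableOn (Eventually.of_forall fun z => sq_nonneg _)
        (Eventually.of_forall fun z hz => ?_)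
      by_contra hlt
      refine hz (mem_iUnion_grid N.succ_pos ?_)
      push_cast
      exact not_le.1 hlt
    · simp_rw [volume_real_grid N.succ_pos]
      rw [Finset.sum_const, Finset.card_univ, Fintype.card_fin, nsmul_eq_mul, card_gridIndex]
      rw [← hA]
      push_cast
      field_simp
      ring
  refine squeeze_zero h0 h1 ?_
  have t1 : Tendsto (fun N : ℕ => ∫ z, {z : Plane | (N : ℝ) + 1 ≤ ‖z‖}.indicator
      (fun z => heatKernel e (y - z) ^ 2) z) atTop (𝓝 (∫ _ : Plane, (0 : ℝ))) := by
    refine tendsto_integral_of_dominated_convergence (fun z => heatKernel e (y - z) ^ 2)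
      (fun N => hi.1.indicator (measurableSet_le measurable_const measurable_norm)) hi
      (fun N => Eventually.of_forall fun z => ?_) (Eventually.of_forall fun z => ?_)
    · refine (norm_indicator_le_norm_self _ _).trans_eq ?_
      rw [Real.norm_eq_abs, abs_of_nonneg (sq_nonneg _)]
    · obtain ⟨N₀, hN₀⟩ := exists_nat_gt ‖z‖
      refine tendsto_const_nhds.congr' ?_
      filter_upwards [eventually_ge_atTop N₀] with N hN
      have : (N₀ : ℝ) ≤ N := by exact_mod_cast hN
      rw [indicator_of_notMem]
      simp only [mem_ofPred_eq, not_le]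
      linarith
  have t2 : Tendsto (fun N : ℕ => 16 * A ^ 2 * (((N : ℝ) + 1)⁻¹) ^ 2) atTop
      (𝓝 (16 * A ^ 2 * 0 ^ 2)) := by
    have : Tendsto (fun N : ℕ => ((N : ℝ) + 1)⁻¹) atTop (𝓝 0) := by
      simpa [one_div] using tendsto_one_div_add_atTop_nhds_zero_nat (𝕜 := ℝ)
    exact (this.pow 2).const_mul _
  have := t1.add t2
  simpa using this

/-- The mollified white noise is approximated by finite-dimensional noises. -/
theorem IsWhiteNoise.exists_approx {Ω : Type*} [MeasurableSpace Ω] {P : Measure Ω}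
    {W : Lp ℝ 2 (volume : Measure Plane) → Ω → ℝ} (hW : IsWhiteNoise P W) {e : ℝ} (he : 0 < e)
    {ϰ : ℝ} (hϰ : 0 < ϰ) :
    ∃ (n : ℕ → ℕ) (γ : ∀ N, Fin (n N) → Plane → ℝ) (G : ∀ N, Ω → Fin (n N) → ℝ)
      (ζ : ℕ → Plane → ℝ) (K : ℝ), (∀ᶠ N in atTop, ∀ T, IsNoiseData T e ϰ (γ N)) ∧
      (∀ N, AEMeasurable (G N) P ∧ P.map (G N) = gaussN (n N)) ∧
      (∀ N, Continuous (ζ N)) ∧ (∀ N y, 0 ≤ ζ N y) ∧ (∀ N y, ζ N y ≤ K) ∧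
      (∀ y, Tendsto (fun N => ζ N y) atTop (𝓝 0)) ∧
      ∀ N y, eLpNorm (fun ω => W (heatKernelLp e he y) ω - linComb (γ N) (G N ω) y) 2 P ≤
        ENNReal.ofReal (ζ N y) := by
  have hQ : ∀ N : ℕ, IsCells (grid (N + 1)) := fun N => isCells_grid N.succ_pos
  have hconst : ∀ y : Plane, ∫ z, heatKernel e (y - z) ^ 2 = ∫ z, heatKernel e z ^ 2 := fun y =>
    integral_sub_left_eq_self (fun z => heatKernel e z ^ 2) volume y
  set κ := ∫ z, heatKernel e z ^ 2 with hκ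
  -- `ζ N y` is the square root of the Bessel defect, that is, the exact `L²` distance between the
  -- two initial fields. It is bounded by the norm of the kernel, which does not depend on `y` by
  -- translation invariance.
  refine ⟨fun N => (gridIndex (N + 1)).card, fun N => cellProfile e (grid (N + 1)),
    fun N => (hQ N).noise W, fun N y => √(κ - ∑ i, cellProfile e (grid (N + 1)) i y ^ 2), √κ,
    ?_, fun N => ⟨(hQ N).aemeasurable_noise hW, (hQ N).map_noise hW⟩, fun N => ?_,
    fun N y => Real.sqrt_nonneg _, fun N y => Real.sqrt_le_sqrt ?_, fun y => ?_, fun N y => ?_⟩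
  · have hlim : Tendsto (fun N : ℕ => (((N : ℝ) + 1)⁻¹) ^ 4) atTop (𝓝 (0 ^ 4)) := by
      have : Tendsto (fun N : ℕ => ((N : ℝ) + 1)⁻¹) atTop (𝓝 0) := by
        simpa [one_div] using tendsto_one_div_add_atTop_nhds_zero_nat (𝕜 := ℝ)
      exact this.pow 4
    have hpos : (0 : ℝ) ^ 4 < 2 * Real.pi * e * ϰ ^ 2 := by
      rw [zero_pow (by norm_num)]; positivity
    filter_upwards [hlim.eventually_le_const hpos] with N hN T
    refine (hQ N).isNoiseData he hϰ.le (fun i => ?_) T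
    rw [volume_real_grid N.succ_pos]
    push_cast
    rwa [inv_pow] at hN
  · have := fun i => (hQ N).continuous_cellProfile he i
    fun_prop
  · have : 0 ≤ ∑ i, cellProfile e (grid (N + 1)) i y ^ 2 := Finset.sum_nonneg fun i _ => sq_nonneg _
    linarith
  · have := (tendsto_grid_error he y).sqrt
    simp only [hconst, Real.sqrt_zero] at this
    exact this
  · have hm : MemLp (fun ω => W (heatKernelLp e he y) ω -
        linComb (cellProfile e (grid (N + 1))) ((hQ N).noise W ω) y) 2 P :=
      (hW.memLp _).sub (memLp_finsetSum _ fun i _ => (hW.memLp ((hQ N).unit i)).mul_const _)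
    rw [eLpNorm_two_le_ofReal_iff hm (Real.sqrt_nonneg _), (hQ N).integral_sq_sub hW he, hconst,
      Real.sq_sqrt]
    rw [← hconst y, ← (hQ N).integral_sq_sub hW he]
    exact integral_nonneg fun ω => sq_nonneg _

end

section
/-! ### Measurable versions and the rescaled reaction term -/

/-- A random field whose paths are almost surely continuous has a version with measurable values and
continuous paths. -/
theorem exists_measurable_continuous_version {S Ω : Type*} [TopologicalSpace S]
    [TopologicalSpace.SeparableSpace S] [FrechetUrysohnSpace S] [Nonempty S] [MeasurableSpace Ω]
    {P : Measure Ω} {X : S → Ω → ℝ} (hX : ∀ p, AEMeasurable (X p) P)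
    (hc : ∀ᵐ ω ∂P, Continuous fun p => X p ω) :
    ∃ Y : S → Ω → ℝ, (∀ p, Measurable (Y p)) ∧ (∀ ω, Continuous fun p => Y p ω) ∧
      ∀ᵐ ω ∂P, ∀ p, Y p ω = X p ω := by
  classical
  set d := TopologicalSpace.denseSeq S
  have hA : ∀ᵐ ω ∂P, ∀ n, X (d n) ω = (hX (d n)).mk _ ω :=
    ae_all_iff.2 fun n => (hX (d n)).ae_eq_mk
  have hgood : ∀ᵐ ω ∂P, (Continuous fun p => X p ω) ∧ ∀ n, X (d n) ω = (hX (d n)).mk _ ω :=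
    hc.and hA
  set B := toMeasurable P {ω | ¬((Continuous fun p => X p ω) ∧
    ∀ n, X (d n) ω = (hX (d n)).mk _ ω)} with hB
  have hBm : MeasurableSet B := measurableSet_toMeasurable _ _
  have hB0 : P B = 0 := by rw [hB, measure_toMeasurable]; exact hgood
  have hBc : ∀ ω, ω ∉ B → (Continuous fun p => X p ω) ∧ ∀ n, X (d n) ω = (hX (d n)).mk _ ω :=
    fun ω hω => by
      by_contra hcon
      exact hω (subset_toMeasurable _ _ hcon)
  set Y : S → Ω → ℝ := fun p ω => if ω ∈ B then 0 else X p ω with hY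
  have hYc : ∀ ω, Continuous fun p => Y p ω := fun ω => by
    by_cases hω : ω ∈ B
    · simp only [hY, hω, if_true]; exact continuous_const
    · simp only [hY, hω, if_false]; exact (hBc ω hω).1
  have hYd : ∀ n, Measurable (Y (d n)) := fun n => by
    have : Y (d n) = fun ω => if ω ∈ B then 0 else (hX (d n)).mk _ ω := by
      ext ω
      by_cases hω : ω ∈ B
      · simp [hY, hω]
      · simp [hY, hω, (hBc ω hω).2 n]
    rw [this]
    exact Measurable.ite hBm measurable_const (hX (d n)).measurable_mk
  refine ⟨Y, fun p => ?_, hYc, ?_⟩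
  · obtain ⟨x, hx, hxp⟩ := mem_closure_iff_seq_limit.1 (TopologicalSpace.denseRange_denseSeq S p)
    refine measurable_of_tendsto_metrizable (f := fun n => Y (x n)) (fun n => ?_) ?_
    · obtain ⟨j, hj⟩ := hx n
      rw [← hj]
      exact hYd j
    · exact tendsto_pi_nhds.2 fun ω => ((hYc ω).tendsto p).comp hxp
  · have : ∀ᵐ ω ∂P, ω ∉ B := measure_eq_zero_iff_ae_notMem.1 hB0
    filter_upwards [this] with ω hω p
    simp [hY, hω]

/-- The derivative of a jointly continuous function is jointly continuous if it is uniformly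
Lipschitz. -/
theorem continuous_deriv_of_lipschitz {h h' : ℝ → ℝ → ℝ} {C : ℝ} (hC : 0 ≤ C)
    (hc : Continuous (Function.uncurry h)) (hd : ∀ s u, HasDerivAt (h s) (h' s u) u)
    (hl : ∀ s u v, |h' s u - h' s v| ≤ C * |u - v|) : Continuous (Function.uncurry h') := by
  refine continuous_prod_of_continuous_lipschitzWith' _ C.toNNReal (fun s => ?_) (fun u => ?_)
  · refine LipschitzWith.of_dist_le_mul fun u v => ?_
    rw [Real.coe_toNNReal _ hC, Real.dist_eq, Real.dist_eq]
    exact hl s u v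
  -- Difference quotients with step `1 / (n + 1)` are continuous in `s` and converge to `h'` at the
  -- rate `C / (n + 1)`, uniformly in `s`.
  · have hunif : TendstoUniformly
        (fun (n : ℕ) s => ((n : ℝ) + 1) * (h s (u + 1 / ((n : ℝ) + 1)) - h s u))
        (fun s => h' s u) atTop := by
      rw [Metric.tendstoUniformly_iff]
      intro r hr
      have hlim : Tendsto (fun n : ℕ => C * (1 / ((n : ℝ) + 1))) atTop (𝓝 (C * 0)) :=
        tendsto_one_div_add_atTop_nhds_zero_nat.const_mul C
      rw [mul_zero] at hlim
      filter_upwards [hlim.eventually_lt_const hr] with n hn s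
      refine lt_of_le_of_lt ?_ hn
      set τ : ℝ := 1 / ((n : ℝ) + 1) with hτ
      have hn1 : (0 : ℝ) < (n : ℝ) + 1 := by positivity
      have hτ0 : 0 < τ := by positivity
      have hτn : ((n : ℝ) + 1) * τ = 1 := by rw [hτ]; field_simp
      have h2 := (convex_Icc u (u + τ)).norm_image_sub_le_of_norm_hasDerivWithin_le
        (f := fun x => h s x - h' s u * x) (f' := fun x => h' s x - h' s u) (C := C * τ)
        (fun x _ => ((hd s x).sub
          (by simpa using (hasDerivAt_id x).const_mul (h' s u))).hasDerivWithinAt)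
        (fun x hx => (hl s x u).trans (mul_le_mul_of_nonneg_left
          (by rw [abs_of_nonneg (by linarith [hx.1])]; linarith [hx.2]) hC))
        ⟨le_rfl, by linarith⟩ ⟨by linarith, le_rfl⟩
      simp only [Real.norm_eq_abs, add_sub_cancel_left, abs_of_pos hτ0] at h2
      rw [dist_comm, Real.dist_eq]
      have e1 : ((n : ℝ) + 1) * (h s (u + τ) - h s u) - h' s u =
          ((n : ℝ) + 1) * (h s (u + τ) - h' s u * (u + τ) - (h s u - h' s u * u)) := by
        linear_combination (h' s u) * hτn
      rw [e1, abs_mul, abs_of_pos hn1]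
      calc ((n : ℝ) + 1) * _ ≤ ((n : ℝ) + 1) * (C * τ * τ) := by gcongr
        _ = C * τ := by linear_combination (C * τ) * hτn
    exact hunif.continuous (Eventually.of_forall fun n => by
      have h1 : Continuous fun s => h s (u + 1 / ((n : ℝ) + 1)) :=
        hc.comp (f := fun s => (s, _)) (by fun_prop)
      have h2 : Continuous fun s => h s u := hc.comp (f := fun s => (s, u)) (by fun_prop)
      fun_prop).frequently

theorem rescaled_eq {f : ℝ → ℝ → ℝ} {t : ℝ} (ht : 0 < t) (u : ℝ) :
    f t u = (t * √t)⁻¹ * rescaled f t (√t * u) := by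
  have h1 : t ^ (3 / 2 : ℝ) = t * √t := by
    rw [Real.sqrt_eq_rpow, ← Real.rpow_one_add' ht.le (by norm_num)]; norm_num
  have h2 : t ^ (-(1 / 2) : ℝ) = (√t)⁻¹ := by rw [Real.sqrt_eq_rpow, Real.rpow_neg ht.le]
  have hs := Real.sqrt_pos.2 ht
  rw [rescaled, h1, h2, inv_mul_cancel_left₀ hs.ne', inv_mul_cancel_left₀ (by positivity)]

/-- The reaction term of the equation for `e^{-𝔪 t} u`, with the time clamped to `[0, T]`. -/
def dampedReaction (f : ℝ → ℝ → ℝ) (m Λ T e s u : ℝ) : ℝ :=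
  Λ⁻¹ * (Real.exp (-(m * clampT T s)) * f (rad T e s) (Real.exp (m * clampT T s) * u))

/-- The derivative of `dampedReaction`. -/
def dampedReaction' (f : ℝ → ℝ → ℝ) (m Λ T e s u : ℝ) : ℝ :=
  Λ⁻¹ * deriv (f (rad T e s)) (Real.exp (m * clampT T s) * u)

/-- Each derivative in `u` brings a factor `t^{1/2}` to the prefactor `t^{-3/2}`. Hence `f'` is of
size `L₁ / t` and has Lipschitz constant `L₂ / √t`, the decay rates required by `IsReaction`. -/
theorem hasDerivAt_of_isS1Bar {L₁ L₂ : ℝ≥0} {f : ℝ → ℝ → ℝ} (hf : IsS1Bar L₁ L₂ f) {t : ℝ}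
    (ht : 0 < t) (u : ℝ) : HasDerivAt (f t) (t⁻¹ * deriv (rescaled f t) (√t * u)) u := by
  have h1 : f t = fun u => (t * √t)⁻¹ * rescaled f t (√t * u) := funext (rescaled_eq ht)
  have h2 := ((hf.differentiable t ht (√t * u)).hasDerivAt.comp u
    ((hasDerivAt_id u).const_mul (√t))).const_mul (t * √t)⁻¹
  have hs := Real.sqrt_pos.2 ht
  rw [h1]
  refine h2.congr_deriv ?_
  rw [mul_one]
  field_simp

/-- In the first derivative the factors `e^{-𝔪t}` and `e^{𝔪t}` cancel, so `ℓ` does not see the mass;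
the Lipschitz constant of the derivative keeps one factor `e^{𝔪t} ≤ e^{|𝔪|T}`. Clamping the time
makes everything globally defined and keeps `s + e` away from zero. -/
theorem isReaction_damped {L₁ L₂ : ℝ≥0} {f : ℝ → ℝ → ℝ} (hf : IsS1Bar L₁ L₂ f) (m : ℝ)
    {Λ T e : ℝ} (hΛ : 0 < Λ) (hT : 0 ≤ T) (he : 0 < e) :
    IsReaction T e (L₁ / Λ) (L₂ * Real.exp (|m| * T) / Λ) (dampedReaction f m Λ T e)
      (dampedReaction' f m Λ T e) := by
  have hr := rad_pos (T := T) hT he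
  have hd : ∀ s u, HasDerivAt (dampedReaction f m Λ T e s) (dampedReaction' f m Λ T e s u) u := by
    intro s u
    have h1 := hasDerivAt_of_isS1Bar hf (hr s) (Real.exp (m * clampT T s) * u)
    have h2 := ((h1.differentiableAt.hasDerivAt.comp u
      ((hasDerivAt_id u).const_mul (Real.exp (m * clampT T s)))).const_mul
      (Real.exp (-(m * clampT T s)))).const_mul Λ⁻¹
    refine h2.congr_deriv ?_
    have := Real.exp_pos (m * clampT T s)
    simp only [dampedReaction', Real.exp_neg]
    field_simp
  have hd' : ∀ s u, dampedReaction' f m Λ T e s u = Λ⁻¹ * ((rad T e s)⁻¹ *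
      deriv (rescaled f (rad T e s)) (√(rad T e s) * (Real.exp (m * clampT T s) * u))) := by
    intro s u
    rw [dampedReaction', (hasDerivAt_of_isS1Bar hf (hr s) _).deriv]
  have hlip : ∀ s u v, |dampedReaction' f m Λ T e s u - dampedReaction' f m Λ T e s v| ≤
      L₂ * Real.exp (|m| * T) / Λ / √(rad T e s) * |u - v| := by
    intro s u v
    have hs := Real.sqrt_pos.2 (hr s)
    have h1 := (hf.lipschitz_deriv _ (hr s)).dist_le_mul
      (√(rad T e s) * (Real.exp (m * clampT T s) * u))
      (√(rad T e s) * (Real.exp (m * clampT T s) * v))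
    rw [Real.dist_eq, Real.dist_eq, ← mul_sub, ← mul_sub, abs_mul, abs_mul, abs_of_pos hs,
      Real.abs_exp] at h1
    rw [hd', hd', ← mul_sub, ← mul_sub, abs_mul, abs_mul, abs_of_pos (inv_pos.2 hΛ),
      abs_of_pos (inv_pos.2 (hr s))]
    have h2 : Real.exp (m * clampT T s) ≤ Real.exp (|m| * T) := by
      have := clampT_mem hT s
      refine Real.exp_le_exp.2 ((le_abs_self _).trans ?_)
      rw [abs_mul, abs_of_nonneg this.1]
      exact mul_le_mul_of_nonneg_left this.2 (abs_nonneg _)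
    calc _ ≤ Λ⁻¹ * ((rad T e s)⁻¹ * (L₂ * (√(rad T e s) * (Real.exp (|m| * T) * |u - v|)))) := by
          have := inv_pos.2 (hr s)
          refine mul_le_mul_of_nonneg_left (mul_le_mul_of_nonneg_left (h1.trans ?_) this.le)
            (inv_pos.2 hΛ).le
          gcongr
      _ = _ := by
          have e1 : (rad T e s)⁻¹ * √(rad T e s) = (√(rad T e s))⁻¹ := by
            rw [← Real.mul_self_sqrt (hr s).le, Real.sqrt_mul_self hs.le]
            field_simp
          calc _ = Λ⁻¹ * ((rad T e s)⁻¹ * √(rad T e s)) * (L₂ * (Real.exp (|m| * T) * |u - v|)) := by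
                ring
            _ = _ := by rw [e1]; ring
  have hcont : Continuous (Function.uncurry (dampedReaction f m Λ T e)) := by
    have e1 : Function.uncurry (dampedReaction f m Λ T e) = fun p : ℝ × ℝ =>
        Λ⁻¹ * (Real.exp (-(m * clampT T p.1)) * ((rad T e p.1 * √(rad T e p.1))⁻¹ *
          rescaled f (rad T e p.1) (√(rad T e p.1) * (Real.exp (m * clampT T p.1) * p.2)))) := by
      ext p
      simp only [Function.uncurry, dampedReaction]
      rw [rescaled_eq (f := f) (hr p.1)]
    rw [e1]
    have c1 := continuous_clampT T
    have c2 := continuous_rad T e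
    have c3 : Continuous fun p : ℝ × ℝ => (rad T e p.1 * √(rad T e p.1))⁻¹ := by
      refine Continuous.inv₀ (by fun_prop) fun p => ?_
      have := hr p.1
      positivity
    have c4 : Continuous fun p : ℝ × ℝ =>
        rescaled f (rad T e p.1) (√(rad T e p.1) * (Real.exp (m * clampT T p.1) * p.2)) :=
      hf.continuousOn.comp_continuous (f := fun p : ℝ × ℝ =>
        (rad T e p.1, √(rad T e p.1) * (Real.exp (m * clampT T p.1) * p.2))) (by fun_prop)
        fun p => ⟨hr p.1, mem_univ _⟩
    fun_prop
  have hk : 0 ≤ (L₂ : ℝ) * Real.exp (|m| * T) / Λ := by positivity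
  refine ⟨hT, he, by positivity, hk, hcont, ?_, hd, ?_, ?_, hlip⟩
  · refine continuous_deriv_of_lipschitz (C := L₂ * Real.exp (|m| * T) / Λ / √e) (by positivity)
      hcont hd fun s u v => (hlip s u v).trans ?_
    have := le_rad (e := e) hT s
    gcongr
  · intro s u
    have h1 := hf.odd _ (hr s) (√(rad T e s) * (Real.exp (m * clampT T s) * u))
    simp only [dampedReaction]
    rw [rescaled_eq (f := f) (hr s), rescaled_eq (f := f) (hr s), mul_neg, mul_neg, h1]
    ring
  · intro s u
    rw [hd', abs_mul, abs_mul, abs_of_pos (inv_pos.2 hΛ), abs_of_pos (inv_pos.2 (hr s))]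
    have h1 : |deriv (rescaled f (rad T e s))
        (√(rad T e s) * (Real.exp (m * clampT T s) * u))| ≤ L₁ :=
      norm_deriv_le_of_lipschitz (hf.lipschitz _ (hr s))
    have := hr s
    calc _ ≤ Λ⁻¹ * ((rad T e s)⁻¹ * L₁) := by gcongr
      _ = _ := by ring

end

section
/-! ### Random mild solutions -/

section Mild

variable {Ω : Type*} [MeasurableSpace Ω] {P : Measure Ω}
  {T e ℓ k ϰ : ℝ} {h h' : ℝ → ℝ → ℝ}

theorem eLpNorm_abs (X : Ω → ℝ) : eLpNorm (fun ω => |X ω|) 2 P = eLpNorm X 2 P := eLpNorm_norm X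

/-- Minkowski's inequality for the heat flow. -/
theorem eLpNorm_heat_le [IsProbabilityMeasure P] {D : Plane → Ω → ℝ} (hD : Measurable (Function.uncurry D)) {ψ : Plane → ℝ}
    {a K : ℝ} (ha : 0 ≤ a) (hψ : ExpBound a K ψ) (hψc : Continuous ψ) (hψ0 : ∀ y, 0 ≤ ψ y)
    (h : ∀ y, eLpNorm (D y) 2 P ≤ ENNReal.ofReal (ψ y)) (t : ℝ) (x : Plane) :
    eLpNorm (fun ω => heat t (fun y => D y ω) x) 2 P ≤ ENNReal.ofReal (heat t ψ x) := by
  refine eLpNorm_integral_le (π := stdG) (X := fun z ω => D (x + √t • z) ω) ?_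
    (hψ.integrable ha t hψc.stronglyMeasurable x) (Eventually.of_forall fun _ => hψ0 _)
    (Eventually.of_forall fun _ => h _)
  exact (hD.comp (g := Function.uncurry D) (f := fun q : Plane × Ω => (x + √t • q.1, q.2))
    (by fun_prop)).aestronglyMeasurable

/-- The random field `z` is a mild solution of `∂ₜz = ½Δz - H` on `[0, T]`. -/
structure IsMildField (P : Measure Ω) (T : ℝ) (H z : ℝ → Plane → Ω → ℝ) : Prop where
  measurable : ∀ s y, Measurable (z s y)
  cont : ∀ ω, Continuous fun p : ℝ × Plane => z p.1 p.2 ω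
  growth : ∀ᵐ ω ∂P, ∃ a K, 0 ≤ a ∧ ∀ s ∈ Icc 0 T, ExpBound a K fun y => z s y ω
  mild : ∀ᵐ ω ∂P, ∀ t ∈ Icc 0 T, ∀ x,
    z t x ω = heat t (fun y => z 0 y ω) x - duhamel (fun s y => H s y ω) t x

namespace IsMildField

variable {H z : ℝ → Plane → Ω → ℝ}

theorem measurable_uncurry (hz : IsMildField P T H z) :
    Measurable fun q : (ℝ × Plane) × Ω => z q.1.1 q.1.2 q.2 :=
  measurable_uncurry_of_continuous_of_measurable (u := fun (p : ℝ × Plane) ω => z p.1 p.2 ω)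
    hz.cont fun p => hz.measurable p.1 p.2

theorem measurable_uncurry_zero (hz : IsMildField P T H z) :
    Measurable fun q : Plane × Ω => z 0 q.1 q.2 :=
  hz.measurable_uncurry.comp (f := fun q : Plane × Ω => ((0, q.1), q.2)) (by fun_prop)

theorem continuous_zero (hz : IsMildField P T H z) (ω : Ω) : Continuous fun y => z 0 y ω :=
  (hz.cont ω).comp (f := fun y => (0, y)) (by fun_prop)

end IsMildField

/-- The mean `E h'(s, z(s, y))` of the derivative of the reaction term along a random field. -/
def meanDeriv (P : Measure Ω) (h' : ℝ → ℝ → ℝ) (z : ℝ → Plane → Ω → ℝ) (s : ℝ) (y : Plane) : ℝ :=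
  ∫ ω, h' s (z s y ω) ∂P

theorem IsReaction.abs_meanDeriv_le [IsProbabilityMeasure P] (hR : IsReaction T e ℓ k h h') (z : ℝ → Plane → Ω → ℝ) (s : ℝ)
    (y : Plane) : |meanDeriv P h' z s y| ≤ ℓ / rad T e s := by
  have := norm_integral_le_of_norm_le_const (μ := P) (f := fun ω => h' s (z s y ω))
    (C := ℓ / rad T e s) (Eventually.of_forall fun ω => hR.bound s _)
  simpa [meanDeriv] using this

theorem IsReaction.continuous_meanDeriv [IsProbabilityMeasure P] (hR : IsReaction T e ℓ k h h') {z : ℝ → Plane → Ω → ℝ}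
    (hm : ∀ s y, Measurable (z s y)) (hc : ∀ ω, Continuous fun p : ℝ × Plane => z p.1 p.2 ω) :
    Continuous (Function.uncurry (meanDeriv P h' z)) := by
  refine continuous_of_dominated (F := fun (p : ℝ × Plane) ω => h' p.1 (z p.1 p.2 ω))
    (bound := fun _ => ℓ / e) (fun p => ?_) (fun p => ?_) (integrable_const _) ?_
  · have : Continuous (h' p.1) := hR.cont'.comp (f := fun u => (p.1, u)) (by fun_prop)
    exact (this.measurable.comp (hm p.1 p.2)).aestronglyMeasurable
  · exact Eventually.of_forall fun ω => (hR.bound _ _).trans (hR.coeff_le _)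
  · exact Eventually.of_forall fun ω =>
      hR.cont'.comp (f := fun p : ℝ × Plane => (p.1, z p.1 p.2 ω)) (continuous_fst.prodMk (hc ω))

variable {n : ℕ} {γ : Fin n → Plane → ℝ} {U : (Fin n → ℝ) → ℝ → Plane → ℝ}
  {V : Fin n → ℝ → Plane → ℝ} {G : Ω → Fin n → ℝ} {u v : ℝ → Plane → Ω → ℝ} {ζ : Plane → ℝ} {K : ℝ}

theorem expBound_of_nonneg_of_le (hζ0 : ∀ y, 0 ≤ ζ y) (hζK : ∀ y, ζ y ≤ K) : ExpBound 0 K ζ :=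
  ExpBound.of_bounded fun y => by rw [Real.norm_eq_abs, abs_of_nonneg (hζ0 y)]; exact hζK y

theorem measurable_linComb_comp (hγ : IsNoiseData T e ϰ γ) (hG : Measurable G) :
    Measurable fun q : Plane × Ω => linComb γ (G q.2) q.1 := by
  have : Continuous fun p : Plane × (Fin n → ℝ) => linComb γ p.2 p.1 := by
    have := hγ.cont
    unfold linComb
    fun_prop
  exact this.measurable.comp (f := fun q : Plane × Ω => (q.1, G q.2)) (by fun_prop)

theorem ExpBound.mono_of_le {a a' K K' : ℝ} {φ : Plane → ℝ} (hφ : ExpBound a K φ) (ha : a ≤ a')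
    (hK : K ≤ K') : ExpBound a' K' φ := fun x =>
  (hφ.mono ha x).trans (mul_le_mul_of_nonneg_right hK (Real.exp_pos _).le)

/-- A mild solution is close to the flow started from a nearby finite-dimensional noise. -/
theorem eLpNorm_sub_flow_le [IsProbabilityMeasure P] (hR : IsReaction T e ℓ k h h') (hγ : IsNoiseData T e ϰ γ)
    (hU : IsFlow T e ℓ h γ U) (hG : Measurable G)
    (hu : IsMildField P T (fun s y ω => h s (u s y ω)) u) (hζc : Continuous ζ)
    (hζ0 : ∀ y, 0 ≤ ζ y) (hζK : ∀ y, ζ y ≤ K)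
    (hζ : ∀ y, eLpNorm (fun ω => u 0 y ω - linComb γ (G ω) y) 2 P ≤ ENNReal.ofReal (ζ y))
    {t : ℝ} (ht : t ∈ Icc 0 T) (x : Plane) :
    eLpNorm (fun ω => u t x ω - U (G ω) t x) 2 P ≤
      ENNReal.ofReal (Real.exp (ℓ * Real.log ((T + e) / e)) * heat t ζ x) := by
  set ρ := Real.exp (ℓ * Real.log ((T + e) / e)) with hρ
  have hρ0 : 0 < ρ := Real.exp_pos _
  set D : Plane → Ω → ℝ := fun y ω => |u 0 y ω - linComb γ (G ω) y| with hDdef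
  have hDm : Measurable (Function.uncurry D) :=
    (hu.measurable_uncurry_zero.sub (measurable_linComb_comp hγ hG)).norm
  have h1 := eLpNorm_heat_le (P := P) hDm le_rfl (expBound_of_nonneg_of_le hζ0 hζK) hζc hζ0
    (fun y => (eLpNorm_abs _).trans_le (hζ y)) t x
  have h2 := eLpNorm_const_mul_le_ofReal ρ h1
  rw [abs_of_pos hρ0] at h2
  refine eLpNorm_le_of_abs_le ?_ h2
  obtain ⟨Kγ, hKγ0, hKγ⟩ := hγ.exists_bound
  filter_upwards [hu.growth, hu.mild] with ω ⟨a, Ku, ha, hub⟩ hmild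
  obtain ⟨M, hM⟩ := (hU.isBC (G ω)).2
  have hT := hR.T_nonneg
  have hKu : 0 ≤ Ku := (hub 0 ⟨le_rfl, hT⟩).nonneg
  have hM0 : 0 ≤ M := (abs_nonneg _).trans (hM 0 0)
  have hlin : ExpBound 0 (n * Kγ * ‖G ω‖) (linComb γ (G ω)) :=
    ExpBound.of_bounded fun y => abs_linComb_le (fun i => by simpa using hKγ i y) (G ω)
  have hlin0 := hlin.nonneg
  have hb : ∀ s ∈ Icc 0 T, ExpBound a (Ku + M + n * Kγ * ‖G ω‖) fun y => u s y ω :=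
    fun s hs => (hub s hs).mono_of_le le_rfl (by linarith)
  have := hR.abs_sub_le_heat (a := a) (K := Ku + M + n * Kγ * ‖G ω‖) ha
    (z := fun s y => u s y ω) (z' := U (G ω)) (hu.cont ω) (hU.isBC (G ω)).1 hb
    (fun s _ => (ExpBound.of_bounded (hM s)).mono_of_le ha (by linarith))
    (hu.continuous_zero ω) (hγ.continuous_linComb (G ω)) (hb 0 ⟨le_rfl, hT⟩)
    (hlin.mono_of_le ha (by linarith)) hmild (hU.mild (G ω)) t ht x
  exact this.trans (le_abs_self _)

/-- A priori bound for the solution of a linear equation. -/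
theorem eLpNorm_linear_le [IsProbabilityMeasure P] (hR : IsReaction T e ℓ k h h') {a : ℝ → Plane → ℝ}
    (ha : ∀ s y, |a s y| ≤ ℓ / rad T e s)
    (hv : IsMildField P T (fun s y ω => a s y * v s y ω) v) {S : ℝ} (hS : 0 ≤ S)
    (hv0 : ∀ y, eLpNorm (v 0 y) 2 P ≤ ENNReal.ofReal S) {t : ℝ} (ht : t ∈ Icc 0 T) (x : Plane) :
    eLpNorm (v t x) 2 P ≤ ENNReal.ofReal (Real.exp (ℓ * Real.log ((T + e) / e)) * S) := by
  set ρ := Real.exp (ℓ * Real.log ((T + e) / e)) with hρ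
  have hρ0 : 0 < ρ := Real.exp_pos _
  have h1 := eLpNorm_heat_le (P := P) (D := fun y ω => |v 0 y ω|)
    hv.measurable_uncurry_zero.norm le_rfl (expBound_of_nonneg_of_le (ζ := fun _ => S)
      (fun _ => hS) fun _ => le_rfl) continuous_const (fun _ => hS)
    (fun y => (eLpNorm_abs _).trans_le (hv0 y)) t x
  rw [heat_const] at h1
  have h2 := eLpNorm_const_mul_le_ofReal ρ h1
  rw [abs_of_pos hρ0] at h2
  refine eLpNorm_le_of_abs_le ?_ h2
  filter_upwards [hv.growth, hv.mild] with ω ⟨b, Kv, hb, hvb⟩ hmild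
  have hvb' : ∀ s ∈ Icc 0 T, ExpBound b Kv fun y => |v s y ω| := fun s hs y => by
    simpa using hvb s hs y
  have := le_exp_mul_heat_of_le_duhamel (T := T) hb
    (continuous_div_rad hR.T_nonneg hR.e_pos ℓ) hR.coeff_nonneg
    (D := fun t x => |v t x ω|) hvb' (ψ := fun y => |v 0 y ω|) (hvb' 0 ⟨le_rfl, hR.T_nonneg⟩)
    (hv.continuous_zero ω).abs (fun x => abs_nonneg _)
    (G := fun s y => a s y * v s y ω)
    (fun s _ y => by rw [norm_mul]; exact mul_le_mul_of_nonneg_right (ha s y) (abs_nonneg _))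
    (fun t ht x => by
      rw [hmild t ht x]
      exact (abs_sub _ _).trans (add_le_add abs_integral_le_integral_abs le_rfl)) t ht x
  refine (this.trans ?_).trans (le_abs_self _)
  exact mul_le_mul_of_nonneg_right (hR.exp_integral_coeff_le ht)
    (heat_nonneg (fun y => abs_nonneg _) x)

theorem integral_abs_le_sqrt [IsProbabilityMeasure P] {X : Ω → ℝ} (hX : MemLp X 2 P) :
    ∫ ω, |X ω| ∂P ≤ √(∫ ω, X ω ^ 2 ∂P) := by
  refine Real.le_sqrt_of_sq_le ?_
  have h3 := variance_nonneg (fun ω => |X ω|) P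
  rw [variance_eq_sub (X := fun ω => |X ω|) hX.abs] at h3
  simp only [Pi.pow_apply, sq_abs] at h3
  linarith

theorem eLpNorm_le_ofReal_sqrt {X : Ω → ℝ} (hX : MemLp X 2 P) :
    eLpNorm X 2 P ≤ ENNReal.ofReal √(∫ ω, X ω ^ 2 ∂P) := by
  rw [eLpNorm_two_le_ofReal_iff hX (Real.sqrt_nonneg _), Real.sq_sqrt]
  exact integral_nonneg fun _ => sq_nonneg _

theorem sqrt_le_of_eLpNorm_le {X : Ω → ℝ} (hX : MemLp X 2 P) {b : ℝ} (hb : 0 ≤ b)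
    (h : eLpNorm X 2 P ≤ ENNReal.ofReal b) : √(∫ ω, X ω ^ 2 ∂P) ≤ b :=
  Real.sqrt_le_iff.2 ⟨hb, (eLpNorm_two_le_ofReal_iff hX hb).1 h⟩

/-- Minkowski's inequality for the Duhamel integral, with a general bound. -/
theorem eLpNorm_duhamel_le_duhamel [IsProbabilityMeasure P] {A : ℝ → Plane → Ω → ℝ} {Ξ : ℝ → Plane → ℝ} {t : ℝ} (ht : 0 ≤ t)
    {x : Plane} (hΞ : Integrable (fun p : ℝ × Plane => Ξ (t * p.1) (x + √(t * (1 - p.1)) • p.2)) stM)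
    (hΞ0 : ∀ s ∈ Icc 0 t, ∀ y, 0 ≤ Ξ s y)
    (hA : Measurable fun q : (ℝ × Plane) × Ω => A q.1.1 q.1.2 q.2)
    (h : ∀ s ∈ Icc 0 t, ∀ y, eLpNorm (A s y) 2 P ≤ ENNReal.ofReal (Ξ s y)) :
    eLpNorm (fun ω => duhamel (fun s y => A s y ω) t x) 2 P ≤ ENNReal.ofReal (duhamel Ξ t x) := by
  have h1 := eLpNorm_integral_le (π := stM) (ν := P)
    (X := fun p ω => A (t * p.1) (x + √(t * (1 - p.1)) • p.2) ω)
    (hA.comp (f := fun q : (ℝ × Plane) × Ω =>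
      ((t * q.1.1, x + √(t * (1 - q.1.1)) • q.1.2), q.2)) (by fun_prop)).aestronglyMeasurable hΞ
    (by
      filter_upwards [ae_stM_fst] with p hp
      exact hΞ0 _ (mul_mem_Icc_of_mem_Ioc ht hp) _)
    (by
      filter_upwards [ae_stM_fst] with p hp
      exact h _ (mul_mem_Icc_of_mem_Ioc ht hp) _)
  have h2 := eLpNorm_const_mul_le_ofReal t h1
  rw [abs_of_nonneg ht] at h2
  exact h2

end Mild

end

section
/-! ### Comparison with the finite-dimensional problem -/

section Mild

set_option linter.unusedSectionVars false

variable {Ω : Type*} [MeasurableSpace Ω] {P : Measure Ω} [IsProbabilityMeasure P]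
  {T e ℓ k ϰ : ℝ} {h h' : ℝ → ℝ → ℝ} {n : ℕ} {γ : Fin n → Plane → ℝ}
  {U : (Fin n → ℝ) → ℝ → Plane → ℝ} {V : Fin n → ℝ → Plane → ℝ} {G : Ω → Fin n → ℝ}
  {u v : ℝ → Plane → Ω → ℝ} {ζ : Plane → ℝ} {K : ℝ}

/-- As `G` has the Gaussian law, the coefficient of the finite-dimensional problem is an expectation
over `Ω`. The Lipschitz bound on `h'` and Jensen's inequality then compare the two coefficients. -/
theorem abs_meanDeriv_sub_meanCoeff_le (hR : IsReaction T e ℓ k h h')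
    (hV : IsMeanField T e ℓ h' γ V) (hG : Measurable G) (hGm : P.map G = gaussN n)
    (hvm : ∀ s y, Measurable (v s y)) (s : ℝ) (y : Plane)
    (hm : MemLp (fun ω => v s y ω - linComb (fun i => V i s) (G ω) y) 2 P) :
    |meanDeriv P h' v s y - meanCoeff h' V s y| ≤
      k / √e * √(∫ ω, (v s y ω - linComb (fun i => V i s) (G ω) y) ^ 2 ∂P) := by
  have hlc : Continuous fun g : Fin n → ℝ => linComb (fun i => V i s) g y :=
    hV.continuous_linComb.comp (f := fun g => (g, s, y)) (by fun_prop)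
  have hc : Continuous (h' s) := hR.cont'.comp (f := fun u => (s, u)) (by fun_prop)
  have e1 : meanCoeff h' V s y = ∫ ω, h' s (linComb (fun i => V i s) (G ω) y) ∂P := by
    rw [meanCoeff, ← hGm, integral_map hG.aemeasurable (by fun_prop)]
  have i1 := hR.integrable_deriv_comp s (μ := P) (hvm s y).aestronglyMeasurable
  have i2 := hR.integrable_deriv_comp s (μ := P)
    (A := fun ω => linComb (fun i => V i s) (G ω) y) (hlc.measurable.comp hG).aestronglyMeasurable
  rw [e1, meanDeriv, ← integral_sub i1 i2]
  have hk : 0 ≤ k / √e := div_nonneg hR.k_nonneg (Real.sqrt_nonneg _)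
  refine abs_integral_le_integral_abs.trans ?_
  refine le_trans ?_ (mul_le_mul_of_nonneg_left (integral_abs_le_sqrt hm) hk)
  rw [← integral_const_mul]
  refine integral_mono (i1.sub i2).abs ((hm.integrable one_le_two).abs.const_mul _) fun ω => ?_
  exact (hR.lip s _ _).trans (mul_le_mul_of_nonneg_right (hR.klip_le s) (abs_nonneg _))

theorem memLp_linComb_comp (hV : IsMeanField T e ℓ h' γ V) (hG : Measurable G)
    (hGm : P.map G = gaussN n) (s : ℝ) (y : Plane) :
    MemLp (fun ω => linComb (fun i => V i s) (G ω) y) 2 P := by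
  obtain ⟨L, hL⟩ := hV.lipschitz_linComb
  have h1 := (hL s y).memLp_gaussN
  rw [← hGm] at h1
  exact h1.comp_of_map hG.aemeasurable

theorem exists_eLpNorm_linComb_comp_le (hV : IsMeanField T e ℓ h' γ V) (hG : Measurable G)
    (hGm : P.map G = gaussN n) :
    ∃ B, 0 ≤ B ∧ ∀ s y, eLpNorm (fun ω => linComb (fun i => V i s) (G ω) y) 2 P ≤
      ENNReal.ofReal B := by
  obtain ⟨M, hM0, hM⟩ := hV.bdd
  have h1 : MemLp (fun g : Fin n → ℝ => n * M * ‖g‖) 2 (gaussN n) :=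
    (memLp_id_gaussN n).norm.const_mul _
  rw [← hGm] at h1
  have h2 : MemLp (fun ω => n * M * ‖G ω‖) 2 P := h1.comp_of_map hG.aemeasurable
  refine ⟨_, ENNReal.toReal_nonneg, fun s y => eLpNorm_le_of_abs_le (Eventually.of_forall fun ω =>
    ?_) (ENNReal.ofReal_toReal h2.2.ne).ge⟩
  exact (abs_linComb_le (fun i => hM i s y) (G ω)).trans (le_abs_self _)

/-- The solution of the mean field equation is close to the solution of the mean field equation for
a nearby finite-dimensional noise. -/
theorem eLpNorm_sub_linComb_le (hR : IsReaction T e ℓ k h h') (hγ : IsNoiseData T e ϰ γ)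
    (hV : IsMeanField T e ℓ h' γ V) (hG : Measurable G) (hGm : P.map G = gaussN n)
    (hv : IsMildField P T (fun s y ω => meanDeriv P h' v s y * v s y ω) v)
    {S : ℝ} (hS : 0 ≤ S) (hv0 : ∀ y, eLpNorm (v 0 y) 2 P ≤ ENNReal.ofReal S) (hζc : Continuous ζ)
    (hζ0 : ∀ y, 0 ≤ ζ y) (hζK : ∀ y, ζ y ≤ K)
    (hζ : ∀ y, eLpNorm (fun ω => v 0 y ω - linComb γ (G ω) y) 2 P ≤ ENNReal.ofReal (ζ y))
    {t : ℝ} (ht : t ∈ Icc 0 T) (x : Plane) :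
    eLpNorm (fun ω => v t x ω - linComb (fun i => V i t) (G ω) x) 2 P ≤
      ENNReal.ofReal (Real.exp (t * (ℓ / e + k / √e *
        (Real.exp (ℓ * Real.log ((T + e) / e)) * S))) * heat t ζ x) := by
  set ρ := Real.exp (ℓ * Real.log ((T + e) / e)) with hρ
  have hρ0 : 0 < ρ := Real.exp_pos _
  -- A crude rate that blows up as `e → 0`. It is independent of the approximation, which suffices
  -- because the approximation is refined at fixed `ε`.
  set c := ℓ / e + k / √e * (ρ * S) with hc
  have hle0 : 0 ≤ ℓ / e := div_nonneg hR.ℓ_nonneg hR.e_pos.le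
  have hke0 : 0 ≤ k / √e := div_nonneg hR.k_nonneg (Real.sqrt_nonneg _)
  have hc0 : 0 ≤ c := by positivity
  set Z : ℝ → Plane → Ω → ℝ := fun s y ω => v s y ω - linComb (fun i => V i s) (G ω) y with hZ
  have hlm : Measurable fun q : (ℝ × Plane) × Ω =>
      linComb (fun i => V i q.1.1) (G q.2) q.1.2 :=
    hV.continuous_linComb.measurable.comp (f := fun q : (ℝ × Plane) × Ω => (G q.2, q.1.1, q.1.2))
      (by fun_prop)
  have hZm : Measurable fun q : (ℝ × Plane) × Ω => Z q.1.1 q.1.2 q.2 :=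
    hv.measurable_uncurry.sub hlm
  have hvn : ∀ s ∈ Icc 0 T, ∀ y, eLpNorm (v s y) 2 P ≤ ENNReal.ofReal (ρ * S) := fun s hs y =>
    eLpNorm_linear_le hR (hR.abs_meanDeriv_le v) hv hS hv0 hs y
  have hvL : ∀ s ∈ Icc 0 T, ∀ y, MemLp (v s y) 2 P := fun s hs y =>
    ⟨(hv.measurable s y).aestronglyMeasurable, (hvn s hs y).trans_lt ENNReal.ofReal_lt_top⟩
  have hlL := memLp_linComb_comp (P := P) hV hG hGm
  have hZL : ∀ s ∈ Icc 0 T, ∀ y, MemLp (Z s y) 2 P := fun s hs y => (hvL s hs y).sub (hlL s y)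
  obtain ⟨B, hB0, hB⟩ := exists_eLpNorm_linComb_comp_le (P := P) hV hG hGm
  set D : ℝ → Plane → ℝ := fun s y => √(∫ ω, Z s y ω ^ 2 ∂P) with hD
  have hD0 : ∀ s y, 0 ≤ D s y := fun s y => Real.sqrt_nonneg _
  have hDm : Measurable (Function.uncurry D) := by
    refine Measurable.sqrt ?_
    exact (StronglyMeasurable.integral_prod_right (f := fun (p : ℝ × Plane) ω => Z p.1 p.2 ω ^ 2)
      (hZm.pow_const 2).stronglyMeasurable).measurable
  have hDe : ∀ s ∈ Icc 0 T, ∀ y, eLpNorm (Z s y) 2 P ≤ ENNReal.ofReal (D s y) := fun s hs y =>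
    eLpNorm_le_ofReal_sqrt (hZL s hs y)
  have hDB : ∀ s ∈ Icc 0 T, ∀ y, D s y ≤ ρ * S + B := fun s hs y => by
    refine sqrt_le_of_eLpNorm_le (hZL s hs y) (by positivity) ?_
    rw [ENNReal.ofReal_add (by positivity) hB0]
    exact (eLpNorm_sub_le (hvL s hs y).1 (hlL s y).1 one_le_two).trans
      (add_le_add (hvn s hs y) (hB s y))
  have hDb : ∀ s ∈ Icc 0 T, ExpBound 0 (ρ * S + B) (D s) := fun s hs =>
    expBound_of_nonneg_of_le (hD0 s) (hDB s hs)
  have hζb := expBound_of_nonneg_of_le hζ0 hζK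
  have hcoeff : ∀ s y, |meanCoeff h' V s y| ≤ ℓ / e := fun s y =>
    (hR.abs_gaussAverage_le s (fun i => V i s y)).trans (hR.coeff_le s)
  -- The difference of the two linear terms, split as coefficient times difference plus difference
  -- of coefficients times solution. The second part is also linear in the `L²` size `D` of the
  -- difference, by the Lipschitz dependence of the coefficient, so Gronwall applies to `D`.
  set Q : ℝ → Plane → Ω → ℝ := fun s y ω => meanCoeff h' V s y * Z s y ω +
    (meanDeriv P h' v s y - meanCoeff h' V s y) * v s y ω with hQ
  have hmc : Continuous (Function.uncurry (meanDeriv P h' v)) :=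
    hR.continuous_meanDeriv hv.measurable hv.cont
  have hcc := (isBC_meanCoeff hR hV).1
  have hQm : Measurable fun q : (ℝ × Plane) × Ω => Q q.1.1 q.1.2 q.2 := by
    have m1 : Measurable fun q : (ℝ × Plane) × Ω => meanDeriv P h' v q.1.1 q.1.2 :=
      hmc.measurable.comp measurable_fst
    have m2 : Measurable fun q : (ℝ × Plane) × Ω => meanCoeff h' V q.1.1 q.1.2 :=
      hcc.measurable.comp measurable_fst
    exact (m2.mul hZm).add ((m1.sub m2).mul hv.measurable_uncurry)
  have hQn : ∀ s ∈ Icc 0 T, ∀ y, eLpNorm (Q s y) 2 P ≤ ENNReal.ofReal (c * D s y) := by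
    intro s hs y
    have q1 := eLpNorm_const_mul_le_ofReal (meanCoeff h' V s y) (hDe s hs y)
    have q2 := eLpNorm_const_mul_le_ofReal (meanDeriv P h' v s y - meanCoeff h' V s y) (hvn s hs y)
    have q3 := abs_meanDeriv_sub_meanCoeff_le (P := P) hR hV hG hGm hv.measurable s y (hZL s hs y)
    have hDs := hD0 s y
    have q4 := eLpNorm_add_le_ofReal (by positivity) (by positivity)
      ((hZL s hs y).1.const_mul _) ((hvL s hs y).1.const_mul _) q1 q2
    refine q4.trans (ENNReal.ofReal_le_ofReal ?_)
    calc _ ≤ ℓ / e * D s y + k / √e * D s y * (ρ * S) := by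
          gcongr
          exact hcoeff s y
      _ = c * D s y := by rw [hc]; ring
  have hheat : ∀ t ∈ Icc 0 T, ∀ x, D t x ≤ heat t ζ x + ‖duhamel (fun s y => c * D s y) t x‖ := by
    intro t ht x
    have hcDb : ∀ s ∈ Icc 0 t, ExpBound 0 (c * (ρ * S + B)) fun y => c * D s y := fun s hs =>
      expBound_of_nonneg_of_le (fun y => mul_nonneg hc0 (hD0 s y)) fun y =>
        mul_le_mul_of_nonneg_left (hDB s ⟨hs.1, hs.2.trans ht.2⟩ y) hc0
    have hint := integrable_duhamel (H := fun s y => c * D s y) ht.1 le_rfl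
      (hDm.const_mul c).stronglyMeasurable hcDb x
    have n1 := eLpNorm_heat_le (P := P) (D := fun y ω => |v 0 y ω - linComb γ (G ω) y|)
      (hv.measurable_uncurry_zero.sub (measurable_linComb_comp hγ hG)).norm le_rfl hζb hζc hζ0
      (fun y => (eLpNorm_abs _).trans_le (hζ y)) t x
    have n2 := eLpNorm_duhamel_le_duhamel ht.1 hint
      (fun s _ y => mul_nonneg hc0 (hD0 s y)) hQm
      (fun s hs y => hQn s ⟨hs.1, hs.2.trans ht.2⟩ y)
    have hd0 : 0 ≤ duhamel (fun s y => c * D s y) t x := by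
      simp only [duhamel]
      exact mul_nonneg ht.1 (integral_nonneg fun p => mul_nonneg hc0 (hD0 _ _))
    have hh0 := heat_nonneg (t := t) hζ0 x
    have m1 : AEStronglyMeasurable
        (fun ω => heat t (fun y => |v 0 y ω - linComb γ (G ω) y|) x) P := by
      have := (hv.measurable_uncurry_zero.sub (measurable_linComb_comp hγ hG)).norm
      refine (StronglyMeasurable.integral_prod_left
        (f := fun (z : Plane) ω => |v 0 (x + √t • z) ω - linComb γ (G ω) (x + √t • z)|)
        (Measurable.stronglyMeasurable ?_)).aestronglyMeasurable
      exact this.comp (f := fun q : Plane × Ω => (x + √t • q.1, q.2)) (by fun_prop)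
    have m2 : AEStronglyMeasurable (fun ω => |duhamel (fun s y => Q s y ω) t x|) P := by
      suffices hs : AEStronglyMeasurable (fun ω => duhamel (fun s y => Q s y ω) t x) P from hs.norm
      refine AEStronglyMeasurable.const_smul ?_ t
      refine (StronglyMeasurable.integral_prod_left
        (f := fun (p : ℝ × Plane) ω => Q (t * p.1) (x + √(t * (1 - p.1)) • p.2) ω)
        (Measurable.stronglyMeasurable ?_)).aestronglyMeasurable
      exact hQm.comp (f := fun q : (ℝ × Plane) × Ω =>
        ((t * q.1.1, x + √(t * (1 - q.1.1)) • q.1.2), q.2)) (by fun_prop)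
    have n3 := eLpNorm_add_le_ofReal hh0 hd0 m1 m2 n1 ((eLpNorm_abs _).trans_le n2)
    rw [Real.norm_eq_abs, abs_of_nonneg hd0]
    refine sqrt_le_of_eLpNorm_le (hZL t ht x) (by positivity) (eLpNorm_le_of_abs_le ?_ n3)
    obtain ⟨Kγ, hKγ0, hKγ⟩ := hγ.exists_bound
    filter_upwards [hv.growth, hv.mild] with ω ⟨b, Kv, hb, hvb⟩ hmild
    refine le_trans ?_ (le_abs_self _)
    have hlin : ExpBound 0 (n * Kγ * ‖G ω‖) (linComb γ (G ω)) :=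
      ExpBound.of_bounded fun y => abs_linComb_le (fun i => by simpa using hKγ i y) (G ω)
    obtain ⟨M, hM⟩ := (hV.isBC_linComb (G ω)).2
    have hvH : StronglyMeasurable (Function.uncurry fun s y => meanDeriv P h' v s y * v s y ω) :=
      (hmc.mul (hv.cont ω)).stronglyMeasurable
    have hvHb : ∀ s ∈ Icc 0 t, ExpBound b (ℓ / e * Kv) fun y => meanDeriv P h' v s y * v s y ω :=
      fun s hs y => by
        rw [norm_mul, mul_assoc]
        exact mul_le_mul ((hR.abs_meanDeriv_le v s y).trans (hR.coeff_le s))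
          (hvb s ⟨hs.1, hs.2.trans ht.2⟩ y) (norm_nonneg _) hle0
    have hlH : StronglyMeasurable (Function.uncurry fun s y =>
        meanCoeff h' V s y * linComb (fun i => V i s) (G ω) y) :=
      (hcc.mul (hV.isBC_linComb (G ω)).1).stronglyMeasurable
    have hlHb : ∀ s ∈ Icc 0 t, ExpBound b (ℓ / e * M) fun y =>
        meanCoeff h' V s y * linComb (fun i => V i s) (G ω) y := fun s _ =>
      (ExpBound.of_bounded fun y => by
        rw [norm_mul]
        exact mul_le_mul (hcoeff s y) (hM s y) (norm_nonneg _) hle0).mono hb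
    have hdu : duhamel (fun s y => Q s y ω) t x =
        duhamel (fun s y => meanDeriv P h' v s y * v s y ω) t x -
          duhamel (fun s y => meanCoeff h' V s y * linComb (fun i => V i s) (G ω) y) t x := by
      rw [← duhamel_sub ht.1 hb hvH hvHb hlH hlHb]
      refine duhamel_congr ht.1 (fun s _ y => ?_) x
      simp only [hQ, hZ]
      ring
    have hhe : heat t (fun y => v 0 y ω) x - heat t (linComb γ (G ω)) x =
        heat t (fun y => v 0 y ω - linComb γ (G ω) y) x := by
      rw [heat, heat, heat, ← integral_sub ((hvb 0 ⟨le_rfl, hR.T_nonneg⟩).integrable hb t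
        (hv.continuous_zero ω).stronglyMeasurable x) (hlin.integrable le_rfl t
        (hγ.continuous_linComb (G ω)).stronglyMeasurable x)]
    have hZe : Z t x ω = heat t (fun y => v 0 y ω - linComb γ (G ω) y) x -
        duhamel (fun s y => Q s y ω) t x := by
      simp only [hZ]
      rw [hmild t ht x, hV.mild_linComb hR hγ (G ω) ht x, hdu, ← hhe]
      ring
    rw [hZe]
    exact (abs_sub _ _).trans (add_le_add abs_integral_le_integral_abs le_rfl)
  have main := le_exp_mul_heat_of_le_duhamel (T := T) le_rfl (c := fun _ => c) continuous_const
    (fun _ => hc0) hDb hζb hζc hζ0 (G := fun s y => c * D s y)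
    (fun s _ y => by rw [Real.norm_eq_abs, abs_of_nonneg (mul_nonneg hc0 (hD0 s y))]) hheat t ht x
  rw [intervalIntegral.integral_const, sub_zero, smul_eq_mul] at main
  exact (hDe t ht x).trans (ENNReal.ofReal_le_ofReal main)

end Mild

end

section
/-! ### The comparison theorem for mild solutions -/

section Mild

variable {Ω : Type*} [MeasurableSpace Ω] {P : Measure Ω}
  {T e ℓ k ϰ : ℝ} {h h' : ℝ → ℝ → ℝ} {u v : ℝ → Plane → Ω → ℝ}
  {W : Lp ℝ 2 (volume : Measure Plane) → Ω → ℝ}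

theorem IsWhiteNoise.exists_eLpNorm_le (hW : IsWhiteNoise P W) (he : 0 < e) :
    ∃ S, 0 ≤ S ∧ ∀ y, eLpNorm (W (heatKernelLp e he y)) 2 P ≤ ENNReal.ofReal S := by
  refine ⟨√(∫ z, heatKernel e z ^ 2), Real.sqrt_nonneg _, fun y => ?_⟩
  have h1 := eLpNorm_le_ofReal_sqrt (hW.memLp (heatKernelLp e he y))
  have h2 : ∫ ω, W (heatKernelLp e he y) ω ^ 2 ∂P = ∫ z, heatKernel e z ^ 2 := by
    simp only [sq]
    rw [hW.covariance, inner_heatKernelLp_self]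
    simp only [sq]
    exact integral_sub_left_eq_self (fun z => heatKernel e z * heatKernel e z) volume y
  rwa [h2] at h1

theorem tendsto_heat_zero {ζ : ℕ → Plane → ℝ} {K : ℝ} (hc : ∀ N, Continuous (ζ N))
    (h0 : ∀ N y, 0 ≤ ζ N y) (hK : ∀ N y, ζ N y ≤ K)
    (hlim : ∀ y, Tendsto (fun N => ζ N y) atTop (𝓝 0)) (t : ℝ) (x : Plane) :
    Tendsto (fun N => heat t (ζ N) x) atTop (𝓝 0) := by
  have := tendsto_integral_of_dominated_convergence (μ := stdG) (fun _ => K)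
    (F := fun N z => ζ N (x + √t • z)) (f := fun _ => 0)
    (fun N => ((hc N).comp (by fun_prop : Continuous fun z : Plane => x + √t • z)).aestronglyMeasurable)
    (integrable_const _) (fun N => Eventually.of_forall fun z => by
      rw [Real.norm_eq_abs, abs_of_nonneg (h0 N _)]; exact hK N _)
    (Eventually.of_forall fun z => hlim _)
  simpa [heat] using this

/-- The solutions of the reaction–diffusion equation and of the mean field equation started from the
mollified white noise are close in `L²`. -/
theorem IsWhiteNoise.eLpNorm_sub_le [IsProbabilityMeasure P] (hW : IsWhiteNoise P W) (hR : IsReaction T e ℓ k h h')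
    (he : 0 < e) (hϰ : 0 < ϰ) (hu : IsMildField P T (fun s y ω => h s (u s y ω)) u)
    (hv : IsMildField P T (fun s y ω => meanDeriv P h' v s y * v s y ω) v)
    (hu0 : ∀ y, u 0 y =ᵐ[P] W (heatKernelLp e he y))
    (hv0 : ∀ y, v 0 y =ᵐ[P] W (heatKernelLp e he y)) {ρ θ : ℝ}
    (hρ : ρ = Real.exp (ℓ * Real.log ((T + e) / e))) (hθ : θ = Real.log ((T + e) / e))
    (x : Plane) :
    eLpNorm (fun ω => u T x ω - v T x ω) 2 P ≤ ENNReal.ofReal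
      ((k * ρ ^ 2 * √(3 * θ) + k * ρ ^ 2 * gaussSqNorm * ϰ / √(2 * Real.pi) * θ) *
        Real.exp ((ℓ + k * ρ * (1 + ϰ) / √(2 * Real.pi)) * θ) / √(2 * Real.pi * (T + e))) := by
  have hTT : T ∈ Icc 0 T := ⟨hR.T_nonneg, le_rfl⟩
  obtain ⟨n, γ, G, ζ, K, hγ, hG, hζc, hζ0, hζK, hζlim, hζ⟩ := hW.exists_approx he hϰ
  obtain ⟨S, hS, hSW⟩ := hW.exists_eLpNorm_le he
  set c := T * (ℓ / e + k / √e * (Real.exp (ℓ * Real.log ((T + e) / e)) * S)) with hc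
  set B := (k * ρ ^ 2 * √(3 * θ) + k * ρ ^ 2 * gaussSqNorm * ϰ / √(2 * Real.pi) * θ) *
        Real.exp ((ℓ + k * ρ * (1 + ϰ) / √(2 * Real.pi)) * θ) / √(2 * Real.pi * (T + e)) with hB
  -- The triangle inequality through the two finite-dimensional solutions: the middle term carries
  -- the estimate, and the outer two are errors of the approximation of the initial data.
  have hbound : ∀ᶠ N in atTop, eLpNorm (fun ω => u T x ω - v T x ω) 2 P ≤
      ENNReal.ofReal (ρ * heat T (ζ N) x) + ENNReal.ofReal B +
        ENNReal.ofReal (Real.exp c * heat T (ζ N) x) := by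
    filter_upwards [hγ] with N hN
    have hγN := hN T
    obtain ⟨U, hU⟩ := exists_flow hR hγN
    obtain ⟨V, hV⟩ := exists_meanField hR hγN
    set G' := (hG N).1.mk (G N) with hG'
    have hGm : Measurable G' := (hG N).1.measurable_mk
    have hGe : G N =ᵐ[P] G' := (hG N).1.ae_eq_mk
    have hGl : P.map G' = gaussN (n N) := by rw [← Measure.map_congr hGe, (hG N).2]
    have hd : ∀ {z : ℝ → Plane → Ω → ℝ}, (∀ y, z 0 y =ᵐ[P] W (heatKernelLp e he y)) → ∀ y,
        eLpNorm (fun ω => z 0 y ω - linComb (γ N) (G' ω) y) 2 P ≤ ENNReal.ofReal (ζ N y) := by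
      intro z hz y
      refine le_trans (eLpNorm_congr_ae ?_).le (hζ N y)
      filter_upwards [hz y, hGe] with ω h1 h2
      rw [h1, h2]
    have b1 := eLpNorm_sub_flow_le hR hγN hU hGm hu (hζc N) (hζ0 N) (hζK N) (hd hu0) hTT x
    have b2 := eLpNorm_sub_linComb_le hR hγN hV hGm hGl hv hS
      (fun y => (eLpNorm_congr_ae (hv0 y)).trans_le (hSW y)) (hζc N) (hζ0 N) (hζK N) (hd hv0) hTT x
    have hgc : Continuous (gap U V T x) := continuous_gap hU hV T x
    have b3 : eLpNorm (fun ω => gap U V T x (G' ω)) 2 P ≤ ENNReal.ofReal B := by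
      have := eLpNorm_gap_le_exp hR hγN hU hV hϰ.le hρ hθ hTT x
      rw [← hGl, eLpNorm_map_measure hgc.aestronglyMeasurable hGm.aemeasurable] at this
      exact this
    rw [← hρ] at b1
    have m1 : AEStronglyMeasurable (fun ω => u T x ω - U (G' ω) T x) P :=
      ((hu.measurable T x).sub ((hU.cont.comp (f := fun g => (g, T, x))
        (by fun_prop)).measurable.comp hGm)).aestronglyMeasurable
    have m3 : AEStronglyMeasurable (fun ω => gap U V T x (G' ω)) P :=
      (hgc.measurable.comp hGm).aestronglyMeasurable
    have m2 : AEStronglyMeasurable (fun ω => v T x ω - linComb (fun i => V i T) (G' ω) x) P :=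
      ((hv.measurable T x).sub ((hV.continuous_linComb.comp (f := fun g => (g, T, x))
        (by fun_prop)).measurable.comp hGm)).aestronglyMeasurable
    have e1 : (fun ω => u T x ω - v T x ω) = ((fun ω => u T x ω - U (G' ω) T x) +
        fun ω => gap U V T x (G' ω)) - fun ω => v T x ω - linComb (fun i => V i T) (G' ω) x := by
      ext ω
      simp only [gap, Pi.sub_apply, Pi.add_apply]
      ring
    rw [e1]
    exact (MeasureTheory.eLpNorm_sub_le (m1.add m3) m2 one_le_two).trans
      (add_le_add ((eLpNorm_add_le m1 m3 one_le_two).trans (add_le_add b1 b3)) b2)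
  have hheat := tendsto_heat_zero hζc hζ0 hζK hζlim T x
  -- The factors in front of the heat flows do not depend on `N`, so both approximation errors
  -- vanish in the limit.
  have hl : ∀ r : ℝ, Tendsto (fun N => ENNReal.ofReal (r * heat T (ζ N) x)) atTop (𝓝 0) :=
    fun r => by simpa using ENNReal.tendsto_ofReal (hheat.const_mul r)
  have := ((hl ρ).add (tendsto_const_nhds (x := ENNReal.ofReal B))).add (hl (Real.exp c))
  simp only [zero_add, add_zero] at this
  exact ge_of_tendsto this hbound

end Mild

end

section
/-! ### Classical solutions are mild solutions -/

/-- The field `e^{-𝔪 t} z`, with the time clamped to `[0, T]`. -/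
def damped (m T : ℝ) (z : ℝ → Plane → ℝ) (s : ℝ) (y : Plane) : ℝ :=
  Real.exp (-(m * clampT T s)) * z (clampT T s) y

theorem damped_of_mem {m T s : ℝ} (hs : s ∈ Icc 0 T) (z : ℝ → Plane → ℝ) (y : Plane) :
    damped m T z s y = Real.exp (-(m * s)) * z s y := by
  rw [damped, clampT_of_mem hs]

section Classical

variable {z : ℝ → Plane → ℝ} {m T : ℝ}

theorem IsC12.continuous_damped (hz : IsC12 z) (hT : 0 ≤ T) :
    Continuous (Function.uncurry (damped m T z)) := by
  have h1 : Continuous fun p : ℝ × Plane => z (clampT T p.1) p.2 :=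
    hz.continuousOn.comp_continuous (f := fun p : ℝ × Plane => (clampT T p.1, p.2))
      (((continuous_clampT T).comp continuous_fst).prodMk continuous_snd)
      fun p => ⟨(clampT_mem hT p.1).1, mem_univ _⟩
  have h2 := continuous_clampT T
  exact (by fun_prop : Continuous fun p : ℝ × Plane => Real.exp (-(m * clampT T p.1))).mul h1

theorem HasExpGrowth.exists_expBound_damped (hz : HasExpGrowth z) (hT : 0 < T) :
    ∃ a K, 0 ≤ a ∧ ∀ s ∈ Icc 0 T, ExpBound a K (damped m T z s) := by
  obtain ⟨a, ha, K, hK⟩ := hz T hT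
  refine ⟨a, Real.exp (|m| * T) * K, ha.le, fun s hs y => ?_⟩
  have h1 := hK s hs y
  have hK0 : 0 ≤ K := le_trans (by positivity) h1
  have h2 : |z s y| ≤ K * Real.exp (a * ‖y‖) := by
    rw [Real.exp_neg, ← div_eq_mul_inv, div_le_iff₀ (Real.exp_pos _)] at h1
    exact h1
  have h3 : Real.exp (-(m * s)) ≤ Real.exp (|m| * T) := by
    refine Real.exp_le_exp.2 ((neg_le_abs _).trans ?_)
    rw [abs_mul, abs_of_nonneg hs.1]
    exact mul_le_mul_of_nonneg_left hs.2 (abs_nonneg _)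
  rw [damped_of_mem hs, Real.norm_eq_abs, abs_mul, Real.abs_exp, mul_assoc]
  exact mul_le_mul h3 h2 (abs_nonneg _) (Real.exp_pos _).le

theorem IsC12.continuousOn_laplacian (hz : IsC12 z) :
    ContinuousOn (fun p : ℝ × Plane => Laplacian.laplacian (z p.1) p.2) (Ioi 0 ×ˢ univ) := by
  have h1 : (fun p : ℝ × Plane => Laplacian.laplacian (z p.1) p.2) = fun p : ℝ × Plane =>
      ∑ i, iteratedFDeriv ℝ 2 (z p.1) p.2
        ![stdOrthonormalBasis ℝ Plane i, stdOrthonormalBasis ℝ Plane i] := by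
    ext p
    rw [InnerProductSpace.laplacian_eq_iteratedFDeriv_stdOrthonormalBasis]
  rw [h1]
  refine continuousOn_finsetSum _ fun i _ => ?_
  exact (ContinuousMultilinearMap.apply ℝ (fun _ : Fin 2 => Plane) ℝ
    ![stdOrthonormalBasis ℝ Plane i, stdOrthonormalBasis ℝ Plane i]).continuous.comp_continuousOn
    hz.continuousOn_iteratedFDeriv_two

/-- A classical solution of exponential growth satisfies the Duhamel formula. -/
theorem IsC12.damped_eq (hz : IsC12 z) (hg : HasExpGrowth z) (hT : 0 < T) {N : ℝ → Plane → ℝ}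
    (heq : ∀ t, 0 < t → ∀ x, deriv (fun s => z s x) t =
      1 / 2 * Laplacian.laplacian (z t) x + m * z t x - N t x)
    {H : ℝ → Plane → ℝ} (hHc : Continuous (Function.uncurry H))
    (hHN : ∀ s ∈ Ioo 0 T, ∀ y, H s y = Real.exp (-(m * s)) * N s y) {C : ℝ} (hC : 0 ≤ C)
    (hHC : ∀ s ∈ Icc 0 T, ∀ y, |H s y| ≤ C * |damped m T z s y|) :
    ∀ t ∈ Icc 0 T, ∀ x, damped m T z t x = heat t (damped m T z 0) x - duhamel H t x := by
  obtain ⟨a, K, ha, hK⟩ := hg.exists_expBound_damped (m := m) hT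
  have hK0 : 0 ≤ K := (hK 0 ⟨le_rfl, hT.le⟩).nonneg
  have hsmul : ∀ s ∈ Ioo 0 T, damped m T z s = Real.exp (-(m * s)) • z s := fun s hs => by
    ext y
    rw [damped_of_mem ⟨hs.1.le, hs.2.le⟩]
    rfl
  have hlap : ∀ s ∈ Ioo 0 T, ∀ x, Laplacian.laplacian (damped m T z s) x =
      Real.exp (-(m * s)) * Laplacian.laplacian (z s) x := fun s hs x => by
    rw [hsmul s hs, InnerProductSpace.laplacian_smul _ (hz.contDiff_space s hs.1).contDiffAt,
      smul_eq_mul]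
  refine eq_heat_sub_duhamel (K := max K (C * K)) ha (hz.continuous_damped hT.le) hHc
    (fun s hs y => (hK s hs y).trans ?_) (fun s hs y => ?_) (fun s hs => ?_) ?_ ?_
  · exact mul_le_mul_of_nonneg_right (le_max_left _ _) (Real.exp_pos _).le
  · refine (hHC s hs y).trans ((mul_le_mul_of_nonneg_left (hK s hs y) hC).trans ?_)
    rw [← mul_assoc]
    exact mul_le_mul_of_nonneg_right (le_max_right _ _) (Real.exp_pos _).le
  · rw [hsmul s hs]
    exact (hz.contDiff_space s hs.1).const_smul (Real.exp (-(m * s)))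
  · have h1 : ContinuousOn (fun p : ℝ × Plane =>
        Real.exp (-(m * p.1)) * Laplacian.laplacian (z p.1) p.2) (Ioo 0 T ×ˢ univ) :=
      (by fun_prop : Continuous fun p : ℝ × Plane => Real.exp (-(m * p.1))).continuousOn.mul
        (hz.continuousOn_laplacian.mono (prod_mono Ioo_subset_Ioi_self subset_rfl))
    exact h1.congr fun p hp => hlap p.1 hp.1 p.2
  · intro s hs x
    have h1 := (hz.differentiableAt_time s hs.1 x).hasDerivAt
    have h2 : HasDerivAt (fun s => Real.exp (-(m * s))) (Real.exp (-(m * s)) * -(m * 1)) s :=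
      (((hasDerivAt_id s).const_mul m).neg).exp
    have h3 := h2.mul h1
    have h4 : (fun s => damped m T z s x) =ᶠ[𝓝 s] fun s => Real.exp (-(m * s)) * z s x := by
      filter_upwards [Ioo_mem_nhds hs.1 hs.2] with r hr
      exact damped_of_mem ⟨hr.1.le, hr.2.le⟩ z x
    refine (h3.congr_of_eventuallyEq h4).congr_deriv ?_
    rw [hlap s hs, hHN s hs, heq s hs.1 x]
    ring

end Classical

section Random

variable {Ω : Type*} [MeasurableSpace Ω] {P : Measure Ω}
  {m T ε : ℝ} {f : ℝ → ℝ → ℝ} {L₁ L₂ : ℝ≥0} {hε : 0 < ε}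
  {W : Lp ℝ 2 (volume : Measure Plane) → Ω → ℝ} {u v : ℝ → Plane → Ω → ℝ}

theorem exists_damped_version (hT : 0 ≤ T) {z : ℝ → Plane → Ω → ℝ}
    (hm : ∀ t, 0 ≤ t → ∀ x, AEMeasurable (z t x) P)
    (hr : ∀ᵐ ω ∂P, IsC12 (fun t x => z t x ω)) :
    ∃ y : ℝ → Plane → Ω → ℝ, (∀ s x, Measurable (y s x)) ∧
      (∀ ω, Continuous fun p : ℝ × Plane => y p.1 p.2 ω) ∧
      ∀ᵐ ω ∂P, ∀ s x, y s x ω = damped m T (fun t x => z t x ω) s x := by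
  obtain ⟨Y, hYm, hYc, hY⟩ := exists_measurable_continuous_version (P := P)
    (X := fun (p : ℝ × Plane) ω => damped m T (fun t x => z t x ω) p.1 p.2)
    (fun p => (hm _ (clampT_mem hT p.1).1 p.2).const_mul _)
    (hr.mono fun ω h => h.continuous_damped hT)
  exact ⟨fun s x => Y (s, x), fun s x => hYm _, hYc, hY.mono fun ω h s x => h (s, x)⟩

theorem exp_mul_dampedReaction {Λ e s : ℝ} (hs : s ∈ Icc 0 T) (w : ℝ) :
    dampedReaction f m Λ T e s (Real.exp (-(m * s)) * w) =
      Real.exp (-(m * s)) * (f (s + e) w / Λ) := by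
  rw [dampedReaction, clampT_of_mem hs, rad_of_mem hs, ← mul_assoc (Real.exp (m * s)),
    ← Real.exp_add, add_neg_cancel, Real.exp_zero, one_mul]
  ring

theorem dampedReaction'_exp_mul {Λ e s : ℝ} (hs : s ∈ Icc 0 T) (w : ℝ) :
    dampedReaction' f m Λ T e s (Real.exp (-(m * s)) * w) = deriv (f (s + e)) w / Λ := by
  rw [dampedReaction', clampT_of_mem hs, rad_of_mem hs, ← mul_assoc (Real.exp (m * s)),
    ← Real.exp_add, add_neg_cancel, Real.exp_zero, one_mul]
  ring

/-- The damped solution of the reaction–diffusion equation is a mild solution. -/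
theorem IsReactionDiffusionSolution.exists_isMildField
    (hu : IsReactionDiffusionSolution P W f m ε hε u) (hf : IsS1Bar L₁ L₂ f)
    (hε1 : ε < 1) (hT : 0 < T) :
    ∃ y : ℝ → Plane → Ω → ℝ,
      IsMildField P T
        (fun s x ω => dampedReaction f m (Real.log ε⁻¹) T (ε ^ 2) s (y s x ω)) y ∧
      (∀ x, y 0 x =ᵐ[P] W (heatKernelLp (ε ^ 2) (pow_pos hε 2) x)) ∧
      ∀ x, (fun ω => u T x ω) =ᵐ[P] fun ω => Real.exp (m * T) * y T x ω := by
  obtain ⟨y, hym, hyc, hy⟩ := exists_damped_version (m := m) hT.le hu.aemeasurable hu.regular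
  have hΛ : 0 < Real.log ε⁻¹ := Real.log_pos ((one_lt_inv₀ hε).2 hε1)
  have hR := isReaction_damped hf m hΛ hT.le (pow_pos hε 2)
  refine ⟨y, ⟨hym, hyc, ?_, ?_⟩, fun x => ?_, fun x => ?_⟩
  · filter_upwards [hu.growth, hy] with ω hg hω
    obtain ⟨a, K, ha, hK⟩ := hg.exists_expBound_damped (m := m) hT
    refine ⟨a, K, ha, fun s hs => ?_⟩
    simp only [hω]
    exact hK s hs
  · filter_upwards [hu.growth, hy, hu.regular, hu.equation] with ω hg hω hr heq
    simp only [hω]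
    have hcd := hr.continuous_damped (m := m) hT.le
    refine hr.damped_eq hg hT (N := fun t x => f (t + ε ^ 2) (u t x ω) / Real.log ε⁻¹) heq
      (hR.cont.comp (f := fun p : ℝ × Plane => (p.1, _)) (continuous_fst.prodMk hcd))
      (fun s hs x => ?_) (div_nonneg hR.ℓ_nonneg hR.e_pos.le)
      fun s _ x => (hR.abs_le s _).trans
        (mul_le_mul_of_nonneg_right (hR.coeff_le s) (abs_nonneg _))
    have hs' : s ∈ Icc 0 T := ⟨hs.1.le, hs.2.le⟩
    rw [damped_of_mem hs', exp_mul_dampedReaction hs']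
  · filter_upwards [hy, hu.initial x] with ω hω h0
    rw [hω, damped_of_mem ⟨le_rfl, hT.le⟩, h0]
    simp [mollifiedNoise]
  · filter_upwards [hy] with ω hω
    rw [hω, damped_of_mem ⟨hT.le, le_rfl⟩, ← mul_assoc, ← Real.exp_add, add_neg_cancel,
      Real.exp_zero, one_mul]

/-- The damped solution of the McKean–Vlasov equation is a mild solution. -/
theorem IsMcKeanVlasovSolution.exists_isMildField [IsProbabilityMeasure P]
    (hv : IsMcKeanVlasovSolution P W f m ε hε v) (hf : IsS1Bar L₁ L₂ f)
    (hε1 : ε < 1) (hT : 0 < T) :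
    ∃ y : ℝ → Plane → Ω → ℝ,
      IsMildField P T
        (fun s x ω =>
          meanDeriv P (dampedReaction' f m (Real.log ε⁻¹) T (ε ^ 2)) y s x * y s x ω) y ∧
      (∀ x, y 0 x =ᵐ[P] W (heatKernelLp (ε ^ 2) (pow_pos hε 2) x)) ∧
      ∀ x, (fun ω => v T x ω) =ᵐ[P] fun ω => Real.exp (m * T) * y T x ω := by
  obtain ⟨y, hym, hyc, hy⟩ := exists_damped_version (m := m) hT.le hv.aemeasurable hv.regular
  have hΛ : 0 < Real.log ε⁻¹ := Real.log_pos ((one_lt_inv₀ hε).2 hε1)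
  have hR := isReaction_damped hf m hΛ hT.le (pow_pos hε 2)
  have hmean : ∀ s ∈ Icc 0 T, ∀ x,
      meanDeriv P (dampedReaction' f m (Real.log ε⁻¹) T (ε ^ 2)) y s x =
        (∫ ω', deriv (f (s + ε ^ 2)) (v s x ω') ∂P) / Real.log ε⁻¹ := by
    intro s hs x
    rw [meanDeriv, ← integral_div]
    refine integral_congr_ae ?_
    filter_upwards [hy] with ω hω
    simp only [hω]
    rw [damped_of_mem hs, dampedReaction'_exp_mul hs]
  have hmc : Continuous (Function.uncurry
      (meanDeriv P (dampedReaction' f m (Real.log ε⁻¹) T (ε ^ 2)) y)) :=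
    hR.continuous_meanDeriv hym hyc
  refine ⟨y, ⟨hym, hyc, ?_, ?_⟩, fun x => ?_, fun x => ?_⟩
  · filter_upwards [hv.growth, hy] with ω hg hω
    obtain ⟨a, K, ha, hK⟩ := hg.exists_expBound_damped (m := m) hT
    refine ⟨a, K, ha, fun s hs => ?_⟩
    simp only [hω]
    exact hK s hs
  · filter_upwards [hv.growth, hy, hv.regular, hv.equation] with ω hg hω hr heq
    simp only [hω]
    have hcd := hr.continuous_damped (m := m) hT.le
    refine hr.damped_eq hg hT (N := fun t x =>
      (∫ ω', deriv (f (t + ε ^ 2)) (v t x ω') ∂P) / Real.log ε⁻¹ * v t x ω) heq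
      (hmc.mul hcd) (fun s hs x => ?_) (div_nonneg hR.ℓ_nonneg hR.e_pos.le)
      fun s _ x => ?_
    · have hs' : s ∈ Icc 0 T := ⟨hs.1.le, hs.2.le⟩
      rw [damped_of_mem hs', hmean s hs']
      ring
    · rw [abs_mul]
      exact mul_le_mul_of_nonneg_right ((hR.abs_meanDeriv_le y s x).trans (hR.coeff_le s))
        (abs_nonneg _)
  · filter_upwards [hy, hv.initial x] with ω hω h0
    rw [hω, damped_of_mem ⟨le_rfl, hT.le⟩, h0]
    simp [mollifiedNoise]
  · filter_upwards [hy] with ω hω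
    rw [hω, damped_of_mem ⟨hT.le, le_rfl⟩, ← mul_assoc, ← Real.exp_add, add_neg_cancel,
      Real.exp_zero, one_mul]

end Random

end

section
/-! ### The constants -/

theorem delta_eq (ε : ℝ) : delta ε = 1 / √(Real.log ε⁻¹) := by
  rw [delta, Real.sqrt_eq_rpow]

/-- Removing the integer part costs one unit, which becomes the extra `√Λ` after multiplication by
`δ_ε⁻¹ = √Λ`. -/
theorem log_lt_of_numSteps_le {T₀ ε : ℝ} (hε : 0 < ε) (hε1 : ε < 1)
    (h : (numSteps T₀ ε : ℝ) ≤ 3 * (delta ε)⁻¹) :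
    Real.log (T₀ + ε ^ 2) < Real.log ε⁻¹ + √(Real.log ε⁻¹) := by
  set Λ := Real.log ε⁻¹ with hΛdef
  have hΛ : 0 < Λ := Real.log_pos ((one_lt_inv₀ hε).2 hε1)
  have hs := Real.sqrt_pos.2 hΛ
  have hss := Real.mul_self_sqrt hΛ.le
  have h1 := Int.lt_floor_add_one ((2 + Real.log (T₀ + ε ^ 2) / Λ) * (delta ε)⁻¹)
  rw [numSteps] at h
  rw [delta_eq, one_div, inv_inv, ← hΛdef] at h h1
  have h2 : (2 + Real.log (T₀ + ε ^ 2) / Λ) * √Λ < 3 * √Λ + 1 := h1.trans_le (by linarith)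
  have h3 := mul_lt_mul_of_pos_right h2 hs
  have e1 : (2 + Real.log (T₀ + ε ^ 2) / Λ) * √Λ * √Λ = 2 * Λ + Real.log (T₀ + ε ^ 2) := by
    rw [mul_assoc, hss]
    field_simp
  have e2 : (3 * √Λ + 1) * √Λ = 3 * Λ + √Λ := by linear_combination 3 * hss
  linarith

/-- The condition on the number of steps bounds `δ_ε` in terms of the time horizon. -/
theorem delta_le_of_numSteps_le {T₀ ε : ℝ} (hT₀ : 0 < T₀) (hε : 0 < ε) (hε1 : ε < 1)
    (h : (numSteps T₀ ε : ℝ) ≤ 3 * (delta ε)⁻¹) :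
    delta ε ≤ 1 + (2 + 2 * Real.exp 2) / T₀ := by
  have h1 := log_lt_of_numSteps_le hε hε1 h
  rw [delta_eq]
  have hε2 : ε ^ 2 = Real.exp (-(2 * Real.log ε⁻¹)) := by
    rw [Real.log_inv, mul_neg, neg_neg, mul_comm, Real.exp_mul, Real.exp_log hε]
    norm_cast
  set Λ := Real.log ε⁻¹ with hΛdef
  have hΛ : 0 < Λ := Real.log_pos ((one_lt_inv₀ hε).2 hε1)
  have hs := Real.sqrt_pos.2 hΛ
  have hss := Real.mul_self_sqrt hΛ.le
  set s := √Λ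
  rcases le_or_gt 1 s with h1s | hs1
  · have : 1 / s ≤ 1 := by rw [div_le_one hs]; exact h1s
    have : 0 ≤ (2 + 2 * Real.exp 2) / T₀ := by positivity
    linarith
  -- For `s = √Λ < 1` one has `Λ ≤ s`. Subtracting `ε² = e^{-2Λ} ≥ 1 - 2s` from `e^{Λ+s} ≤ 1 + 2s
  -- e²` leaves `T₀ ≤ (2 + 2e²) s`, so `Λ` cannot be too small.
  · have h2 : T₀ + ε ^ 2 < Real.exp (Λ + s) := (Real.log_lt_iff_lt_exp (by positivity)).1 h1
    have h3 : -(2 * Λ) + 1 ≤ ε ^ 2 := hε2 ▸ Real.add_one_le_exp _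
    have hΛs : Λ ≤ s := by nlinarith
    have h4 : Real.exp (Λ + s) ≤ Real.exp (2 * s) := Real.exp_le_exp.2 (by linarith)
    have h5 : Real.exp (2 * s) ≤ 1 + 2 * s * Real.exp 2 := by
      have a1 : -(2 * s) + 1 ≤ Real.exp (-(2 * s)) := Real.add_one_le_exp _
      have a2 : Real.exp (-(2 * s)) * Real.exp (2 * s) = 1 := by rw [← Real.exp_add]; simp
      have a3 : Real.exp (2 * s) ≤ Real.exp 2 := Real.exp_le_exp.2 (by linarith)
      have a4 := mul_le_mul_of_nonneg_right a1 (Real.exp_pos (2 * s)).le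
      rw [a2] at a4
      have a5 := mul_le_mul_of_nonneg_left a3 (by positivity : 0 ≤ 2 * s)
      linarith
    have h6 : T₀ ≤ (2 + 2 * Real.exp 2) * s := by nlinarith
    have h7 : 1 / s ≤ (2 + 2 * Real.exp 2) / T₀ := by
      rw [div_le_div_iff₀ hs hT₀]
      linarith
    linarith

/-- The term `-log ε²` contributes `2Λ` and the hypothesis on the number of steps `Λ + √Λ`; this is
the origin of the `3` in the exponents of the final bound. -/
theorem log_div_le_of_numSteps_le {T₀ T ε : ℝ} (hε : 0 < ε) (hε1 : ε < 1) (hT : T ∈ Icc 0 T₀)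
    (h : (numSteps T₀ ε : ℝ) ≤ 3 * (delta ε)⁻¹) :
    Real.log ((T + ε ^ 2) / ε ^ 2) ≤ (3 + delta ε) * Real.log ε⁻¹ := by
  have h1 := log_lt_of_numSteps_le hε hε1 h
  have hΛ : 0 < Real.log ε⁻¹ := Real.log_pos ((one_lt_inv₀ hε).2 hε1)
  have hs := Real.sqrt_pos.2 hΛ
  have hss := Real.mul_self_sqrt hΛ.le
  have hT0 := hT.1
  have hpos : 0 < T + ε ^ 2 := by positivity
  have h2 : Real.log (T + ε ^ 2) ≤ Real.log (T₀ + ε ^ 2) :=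
    Real.log_le_log hpos (by linarith [hT.2])
  have h3 : delta ε * Real.log ε⁻¹ = √(Real.log ε⁻¹) := by
    rw [delta_eq, one_div, inv_mul_eq_div, div_eq_iff hs.ne']
    exact hss.symm
  rw [Real.log_div hpos.ne' (by positivity), Real.log_pow, add_mul, h3]
  have h4 : Real.log ε⁻¹ = -Real.log ε := Real.log_inv ε
  push_cast
  linarith

/-- The numerical slack of `√(2π) ≥ 5/2` absorbs both `e^{1/2}`, lost in `ρ`, and `1 + ϰ`. Hence the
coefficient in the final exponent is exactly `3e^{3L₁}L₂`, without an additional factor. -/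
theorem exp_half_mul_div_le {ϰ : ℝ} (hϰ : ϰ ≤ 1 / 4) :
    Real.exp (1 / 2) * (1 + ϰ) / √(2 * Real.pi) ≤ 1 := by
  have h1 : (5 / 2 : ℝ) ≤ √(2 * Real.pi) :=
    Real.le_sqrt_of_sq_le (by linarith [Real.pi_gt_d2])
  have h2 : Real.exp (1 / 2) ≤ 2 := by
    have h := Real.exp_one_lt_d9
    have h3 : Real.exp (1 / 2) ^ 2 = Real.exp 1 := by rw [← Real.exp_nat_mul]; norm_num
    nlinarith [Real.exp_pos (1 / 2 : ℝ)]
  rw [div_le_one (by linarith)]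
  nlinarith [Real.exp_pos (1 / 2 : ℝ)]

/-- The constant of the comparison theorem. -/
def boundConst (E Γ Δ : ℝ) : ℝ :=
  E ^ 2 * √Δ * (√(9 + 3 * Δ) + Γ * (3 + Δ)) * Real.exp (3 / 2 + E)

/-- With `ℓθ ≤ 3L₁ + 1/2` one has `ρ² ≤ e^{6L₁+1}`, and the Gronwall exponent contributes a further
`e^{3L₁}`. The part of `kθ` proportional to `δ` is bounded using `e^{3L₁}L₂δ ≤ 1` and goes into the
constant. The prefactor is `O(L₂δ)`: the fluctuation term because `k√θ` is of that order, the
diagonal term because `ϰ ≤ δ`. -/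
theorem comparison_bound_le {L₁ L₂ Γ ϰ δ Δ Λ θ E E' ρ k : ℝ} (hL₁ : 0 ≤ L₁) (hL₂ : 0 ≤ L₂)
    (hΓ : 0 ≤ Γ) (hΛ : 0 < Λ) (hδ : δ = 1 / √Λ) (hδΔ : δ ≤ Δ) (hθ0 : 0 ≤ θ)
    (hθ : θ ≤ (3 + δ) * Λ) (hL₁δ : L₁ * δ ≤ 1 / 2) (hz : Real.exp (3 * L₁) * L₂ * δ ≤ 1)
    (hE1 : 1 ≤ E') (hEE : E' ≤ E) (hϰ0 : 0 < ϰ) (hϰ : ϰ ≤ 1 / 4) (hϰδ : ϰ ≤ δ)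
    (hρ : ρ = Real.exp (L₁ / Λ * θ)) (hk : k = L₂ * E' / Λ) :
    E' * ((k * ρ ^ 2 * √(3 * θ) + k * ρ ^ 2 * Γ * ϰ / √(2 * Real.pi) * θ) *
        Real.exp ((L₁ / Λ + k * ρ * (1 + ϰ) / √(2 * Real.pi)) * θ)) ≤
      boundConst E Γ Δ * Real.exp (18 * L₁) * L₂ / Λ ^ (1 / 4 : ℝ) *
        Real.exp (3 * (Real.exp (3 * L₁) * L₂) * E') := by
  have hs := Real.sqrt_pos.2 hΛ
  have hss := Real.mul_self_sqrt hΛ.le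
  have hδ0 : 0 < δ := by rw [hδ]; positivity
  have hΔ0 : 0 < Δ := hδ0.trans_le hδΔ
  have hE0 : 0 < E := by linarith
  have hE'0 : 0 < E' := by linarith
  have hk0 : 0 ≤ k := by rw [hk]; positivity
  have hπ : (1 : ℝ) ≤ √(2 * Real.pi) :=
    Real.le_sqrt_of_sq_le (by linarith [Real.pi_gt_three])
  have hlθ : L₁ / Λ * θ ≤ 3 * L₁ + 1 / 2 := by
    calc L₁ / Λ * θ ≤ L₁ / Λ * ((3 + δ) * Λ) := by gcongr
      _ = 3 * L₁ + L₁ * δ := by field_simp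
      _ ≤ _ := by linarith
  have hkθ : k * θ ≤ L₂ * E' * (3 + δ) := by
    calc k * θ ≤ k * ((3 + δ) * Λ) := by gcongr
      _ = _ := by rw [hk]; field_simp
  have hρ0 : 0 < ρ := by rw [hρ]; exact Real.exp_pos _
  have hρle : ρ ≤ Real.exp (3 * L₁) * Real.exp (1 / 2) := by
    rw [hρ, ← Real.exp_add]; exact Real.exp_le_exp.2 hlθ
  have hρ2 : ρ ^ 2 ≤ Real.exp (6 * L₁ + 1) := by
    rw [hρ, ← Real.exp_nat_mul]
    refine Real.exp_le_exp.2 ?_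
    push_cast
    linarith
  have hexp : (L₁ / Λ + k * ρ * (1 + ϰ) / √(2 * Real.pi)) * θ ≤
      3 * L₁ + 1 / 2 + E + 3 * (Real.exp (3 * L₁) * L₂) * E' := by
    have a1 : k * ρ * (1 + ϰ) / √(2 * Real.pi) * θ =
        (k * θ) * (ρ * ((1 + ϰ) / √(2 * Real.pi))) := by ring
    have a2 : ρ * ((1 + ϰ) / √(2 * Real.pi)) ≤ Real.exp (3 * L₁) := by
      calc ρ * ((1 + ϰ) / √(2 * Real.pi)) ≤
            Real.exp (3 * L₁) * Real.exp (1 / 2) * ((1 + ϰ) / √(2 * Real.pi)) := by gcongr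
        _ = Real.exp (3 * L₁) * (Real.exp (1 / 2) * (1 + ϰ) / √(2 * Real.pi)) := by ring
        _ ≤ Real.exp (3 * L₁) * 1 := by gcongr; exact exp_half_mul_div_le hϰ
        _ = _ := mul_one _
    have a3 : (k * θ) * (ρ * ((1 + ϰ) / √(2 * Real.pi))) ≤
        L₂ * E' * (3 + δ) * Real.exp (3 * L₁) := by gcongr
    have a4 : L₂ * E' * (3 + δ) * Real.exp (3 * L₁) =
        3 * (Real.exp (3 * L₁) * L₂) * E' + E' * (Real.exp (3 * L₁) * L₂ * δ) := by ring
    have a5 : E' * (Real.exp (3 * L₁) * L₂ * δ) ≤ E' * 1 := by gcongr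
    rw [add_mul, a1]
    linarith
  have hsum : k * √(3 * θ) + k * Γ * ϰ / √(2 * Real.pi) * θ ≤
      L₂ * E' * δ * (√(9 + 3 * Δ) + Γ * (3 + Δ)) := by
    have b1 : k * √(3 * θ) ≤ L₂ * E' * δ * √(9 + 3 * Δ) := by
      have c1 : √(3 * θ) ≤ √(9 + 3 * Δ) * √Λ := by
        rw [← Real.sqrt_mul (by positivity)]
        refine Real.sqrt_le_sqrt ?_
        nlinarith
      calc k * √(3 * θ) ≤ k * (√(9 + 3 * Δ) * √Λ) := by gcongr
        _ = _ := by
          rw [hk, hδ]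
          field_simp
          linear_combination L₂ * hss
    have b2 : k * Γ * ϰ / √(2 * Real.pi) * θ ≤ L₂ * E' * δ * (Γ * (3 + Δ)) := by
      calc k * Γ * ϰ / √(2 * Real.pi) * θ ≤ k * Γ * ϰ * θ := by
            gcongr
            exact div_le_self (by positivity) hπ
        _ = (k * θ) * (Γ * ϰ) := by ring
        _ ≤ (L₂ * E' * (3 + Δ)) * (Γ * δ) := by
            refine mul_le_mul (hkθ.trans ?_) ?_ (by positivity) (by positivity) <;> gcongr
        _ = _ := by ring
    linarith
  -- The argument gives the rate `δ = Λ^{-1/2}`; here `δ = √δ √δ` is weakened to `Λ^{-1/4}`, with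
  -- `√δ ≤ √Δ` entering the constant.
  have hδ4 : δ ≤ √Δ / Λ ^ (1 / 4 : ℝ) := by
    have c1 : Λ ^ (1 / 4 : ℝ) = √(√Λ) := by
      rw [Real.sqrt_eq_rpow, Real.sqrt_eq_rpow, ← Real.rpow_mul hΛ.le]
      norm_num
    rw [c1, ← Real.sqrt_div hΔ0.le]
    refine Real.le_sqrt_of_sq_le ?_
    rw [sq, div_eq_mul_one_div, ← hδ]
    gcongr
  have hR0 : 0 ≤ √(9 + 3 * Δ) + Γ * (3 + Δ) := by positivity
  calc _ = E' * (k * √(3 * θ) + k * Γ * ϰ / √(2 * Real.pi) * θ) * ρ ^ 2 *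
        Real.exp ((L₁ / Λ + k * ρ * (1 + ϰ) / √(2 * Real.pi)) * θ) := by ring
    _ ≤ E * (L₂ * E * (√Δ / Λ ^ (1 / 4 : ℝ)) * (√(9 + 3 * Δ) + Γ * (3 + Δ))) *
        Real.exp (6 * L₁ + 1) *
        Real.exp (3 * L₁ + 1 / 2 + E + 3 * (Real.exp (3 * L₁) * L₂) * E') := by
          gcongr
          refine hsum.trans ?_
          gcongr
    _ = E ^ 2 * √Δ * (√(9 + 3 * Δ) + Γ * (3 + Δ)) * L₂ / Λ ^ (1 / 4 : ℝ) *
        (Real.exp (3 / 2 + E) * Real.exp (9 * L₁) *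
          Real.exp (3 * (Real.exp (3 * L₁) * L₂) * E')) := by
          rw [← Real.exp_add, ← Real.exp_add, mul_assoc (E * _) (Real.exp _), ← Real.exp_add]
          have : 6 * L₁ + 1 + (3 * L₁ + 1 / 2 + E + 3 * (Real.exp (3 * L₁) * L₂) * E') =
            3 / 2 + E + 9 * L₁ + 3 * (Real.exp (3 * L₁) * L₂) * E' := by ring
          rw [this]
          ring
    -- The estimate obtained has `e^{9L₁}`, which is relaxed to `e^{18L₁}`.
    _ ≤ E ^ 2 * √Δ * (√(9 + 3 * Δ) + Γ * (3 + Δ)) * L₂ / Λ ^ (1 / 4 : ℝ) *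
        (Real.exp (3 / 2 + E) * Real.exp (18 * L₁) *
          Real.exp (3 * (Real.exp (3 * L₁) * L₂) * E')) := by
          gcongr
          norm_num
    _ = _ := by rw [boundConst]; ring

end

end CriticalReaction

end

/-! ### The proposition. -/

open CriticalReaction in
theorem proposition1p4 (T₀ : ℝ) (hT₀ : 0 < T₀) (m : ℝ) :
    ∃ C : ℝ, ∀ (L₁ L₂ : ℝ≥0) (ε : ℝ) (hε : 0 < ε), ε < 1 →
      (numSteps T₀ ε : ℝ) ≤ 3 * (delta ε)⁻¹ →
      delta ε * (2 * Real.exp (|m| * T₀) * L₁) ≤ 1 →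
      delta ε * (Real.exp (3 * L₁) * L₂ / (1 - L₁ * delta ε)) < 1 →
      ∀ f : ℝ → ℝ → ℝ, IsS1Bar L₁ L₂ f →
      ∀ (Ω : Type*) [MeasurableSpace Ω] (P : Measure Ω) [IsProbabilityMeasure P]
        (W : Lp ℝ 2 (volume : Measure Plane) → Ω → ℝ), IsWhiteNoise P W →
      ∀ u v : ℝ → Plane → Ω → ℝ,
        IsReactionDiffusionSolution P W f m ε hε u →
        IsMcKeanVlasovSolution P W f m ε hε v →
      ∀ X : Plane, ∀ T ∈ Icc 0 T₀,
        ENNReal.ofReal ((T + ε ^ 2) ^ (1 / 2 : ℝ)) *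
            eLpNorm (fun ω => u T X ω - v T X ω) 2 P ≤
          ENNReal.ofReal
            (C * Real.exp (18 * L₁) * L₂ / (Real.log ε⁻¹) ^ (1 / 4 : ℝ) *
              Real.exp (3 * Real.exp (3 * L₁ + |m| * T) * L₂ /
                (1 - (L₁ + Real.exp (3 * L₁) * L₂) * delta ε))) := by
  refine ⟨boundConst (Real.exp (|m| * T₀)) gaussSqNorm (1 + (2 + 2 * Real.exp 2) / T₀), ?_⟩
  intro L₁ L₂ ε hε hε1 hsteps hL₁ hL₂ f hf Ω _ P _ W hW u v hu hv X T hT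
  rcases hT.1.eq_or_lt with rfl | hT0
  -- At time zero both fields equal the mollified noise; the mild formulation below is set up for `T
  -- > 0`.
  · have : (fun ω => u 0 X ω - v 0 X ω) =ᵐ[P] 0 := by
      filter_upwards [hu.initial X, hv.initial X] with ω h1 h2
      simp [h1, h2]
    rw [eLpNorm_congr_ae this]
    simp
  have hΛ : 0 < Real.log ε⁻¹ := Real.log_pos ((one_lt_inv₀ hε).2 hε1)
  have hδ0 : 0 < delta ε := by
    rw [delta_eq]
    have := Real.sqrt_pos.2 hΛ
    positivity
  have he : 0 < ε ^ 2 := pow_pos hε 2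
  have hTe : 0 < T + ε ^ 2 := by positivity
  have hE1 : 1 ≤ Real.exp (|m| * T₀) := Real.one_le_exp (by positivity)
  have hL₁δ : (L₁ : ℝ) * delta ε ≤ 1 / 2 := by
    have h1 : (L₁ : ℝ) * delta ε * 1 ≤ L₁ * delta ε * Real.exp (|m| * T₀) := by gcongr
    linarith
  have hz : Real.exp (3 * L₁) * L₂ * delta ε < 1 - L₁ * delta ε := by
    have h1 : 0 < 1 - (L₁ : ℝ) * delta ε := by linarith
    rw [← mul_div_assoc, div_lt_one h1] at hL₂
    linarith
  have hz0 : 0 ≤ Real.exp (3 * L₁) * L₂ * delta ε := by positivity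
  have hLδ0 : 0 ≤ (L₁ : ℝ) * delta ε := by positivity
  obtain ⟨yu, hyu, hyu0, hyuT⟩ := hu.exists_isMildField hf hε1 hT0
  obtain ⟨yv, hyv, hyv0, hyvT⟩ := hv.exists_isMildField hf hε1 hT0
  have hR := isReaction_damped hf m hΛ hT.1 he
  set Λ := Real.log ε⁻¹ with hΛdef
  -- The cell size is a free parameter: `ϰ ≤ 1/4` is needed in `exp_half_mul_div_le`, and `ϰ ≤ δ_ε`
  -- makes the diagonal source no larger than the fluctuation one.
  set ϰ := min (1 / 4) (delta ε) with hϰdef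
  have hϰ : 0 < ϰ := lt_min (by norm_num) hδ0
  set θ := Real.log ((T + ε ^ 2) / ε ^ 2) with hθdef
  set k := (L₂ : ℝ) * Real.exp (|m| * T) / Λ with hk
  set ρ := Real.exp (L₁ / Λ * θ) with hρ
  set A := (k * ρ ^ 2 * √(3 * θ) + k * ρ ^ 2 * gaussSqNorm * ϰ / √(2 * Real.pi) * θ) *
    Real.exp ((L₁ / Λ + k * ρ * (1 + ϰ) / √(2 * Real.pi)) * θ) with hA
  have hθ0 : 0 ≤ θ := Real.log_nonneg (by rw [le_div_iff₀ he]; linarith)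
  have hk0 : 0 ≤ k := by positivity
  have hΓ : 0 ≤ gaussSqNorm := ENNReal.toReal_nonneg
  have hA0 : 0 ≤ A := by positivity
  have main := hW.eLpNorm_sub_le hR he hϰ hyu hyv hyu0 hyv0 hρ hθdef X
  have hnorm : eLpNorm (fun ω => u T X ω - v T X ω) 2 P ≤
      ENNReal.ofReal (Real.exp (|m| * T) * (A / √(2 * Real.pi * (T + ε ^ 2)))) := by
    have h1 := eLpNorm_const_mul_le_ofReal (Real.exp (m * T)) main
    rw [Real.abs_exp] at h1
    have h2 : (fun ω => u T X ω - v T X ω) =ᵐ[P]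
        fun ω => Real.exp (m * T) * (yu T X ω - yv T X ω) := by
      filter_upwards [hyuT X, hyvT X] with ω h3 h4
      rw [h3, h4, mul_sub]
    rw [eLpNorm_congr_ae h2]
    refine h1.trans (ENNReal.ofReal_le_ofReal ?_)
    have h3 : Real.exp (m * T) ≤ Real.exp (|m| * T) :=
      Real.exp_le_exp.2 (mul_le_mul_of_nonneg_right (le_abs_self m) hT.1)
    gcongr
  have hbound := comparison_bound_le (Γ := gaussSqNorm) L₁.coe_nonneg L₂.coe_nonneg hΓ hΛ
    (delta_eq ε) (delta_le_of_numSteps_le hT₀ hε hε1 hsteps) hθ0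
    (log_div_le_of_numSteps_le hε hε1 hT hsteps) hL₁δ (by linarith)
    (Real.one_le_exp (by positivity : 0 ≤ |m| * T))
    (Real.exp_le_exp.2 (mul_le_mul_of_nonneg_left hT.2 (abs_nonneg m))) hϰ (min_le_left _ _)
    (min_le_right _ _) hρ hk
  have hsqrt : (T + ε ^ 2) ^ (1 / 2 : ℝ) = √(T + ε ^ 2) := by rw [Real.sqrt_eq_rpow]
  have hs := Real.sqrt_pos.2 hTe
  have hπ : (1 : ℝ) ≤ √(2 * Real.pi) :=
    Real.le_sqrt_of_sq_le (by linarith [Real.pi_gt_three])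
  rw [hsqrt]
  refine (mul_le_mul_right hnorm _).trans ?_
  rw [← ENNReal.ofReal_mul hs.le]
  refine ENNReal.ofReal_le_ofReal ?_
  have hC0 : 0 ≤ boundConst (Real.exp (|m| * T₀)) gaussSqNorm
      (1 + (2 + 2 * Real.exp 2) / T₀) := by
    unfold boundConst
    positivity
  calc √(T + ε ^ 2) * (Real.exp (|m| * T) * (A / √(2 * Real.pi * (T + ε ^ 2))))
      = Real.exp (|m| * T) * A / √(2 * Real.pi) := by
        rw [Real.sqrt_mul (by positivity)]
        field_simp
    _ ≤ Real.exp (|m| * T) * A := div_le_self (by positivity) hπ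
    _ ≤ _ := hbound
    _ ≤ _ := by
        gcongr
        -- The denominator lies in `(0, 1]`, so dividing by it only enlarges the exponent already
        -- obtained.
        have hD : 0 < 1 - ((L₁ : ℝ) + Real.exp (3 * L₁) * L₂) * delta ε := by linarith
        rw [Real.exp_add, le_div_iff₀ hD]
        have hq : 0 ≤ 3 * (Real.exp (3 * L₁) * L₂) * Real.exp (|m| * T) := by positivity
        calc _ ≤ 3 * (Real.exp (3 * L₁) * L₂) * Real.exp (|m| * T) * 1 := by
              gcongr
              linarith
          _ = _ := by ring
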